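/- **Setting.** A decremental weighted digraph $G$ has vertex set $V$ with $|V| = n \ge 2$ and edge weights in $\{1,\dots,W\}\cup\{\infty\}$ (weight $\infty$ meaning that the edge is absent), and undergoes a finite sequence of updates, each of which deletes one edge or increases the weight of one edge. *Stage* $t$ is the situation after the first $t$ updates. $\mathbf{dist}_G(u,v)\in\mathbb N\cup\{\infty\}$ is the distance in the current graph. For $\eta_{diam}\ge 0$, an *approximate topological order* $\mathcal{ATO}(G,\eta_{diam})$ is a pair $(\mathcal V,\tau)$, changing with the stages, such that at every stage (i) $\mathcal V$ is a partition of $V$ refining all its earlier versions; (ii) $\tau:\mathcal V\to[0,n)$ is integer valued, the intervals $[\tau(X),\tau(X)+|X|)$, $X\in\mathcal V$, are pairwise disjoint and contained in $[0,n)$, and whenever a set $X$ is replaced by sets $X_1,\dots,X_k$ ($k\ge1$) partitioning it, then for some permutation $\pi$ the new values are $\tau(X_{\pi(1)})=\tau(X)$ and $\tau(X_{\pi(j+1)})=\tau(X_{\pi(j)})+|X_{\pi(j)}|$ for $j<k$; (iii) $\mathbf{dist}_G(x,y)\le |X|\,\eta_{diam}/n$ for all $x,y\in X\in\mathcal V$.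 Writing $X^u$ for the set of $\mathcal V$ containing $u$, for a path $p$ put $\mathcal T(p,\tau)=\sum_{(u,v)\in p}|\tau(X^u)-\tau(X^v)|$. **Theorem.** There is a deterministic data structure with the following property. It is given a source $r\in V$, rational parameters $\delta,q,\varepsilon>0$ and $\eta_{diam}\ge0$ with $\delta q\ge n$, and online access to a decremental weighted digraph $G$ and to an $\mathcal{ATO}(G,\eta_{diam})$ $(\mathcal V,\tau)$: initially it receives the graph and all sets of $\mathcal V$ with their $\tau$-values, and with each update it receives the updated edge with its new weight and the sets newly arisen in $\mathcal V$ with their $\tau$-values. At each stage, before it sees the next update, it stores an estimate $\widetilde{\mathbf{dist}}(r,v)\in\mathbb N\cup\{\infty\}$ for every $v\in V$ such that $$\mathbf{dist}_G(r,v)\le\widetilde{\mathbf{dist}}(r,v),$$ and such that, if $\mathbf{dist}_G(r,v)\le\delta$ and some shortest path $\pi_{r,v}$ from $r$ to $v$ in the current graph satisfies $\mathcal T(\pi_{r,v},\tau)\le q\delta+n$, then $$\widetilde{\mathbf{dist}}(r,v)\le\mathbf{dist}_G(r,v)+\eta_{diam}+\varepsilon\delta .$$ Its total running time over the whole sequence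 of updates is $$O\!\left(\frac{n\,\delta\,q\,\log n}{\min(\varepsilon,1)}+n^2\log n+K\log n\right),$$ where $K$ is the number of updates that are not deletions (they raise a weight to a new finite value). In particular, for $\varepsilon\le 1$ and at most $O(n^2)$ updates, or any number of deletions only, it is $O(n\delta q\log n/\varepsilon+n^2\log n)$. The model is a word RAM (unit-cost addition, subtraction, multiplication, integer division, comparison and memory access, memory initially zero) with words of $O(\log S)$ bits, where $S$ is the sum of $n$, $W$ and the numerators and denominators of the four parameters. The program and the constants hidden in the $O$-notation are universal. -/

import Mathlib

/-! ### Weighted digraphs and decremental digraphs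

A weighted digraph on the vertex set `Fin n` is given by its weights in `ℕ∞`, where the weight `⊤`
means that the edge is absent (or has infinite weight). -/

/-- The weight of a walk, listed as the sequence of its vertices. -/
def pathWeight {n : ℕ} (w : Fin n → Fin n → ℕ∞) : List (Fin n) → ℕ∞
  | [] => 0
  | [_] => 0
  | u :: v :: l => w u v + pathWeight w (v :: l)

/-- The vertex sequence `p` starts at `a` and ends at `b`. -/
def IsWalk {n : ℕ} (a b : Fin n) (p : List (Fin n)) : Prop :=
  p.head? = some a ∧ p.getLast? = some b

/-- The distance from `a` to `b`; it is `⊤` if `b` cannot be reached from `a`. -/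
noncomputable def graphDist {n : ℕ} (w : Fin n → Fin n → ℕ∞) (a b : Fin n) : ℕ∞ :=
  ⨅ p : {p : List (Fin n) // IsWalk a b p}, pathWeight w p.1

/-- `p` is a shortest path from `a` to `b` (of finite weight). As all weights are at least one,
such a walk never repeats a vertex. -/
def IsShortestPath {n : ℕ} (w : Fin n → Fin n → ℕ∞) (a b : Fin n) (p : List (Fin n)) : Prop :=
  IsWalk a b p ∧ pathWeight w p = graphDist w a b ∧ pathWeight w p ≠ ⊤

/-- A digraph with weights in `{1, …, W} ∪ {∞}` undergoing `numUpdates` updates. The update from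
stage `t` to stage `t + 1` strictly increases the weight of the single edge `edge t`;
an increase to `⊤` is the deletion of that edge. -/
structure DecrementalGraph (n : ℕ) where
  maxWeight : ℕ
  numUpdates : ℕ
  weight : ℕ → Fin n → Fin n → ℕ∞
  edge : ℕ → Fin n × Fin n
  one_le_weight : ∀ t ≤ numUpdates, ∀ u v, 1 ≤ weight t u v
  weight_le : ∀ t ≤ numUpdates, ∀ u v, weight t u v ≠ ⊤ → weight t u v ≤ (maxWeight : ℕ∞)
  weight_edge_lt : ∀ t < numUpdates,
    weight t (edge t).1 (edge t).2 < weight (t + 1) (edge t).1 (edge t).2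
  weight_eq : ∀ t < numUpdates, ∀ u v, (u, v) ≠ edge t → weight (t + 1) u v = weight t u v

/-- The number of updates that are not deletions, i.e. that raise the weight of an edge to a new
finite value. -/
noncomputable def DecrementalGraph.numIncreases {n : ℕ} (G : DecrementalGraph n) : ℕ :=
  Set.ncard {t : ℕ | t < G.numUpdates ∧ G.weight (t + 1) (G.edge t).1 (G.edge t).2 ≠ ⊤}

/-! ### Approximate topological orders -/

/-- A dynamic tuple `(𝒱, τ)`: at each stage a partition of the vertex set and a function on its
parts (the values of `τ` at other sets are irrelevant). -/
structure DynamicOrder (n : ℕ) where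
  part : ℕ → Finpartition (Finset.univ : Finset (Fin n))
  τ : ℕ → Finset (Fin n) → ℕ

/-- `τ` maps the sets in the list to consecutive intervals, the first of which starts at `a`. -/
def Consecutive {n : ℕ} (τ : Finset (Fin n) → ℕ) : ℕ → List (Finset (Fin n)) → Prop
  | _, [] => True
  | a, X :: l => τ X = a ∧ Consecutive τ (a + X.card) l

/-- `(𝒱, τ)` is an approximate topological order of `G` with diameter parameter `η`
(without any requirement on its quality). -/
structure IsATO {n : ℕ} (G : DecrementalGraph n) (η : ℚ) (A : DynamicOrder n) : Prop where
  /-- The partition only gets finer. -/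
  refines : ∀ t < G.numUpdates, A.part (t + 1) ≤ A.part t
  /-- The parts `X` are in correspondence with disjoint intervals `[τ X, τ X + |X|)` in `[0, n)`. -/
  interval_le : ∀ t ≤ G.numUpdates, ∀ X ∈ (A.part t).parts, A.τ t X + X.card ≤ n
  interval_disjoint : ∀ t ≤ G.numUpdates, ∀ X ∈ (A.part t).parts, ∀ Y ∈ (A.part t).parts, X ≠ Y →
    Disjoint (Finset.Ico (A.τ t X) (A.τ t X + X.card)) (Finset.Ico (A.τ t Y) (A.τ t Y + Y.card))
  /-- When `X` is split, its interval is divided among the pieces in some order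
  (so `τ X` does not change as long as `X` is not split). -/
  split : ∀ t < G.numUpdates, ∀ X ∈ (A.part t).parts, ∃ l : List (Finset (Fin n)), l.Nodup ∧
    (∀ Y, Y ∈ l ↔ Y ∈ (A.part (t + 1)).parts ∧ Y ⊆ X) ∧ Consecutive (A.τ (t + 1)) (A.τ t X) l
  /-- Each part has weak diameter at most `|X| η / n`. -/
  diam_le : ∀ t ≤ G.numUpdates, ∀ X ∈ (A.part t).parts, ∀ x ∈ X, ∀ y ∈ X,
    ∃ d : ℕ, graphDist (G.weight t) x y = d ∧ (d : ℚ) ≤ X.card * η / n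

/-- The topological order difference of a path: the sum of `|τ(X^u) - τ(X^v)|` over its edges
`(u, v)`, where `X^u` is the part that contains `u`. -/
def topDiff {n : ℕ} (P : Finpartition (Finset.univ : Finset (Fin n))) (τ : Finset (Fin n) → ℕ) :
    List (Fin n) → ℕ
  | [] => 0
  | [_] => 0
  | u :: v :: l => ((τ (P.part u) : ℤ) - (τ (P.part v) : ℤ)).natAbs + topDiff P τ (v :: l)

/-! ### A word RAM with structured programs and a step count -/

inductive ArithOp where
  | add | sub | mul | div

/-- Truncated subtraction and rounding division. -/
def ArithOp.eval : ArithOp → ℕ → ℕ → ℕ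
  | .add, a, b => a + b
  | .sub, a, b => a - b
  | .mul, a, b => a * b
  | .div, a, b => a / b

/-- Programs; the arguments of type `ℕ` are names of registers, except for the constant in
`const`. -/
inductive Prog where
  | skip : Prog
  | const (x k : ℕ) : Prog
  | arith (o : ArithOp) (x y z : ℕ) : Prog
  | load (x a : ℕ) : Prog
  | store (a x : ℕ) : Prog
  | input (x i : ℕ) : Prog
  | seq (p q : Prog) : Prog
  | ifLt (x y : ℕ) (p q : Prog) : Prog
  | whileLt (x y : ℕ) (p : Prog) : Prog

/-- The contents of the registers and of the random access memory. -/
structure RamState where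
  reg : ℕ → ℕ
  mem : ℕ → ℕ

def RamState.zero : RamState := ⟨fun _ => 0, fun _ => 0⟩

def RamState.setReg (s : RamState) (x v : ℕ) : RamState := ⟨Function.update s.reg x v, s.mem⟩

def RamState.setMem (s : RamState) (a v : ℕ) : RamState := ⟨s.reg, Function.update s.mem a v⟩

/-- `Exec B inp p s k s'`: with the read-only input array `inp`, the program `p` started in the
state `s` halts after `k` steps in the state `s'`, and every word computed or read on the way is
smaller than `B` (a larger word cannot be produced: the execution would be stuck). -/
inductive Exec (B : ℕ) (inp : List ℕ) : Prog → RamState → ℕ → RamState → Prop where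
  | skip (s : RamState) : Exec B inp .skip s 1 s
  | const (s : RamState) (x k : ℕ) (h : k < B) : Exec B inp (.const x k) s 1 (s.setReg x k)
  | arith (s : RamState) (o : ArithOp) (x y z : ℕ) (h : o.eval (s.reg y) (s.reg z) < B) :
      Exec B inp (.arith o x y z) s 1 (s.setReg x (o.eval (s.reg y) (s.reg z)))
  | load (s : RamState) (x a : ℕ) : Exec B inp (.load x a) s 1 (s.setReg x (s.mem (s.reg a)))
  | store (s : RamState) (a x : ℕ) : Exec B inp (.store a x) s 1 (s.setMem (s.reg a) (s.reg x))
  | input (s : RamState) (x i : ℕ) (h : inp.getD (s.reg i) 0 < B) :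
      Exec B inp (.input x i) s 1 (s.setReg x (inp.getD (s.reg i) 0))
  | seq {p q : Prog} {s₁ s₂ s₃ : RamState} {k l : ℕ} (hp : Exec B inp p s₁ k s₂)
      (hq : Exec B inp q s₂ l s₃) : Exec B inp (.seq p q) s₁ (k + l) s₃
  | ifTrue {x y : ℕ} {p q : Prog} {s s' : RamState} {k : ℕ} (h : s.reg x < s.reg y)
      (hp : Exec B inp p s k s') : Exec B inp (.ifLt x y p q) s (k + 1) s'
  | ifFalse {x y : ℕ} {p q : Prog} {s s' : RamState} {k : ℕ} (h : ¬ s.reg x < s.reg y)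
      (hq : Exec B inp q s k s') : Exec B inp (.ifLt x y p q) s (k + 1) s'
  | whileDone {x y : ℕ} {p : Prog} {s : RamState} (h : ¬ s.reg x < s.reg y) :
      Exec B inp (.whileLt x y p) s 1 s
  | whileStep {x y : ℕ} {p : Prog} {s₁ s₂ s₃ : RamState} {k l : ℕ} (h : s₁.reg x < s₁.reg y)
      (hp : Exec B inp p s₁ k s₂) (hw : Exec B inp (.whileLt x y p) s₂ l s₃) :
      Exec B inp (.whileLt x y p) s₁ (k + l + 1) s₃

/-! ### The interface of the data structure -/

/-- A weight as a word: `0` stands for an absent edge. -/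
def encodeWeight (x : ℕ∞) : ℕ := x.toNat

/-- The distance estimate stored in a word: `0` stands for `∞`, and `k + 1` for `k`. -/
def decodeEstimate : ℕ → ℕ∞
  | 0 => ⊤
  | k + 1 => (k : ℕ∞)

/-- A nonnegative rational number as a pair of words. -/
def encodeRat (x : ℚ) : List ℕ := [x.num.toNat, x.den]

/-- `L` lists the sets in `new`, each one once and each as a list of its vertices, in any order. -/
def Announces {n : ℕ} (new : Finset (Finset (Fin n))) (L : List (List (Fin n))) : Prop :=
  (∀ l ∈ L, l.Nodup) ∧ (L.map List.toFinset).Nodup ∧ (L.map List.toFinset).toFinset = new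

/-- The number of listed sets, and then for each of them its size, its value under `τ`
and its vertices. -/
def encodeSets {n : ℕ} (τ : Finset (Fin n) → ℕ) (L : List (List (Fin n))) : List ℕ :=
  L.length :: L.flatMap fun l => l.length :: τ l.toFinset :: l.map Fin.val

/-- The sets that the data structure is told about at stage `t`: all sets of the initial partition
at stage `0`, and later on the sets that were not in the partition one stage before. -/
def DynamicOrder.newSets {n : ℕ} (A : DynamicOrder n) : ℕ → Finset (Finset (Fin n))
  | 0 => (A.part 0).parts
  | t + 1 => (A.part (t + 1)).parts \ (A.part t).parts

/-- The input of the initialization: `n`, the source, the parameters, the weight matrix of the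
initial graph (row by row), and the initial partition with its values of `τ`. -/
noncomputable def initInput {n : ℕ} (G : DecrementalGraph n) (A : DynamicOrder n)
    (L : ℕ → List (List (Fin n))) (r : Fin n) (δ q ε η : ℚ) : List ℕ :=
  [n, (r : ℕ)] ++ encodeRat δ ++ encodeRat q ++ encodeRat ε ++ encodeRat η ++
    (List.finRange n).flatMap (fun u => (List.finRange n).map fun v =>
      encodeWeight (G.weight 0 u v)) ++
    encodeSets (A.τ 0) (L 0)

/-- The input of the update from stage `t` to stage `t + 1`: the updated edge with its new weight,
and the new sets of the partition with their values of `τ`. -/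
noncomputable def updateInput {n : ℕ} (G : DecrementalGraph n) (A : DynamicOrder n)
    (L : ℕ → List (List (Fin n))) (t : ℕ) : List ℕ :=
  [((G.edge t).1 : ℕ), ((G.edge t).2 : ℕ),
    encodeWeight (G.weight (t + 1) (G.edge t).1 (G.edge t).2)] ++
    encodeSets (A.τ (t + 1)) (L (t + 1))

/-- A number of the order of the largest word needed to write down the input; machine words have
`O(log (inputSize))` bits. -/
def inputSize {n : ℕ} (G : DecrementalGraph n) (δ q ε η : ℚ) : ℕ :=
  n + G.maxWeight + (encodeRat δ).sum + (encodeRat q).sum + (encodeRat ε).sum + (encodeRat η).sum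

/-! Lengths are measured in the unit g = min(ε, 1) / (6 q). Weights are rounded up to multiples of
g, and each set of the partition carries one integer label L that only grows, from 0 up to at most M
+ 1, where M = ⌊2 δ / g⌋ and M + 1 stands for ∞. The set of the source keeps the label 0. As in an
Even–Shiloach tree, a label is raised only if no inspected edge supports it. The new point is that
at label l a vertex inspects only sets fewer than `low l` positions away from its own interval,
where `low l` is the largest power of two dividing l. An edge across a gap of d positions is
therefore inspected whenever the label passes a multiple of a power of two exceeding d.

Upper bound. For an edge (u, v) between different sets, the last such multiple below L v gives L v ≤
L u + w u v + 2 |τ(X^u) - τ(X^v)| (`Valid.label_le`). Rounding the weight costs at most one more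
unit, which the difference of the τ-values also covers, since they are distinct. Summed over a
shortest path the excess is at most 3 𝒯 g ≤ 3 (q δ + n) g ≤ 6 q δ g = min(ε, 1) δ, by n ≤ δ q
(`Store.label_path`, `Store.upper`). The label then stays below 2 δ / g, so it is finite.

Lower bound. Once the work list is empty, every set with a finite label, except that of the source,
has an incoming edge from u with L u + w ≤ L v (`Valid.exists_support`). Following such edges back
to the source, labels strictly decrease, so the sets met are distinct, and crossing their weak
diameters costs at most Σ |X| η / n ≤ η (`Store.dist_le`, `Store.lower`).

Running time. With h = ⌈log₂ n⌉, the windows of one vertex over all its labels have total length O(M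
h) (`sum_min_low_le`), and M = O(δ q / min(ε, 1)). Three devices make the work proportional to this
length. First, a failed test stays failed at a fixed label, as labels and weights only grow; so scan
pointers are never reset while the label stays the same, not even by a refinement: pieces of one set
start with equal labels and weights are at least 1, so tests among them fail by themselves, and all
other gaps only widen. Second, a vertex tests a whole set at once through the minimal weight of an
edge from it. These minima sit at the roots of binary trees over the vertices; a refinement makes
some vertices new least vertices of their nodes, which happens at most (h + 1) n times, and each
time O(n) words are recomputed (`stale`, `Tr.renew`). Third, a vertex whose test succeeds waits in a
watch list indexed by the tested set and the label at which the test would fail. All of this is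
charged to the potential `Core.pot`; the lemmas on `pot` are the amortized analysis. A refinement
costs O(n h) on top, and there are at most n of them, since each increases the number of sets; an
update costs O(h) on top, and at most n² updates are deletions.

The invariants are collected in `Valid`. The programs are written in a small language `Cmd` compiled
to the RAM; the triples `Tr` prove correctness, step counts and word bounds simultaneously. -/

section

/-! ### A small imperative language over the word RAM

Programs are written with scalar registers and with unbounded arrays, which are interleaved in the
memory above the first `n` words; these `n` words hold the output. -/

/-- Scalar registers, the output words and the arrays. -/
@[ext] structure St where
  reg : ℕ → ℕ
  out : ℕ → ℕ
  arr : ℕ → ℕ → ℕ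

namespace St

def setReg (s : St) (x v : ℕ) : St := { s with reg := Function.update s.reg x v }
def setOut (s : St) (i v : ℕ) : St := { s with out := Function.update s.out i v }
def setArr (s : St) (a i v : ℕ) : St :=
  { s with arr := Function.update s.arr a (Function.update (s.arr a) i v) }

@[simp] theorem setReg_reg (s : St) (x v y : ℕ) :
    (s.setReg x v).reg y = if y = x then v else s.reg y := by
  simp [setReg, Function.update_apply]
@[simp] theorem setReg_arr (s : St) (x v : ℕ) : (s.setReg x v).arr = s.arr := rfl
@[simp] theorem setReg_out (s : St) (x v : ℕ) : (s.setReg x v).out = s.out := rfl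
@[simp] theorem setOut_reg (s : St) (x v : ℕ) : (s.setOut x v).reg = s.reg := rfl
@[simp] theorem setOut_arr (s : St) (x v : ℕ) : (s.setOut x v).arr = s.arr := rfl
@[simp] theorem setOut_out (s : St) (x v : ℕ) :
    (s.setOut x v).out = Function.update s.out x v := rfl
@[simp] theorem setArr_reg (s : St) (a i v : ℕ) : (s.setArr a i v).reg = s.reg := rfl
@[simp] theorem setArr_out (s : St) (a i v : ℕ) : (s.setArr a i v).out = s.out := rfl
@[simp] theorem setArr_arr (s : St) (a i v b : ℕ) :
    (s.setArr a i v).arr b = if b = a then Function.update (s.arr a) i v else s.arr b := by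
  simp only [setArr, Function.update_apply]

end St

/-- Expressions: registers, constants, arithmetic and array look-ups. -/
inductive Ex where
  | r (x : ℕ) : Ex
  | c (k : ℕ) : Ex
  | op (o : ArithOp) (e f : Ex) : Ex
  | ld (a : ℕ) (e : Ex) : Ex

namespace Ex

instance : Add Ex := ⟨op .add⟩
instance : Sub Ex := ⟨op .sub⟩
instance : Mul Ex := ⟨op .mul⟩
instance : Div Ex := ⟨op .div⟩
instance (k : ℕ) : OfNat Ex k := ⟨c k⟩

def eval (s : St) : Ex → ℕ
  | r x => s.reg x
  | c k => k
  | op o e f => o.eval (e.eval s) (f.eval s)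
  | ld a e => s.arr a (e.eval s)

@[simp] theorem eval_r (s : St) (x : ℕ) : (r x).eval s = s.reg x := rfl
@[simp] theorem eval_num (s : St) (k : ℕ) :
    (no_index (OfNat.ofNat k : Ex)).eval s = (OfNat.ofNat k : ℕ) := rfl
@[simp] theorem eval_add (s : St) (e f : Ex) : (e + f).eval s = e.eval s + f.eval s := rfl
@[simp] theorem eval_sub (s : St) (e f : Ex) : (e - f).eval s = e.eval s - f.eval s := rfl
@[simp] theorem eval_mul (s : St) (e f : Ex) : (e * f).eval s = e.eval s * f.eval s := rfl
@[simp] theorem eval_div (s : St) (e f : Ex) : (e / f).eval s = e.eval s / f.eval s := rfl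
@[simp] theorem eval_ld (s : St) (a : ℕ) (e : Ex) : (ld a e).eval s = s.arr a (e.eval s) := rfl

/-- Expressions whose value is a word in any case. -/
def leaf : Ex → Bool
  | op _ _ _ => false
  | _ => true

@[simp] theorem leaf_r (x : ℕ) : (r x).leaf = true := rfl
@[simp] theorem leaf_ld (a : ℕ) (e : Ex) : (ld a e).leaf = true := rfl
@[simp] theorem leaf_num (k : ℕ) : (no_index (OfNat.ofNat k : Ex)).leaf = true := rfl
@[simp] theorem leaf_add (e f : Ex) : (e + f).leaf = false := rfl
@[simp] theorem leaf_sub (e f : Ex) : (e - f).leaf = false := rfl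
@[simp] theorem leaf_mul (e f : Ex) : (e * f).leaf = false := rfl
@[simp] theorem leaf_div (e f : Ex) : (e / f).leaf = false := rfl

/-- The value is smaller than the `deg`-th power of the word bound of the leaves. -/
def deg : Ex → ℕ
  | r _ => 1
  | c _ => 1
  | op _ e f => e.deg + f.deg
  | ld _ _ => 1

/-- Bounds the `deg` of all intermediate results. -/
def mdeg : Ex → ℕ
  | r _ => 1
  | c _ => 1
  | op _ e f => max (e.deg + f.deg) (max e.mdeg f.mdeg)
  | ld _ e => max e.mdeg (e.deg + 2)

def cost : Ex → ℕ
  | r _ => 2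
  | c _ => 1
  | op _ e f => e.cost + (f.cost + 1)
  | ld _ e => e.cost + 5 + 1

def ok : Ex → Bool
  | r x => decide (x < 40)
  | c k => decide (k < 64)
  | op _ e f => e.ok && f.ok
  | ld a e => decide (a < 16) && e.ok

/-- Turns the index of an entry of the array `a` in the register `d` into its address. -/
def addr (a d : ℕ) : Prog :=
  .seq (.const (d + 1) 16) (.seq (.arith .mul d d (d + 1)) (.seq (.arith .add d d 0)
    (.seq (.const (d + 1) a) (.arith .add d d (d + 1)))))

/-- Computes the expression into the register `d`, using the registers from `d` on. -/
def comp : Ex → ℕ → Prog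
  | r x, d => .seq (.const d 0) (.arith .add d x d)
  | c k, d => .const d k
  | op o e f, d => .seq (e.comp d) (.seq (f.comp (d + 1)) (.arith o d d (d + 1)))
  | ld a e, d => .seq (.seq (e.comp d) (addr a d)) (.load d d)

theorem one_le_deg (e : Ex) : 1 ≤ e.deg := by
  induction e with
  | op o e f he hf => simp only [deg]; omega
  | _ => simp [deg]

end Ex

/-- The parameters of an execution: the number of output words, the bound for stored words and the
input. -/
structure Env where
  n : ℕ
  V : ℕ
  inp : List ℕ
  hV : 64 ≤ V
  hinp : ∀ i, inp.getD i 0 < V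

/-- The bound for all words. -/
def Env.B (E : Env) : ℕ := E.V ^ 16

/-- The state of the RAM represents the state of the language. -/
structure Represents (n V : ℕ) (s : RamState) (t : St) : Prop where
  reg : ∀ x < 40, s.reg x = t.reg x
  out : ∀ i < n, s.mem i = t.out i
  arr : ∀ a < 16, ∀ i, s.mem (n + 16 * i + a) = t.arr a i
  zero : t.reg 0 = n
  reg_lt : ∀ x < 40, t.reg x < V
  arr_lt : ∀ a < 16, ∀ i, t.arr a i < V

/-- Registers from 40 on are scratch space for compiled expressions and are invisible to the
represented state. -/
theorem Represents.congr {n V : ℕ} {s s' : RamState} {t : St} (h : Represents n V s t)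
    (hm : s'.mem = s.mem) (hr : ∀ x < 40, s'.reg x = s.reg x) : Represents n V s' t :=
  ⟨fun x hx => (hr x hx).trans (h.reg x hx), fun i hi => hm ▸ h.out i hi,
    fun a ha i => hm ▸ h.arr a ha i, h.zero, h.reg_lt, h.arr_lt⟩

namespace Ex

/-- Leaves are below V, and a sum, difference, product or quotient of numbers below a and b is below
a b once a, b ≥ 2. This lets a syntactic degree control all intermediate words. -/
theorem eval_lt {n V : ℕ} (hV : 64 ≤ V) {s : RamState} {t : St} (h : Represents n V s t) (e : Ex)
    (he : e.ok) : e.eval t < V ^ e.deg := by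
  induction e with
  | r x => simpa [deg, ok, eval] using h.reg_lt x (by simpa [ok] using he)
  | c k =>
    have : k < 64 := by simpa [ok] using he
    simp only [deg, eval, pow_one]; omega
  | ld a e _ =>
    simp only [ok, Bool.and_eq_true, decide_eq_true_eq] at he
    simpa [deg, eval] using h.arr_lt a he.1 _
  | op o e f ihe ihf =>
    simp only [ok, Bool.and_eq_true] at he
    have h1 := ihe he.1
    have h2 := ihf he.2
    have h3 : 2 ≤ V ^ e.deg := le_trans (by omega : 2 ≤ V) (Nat.le_self_pow (by
      have := e.one_le_deg; omega) V)
    have h4 : 2 ≤ V ^ f.deg := le_trans (by omega : 2 ≤ V) (Nat.le_self_pow (by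
      have := f.one_le_deg; omega) V)
    simp only [deg, eval, pow_add]
    generalize V ^ e.deg = a at *
    generalize V ^ f.deg = b at *
    have h5 : a ≤ a * b := Nat.le_mul_of_pos_right a (by omega)
    cases o with
    | add => simp only [ArithOp.eval]; nlinarith
    | sub => simp only [ArithOp.eval]; omega
    | mul => simp only [ArithOp.eval]; exact Nat.mul_lt_mul'' h1 h2
    | div => simp only [ArithOp.eval]; exact lt_of_le_of_lt (Nat.div_le_self _ _) (by omega)

theorem eval_lt_of_leaf {n V : ℕ} (hV : 64 ≤ V) {s : RamState} {t : St} (h : Represents n V s t)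
    {e : Ex} (he : e.ok) (hl : e.leaf = true ∨ e.eval t < V) : e.eval t < V := by
  rcases hl with hl | hl
  · have h1 : e.deg = 1 := by cases e <;> simp_all [leaf, deg]
    simpa [h1] using eval_lt hV h e he
  · exact hl

theorem lt_bound {V : ℕ} (hV : 64 ≤ V) {x d : ℕ} (hx : x < V ^ d) (hd : d ≤ 16) :
    x < V ^ 16 :=
  lt_of_lt_of_le hx (Nat.pow_le_pow_right (by omega) hd)

/-- The address n + 16 i + a costs two more powers of V than the index i, which explains the `+ 2`
in `mdeg` and in `Cmd.ok`. -/
theorem addr_spec {n V : ℕ} {inp : List ℕ} (hV : 64 ≤ V) {s : RamState} {t : St}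
    (h : Represents n V s t) {a i D d : ℕ} (ha : a < 16) (hd : 40 ≤ d) (hi : s.reg d = i)
    (hiV : i < V ^ D) (hD : D + 2 ≤ 16) :
    ∃ s', Exec (V ^ 16) inp (addr a d) s 5 s' ∧
      s'.mem = s.mem ∧ (∀ x < d, s'.reg x = s.reg x) ∧ s'.reg d = n + 16 * i + a := by
  have hn : s.reg 0 = n := (h.reg 0 (by omega)).trans h.zero
  have hnV : n < V := h.zero ▸ h.reg_lt 0 (by omega)
  have hV2 : V ≤ V ^ 16 := Nat.le_self_pow (by omega) V
  have hb : n + 16 * i + a < V ^ 16 := by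
    refine lt_bound hV (d := D + 2) ?_ hD
    rw [pow_add]
    have : V ^ D * V ^ 2 = V ^ D * V * V := by ring
    rw [this]
    have h64 : 64 * V ^ D ≤ V ^ D * V := by rw [mul_comm]; exact Nat.mul_le_mul_left _ hV
    have h1 : 64 * (V ^ D * V) ≤ V ^ D * V * V := by rw [mul_comm]; exact Nat.mul_le_mul_left _ hV
    have h2 : V ≤ V ^ D * V := Nat.le_mul_of_pos_left V (by omega)
    omega
  refine ⟨_, .seq (.const _ _ _ (by omega)) (.seq (.arith _ _ _ _ _ ?_) (.seq
    (.arith _ _ _ _ _ ?_) (.seq (.const _ _ _ ?_) (.arith _ _ _ _ _ ?_)))), ?_, ?_, ?_⟩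
  all_goals have hd0 : d ≠ 0 := by omega
  all_goals simp +contextual [RamState.setReg, ArithOp.eval, Function.update_apply, hi, hn, hd0, hd0.symm]
  · omega
  · omega
  · omega
  · omega
  · intro x hx
    have : x ≠ d := by omega
    have : x ≠ d + 1 := by omega
    simp [*]
  · omega

/-- Registers below d survive, so the value of a left operand is still there after the right one has
been computed one register higher. -/
theorem comp_spec {n V : ℕ} {inp : List ℕ} (hV : 64 ≤ V) {t : St} (e : Ex)
    (he : e.ok) (hm : e.mdeg ≤ 16) : ∀ (d : ℕ) (s : RamState), 40 ≤ d → Represents n V s t →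
    ∃ s', Exec (V ^ 16) inp (e.comp d) s e.cost s' ∧
      s'.mem = s.mem ∧ (∀ x < d, s'.reg x = s.reg x) ∧ s'.reg d = e.eval t := by
  have hV2 : V ≤ V ^ 16 := Nat.le_self_pow (by omega) V
  induction e with
  | r x =>
    intro d s hd h
    have hx : x < 40 := by simpa [ok] using he
    have hxd : x ≠ d := by omega
    refine ⟨_, .seq (.const _ _ _ (by omega)) (.arith _ _ _ _ _ ?_), ?_, ?_, ?_⟩
    all_goals simp +contextual [RamState.setReg, ArithOp.eval, Function.update_apply, hxd,
      h.reg x hx, eval]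
    · exact lt_of_lt_of_le (h.reg_lt x hx) hV2
    · intro y hy hyd; omega
  | c k =>
    intro d s hd h
    have hk : k < 64 := by simpa [ok] using he
    refine ⟨_, .const _ _ _ (by omega), ?_, ?_, ?_⟩
    all_goals simp +contextual [RamState.setReg, Function.update_apply, eval]
    · intro y hy hyd; omega
  | op o e f ihe ihf =>
    intro d s hd h
    simp only [ok, Bool.and_eq_true] at he
    simp only [mdeg, max_le_iff] at hm
    obtain ⟨s1, h1, m1, r1, v1⟩ := ihe he.1 hm.2.1 d s hd h
    have R1 : Represents n V s1 t := h.congr m1 (fun x hx => r1 x (by omega))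
    obtain ⟨s2, h2, m2, r2, v2⟩ := ihf he.2 hm.2.2 (d + 1) s1 (by omega) R1
    have e1 : s2.reg d = e.eval t := (r2 d (by omega)).trans v1
    refine ⟨_, .seq h1 (.seq h2 (.arith _ _ _ _ _ ?_)), ?_, ?_, ?_⟩
    · rw [e1, v2]
      exact lt_bound hV (eval_lt hV h (op o e f) (by simp [ok, he])) hm.1
    · simp [RamState.setReg, m2, m1]
    · intro x hx
      have : x ≠ d := by omega
      simp [RamState.setReg, this, r2 x (by omega), r1 x hx]
    · simp [RamState.setReg, e1, v2, eval]
  | ld a e ih =>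
    intro d s hd h
    simp only [ok, Bool.and_eq_true, decide_eq_true_eq] at he
    simp only [mdeg, max_le_iff] at hm
    obtain ⟨s1, h1, m1, r1, v1⟩ := ih he.2 hm.1 d s hd h
    have R1 : Represents n V s1 t := h.congr m1 (fun x hx => r1 x (by omega))
    obtain ⟨s2, h2, m2, r2, v2⟩ := addr_spec (inp := inp) hV R1 he.1 hd v1
      (eval_lt hV h e he.2) hm.2
    refine ⟨_, .seq (.seq h1 h2) (.load _ d d), ?_, ?_, ?_⟩
    · simp [RamState.setReg, m2, m1]
    · intro x hx
      have : x ≠ d := by omega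
      simp [RamState.setReg, this, r2 x hx, r1 x hx]
    · simp [RamState.setReg, v2, eval, m2, R1.arr a he.1]

theorem compAddr_spec {n V : ℕ} {inp : List ℕ} (hV : 64 ≤ V) {t : St} (a : ℕ) (ha : a < 16)
    (e : Ex) (he : e.ok) (hm : e.mdeg ≤ 16) (hd2 : e.deg + 2 ≤ 16) (d : ℕ) (s : RamState)
    (hd : 40 ≤ d) (h : Represents n V s t) :
    ∃ s', Exec (V ^ 16) inp (.seq (e.comp d) (addr a d)) s (e.cost + 5) s' ∧
      s'.mem = s.mem ∧ (∀ x < d, s'.reg x = s.reg x) ∧ s'.reg d = n + 16 * e.eval t + a := by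
  obtain ⟨s1, h1, m1, r1, v1⟩ := comp_spec (inp := inp) hV e he hm d s hd h
  have R1 : Represents n V s1 t := h.congr m1 (fun x hx => r1 x (by omega))
  obtain ⟨s2, h2, m2, r2, v2⟩ := addr_spec (inp := inp) hV R1 ha hd v1
    (eval_lt hV h e he) hd2
  exact ⟨s2, .seq h1 h2, m2.trans m1, fun x hx => (r2 x hx).trans (r1 x hx), v2⟩

end Ex

/-- Commands of the language. -/
inductive Cmd where
  | skip : Cmd
  | set (x : ℕ) (e : Ex) : Cmd
  | put (a : ℕ) (e f : Ex) : Cmd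
  | outp (e f : Ex) : Cmd
  | inp (x : ℕ) (e : Ex) : Cmd
  | seq (p q : Cmd) : Cmd
  | ite (e f : Ex) (p q : Cmd) : Cmd
  | wh (e f : Ex) (p : Cmd) : Cmd

infixr:30 " ;; " => Cmd.seq

namespace Cmd

/-- As `whileLt` only compares registers, a loop evaluates its guards once before it and again at
the end of each round. -/
def comp : Cmd → Prog
  | skip => .skip
  | set x e => .seq (e.comp 40) (.seq (.const 41 0) (.arith .add x 40 41))
  | put a e f => .seq (.seq (e.comp 40) (Ex.addr a 40)) (.seq (f.comp 41) (.store 40 41))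
  | outp e f => .seq (e.comp 40) (.seq (f.comp 41) (.store 40 41))
  | inp x e => .seq (e.comp 40) (.input x 40)
  | seq p q => .seq p.comp q.comp
  | ite e f p q => .seq (e.comp 40) (.seq (f.comp 41) (.ifLt 40 41 p.comp q.comp))
  | wh e f p => .seq (e.comp 40) (.seq (f.comp 41)
      (.whileLt 40 41 (.seq p.comp (.seq (e.comp 40) (f.comp 41)))))

def okEx (e : Ex) : Bool := e.ok && decide (e.mdeg ≤ 16)

/-- A static check of the register names and the depth of the expressions. -/
def ok : Cmd → Bool
  | skip => true
  | set x e => decide (0 < x) && decide (x < 40) && okEx e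
  | put a e f => decide (a < 16) && okEx e && decide (e.deg + 2 ≤ 16) && okEx f
  | outp e f => okEx e && okEx f
  | inp x e => decide (0 < x) && decide (x < 40) && okEx e
  | seq p q => p.ok && q.ok
  | ite e f p q => okEx e && okEx f && p.ok && q.ok
  | wh e f p => okEx e && okEx f && p.ok

/-- The weakest precondition of a loop-free command. -/
def wp (E : Env) : Cmd → (St → Prop) → St → Prop
  | skip, Q, t => Q t
  | set x e, Q, t => (e.leaf = true ∨ e.eval t < E.V) ∧ Q (t.setReg x (e.eval t))
  | put a e f, Q, t => (f.leaf = true ∨ f.eval t < E.V) ∧ Q (t.setArr a (e.eval t) (f.eval t))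
  | outp e f, Q, t => e.eval t < E.n ∧ Q (t.setOut (e.eval t) (f.eval t))
  | inp x e, Q, t => Q (t.setReg x (E.inp.getD (e.eval t) 0))
  | seq p q, Q, t => p.wp E (q.wp E Q) t
  | ite e f p q, Q, t =>
      (e.eval t < f.eval t → p.wp E Q t) ∧ (f.eval t ≤ e.eval t → q.wp E Q t)
  | wh _ _ _, _, _ => False

/-- A bound for the number of steps of a loop-free command. -/
def cost : Cmd → ℕ
  | skip => 1
  | set _ e => e.cost + 2
  | put _ e f => e.cost + f.cost + 6
  | outp e f => e.cost + f.cost + 1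
  | inp _ e => e.cost + 1
  | seq p q => p.cost + q.cost
  | ite e f p q => e.cost + f.cost + 1 + max p.cost q.cost
  | wh _ _ _ => 0

end Cmd

/-- Total correctness with a step count. -/
def Tr (E : Env) (p : Cmd) (t : St) (Q : ℕ → St → Prop) : Prop :=
  ∀ s, Represents E.n E.V s t → ∃ k s' t', Exec E.B E.inp p.comp s k s' ∧ Represents E.n E.V s' t' ∧ Q k t'

variable {E : Env} {p q : Cmd} {t : St} {Q Q' : ℕ → St → Prop}

theorem Tr.mono (h : Tr E p t Q) (hQ : ∀ k t', Q k t' → Q' k t') : Tr E p t Q' := by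
  intro s hs
  obtain ⟨k, s', t', h1, h2, h3⟩ := h s hs
  exact ⟨k, s', t', h1, h2, hQ _ _ h3⟩

theorem Tr.seq (h : Tr E p t fun k t' => Tr E q t' fun l t'' => Q (k + l) t'') :
    Tr E (p ;; q) t Q := by
  intro s hs
  obtain ⟨k, s', t', h1, h2, h3⟩ := h s hs
  obtain ⟨l, s'', t'', h4, h5, h6⟩ := h3 s' h2
  exact ⟨k + l, s'', t'', .seq h1 h4, h5, h6⟩

theorem okEx_iff {e : Ex} : Cmd.okEx e = true ↔ e.ok = true ∧ e.mdeg ≤ 16 := by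
  simp [Cmd.okEx]

theorem eval_pair {n V : ℕ} {inp : List ℕ} (hV : 64 ≤ V) {s : RamState} {t : St} {e f : Ex}
    (h : Represents n V s t) (he : Cmd.okEx e) (hf : Cmd.okEx f) :
    ∃ s1 s2, Exec (V ^ 16) inp (e.comp 40) s e.cost s1 ∧
      Exec (V ^ 16) inp (f.comp 41) s1 f.cost s2 ∧
      Represents n V s2 t ∧ s2.reg 40 = e.eval t ∧ s2.reg 41 = f.eval t := by
  rw [okEx_iff] at he hf
  obtain ⟨s1, h1, m1, r1, v1⟩ := Ex.comp_spec (inp := inp) hV e he.1 he.2 40 s le_rfl h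
  have R1 : Represents n V s1 t := h.congr m1 (fun x hx => r1 x (by omega))
  obtain ⟨s2, h2, m2, r2, v2⟩ := Ex.comp_spec (inp := inp) hV f hf.1 hf.2 41 s1 (by omega) R1
  exact ⟨s1, s2, h1, h2, R1.congr m2 (fun x hx => r2 x (by omega)),
    (r2 40 (by omega)).trans v1, v2⟩

theorem Represents.setReg {n V : ℕ} {s : RamState} {t : St} (h : Represents n V s t) {x v : ℕ} (hx : 0 < x)
    (hv : v < V) : Represents n V (s.setReg x v) (t.setReg x v) := by
  refine ⟨fun y hy => ?_, h.out, h.arr, ?_, fun y hy => ?_, h.arr_lt⟩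
  · simp only [RamState.setReg, Function.update_apply, St.setReg_reg, h.reg y hy]
  · have : (0 : ℕ) ≠ x := by omega
    simp [this, h.zero]
  · simp only [St.setReg_reg]; split_ifs <;> [exact hv; exact h.reg_lt y hy]

theorem Represents.setArr {n V : ℕ} {s : RamState} {t : St} (h : Represents n V s t) {a i v : ℕ} (ha : a < 16)
    (hv : v < V) : Represents n V (s.setMem (n + 16 * i + a) v) (t.setArr a i v) := by
  refine ⟨h.reg, fun j hj => ?_, fun b hb j => ?_, h.zero, h.reg_lt, fun b hb j => ?_⟩
  · have : j ≠ n + 16 * i + a := by omega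
    simp [RamState.setMem, this, h.out j hj]
  · simp only [RamState.setMem, Function.update_apply, St.setArr_arr, h.arr b hb j]
    by_cases hba : b = a
    · subst hba
      by_cases hij : j = i
      · subst hij; simp
      · simp [hij]
    · have : n + 16 * j + b ≠ n + 16 * i + a := by omega
      simp [hba, this]
  · simp only [St.setArr_arr]
    split_ifs with h1
    · simp only [Function.update_apply]
      split_ifs <;> [exact hv; exact h.arr_lt a ha j]
    · exact h.arr_lt b hb j

theorem Represents.setOut {n V : ℕ} {s : RamState} {t : St} (h : Represents n V s t) {i v : ℕ} (hi : i < n) :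
    Represents n V (s.setMem i v) (t.setOut i v) := by
  refine ⟨h.reg, fun j hj => ?_, fun b hb j => ?_, h.zero, h.reg_lt, h.arr_lt⟩
  · simp [RamState.setMem, Function.update_apply, h.out j hj]
  · have : n + 16 * j + b ≠ i := by omega
    simp [RamState.setMem, this, h.arr b hb j]

/-- For loop-free commands the step bound is syntactic, so that concrete programs get numerical
bounds by `decide`. The precondition of a loop is `False`, which excludes loops. -/
theorem Tr.of_wp {Q : St → Prop} (hp : p.ok) (h : p.wp E Q t) :
    Tr E p t (fun k t' => k ≤ p.cost ∧ Q t') := by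
  have hV := E.hV
  have hV2 : E.V ≤ E.V ^ 16 := Nat.le_self_pow (by omega) _
  induction p generalizing t Q with
  | skip => exact fun s hs => ⟨1, s, t, .skip s, hs, le_rfl, h⟩
  | set x e =>
    intro s hs
    simp only [Cmd.ok, Bool.and_eq_true, decide_eq_true_eq, okEx_iff] at hp
    obtain ⟨s1, h1, m1, r1, v1⟩ := Ex.comp_spec (inp := E.inp) hV e hp.2.1 hp.2.2 40 s le_rfl hs
    have R1 := hs.congr m1 r1
    have hlt := Ex.eval_lt_of_leaf hV hs hp.2.1 h.1
    have R2 : Represents E.n E.V (s1.setReg 41 0) t := R1.congr rfl (fun x hx => by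
      have : x ≠ 41 := by omega
      simp [RamState.setReg, this])
    have ev : (s1.setReg 41 0).reg 40 + (s1.setReg 41 0).reg 41 = e.eval t := by
      simp [RamState.setReg, v1]
    refine ⟨_, _, _, .seq h1 (.seq (.const _ _ _ ?_) (.arith _ _ _ _ _ ?_)),
      ?_, ?_, h.2⟩
    · simp only [Env.B]; omega
    · simp only [ArithOp.eval, ev, Env.B]; exact lt_of_lt_of_le hlt hV2
    · simp only [ArithOp.eval, ev]; exact R2.setReg hp.1.1 hlt
    · simp [Cmd.cost]
  | put a e f =>
    intro s hs
    simp only [Cmd.ok, Bool.and_eq_true, decide_eq_true_eq, okEx_iff] at hp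
    obtain ⟨s1, h1, m1, r1, v1⟩ := Ex.compAddr_spec (inp := E.inp) hV a hp.1.1.1 e hp.1.1.2.1
      hp.1.1.2.2 hp.1.2 40 s le_rfl hs
    have R1 := hs.congr m1 r1
    obtain ⟨s2, h2, m2, r2, v2⟩ := Ex.comp_spec (inp := E.inp) hV f hp.2.1 hp.2.2 41 s1
      (by omega) R1
    have R2 := R1.congr m2 (fun x hx => r2 x (by omega))
    refine ⟨_, _, _, .seq h1 (.seq h2 (.store _ _ _)), ?_, ?_, h.2⟩
    · rw [r2 40 (by omega), v1, v2]; exact R2.setArr hp.1.1.1 (Ex.eval_lt_of_leaf hV hs hp.2.1 h.1)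
    · simp only [Cmd.cost]; omega
  | outp e f =>
    intro s hs
    simp only [Cmd.ok, Bool.and_eq_true] at hp
    obtain ⟨s1, s2, h1, h2, R2, v1, v2⟩ := eval_pair (inp := E.inp) hV hs hp.1 hp.2
    refine ⟨_, _, _, .seq h1 (.seq h2 (.store _ _ _)), ?_, ?_, h.2⟩
    · rw [v1, v2]; exact R2.setOut h.1
    · simp only [Cmd.cost]; omega
  | inp x e =>
    intro s hs
    simp only [Cmd.ok, Bool.and_eq_true, decide_eq_true_eq, okEx_iff] at hp
    obtain ⟨s1, h1, m1, r1, v1⟩ := Ex.comp_spec (inp := E.inp) hV e hp.2.1 hp.2.2 40 s le_rfl hs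
    have R1 := hs.congr m1 r1
    refine ⟨_, _, _, .seq h1 (.input _ _ _ ?_), ?_, ?_, h⟩
    · exact lt_of_lt_of_le (E.hinp _) hV2
    · rw [v1]; exact R1.setReg hp.1.1 (E.hinp _)
    · simp [Cmd.cost]
  | seq p q ihp ihq =>
    simp only [Cmd.ok, Bool.and_eq_true] at hp
    refine Tr.seq ((ihp hp.1 h).mono fun k t' h' => (ihq hp.2 h'.2).mono fun l t'' h'' => ?_)
    simp only [Cmd.cost]
    exact ⟨by omega, h''.2⟩
  | ite e f p q ihp ihq =>
    intro s hs
    simp only [Cmd.ok, Bool.and_eq_true] at hp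
    obtain ⟨s1, s2, h1, h2, R2, v1, v2⟩ := eval_pair (inp := E.inp) hV hs hp.1.1.1 hp.1.1.2
    by_cases hlt : e.eval t < f.eval t
    · obtain ⟨k, s', t', h3, h4, h5⟩ := ihp hp.1.2 (h.1 hlt) s2 R2
      refine ⟨_, s', t', .seq h1 (.seq h2 (.ifTrue (by rwa [v1, v2]) h3)), h4, ?_, h5.2⟩
      simp only [Cmd.cost]; omega
    · obtain ⟨k, s', t', h3, h4, h5⟩ := ihq hp.2 (h.2 (by omega)) s2 R2
      refine ⟨_, s', t', .seq h1 (.seq h2 (.ifFalse (by rwa [v1, v2]) h3)), h4, ?_, h5.2⟩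
      simp only [Cmd.cost]; omega
  | wh => exact h.elim

/-- A conditional whose branches may contain loops. -/
theorem Tr.ite {e f : Ex} (he : Cmd.okEx e) (hf : Cmd.okEx f)
    (h1 : e.eval t < f.eval t → Tr E p t (fun k t' => Q (e.cost + (f.cost + (k + 1))) t'))
    (h2 : f.eval t ≤ e.eval t → Tr E q t (fun k t' => Q (e.cost + (f.cost + (k + 1))) t')) :
    Tr E (.ite e f p q) t Q := by
  intro s hs
  obtain ⟨s1, s2, x1, x2, R2, v1, v2⟩ := eval_pair (inp := E.inp) E.hV hs he hf
  by_cases hlt : e.eval t < f.eval t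
  · obtain ⟨k, s', t', h3, h4, h5⟩ := h1 hlt s2 R2
    exact ⟨_, s', t', .seq x1 (.seq x2 (.ifTrue (by rwa [v1, v2]) h3)), h4, h5⟩
  · obtain ⟨k, s', t', h3, h4, h5⟩ := h2 (by omega) s2 R2
    exact ⟨_, s', t', .seq x1 (.seq x2 (.ifFalse (by rwa [v1, v2]) h3)), h4, h5⟩

/-- Loops, with an invariant and a potential that pays for the steps; both may refer to a ghost
state. -/
theorem Tr.wh {γ : Type*} {e f : Ex} {Inv : γ → St → Prop} {Φ : γ → ℕ} (he : Cmd.okEx e)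
    (hf : Cmd.okEx f)
    (hbody : ∀ g t, Inv g t → e.eval t < f.eval t →
      Tr E p t (fun k t' => ∃ g', Inv g' t' ∧ k + (e.cost + f.cost + 1) + Φ g' ≤ Φ g))
    {g : γ} (ht : Inv g t) :
    Tr E (.wh e f p) t (fun k t' => ∃ g', Inv g' t' ∧ f.eval t' ≤ e.eval t' ∧
      k + Φ g' ≤ Φ g + (e.cost + f.cost + 1)) := by
  -- Each round lowers the potential by at least one, so the potential also proves termination.
  have key : ∀ N g t, Φ g ≤ N → Inv g t → ∀ s, Represents E.n E.V s t → s.reg 40 = e.eval t →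
      s.reg 41 = f.eval t → ∃ k s' t' g', Exec E.B E.inp
        (.whileLt 40 41 (.seq p.comp (.seq (e.comp 40) (f.comp 41)))) s k s' ∧
        Represents E.n E.V s' t' ∧ Inv g' t' ∧ f.eval t' ≤ e.eval t' ∧ k + Φ g' ≤ Φ g + 1 := by
    intro N
    induction N using Nat.strong_induction_on with
    | _ N ih =>
    intro g t hN ht s hs v1 v2
    by_cases hlt : e.eval t < f.eval t
    · obtain ⟨k, s', t', h3, h4, g', h5, h6⟩ := hbody g t ht hlt s hs
      obtain ⟨s1, s2, x1, x2, R2, w1, w2⟩ := eval_pair (inp := E.inp) E.hV h4 he hf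
      obtain ⟨k', s'', t'', g'', y1, y2, y3, y4, y5⟩ :=
        ih (Φ g') (by omega) g' t' le_rfl h5 s2 R2 w1 w2
      refine ⟨_, s'', t'', g'', .whileStep (by rwa [v1, v2]) (.seq h3 (.seq x1 x2)) y1,
        y2, y3, y4, ?_⟩
      omega
    · exact ⟨1, s, t, g, .whileDone (by rwa [v1, v2]), hs, ht, by omega, by omega⟩
  intro s hs
  obtain ⟨s1, s2, x1, x2, R2, v1, v2⟩ := eval_pair (inp := E.inp) E.hV hs he hf
  obtain ⟨k, s', t', g', h3, h4, h5, h6, h7⟩ := key _ g t le_rfl ht s2 R2 v1 v2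
  exact ⟨_, s', t', .seq x1 (.seq x2 h3), h4, g', h5, h6, by omega⟩

/-- `for x in [x, y)`, where `y` is a register. -/
def Cmd.for (x y : ℕ) (p : Cmd) : Cmd := .wh (.r x) (.r y) (p ;; .set x (.r x + 1))

/-- Counting loops. The body costs at most `c`, apart from what the potential pays. -/
theorem Tr.for {x y N c : ℕ} {I : ℕ → St → Prop} {Ψ : St → ℕ} (hx : 0 < x) (hx' : x < 40)
    (hy : y < 40) (hxy : y ≠ x) (hN : N < E.V)
    (hbody : ∀ i < N, ∀ t, I i t → t.reg x = i → t.reg y = N →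
      Tr E p t (fun k t' => I (i + 1) t' ∧ t'.reg x = i ∧ t'.reg y = N ∧ k + Ψ t' ≤ c + Ψ t))
    (hI : ∀ i t, I i t → I i (t.setReg x i))
    (hΨ : ∀ i t, Ψ (t.setReg x i) = Ψ t)
    (ht : I (t.reg x) t) (hxN : t.reg x ≤ N) (hyN : t.reg y = N) :
    Tr E (.for x y p) t (fun k t' => I N t' ∧ t'.reg x = N ∧ t'.reg y = N ∧
      k + Ψ t' ≤ (N - t.reg x) * (c + 16) + 5 + Ψ t) := by
  have okx : Cmd.okEx (.r x) := by simp [Cmd.okEx, Ex.ok, Ex.mdeg, hx']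
  have oky : Cmd.okEx (.r y) := by simp [Cmd.okEx, Ex.ok, Ex.mdeg, hy]
  have main := Tr.wh (E := E) (t := t) (e := .r x) (f := .r y) (p := p ;; .set x (.r x + 1))
    (Inv := fun g t => g = t ∧ I (t.reg x) t ∧ t.reg x ≤ N ∧ t.reg y = N)
    (Φ := fun t => (N - t.reg x) * (c + 16) + Ψ t) okx oky ?_ ⟨rfl, ht, hxN, hyN⟩
  · refine main.mono fun k t' h => ?_
    obtain ⟨g, ⟨hg, h1, h2, h3⟩, h4, h5⟩ := h
    subst g
    simp only [Ex.eval_r] at h4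
    have h6 : t'.reg x = N := by omega
    rw [h6] at h1 h5
    simp only [Ex.cost] at h5
    exact ⟨h1, h6, h3, by omega⟩
  · rintro g t ⟨hg, h1, h2, h3⟩ h4
    subst g
    simp only [Ex.eval_r, h3] at h4
    refine Tr.seq ((hbody _ h4 t h1 rfl h3).mono fun k t' h => ?_)
    obtain ⟨g1, g2, g3, g4⟩ := h
    refine Tr.mono (Tr.of_wp (Q := fun t'' => t'' = t'.setReg x (t.reg x + 1)) ?_ ?_) ?_
    · have : Ex.ok (Ex.r x + 1) ∧ Ex.mdeg (Ex.r x + 1) ≤ 16 := by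
        constructor
        · change (Ex.ok (Ex.r x) && Ex.ok (Ex.c 1)) = true
          simp [Ex.ok, hx']
        · change max _ (max _ _) ≤ 16
          simp [Ex.deg, Ex.mdeg]
      simp [Cmd.ok, okEx_iff, this, hx, hx']
    · simp only [Cmd.wp, Ex.eval_add, Ex.eval_r, g2, Ex.eval_num, and_true]
      right; omega
    · rintro l t'' ⟨hl, rfl⟩
      have hl' : l ≤ 6 := hl
      refine ⟨_, ⟨rfl, ?_, ?_, ?_⟩, ?_⟩
      · simp only [St.setReg_reg, if_true]; exact hI _ _ g1
      · simp only [St.setReg_reg, if_true]; omega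
      · simp [hxy, g3]
      · simp only [St.setReg_reg, if_true, hΨ, Ex.cost]
        have : N - t.reg x = (N - (t.reg x + 1)) + 1 := by omega
        rw [this, add_mul]
        omega

/-- Only the arrays in `A` and the temporary registers have changed. -/
structure Frame (A : List ℕ) (t t' : St) : Prop where
  out : t'.out = t.out
  reg : ∀ x < 16, t'.reg x = t.reg x
  arr : ∀ a, a ∉ A → t'.arr a = t.arr a

theorem Frame.refl (A : List ℕ) (t : St) : Frame A t t := ⟨rfl, fun _ _ => rfl, fun _ _ => rfl⟩

theorem Frame.trans {A : List ℕ} {t t' t'' : St} (h : Frame A t t') (h' : Frame A t' t'') :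
    Frame A t t'' :=
  ⟨h'.out.trans h.out, fun x hx => (h'.reg x hx).trans (h.reg x hx),
    fun a ha => (h'.arr a ha).trans (h.arr a ha)⟩

theorem Frame.mono {A A' : List ℕ} {t t' : St} (h : Frame A t t') (hA : A ⊆ A') :
    Frame A' t t' := ⟨h.out, h.reg, fun a ha => h.arr a fun h' => ha (hA h')⟩

/-- The representation provides bounds for all words. -/
theorem Tr.bounded (h : (∀ x < 40, t.reg x < E.V) → (∀ a < 16, ∀ i, t.arr a i < E.V) →
    t.reg 0 = E.n → Tr E p t Q) : Tr E p t Q :=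
  fun s hs => h hs.reg_lt hs.arr_lt hs.zero s hs

end

section

/-! ### The largest power of two dividing a number -/

/-- The largest power of two that divides `k`, and `0` for `k = 0`. -/
def low (k : ℕ) : ℕ := if k = 0 then 0 else if k % 2 = 1 then 1 else 2 * low (k / 2)
decreasing_by omega

theorem low_zero : low 0 = 0 := by rw [low]; rfl

theorem low_odd {k : ℕ} (h : k % 2 = 1) : low k = 1 := by
  rw [low, if_neg (by omega), if_pos h]

theorem low_even {k : ℕ} (h : k % 2 = 0) : low k = 2 * low (k / 2) := by
  rcases Nat.eq_zero_or_pos k with rfl | hk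
  · simp [low_zero]
  · rw [low, if_neg (by omega), if_neg (by omega)]

theorem low_eq_pow (k : ℕ) (hk : 0 < k) : ∃ e, low k = 2 ^ e ∧ 2 ^ e ∣ k := by
  induction k using Nat.strong_induction_on with
  | _ k ih =>
  rcases Nat.mod_two_eq_zero_or_one k with h | h
  · obtain ⟨e, h1, h2⟩ := ih (k / 2) (by omega) (by omega)
    refine ⟨e + 1, by rw [low_even h, h1]; ring, ?_⟩
    rw [pow_succ]
    obtain ⟨x, hx⟩ := h2
    exact ⟨x, by rw [mul_right_comm, ← hx]; omega⟩
  · exact ⟨0, by rw [low_odd h]; rfl, by simp⟩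

theorem low_le (k : ℕ) : low k ≤ k := by
  rcases Nat.eq_zero_or_pos k with rfl | hk
  · simp [low_zero]
  · obtain ⟨e, h1, h2⟩ := low_eq_pow k hk
    exact h1 ▸ Nat.le_of_dvd hk h2

/-- This guarantees that at every positive multiple of 2 ^ j the window has length at least 2 ^ j.
-/
theorem pow_le_low {j k : ℕ} (hk : 0 < k) (h : 2 ^ j ∣ k) : 2 ^ j ≤ low k := by
  induction j generalizing k with
  | zero =>
    obtain ⟨e, h1, -⟩ := low_eq_pow k hk
    rw [h1]; exact Nat.one_le_two_pow
  | succ j ih =>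
    obtain ⟨x, rfl⟩ := h
    have hx : 0 < x := Nat.pos_of_ne_zero (by rintro rfl; simp at hk)
    have h2 : 2 ^ (j + 1) * x / 2 = 2 ^ j * x := by
      rw [pow_succ, mul_right_comm]; exact Nat.mul_div_cancel _ (by omega)
    rw [low_even (by rw [pow_succ, mul_right_comm]; omega), h2, pow_succ, mul_comm]
    exact Nat.mul_le_mul_left 2 (ih (by positivity) ⟨x, rfl⟩)

/-- One term of the sum suffices: the exact power of two dividing k, or 2 ^ h if that power is
larger. -/
theorem min_low_le (h k : ℕ) (hk : 0 < k) :
    min (low k) (2 ^ h) ≤ ∑ j ∈ Finset.range (h + 1), if 2 ^ j ∣ k then 2 ^ j else 0 := by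
  obtain ⟨e, h1, h2⟩ := low_eq_pow k hk
  rcases le_total e h with he | he
  · refine (min_le_left _ _).trans ?_
    rw [h1]
    refine le_trans ?_ (Finset.single_le_sum (f := fun j => if 2 ^ j ∣ k then 2 ^ j else 0)
      (fun _ _ => Nat.zero_le _) (Finset.mem_range.2 (by omega : e < h + 1)))
    simp [h2]
  · refine (min_le_right _ _).trans ?_
    refine le_trans ?_ (Finset.single_le_sum (f := fun j => if 2 ^ j ∣ k then 2 ^ j else 0)
      (fun _ _ => Nat.zero_le _) (Finset.mem_range.2 (by omega : h < h + 1)))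
    simp [(pow_dvd_pow 2 he).trans h2]

/-- Among N consecutive labels starting at 1 there are at most N / 2 ^ j multiples of 2 ^ j, so each
of the h + 1 scales contributes at most N. This is the source of the logarithm in the running time.
-/
theorem sum_min_low_le {n h : ℕ} (hn : n ≤ 2 ^ h) (N : ℕ) :
    ∑ k ∈ Finset.range N, min (low (k + 1)) n ≤ N * (h + 1) := by
  calc ∑ k ∈ Finset.range N, min (low (k + 1)) n
      ≤ ∑ k ∈ Finset.range N, ∑ j ∈ Finset.range (h + 1), if 2 ^ j ∣ k + 1 then 2 ^ j else 0 :=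
        Finset.sum_le_sum fun k _ => (min_le_min_left _ hn).trans (min_low_le h (k + 1) (by omega))
    _ = ∑ j ∈ Finset.range (h + 1), ∑ k ∈ Finset.range N, if 2 ^ j ∣ k + 1 then 2 ^ j else 0 :=
        Finset.sum_comm
    _ ≤ ∑ j ∈ Finset.range (h + 1), N := by
        refine Finset.sum_le_sum fun j _ => ?_
        rw [← Finset.sum_filter, Finset.sum_const, Nat.card_multiples, smul_eq_mul]
        exact Nat.div_mul_le_self N _
    _ = N * (h + 1) := by simp [mul_comm]

/-! ### Layouts: partitions of the vertices into intervals of positions -/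

/-- The vertex `v` belongs to the part with the interval `[T v, T v + Z (T v))`, and `P` lists the
vertices of each part in its interval. -/
structure Layout (n : ℕ) (T P Z : ℕ → ℕ) : Prop where
  le : ∀ v < n, T v + Z (T v) ≤ n
  pos : ∀ p < n, P p < n ∧ T (P p) ≤ p ∧ p < T (P p) + Z (T (P p))
  surj : ∀ v < n, ∃ p, T v ≤ p ∧ p < T v + Z (T v) ∧ P p = v
  disj : ∀ u < n, ∀ v < n, T u ≠ T v → T u + Z (T u) ≤ T v ∨ T v + Z (T v) ≤ T u
  card : ∀ v < n, ((Finset.range n).filter fun u => T u = T v).card = Z (T v)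

theorem Layout.Z_pos {n : ℕ} {T P Z : ℕ → ℕ} (h : Layout n T P Z) {v : ℕ} (hv : v < n) :
    0 < Z (T v) := by
  obtain ⟨p, h1, h2, -⟩ := h.surj v hv
  omega

/-- Intervals of different parts are disjoint, so a shared position forces equal parts. -/
theorem Layout.part_eq {n : ℕ} {T P Z : ℕ → ℕ} (h : Layout n T P Z) {v p : ℕ} (hv : v < n)
    (h1 : T v ≤ p) (h2 : p < T v + Z (T v)) : T (P p) = T v := by
  have hp : p < n := lt_of_lt_of_le h2 (h.le v hv)
  obtain ⟨h3, h4, h5⟩ := h.pos p hp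
  by_contra hne
  rcases h.disj _ h3 v hv hne with h6 | h6 <;> omega

/-- Two vertices whose intervals share a position are in the same part. -/
theorem Layout.eq_of_mem {n : ℕ} {T P Z : ℕ → ℕ} (h : Layout n T P Z) {u v p : ℕ} (hu : u < n)
    (hv : v < n) (h1 : T v ≤ p) (h2 : p < T v + Z (T v)) (h3 : T u ≤ p)
    (h4 : p < T u + Z (T u)) : T u = T v :=
  (h.part_eq hu h3 h4).symm.trans (h.part_eq hv h1 h2)

/-! ### The state of the algorithm -/

/-- The layout `T, P, Z`, the labels `L`, the scan pointers `X` of the vertices, the current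
positions `C` of the parts, the registration flags `R`, the work list `W 0` and the watch lists
`W q`, the rounded weights `w` and their minima `m` over the parts. -/
structure Core where
  T : ℕ → ℕ
  P : ℕ → ℕ
  Z : ℕ → ℕ
  L : ℕ → ℕ
  X : ℕ → ℕ
  C : ℕ → ℕ
  R : ℕ → ℕ
  W : ℕ → List ℕ
  w : ℕ → ℕ → ℕ
  m : ℕ → ℕ → ℕ

namespace Core

variable (c : Core)

/-- The end of the interval of the part of `v`. -/
def e (v : ℕ) : ℕ := c.T v + c.Z (c.T v)

/-- The number of positions between the intervals of `u` and `v`. -/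
def gap (u v : ℕ) : ℕ := (c.T v - c.e u) + (c.T u - c.e v)

/-- The scan stands here: at the stored pointer or, if that lies further left, at the start of the
window. Subtraction truncates the window at position 0. -/
def x0 (v : ℕ) : ℕ := max (c.X v) (c.T v - low (c.L v))

/-- The position that `v` looks at next. -/
def xx (v : ℕ) : ℕ := if c.T v ≤ c.x0 v then max (c.x0 v) (c.e v) else c.x0 v

/-- The end of the window of `v`. -/
def hi (n v : ℕ) : ℕ := min n (c.e v + low (c.L v))

/-- The part that `v` looks at next. -/
def item (v : ℕ) : ℕ := c.T (c.P (c.xx v))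

/-- The part that `v` looks at supports the label of `v`. -/
def Hit (n v : ℕ) : Prop :=
  c.xx v < c.hi n v ∧ c.L (c.P (c.xx v)) + c.m (c.item v) v ≤ c.L v

end Core

/-- The number of the watch list of the part `a` for the label `θ`. -/
def watch (M a θ : ℕ) : ℕ := 1 + (a * (M + 2) + θ)

theorem watch_inj {M a a' θ θ' : ℕ} (h : θ < M + 2) (h' : θ' < M + 2)
    (he : watch M a θ = watch M a' θ') : a = a' ∧ θ = θ' := by
  simp only [watch, add_right_inj] at he
  have h1 : (a * (M + 2) + θ) / (M + 2) = a := by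
    rw [mul_comm, Nat.mul_add_div (by omega), Nat.div_eq_of_lt h, add_zero]
  have h2 : (a' * (M + 2) + θ') / (M + 2) = a' := by
    rw [mul_comm, Nat.mul_add_div (by omega), Nat.div_eq_of_lt h', add_zero]
  have : a = a' := by rw [← h1, he, h2]
  subst this
  exact ⟨rfl, by omega⟩

namespace Core

variable (c : Core)

/-- The list in which `v` registers for the part that it looks at. -/
def regList (M v : ℕ) : ℕ := watch M (c.item v) (c.L v - c.m (c.item v) v + 1)

/-- The part at `b` has a vertex with a supported label that is registered for changes. -/
def Stable (n M b : ℕ) : Prop :=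
  c.C b < b + c.Z b ∧ c.Hit n (c.P (c.C b)) ∧ c.P (c.C b) ∈ c.W (c.regList M (c.P (c.C b)))

end Core

/-- `m a v` is the minimum of the weights `w u v` over the vertices `u` of the part at `a`. -/
def MinSpec (n : ℕ) (T : ℕ → ℕ) (w m : ℕ → ℕ → ℕ) : Prop :=
  ∀ a < n, ∀ v < n, (∀ u < n, T u = T a → m (T a) v ≤ w u v) ∧
    ∃ u < n, T u = T a ∧ m (T a) v = w u v

/-- The invariants; the parts in `Ex` may violate stability. -/
structure Valid (n r M : ℕ) (Ex : ℕ → Prop) (c : Core) : Prop where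
  lay : Layout n c.T c.P c.Z
  mins : MinSpec n c.T c.w c.m
  wpos : ∀ u < n, ∀ v < n, 1 ≤ c.w u v
  Lpart : ∀ u < n, ∀ v < n, c.T u = c.T v → c.L u = c.L v
  Lle : ∀ v < n, c.L v ≤ M + 1
  Lsrc : ∀ v < n, c.T v = c.T r → c.L v = 0
  scan : ∀ u < n, ∀ v < n, c.T u ≠ c.T v → ∀ k < c.L v, c.gap u v < low k → k < c.L u + c.w u v
  ptr : ∀ u < n, ∀ v < n, c.T u ≠ c.T v → ∀ p, c.T v - low (c.L v) ≤ p → p < c.X v →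
    c.T u ≤ p → p < c.e u → c.L v < c.L u + c.w u v
  cur : ∀ v < n, c.T v ≤ c.C (c.T v) ∧ c.C (c.T v) ≤ c.e v
  done : ∀ p < n, p < c.C (c.T (c.P p)) → ∀ u < n, c.T u ≠ c.T (c.P p) →
    c.gap u (c.P p) < low (c.L (c.P p)) → c.L (c.P p) < c.L u + c.w u (c.P p)
  stab : ∀ v < n, c.T v ≠ c.T r → c.L v ≤ M → ¬ Ex (c.T v) →
    (∃ v' ∈ c.W 0, c.T v' = c.T v) ∨ c.Stable n M (c.T v)
  reg : ∀ v < n, c.R v = 1 → c.Hit n v → v ∈ c.W (c.regList M v)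
  Rle : ∀ v < n, c.R v ≤ 1

/-! ### The potential -/

namespace Core

variable (c : Core)

/-- Bounds the number of positions that `v` still looks at with its current label. -/
def φ (n v : ℕ) : ℕ :=
  (n - min (c.x0 v) (c.T v)) + (c.e v + min (low (c.L v)) n - max (c.x0 v) (c.e v))

/-- The number of positions that are still to be visited by the parts. -/
def cnt (n : ℕ) : ℕ := ((Finset.range n).filter fun p => c.C (c.T (c.P p)) ≤ p).card

end Core

/-- The potential of a vertex with label `l`. -/
def lab (n M l : ℕ) : ℕ := ∑ k ∈ Finset.Ico l (M + 1), (6 + 8 * min (low (k + 1)) n)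

/-- The number of entries of the watch lists. -/
def entries (n M : ℕ) (W : ℕ → List ℕ) : ℕ :=
  ∑ q ∈ Finset.range (n * (M + 2)), (W (1 + q)).length

def Core.pot (c : Core) (n M : ℕ) : ℕ :=
  4 * ∑ v ∈ Finset.range n, c.φ n v + c.cnt n + ∑ v ∈ Finset.range n, lab n M (c.L v) +
    2 * (c.W 0).length + 3 * entries n M c.W + 3 * ∑ v ∈ Finset.range n, (1 - c.R v)

variable {n r M : ℕ} {Ex : ℕ → Prop} {c : Core}

theorem Valid.m_pos (h : Valid n r M Ex c) {a v : ℕ} (ha : a < n) (hv : v < n) :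
    1 ≤ c.m (c.T a) v := by
  obtain ⟨-, u, hu, -, h2⟩ := h.mins a ha v hv
  rw [h2]; exact h.wpos u hu v hv

theorem Valid.T_lt (h : Valid n r M Ex c) {v : ℕ} (hv : v < n) : c.T v < n := by
  have := h.lay.le v hv
  have := h.lay.Z_pos hv
  omega

theorem Valid.T_lt_e (h : Valid n r M Ex c) {v : ℕ} (hv : v < n) : c.T v < c.e v := by
  have := h.lay.Z_pos hv
  simp only [Core.e]; omega

/-- The current vertex of a part belongs to the part. -/
theorem Valid.T_cur (h : Valid n r M Ex c) {v : ℕ} (hv : v < n)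
    (hC : c.C (c.T v) < c.T v + c.Z (c.T v)) :
    c.P (c.C (c.T v)) < n ∧ c.T (c.P (c.C (c.T v))) = c.T v := by
  have h1 := (h.cur v hv).1
  exact ⟨(h.lay.pos _ (lt_of_lt_of_le hC (h.lay.le v hv))).1, h.lay.part_eq hv h1 hC⟩

/-- The position looked at is outside the interval of the part. -/
theorem Core.xx_cases (c : Core) (v : ℕ) :
    c.xx v < c.T v ∧ c.xx v = c.x0 v ∨ c.e v ≤ c.xx v ∧ c.T v ≤ c.x0 v ∧
      c.xx v = max (c.x0 v) (c.e v) := by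
  unfold Core.xx
  split_ifs with h
  · right; exact ⟨le_max_right _ _, h, rfl⟩
  · left; exact ⟨by omega, rfl⟩

/-- The position looked at avoids the interval of the own part, by `Core.xx_cases`. -/
theorem Valid.item_ne (h : Valid n r M Ex c) {v : ℕ} (hx : c.xx v < c.hi n v) :
    c.item v ≠ c.T v := by
  intro he
  have hn : c.xx v < n := lt_of_lt_of_le hx (min_le_left _ _)
  obtain ⟨h1, h2, h3⟩ := h.lay.pos _ hn
  unfold Core.item at he
  rw [he] at h2 h3
  rcases c.xx_cases v with h4 | h4
  · omega
  · have := h4.1; simp only [Core.e] at this; omega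

/-- A vertex whose pointer has reached the end of its window is supported by no part in it. -/
theorem Valid.exhausted (h : Valid n r M Ex c) {v : ℕ} (hv : v < n) (hx : c.hi n v ≤ c.xx v) {u : ℕ}
    (hu : u < n) (hne : c.T u ≠ c.T v) (hg : c.gap u v < low (c.L v)) :
    c.L v < c.L u + c.w u v := by
  have h1 := h.T_lt_e hv
  have h2 := h.T_lt hv
  have h3 := h.T_lt_e hu
  have h4 := h.T_lt hu
  have h5 : c.T v < c.hi n v := by simp only [Core.hi, lt_min_iff]; omega
  rcases c.xx_cases v with h6 | ⟨h6, h7, h8⟩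
  · omega
  have hX : c.T v ≤ c.X v := by
    have : c.x0 v = max (c.X v) (c.T v - low (c.L v)) := rfl
    rw [this] at h7
    rcases le_max_iff.1 h7 with h | h <;> omega
  have hx0 : c.x0 v = c.X v := by
    simp only [Core.x0]; omega
  simp only [Core.gap] at hg
  -- A part closer than the window length meets the window: in its last position if it lies to the
  -- left, in its first if it lies to the right. Both are before the pointer, so `ptr` applies
  -- there.
  rcases h.lay.disj u hu v hv hne with h9 | h9
  · change c.e u ≤ c.T v at h9
    exact h.ptr u hu v hv hne (c.e u - 1) (by omega) (by omega) (by omega) (by omega)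
  · change c.e v ≤ c.T u at h9
    have h10 : c.T u < c.hi n v := by simp only [Core.hi, lt_min_iff]; omega
    exact h.ptr u hu v hv hne (c.T u) (by omega) (by omega) (by omega) (by omega)

/-! ### The steps of the main loop -/

theorem sum_update_add {f g : ℕ → ℕ} {v a : ℕ} (hv : v < n) (h : ∀ u < n, u ≠ v → g u ≤ f u)
    (h' : g v + a ≤ f v) :
    ∑ u ∈ Finset.range n, g u + a ≤ ∑ u ∈ Finset.range n, f u := by
  rw [← Finset.sum_erase_add _ g (Finset.mem_range.2 hv),
    ← Finset.sum_erase_add _ f (Finset.mem_range.2 hv), add_assoc]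
  refine add_le_add (Finset.sum_le_sum fun u hu => ?_) h'
  rw [Finset.mem_erase, Finset.mem_range] at hu
  exact h u hu.2 hu.1

/-- `v` proceeds to the next part. -/
def Core.advance (c : Core) (v : ℕ) : Core :=
  { c with X := Function.update c.X v (c.item v + c.Z (c.item v)), R := Function.update c.R v 0 }

/-- The test against the minimum fails, hence it fails for every vertex of the part looked at, and
the pointer may jump over the whole interval of that part. The flag is cleared because `v` now looks
elsewhere. -/
theorem Valid.advance {v : ℕ} (h : Valid n r M (· = c.T v) c) (hv : v < n) (hx : c.xx v < c.hi n v)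
    (hf : c.L v < c.L (c.P (c.xx v)) + c.m (c.item v) v) :
    Valid n r M (· = c.T v) (c.advance v) where
  lay := h.lay
  mins := h.mins
  wpos := h.wpos
  Lpart := h.Lpart
  Lle := h.Lle
  Lsrc := h.Lsrc
  scan := h.scan
  cur := h.cur
  done := h.done
  Rle u hu := by
    simp only [Core.advance, Function.update_apply]
    split_ifs <;> [omega; exact h.Rle u hu]
  reg u hu := by
    by_cases huv : u = v
    · subst huv; simp [Core.advance]
    · have := h.reg u hu
      simpa [Core.advance, Core.Hit, Core.xx, Core.x0, Core.regList, Core.item, Core.hi, Core.e,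
        huv] using this
  stab u hu h1 h2 h3 := by
    rcases h.stab u hu h1 h2 h3 with h4 | h4
    · exact .inl h4
    · right
      have huv : c.P (c.C (c.T u)) ≠ v := by
        intro he
        exact h3 ((he ▸ (h.T_cur hu h4.1).2).symm)
      simpa [Core.advance, Core.Stable, Core.Hit, Core.xx, Core.x0, Core.regList, Core.item,
        Core.hi, Core.e, huv] using h4
  ptr u hu v' hv' hne p hp1 hp2 hp3 hp4 := by
    by_cases hvv : v' = v
    · subst hvv
      change c.L v' < c.L u + c.w u v'
      change c.T u ≠ c.T v' at hne
      change c.T v' - low (c.L v') ≤ p at hp1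
      change c.T u ≤ p at hp3
      change p < c.e u at hp4
      have hp2 : p < c.item v' + c.Z (c.item v') := by simpa [Core.advance] using hp2
      rcases lt_or_ge p (c.X v') with h5 | h5
      · exact h.ptr u hu v' hv hne p hp1 h5 hp3 hp4
      have hn : c.xx v' < n := lt_of_lt_of_le hx (min_le_left _ _)
      obtain ⟨g1, g2, g3⟩ := h.lay.pos _ hn
      -- A position that is newly passed lies in the part looked at, unless it belongs to the own
      -- part, which `hne` excludes.
      have h6 : c.x0 v' ≤ p := by simp only [Core.x0]; omega
      have h7 : c.xx v' ≤ p := by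
        rcases c.xx_cases v' with h8 | h8
        · omega
        · rw [h8.2.2]
          refine max_le h6 ?_
          by_contra h9
          exact hne (h.lay.eq_of_mem hu hv (by omega) (by unfold Core.e at h9; omega) hp3 hp4)
      have h8 : c.T u = c.T (c.P (c.xx v')) :=
        h.lay.eq_of_mem hu g1 (by omega) hp2 hp3 hp4
      have h9 := (h.mins _ g1 v' hv).1 u hu h8
      have h10 := h.Lpart u hu _ g1 h8
      unfold Core.item at hf
      omega
    · refine h.ptr u hu v' hv' hne p hp1 ?_ hp3 hp4
      simpa [Core.advance, hvv] using hp2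

/-- The value of `φ` drops by at least one, which is worth 4; of this, 3 pay for the cleared flag
and 1 remains for the step. -/
theorem Valid.pot_advance (h : Valid n r M Ex c) {v : ℕ} (hv : v < n)
    (hx : c.xx v < c.hi n v) : (c.advance v).pot n M + 1 ≤ c.pot n M := by
  have h1 : ∑ u ∈ Finset.range n, (c.advance v).φ n u + 1 ≤ ∑ u ∈ Finset.range n, c.φ n u := by
    refine sum_update_add hv (fun u _ hu => ?_) ?_
    · simp [Core.advance, Core.φ, Core.x0, Core.e, hu]
    · have hn : c.xx v < n := lt_of_lt_of_le hx (min_le_left _ _)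
      obtain ⟨g1, g2, g3⟩ := h.lay.pos _ hn
      change c.T (c.P (c.xx v)) ≤ _ at g2
      have hX : (c.advance v).x0 v =
          max (c.item v + c.Z (c.item v)) (c.T v - low (c.L v)) := by
        simp [Core.advance, Core.x0]
      have hT := h.T_lt hv
      have hTe := h.T_lt_e hv
      have hne := h.item_ne hx
      have hd := h.lay.disj _ g1 v hv hne
      have hl : c.T v - low (c.L v) ≤ c.x0 v := le_max_right _ _
      change (n - min ((c.advance v).x0 v) (c.T v)) +
        (c.e v + min (low (c.L v)) n - max ((c.advance v).x0 v) (c.e v)) + 1 ≤ c.φ n v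
      have hhi : c.xx v < c.e v + low (c.L v) := lt_of_lt_of_le hx (min_le_right _ _)
      rw [hX]
      unfold Core.φ
      simp only [Core.item] at *
      change _ ∨ c.e v ≤ _ at hd
      rcases c.xx_cases v with h6 | h6 <;> omega
  have h2 : ∑ u ∈ Finset.range n, (1 - (c.advance v).R u) ≤
      ∑ u ∈ Finset.range n, (1 - c.R u) + 1 := by
    have := sum_update_add (n := n) (f := fun u => 1 - (c.R u) + if u = v then 1 else 0)
      (g := fun u => 1 - (c.advance v).R u) (v := v) (a := 0) hv ?_ ?_
    · simp only [add_zero] at this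
      refine this.trans ?_
      rw [Finset.sum_add_distrib]
      simp [hv]
    · intro u _ hu; simp [Core.advance, hu]
    · simp [Core.advance]
  change 4 * ∑ u ∈ Finset.range n, (c.advance v).φ n u + c.cnt n +
    ∑ u ∈ Finset.range n, lab n M (c.L u) + 2 * (c.W 0).length + 3 * entries n M c.W +
    3 * ∑ u ∈ Finset.range n, (1 - (c.advance v).R u) + 1 ≤ _
  unfold Core.pot
  omega

/-- The part at `b` proceeds to its next vertex. -/
def Core.next (c : Core) (b : ℕ) : Core := { c with C := Function.update c.C b (c.C b + 1) }

/-- The current vertex has exhausted its window, which is what `done` asks for at the position that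
is being passed. -/
theorem Valid.next {v : ℕ} (h : Valid n r M (· = c.T v) c) (hv : v < n)
    (hC : c.C (c.T v) < c.T v + c.Z (c.T v))
    (hx : c.hi n (c.P (c.C (c.T v))) ≤ c.xx (c.P (c.C (c.T v)))) :
    Valid n r M (· = c.T v) (c.next (c.T v)) where
  lay := h.lay
  mins := h.mins
  wpos := h.wpos
  Lpart := h.Lpart
  Lle := h.Lle
  Lsrc := h.Lsrc
  scan := h.scan
  ptr := h.ptr
  Rle := h.Rle
  reg := h.reg
  cur u hu := by
    change c.T u ≤ Function.update c.C (c.T v) _ (c.T u) ∧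
      Function.update c.C (c.T v) _ (c.T u) ≤ c.e u
    have := h.cur u hu
    by_cases he : c.T u = c.T v
    · simp only [Core.e, he, Function.update_self] at *; omega
    · simpa [he] using this
  stab u hu h1 h2 h3 := by
    rcases h.stab u hu h1 h2 h3 with h4 | h4
    · exact .inl h4
    · right
      have h3' : c.T u ≠ c.T v := h3
      simpa [Core.next, Core.Stable, Core.Hit, Core.xx, Core.x0, Core.regList, Core.item,
        Core.hi, Core.e, h3'] using h4
  done p hp h1 u hu h2 h3 := by
    change p < Function.update c.C (c.T v) _ (c.T (c.P p)) at h1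
    by_cases he : c.T (c.P p) = c.T v
    · rw [he, Function.update_self] at h1
      rcases Nat.lt_succ_iff_lt_or_eq.1 h1 with h4 | h4
      · exact h.done p hp (he.symm ▸ h4) u hu h2 h3
      · subst h4
        exact h.exhausted (h.T_cur hv hC).1 hx hu h2 h3
    · rw [Function.update_of_ne he] at h1
      exact h.done p hp h1 u hu h2 h3

/-- The position that is left no longer counts in `cnt`. -/
theorem Valid.pot_next (h : Valid n r M Ex c) {v : ℕ} (hv : v < n)
    (hC : c.C (c.T v) < c.T v + c.Z (c.T v)) :
    (c.next (c.T v)).pot n M + 1 ≤ c.pot n M := by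
  have h1 : (c.next (c.T v)).cnt n + 1 ≤ c.cnt n := by
    have hn : c.C (c.T v) < n := lt_of_lt_of_le hC (h.lay.le v hv)
    have hT := (h.T_cur hv hC).2
    have hmem : c.C (c.T v) ∈ (Finset.range n).filter fun p => c.C (c.T (c.P p)) ≤ p := by
      simp [hn, hT]
    unfold Core.cnt
    rw [← Finset.card_erase_add_one hmem]
    refine Nat.succ_le_succ (Finset.card_le_card fun p hp => ?_)
    simp only [Finset.mem_filter, Finset.mem_range, Core.next, Finset.mem_erase,
      Function.update_apply] at hp ⊢
    obtain ⟨hp1, hp2⟩ := hp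
    split_ifs at hp2 with he
    · rw [he]; exact ⟨by omega, hp1, by omega⟩
    · refine ⟨fun hpe => he ?_, hp1, hp2⟩
      rw [hpe, hT]
  change 4 * ∑ u ∈ Finset.range n, c.φ n u + (c.next (c.T v)).cnt n +
    ∑ u ∈ Finset.range n, lab n M (c.L u) + 2 * (c.W 0).length + 3 * entries n M c.W +
    3 * ∑ u ∈ Finset.range n, (1 - c.R u) + 1 ≤ _
  unfold Core.pot
  omega

/-- Adds `v` to the list with number `q`. -/
def pushList (W : ℕ → List ℕ) (q v : ℕ) : ℕ → List ℕ :=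
  if v ∈ W q then W else Function.update W q (v :: W q)

theorem mem_pushList {W : ℕ → List ℕ} {q v q' v' : ℕ} :
    v' ∈ pushList W q v q' ↔ v' ∈ W q' ∨ q' = q ∧ v' = v := by
  unfold pushList
  split_ifs with h
  · constructor
    · exact .inl
    · rintro (h' | ⟨rfl, rfl⟩) <;> assumption
  · rw [Function.update_apply]
    split_ifs with h1
    · subst h1; simp [or_comm]
    · simp [h1]

theorem length_pushList_le (W : ℕ → List ℕ) (q v : ℕ) :
    (pushList W q v q).length ≤ (W q).length + 1 := by
  unfold pushList; split_ifs <;> simp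

theorem pushList_of_ne (W : ℕ → List ℕ) {q q' : ℕ} (v : ℕ) (h : q' ≠ q) :
    pushList W q v q' = W q' := by
  unfold pushList; split_ifs <;> simp [h]

theorem entries_pushList_zero (W : ℕ → List ℕ) (v : ℕ) :
    entries n M (pushList W 0 v) = entries n M W :=
  Finset.sum_congr rfl fun q _ => by rw [pushList_of_ne _ _ (by omega)]

theorem entries_pushList_le (W : ℕ → List ℕ) (q v : ℕ) :
    entries n M (pushList W q v) ≤ entries n M W + 1 := by
  unfold entries
  by_cases hq : 1 ≤ q ∧ q - 1 < n * (M + 2)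
  · have := sum_update_add (n := n * (M + 2)) (v := q - 1) (a := 0)
      (f := fun x => (W (1 + x)).length + if x = q - 1 then 1 else 0)
      (g := fun x => (pushList W q v (1 + x)).length) hq.2 ?_ ?_
    · simp only [add_zero] at this
      refine this.trans ?_
      rw [Finset.sum_add_distrib]
      simp [hq.2]
    · intro u _ hu
      rw [pushList_of_ne _ _ (by omega)]; simp
    · have h1 : 1 + (q - 1) = q := by omega
      simp only [h1, add_zero, if_true]
      exact length_pushList_le W q v
  · refine le_trans (le_of_eq (Finset.sum_congr rfl fun x hx => ?_)) (Nat.le_succ _)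
    rw [Finset.mem_range] at hx
    rw [pushList_of_ne _ _ (by rintro rfl; exact hq ⟨by omega, by simpa using hx⟩)]

/-- `v` registers for the part that it looks at. -/
def Core.register (c : Core) (M v : ℕ) : Core :=
  if c.R v = 1 then c else
    { c with R := Function.update c.R v 1, W := pushList c.W (c.regList M v) v }

/-- The current vertex has a supported label and is in the right watch list, either now or, if its
flag was set, already by `reg`. So its part is stable, and no part is exempt any more. -/
theorem Valid.register {v : ℕ} (h : Valid n r M (· = c.T v) c) (hv : v < n)
    (hC : c.C (c.T v) < c.T v + c.Z (c.T v)) (hP : c.P (c.C (c.T v)) = v) (hx : c.Hit n v) :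
    Valid n r M (fun _ => False) (c.register M v) := by
  have key : ∀ c' : Core, Valid n r M (· = c.T v) c' → c'.T = c.T → c'.Stable n M (c.T v) →
      Valid n r M (fun _ => False) c' := by
    intro c' h' hT hS
    refine { h' with stab := fun u hu h1 h2 _ => ?_ }
    by_cases he : c'.T u = c.T v
    · right; rw [he]; exact hS
    · exact h'.stab u hu h1 h2 he
  unfold Core.register
  split_ifs with hR
  · refine key c h rfl ⟨hC, ?_⟩
    rw [hP]
    exact ⟨hx, h.reg v hv hR hx⟩
  · refine key _ { h with stab := ?_, reg := ?_, Rle := ?_ } rfl ⟨hC, ?_, ?_⟩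
    · intro u hu h1 h2 h3
      rcases h.stab u hu h1 h2 h3 with ⟨v', h4, h5⟩ | h4
      · exact .inl ⟨v', mem_pushList.2 (.inl h4), h5⟩
      · exact .inr ⟨h4.1, h4.2.1, mem_pushList.2 (.inl h4.2.2)⟩
    · intro u hu h1 h2
      by_cases huv : u = v
      · subst huv; exact mem_pushList.2 (.inr ⟨rfl, rfl⟩)
      · refine mem_pushList.2 (.inl (h.reg u hu ?_ h2))
        simpa [huv] using h1
    · intro u hu
      simp only [Function.update_apply]
      split_ifs <;> [omega; exact h.Rle u hu]
    · change c.Hit n (c.P (c.C (c.T v)))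
      rw [hP]; exact hx
    · change c.P (c.C (c.T v)) ∈ pushList c.W _ v (c.regList M (c.P (c.C (c.T v))))
      rw [hP]; exact mem_pushList.2 (.inr ⟨rfl, rfl⟩)

/-- Setting the flag releases 3, the price of the new list entry. -/
theorem Valid.pot_register (h : Valid n r M Ex c) {v : ℕ} (hv : v < n) :
    (c.register M v).pot n M ≤ c.pot n M := by
  unfold Core.register
  split_ifs with hR
  · exact le_rfl
  have h0 : c.R v = 0 := by have := h.Rle v hv; omega
  have h1 : ∑ u ∈ Finset.range n, (1 - Function.update c.R v 1 u) + 1 ≤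
      ∑ u ∈ Finset.range n, (1 - c.R u) :=
    sum_update_add hv (fun u _ hu => by simp [hu]) (by simp [h0])
  have h2 := entries_pushList_le (n := n) (M := M) c.W (c.regList M v) v
  have h3 : pushList c.W (c.regList M v) v 0 = c.W 0 :=
    pushList_of_ne _ _ (by simp only [Core.regList, watch]; omega)
  change 4 * ∑ u ∈ Finset.range n, c.φ n u + c.cnt n +
    ∑ u ∈ Finset.range n, lab n M (c.L u) + 2 * (pushList c.W (c.regList M v) v 0).length +
      3 * entries n M (pushList c.W (c.regList M v) v) +
    3 * ∑ u ∈ Finset.range n, (1 - Function.update c.R v 1 u) ≤ _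
  rw [h3]
  unfold Core.pot
  omega

/-- The work list loses its first element, whose part becomes active. -/
theorem Valid.pop (h : Valid n r M (fun _ => False) c) {v : ℕ} {l : List ℕ} (hl : c.W 0 = v :: l) :
    Valid n r M (· = c.T v) { c with W := Function.update c.W 0 l } := by
  have hne : ∀ u, c.regList M u ≠ 0 := fun u => by simp only [Core.regList, watch]; omega
  refine { h with stab := ?_, reg := ?_ }
  · intro u hu h1 h2 h3
    rcases h.stab u hu h1 h2 id with ⟨v', h4, h5⟩ | h4
    · rw [hl, List.mem_cons] at h4
      rcases h4 with rfl | h4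
      · exact absurd h5.symm h3
      · exact .inl ⟨v', by simpa using h4, h5⟩
    · refine .inr ⟨h4.1, h4.2.1, ?_⟩
      change _ ∈ Function.update c.W 0 l (c.regList M _)
      rw [Function.update_of_ne (hne _)]
      exact h4.2.2
  · intro u hu h1 h2
    change _ ∈ Function.update c.W 0 l (c.regList M _)
    rw [Function.update_of_ne (hne _)]
    exact h.reg u hu h1 h2

/-- Of the 2 units released, one pays for taking the vertex out and one for its part being active.
-/
theorem Core.pot_pop (c : Core) {v : ℕ} {l : List ℕ} (hl : c.W 0 = v :: l) :
    Core.pot { c with W := Function.update c.W 0 l } n M + 2 ≤ c.pot n M := by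
  have h1 : entries n M (Function.update c.W 0 l) = entries n M c.W :=
    Finset.sum_congr rfl fun q _ => by rw [Function.update_of_ne (by omega)]
  change 4 * ∑ u ∈ Finset.range n, c.φ n u + c.cnt n +
    ∑ u ∈ Finset.range n, lab n M (c.L u) + 2 * (Function.update c.W 0 l 0).length +
      3 * entries n M (Function.update c.W 0 l) +
    3 * ∑ u ∈ Finset.range n, (1 - c.R u) + 2 ≤ _
  rw [h1, Function.update_self]
  unfold Core.pot
  rw [hl, List.length_cons]
  omega

/-- An active part that needs no support is not active any more. -/
theorem Valid.inactive {b : ℕ} (h : Valid n r M (· = b) c)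
    (hb : ∀ v < n, c.T v = b → c.T v = c.T r ∨ M < c.L v) : Valid n r M (fun _ => False) c := by
  refine { h with stab := fun u hu h1 h2 _ => h.stab u hu h1 h2 fun he => ?_ }
  rcases hb u hu he with h3 | h3
  · exact h1 h3
  · omega

end

section

variable {n r M : ℕ} {Ex : ℕ → Prop} {c : Core}

/-! ### Raising a label -/

/-- These are the positions that a part has to visit again after its label has been raised. -/
theorem Layout.filter_le {T P Z : ℕ → ℕ} (h : Layout n T P Z) (b : ℕ) :
    ((Finset.range n).filter fun p => T (P p) = b).card ≤ Z b := by
  have : ((Finset.range n).filter fun p => T (P p) = b) ⊆ Finset.Ico b (b + Z b) := by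
    intro p hp
    simp only [Finset.mem_filter, Finset.mem_range, Finset.mem_Ico] at hp ⊢
    obtain ⟨h1, h2, h3⟩ := h.pos p hp.1
    rw [hp.2] at h2 h3
    exact ⟨h2, h3⟩
  simpa using Finset.card_le_card this

theorem lab_succ {l : ℕ} (hl : l ≤ M) : lab n M l = lab n M (l + 1) + 6 + 8 * min (low (l + 1)) n := by
  unfold lab
  rw [Finset.sum_eq_sum_Ico_succ_bot (by omega)]
  omega

theorem Valid.watch_eq (h : Valid n r M Ex c) {y a θ : ℕ} (hy : y < n) (hx : c.xx y < n)
    (hθ : θ < M + 2) (he : c.regList M y = watch M a θ) :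
    c.item y = a ∧ c.L y - c.m (c.item y) y + 1 = θ := by
  have h1 := h.Lle y hy
  have h2 := h.m_pos (h.lay.pos _ hx).1 hy
  change 1 ≤ c.m (c.item y) y at h2
  exact watch_inj (by omega) hθ he

/-- All vertices of the part have exhausted their windows, so `done` supplies the new instance of
`scan` for the label that is left behind; the scan restarts from the beginning. For other parts a
larger label only makes more tests fail, and a successful test on this part survives unless its
threshold is exactly the new label. The vertices with that threshold have been moved to the work
list. -/
theorem Valid.rise {v : ℕ} (h : Valid n r M (· = c.T v) c) (hv : v < n)
    (hC : c.e v ≤ c.C (c.T v)) (hr : c.T v ≠ c.T r) (hL : c.L v ≤ M) {c' : Core}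
    (hcT : c'.T = c.T) (hcP : c'.P = c.P) (hcZ : c'.Z = c.Z) (hcw : c'.w = c.w) (hcm : c'.m = c.m)
    (hcC : c'.C = Function.update c.C (c.T v) (c.T v))
    (hcL : ∀ u < n, c'.L u = if c.T u = c.T v then c.L v + 1 else c.L u)
    (hcX : ∀ u < n, c'.X u = if c.T u = c.T v then 0 else c.X u)
    (hcR : ∀ u < n, c'.R u = if c.T u = c.T v then 0 else c.R u)
    (hW0 : ∀ u, u ∈ c.W 0 ∨ u ∈ c.W (watch M (c.T v) (c.L v + 1)) → u ∈ c'.W 0)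
    (hWq : ∀ q, q ≠ 0 → q ≠ watch M (c.T v) (c.L v + 1) → c'.W q = c.W q) :
    Valid n r M (· = c'.T v) c' := by
  obtain ⟨T, P, Z, L, X, C, R, W, w, m⟩ := c
  obtain ⟨T', P', Z', L', X', C', R', W', w', m'⟩ := c'
  dsimp only at hcT hcP hcZ hcw hcm hcC hcL hcX hcR hW0 hWq hr hL hv
  subst hcT hcP hcZ hcw hcm hcC
  set c : Core := ⟨T', P', Z', L, X, C, R, W, w', m'⟩ with hc
  have hmono : ∀ u < n, L u ≤ L' u := by
    intro u hu
    rw [hcL u hu]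
    split_ifs with h1
    · have : L u = L v := h.Lpart u hu v hv h1
      omega
    · exact le_rfl
  have hxx : ∀ u < n, T' u ≠ T' v →
      Core.xx ⟨T', P', Z', L', X', Function.update C (T' v) (T' v), R', W', w', m'⟩ u = c.xx u ∧
      Core.hi ⟨T', P', Z', L', X', Function.update C (T' v) (T' v), R', W', w', m'⟩ n u =
        c.hi n u := by
    intro u hu hne
    simp only [Core.xx, Core.x0, Core.e, Core.hi, hcL u hu, hcX u hu, if_neg hne, hc]
    exact ⟨trivial, trivial⟩
  refine ⟨h.lay, h.mins, h.wpos, ?_, ?_, ?_, ?_, ?_, ?_, ?_, ?_, ?_, ?_⟩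
  · intro u hu u' hu' he
    change T' u = T' u' at he
    change L' u = L' u'
    have hLL : L u = L u' := h.Lpart u hu u' hu' he
    rw [hcL u hu, hcL u' hu']
    simp only [he, hLL]
  · intro u hu
    change L' u ≤ _
    rw [hcL u hu]
    split_ifs <;> [omega; exact h.Lle u hu]
  · intro u hu he
    change T' u = T' r at he
    change L' u = 0
    rw [hcL u hu, if_neg (fun h' => hr (h'.symm.trans he))]
    exact h.Lsrc u hu he
  · intro u hu u' hu' hne k hk hg
    change T' u ≠ T' u' at hne
    change k < L' u' at hk
    change c.gap u u' < low k at hg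
    change k < L' u + w' u u'
    have h1 := hmono u hu
    rw [hcL u' hu'] at hk
    split_ifs at hk with he
    · have hLv : L u' = L v := h.Lpart u' hu' v hv he
      rcases Nat.lt_succ_iff_lt_or_eq.1 hk with h2 | h2
      · have := h.scan u hu u' hu' hne k (by change k < L u'; omega) hg
        change k < L u + w' u u' at this
        omega
      -- This is the old label itself. The position of `u'` lies before the exhausted pointer `C`,
      -- so `done` applies there.
      · obtain ⟨p, hp1, hp2, hp3⟩ := h.lay.surj u' hu'
        change T' u' ≤ p at hp1
        change p < T' u' + Z' (T' u') at hp2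
        change P' p = u' at hp3
        have hpn : p < n := lt_of_lt_of_le hp2 (h.lay.le u' hu')
        have := h.done p hpn ?_ u hu ?_ ?_
        · change L (P' p) < L u + w' u (P' p) at this
          rw [hp3] at this
          omega
        · change p < C (T' (P' p))
          rw [hp3, he]
          refine lt_of_lt_of_le ?_ hC
          rw [he] at hp2
          exact hp2
        · change T' u ≠ T' (P' p)
          rwa [hp3]
        · change c.gap u (P' p) < low (L (P' p))
          rwa [hp3, hLv, ← h2]
    · have := h.scan u hu u' hu' hne k hk hg
      change k < L u + w' u u' at this
      omega
  · intro u hu u' hu' hne p hp1 hp2 hp3 hp4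
    change p < X' u' at hp2
    change T' u' - low (L' u') ≤ p at hp1
    change L' u' < L' u + w' u u'
    have h1 := hmono u hu
    rw [hcX u' hu'] at hp2
    split_ifs at hp2 with he
    · omega
    · rw [hcL u' hu', if_neg he] at hp1 ⊢
      have := h.ptr u hu u' hu' hne p hp1 hp2 hp3 hp4
      change L u' < L u + w' u u' at this
      omega
  · intro u hu
    change T' u ≤ Function.update C (T' v) (T' v) (T' u) ∧
      Function.update C (T' v) (T' v) (T' u) ≤ c.e u
    by_cases he : T' u = T' v
    · rw [he, Function.update_self]
      exact ⟨le_rfl, he ▸ (h.T_lt_e hu).le⟩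
    · rw [Function.update_of_ne he]; exact h.cur u hu
  · intro p hp h1 u hu h2 h3
    change p < Function.update C (T' v) (T' v) (T' (P' p)) at h1
    change L' (P' p) < L' u + w' u (P' p)
    have hPp : P' p < n ∧ T' (P' p) ≤ p ∧ p < T' (P' p) + Z' (T' (P' p)) := h.lay.pos p hp
    by_cases he : T' (P' p) = T' v
    · rw [he, Function.update_self] at h1
      have := hPp.2.1
      change T' (P' p) ≤ p at this
      omega
    · rw [Function.update_of_ne he] at h1
      change c.gap u (P' p) < low (L' (P' p)) at h3
      rw [hcL _ hPp.1, if_neg he] at h3 ⊢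
      have := h.done p hp h1 u hu h2 h3
      change L (P' p) < L u + w' u (P' p) at this
      have := hmono u hu
      omega
  · intro u hu h1 h2 h3
    change T' u ≠ T' r at h1
    change ¬ T' u = T' v at h3
    change L' u ≤ M at h2
    rw [hcL u hu, if_neg h3] at h2
    rcases h.stab u hu h1 h2 h3 with ⟨v', h4, h5⟩ | ⟨h4, h5, h6⟩
    · exact .inl ⟨v', hW0 v' (.inl h4), h5⟩
    · obtain ⟨hy, hTy⟩ := h.T_cur hu h4
      change T' (P' (C (T' u))) = T' u at hTy
      change c.Hit n (P' (C (T' u))) at h5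
      change P' (C (T' u)) ∈ W (c.regList M (P' (C (T' u)))) at h6
      have hCu : Function.update C (T' v) (T' v) (T' u) = C (T' u) := Function.update_of_ne h3 _ _
      simp only [Core.Stable, hCu]
      change P' (C (T' u)) < n at hy
      generalize P' (C (T' u)) = y at *
      have hyv : T' y ≠ T' v := by rwa [hTy]
      have hxn : c.xx y < n := lt_of_lt_of_le h5.1 (min_le_left _ _)
      obtain ⟨hxx1, hxx2⟩ := hxx y hy hyv
      by_cases hq : c.regList M y = watch M (T' v) (L v + 1)
      · rw [hq] at h6
        exact .inl ⟨y, hW0 y (.inr h6), hTy⟩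
      · right
        refine ⟨h4, ⟨?_, ?_⟩, ?_⟩
        · rw [hxx1, hxx2]; exact h5.1
        · simp only [Core.item, hxx1]
          have hP := (h.lay.pos _ hxn).1
          change P' (c.xx y) < n at hP
          rw [hcL _ hP, hcL y hy, if_neg hyv]
          have h7 := h5.2
          simp only [Core.item, hc] at h7
          split_ifs with h8
          · simp only [Core.regList, Core.item, hc] at hq
            rw [h8] at hq h7 ⊢
            have h9 : L (P' (Core.xx ⟨T', P', Z', L, X, C, R, W, w', m'⟩ y)) = L v :=
              h.Lpart _ hP v hv h8
            rw [h9] at h7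
            -- `y` is not in the list being woken, so its test has slack and survives the increase
            -- by one.
            have : L y - m' (T' v) y ≠ L v := by
              intro h10; rw [h10] at hq; exact hq rfl
            omega
          · exact h7
        · have h8 : Core.regList ⟨T', P', Z', L', X', Function.update C (T' v) (T' v), R', W', w',
              m'⟩ M y = c.regList M y := by
            simp only [Core.regList, Core.item, hxx1, hcL y hy, if_neg hyv, hc]
          rw [h8]
          change y ∈ W' _
          rw [hWq _ (by simp only [Core.regList, watch]; omega) hq]
          exact h6
  · intro u hu h1 h2
    change R' u = 1 at h1
    rw [hcR u hu] at h1
    split_ifs at h1 with he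
    obtain ⟨hxx1, hxx2⟩ := hxx u hu he
    obtain ⟨h3, h4⟩ := h2
    rw [hxx1, hxx2] at h3
    have hxn : c.xx u < n := lt_of_lt_of_le h3 (min_le_left _ _)
    have hP := (h.lay.pos _ hxn).1
    change P' (c.xx u) < n at hP
    simp only [Core.item, hxx1] at h4
    rw [hcL u hu, if_neg he] at h4
    have h5 := hmono _ hP
    have h6 := h.reg u hu h1 ⟨h3, by simp only [Core.item, hc] at h4 h5 ⊢; omega⟩
    have h8 : Core.regList ⟨T', P', Z', L', X', Function.update C (T' v) (T' v), R', W', w',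
        m'⟩ M u = c.regList M u := by
      simp only [Core.regList, Core.item, hxx1, hcL u hu, if_neg he, hc]
    rw [h8]
    change u ∈ W' _
    rw [hWq _ (by simp only [Core.regList, watch]; omega) ?_]
    · exact h6
    -- If `u` waited for exactly this increase, its test would fail now, contrary to `h4`.
    · intro hq
      obtain ⟨h9, h10⟩ := h.watch_eq hu hxn (by omega) hq
      simp only [Core.item, hc] at h9 h10
      rw [hcL _ hP, if_pos (by simpa [hc] using h9)] at h4
      simp only [hc] at h4
      have h11 := h.m_pos hP hu
      simp only [hc] at h11
      omega
  · intro u hu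
    change R' u ≤ 1
    rw [hcR u hu]
    split_ifs <;> [omega; exact h.Rle u hu]

/-- Per vertex of the part, `lab` releases 6 + 8 min(`low`, n): the second term pays for the two
halves of the new window at price 4, and 6 pays for the cleared flag (3), for the position to be
visited again (1) and for 2 spare units. The spare units amount to at least 1 + Z. A woken vertex
moves from a list of price 3 to one of price 2, which leaves 1. -/
theorem Valid.pot_rise {v : ℕ} (h : Valid n r M Ex c) (hv : v < n) (hL : c.L v ≤ M) {c' : Core}
    (hcT : c'.T = c.T) (hcP : c'.P = c.P) (hcZ : c'.Z = c.Z)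
    (hcC : c'.C = Function.update c.C (c.T v) (c.T v))
    (hcL : ∀ u < n, c'.L u = if c.T u = c.T v then c.L v + 1 else c.L u)
    (hcX : ∀ u < n, c'.X u = if c.T u = c.T v then 0 else c.X u)
    (hW0 : (c'.W 0).length ≤ (c.W 0).length + (c.W (watch M (c.T v) (c.L v + 1))).length)
    (hWq : ∀ q, q ≠ 0 → q ≠ watch M (c.T v) (c.L v + 1) → c'.W q = c.W q)
    (hWn : c'.W (watch M (c.T v) (c.L v + 1)) = [])
    (hcR : ∀ u < n, c'.R u = if c.T u = c.T v then 0 else c.R u) :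
    c'.pot n M + (1 + c.Z (c.T v) + (c.W (watch M (c.T v) (c.L v + 1))).length) ≤
      c.pot n M := by
  have hTn := h.T_lt hv
  have hZ := h.lay.Z_pos hv
  have h1 : c'.cnt n ≤ c.cnt n + c.Z (c.T v) := by
    refine le_trans ?_ (Nat.add_le_add_left (h.lay.filter_le (c.T v)) _)
    refine (Finset.card_le_card ?_).trans (Finset.card_union_le _ _)
    intro p hp
    simp only [Finset.mem_filter, Finset.mem_union, Finset.mem_range, hcC, hcT, hcP,
      Function.update_apply] at hp ⊢
    split_ifs at hp with he
    · exact .inr ⟨hp.1, he⟩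
    · exact .inl hp
  have h2 : entries n M c'.W + (c.W (watch M (c.T v) (c.L v + 1))).length ≤ entries n M c.W := by
    refine sum_update_add (v := c.T v * (M + 2) + (c.L v + 1)) ?_ ?_ ?_
    · calc c.T v * (M + 2) + (c.L v + 1) < c.T v * (M + 2) + (M + 2) := by omega
        _ = (c.T v + 1) * (M + 2) := by ring
        _ ≤ n * (M + 2) := Nat.mul_le_mul_right _ (by omega)
    · intro u _ hu
      rw [hWq _ (by omega) (by simp only [watch]; omega)]
    · change (c'.W (watch M (c.T v) (c.L v + 1))).length + _ ≤
        (c.W (watch M (c.T v) (c.L v + 1))).length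
      rw [hWn]; simp
  have h3 : ∑ u ∈ Finset.range n, (4 * c'.φ n u + lab n M (c'.L u) + 3 * (1 - c'.R u) +
      if c.T u = c.T v then 3 else 0) ≤
      ∑ u ∈ Finset.range n, (4 * c.φ n u + lab n M (c.L u) + 3 * (1 - c.R u)) := by
    refine Finset.sum_le_sum fun u hu => ?_
    rw [Finset.mem_range] at hu
    rw [hcL u hu, hcR u hu]
    split_ifs with he
    · have hLu := h.Lpart u hu v hv he
      -- The old value is at least n - T, and the restarted scan exceeds n - T by at most one window
      -- on each side. Measuring the left half from n rather than from T also makes `φ` monotone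
      -- under refinements.
      have h4 : c'.φ n u ≤ c.φ n u + 2 * min (low (c.L v + 1)) n := by
        have hT := h.T_lt hu
        simp only [Core.φ, Core.x0, Core.e, hcX u hu, hcL u hu, he, if_true, hcT, hcZ]
        rw [he] at hT
        omega
      have := lab_succ (n := n) hL
      rw [hLu]
      omega
    · have h4 : c'.φ n u = c.φ n u := by
        simp only [Core.φ, Core.x0, Core.e, hcX u hu, hcL u hu, he, if_false, hcT, hcZ]
      rw [h4]; omega
  rw [Finset.sum_add_distrib, Finset.sum_add_distrib, Finset.sum_add_distrib,
    Finset.sum_add_distrib, Finset.sum_add_distrib, ← Finset.mul_sum, ← Finset.mul_sum,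
    ← Finset.mul_sum, ← Finset.mul_sum, ← Finset.sum_filter, Finset.sum_const, h.lay.card v hv,
    smul_eq_mul] at h3
  unfold Core.pot
  omega

/-! ### Changes from outside -/

/-- The weight of an edge into `v` increases. -/
theorem Valid.weight {v : ℕ} (h : Valid n r M (fun _ => False) c) {c' : Core}
    (hcT : c'.T = c.T) (hcP : c'.P = c.P) (hcZ : c'.Z = c.Z) (hcL : c'.L = c.L) (hcX : c'.X = c.X)
    (hcC : c'.C = c.C) (hcR : c'.R = Function.update c.R v 0)
    (hW0 : c'.W = pushList c.W 0 v)
    (hw : ∀ x < n, ∀ y < n, c.w x y ≤ c'.w x y)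
    (hm : ∀ a < n, ∀ y < n, y ≠ v → c'.m (c.T a) y = c.m (c.T a) y)
    (hmin : MinSpec n c.T c'.w c'.m) : Valid n r M (fun _ => False) c' := by
  obtain ⟨T, P, Z, L, X, C, R, W, w, m⟩ := c
  obtain ⟨T', P', Z', L', X', C', R', W', w', m'⟩ := c'
  dsimp only at hcT hcP hcZ hcL hcX hcC hcR hW0 hw hm hmin
  subst hcT hcP hcZ hcL hcX hcC hcR
  have hWne : ∀ q, q ≠ 0 → W' q = W q := fun q hq => by rw [hW0, pushList_of_ne _ _ hq]
  have hWv : v ∈ W' 0 := by rw [hW0]; exact mem_pushList.2 (.inr ⟨rfl, rfl⟩)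
  refine ⟨h.lay, hmin, ?_, h.Lpart, h.Lle, h.Lsrc, ?_, ?_, h.cur, ?_, ?_, ?_, ?_⟩
  · intro u hu y hy; exact (h.wpos u hu y hy).trans (hw u hu y hy)
  · intro u hu y hy h1 k hk h2
    exact (h.scan u hu y hy h1 k hk h2).trans_le (Nat.add_le_add_left (hw u hu y hy) _)
  · intro u hu y hy h1 p h2 h3 h4 h5
    exact (h.ptr u hu y hy h1 p h2 h3 h4 h5).trans_le (Nat.add_le_add_left (hw u hu y hy) _)
  · intro p hp h1 u hu h2 h3
    exact (h.done p hp h1 u hu h2 h3).trans_le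
      (Nat.add_le_add_left (hw u hu _ (h.lay.pos p hp).1) _)
  · intro u hu h1 h2 h3
    by_cases huv : T' u = T' v
    · exact .inl ⟨v, hWv, huv.symm⟩
    rcases h.stab u hu h1 h2 h3 with ⟨v', h4, h5⟩ | ⟨h4, h5, h6⟩
    · refine .inl ⟨v', ?_, h5⟩
      change v' ∈ W' 0
      rw [hW0]; exact mem_pushList.2 (.inl h4)
    · right
      obtain ⟨hy, hTy⟩ := h.T_cur hu h4
      have hyv : P' (C' (T' u)) ≠ v := fun he => huv (by rw [← he]; exact hTy.symm)
      have hxn := lt_of_lt_of_le h5.1 (min_le_left _ _)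
      have hmm := hm _ (h.lay.pos _ hxn).1 _ hy hyv
      refine ⟨h4, ⟨h5.1, ?_⟩, ?_⟩
      · refine le_trans (Nat.add_le_add_left (le_of_eq ?_) _) h5.2
        exact hmm
      · change _ ∈ W' (watch M _ (L' _ - m' _ _ + 1))
        rw [hWne _ (by simp only [watch]; omega)]
        refine Eq.subst (motive := fun x => _ ∈ W (watch M _ (L' _ - x + 1))) hmm.symm h6
  · intro u hu h1 h2
    change Function.update R v 0 u = 1 at h1
    by_cases huv : u = v
    · simp [huv] at h1
    · rw [Function.update_of_ne huv] at h1
      have hxn := lt_of_lt_of_le h2.1 (min_le_left _ _)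
      have hmm := hm _ (h.lay.pos _ hxn).1 _ hu huv
      change _ ∈ W' (watch M _ (L' _ - m' _ _ + 1))
      rw [hWne _ (by simp only [watch]; omega)]
      have h3 : Core.Hit ⟨T', P', Z', L', X', C', R, W, w, m⟩ n u :=
        ⟨h2.1, le_trans (Nat.add_le_add_left (le_of_eq hmm.symm) _) h2.2⟩
      exact Eq.subst (motive := fun x => _ ∈ W (watch M _ (L' _ - x + 1))) hmm.symm
        (h.reg u hu h1 h3)
  · intro u hu
    change Function.update R v 0 u ≤ 1
    rw [Function.update_apply]
    split_ifs <;> [omega; exact h.Rle u hu]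

/-- The increase 5 is 3 for the cleared flag plus 2 for the new entry of the work list. -/
theorem Core.pot_weight {v : ℕ} (hv : v < n) {c' : Core}
    (hcT : c'.T = c.T) (hcP : c'.P = c.P) (hcZ : c'.Z = c.Z) (hcL : c'.L = c.L) (hcX : c'.X = c.X)
    (hcC : c'.C = c.C) (hcR : c'.R = Function.update c.R v 0)
    (hW0 : c'.W = pushList c.W 0 v) : c'.pot n M ≤ c.pot n M + 5 := by
  have h1 : ∑ u ∈ Finset.range n, (1 - c'.R u) ≤ ∑ u ∈ Finset.range n, (1 - c.R u) + 1 := by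
    have := sum_update_add (n := n) (f := fun u => 1 - (c.R u) + if u = v then 1 else 0)
      (g := fun u => 1 - c'.R u) (v := v) (a := 0) hv ?_ ?_
    · simp only [add_zero] at this
      refine this.trans ?_
      rw [Finset.sum_add_distrib]
      simp [hv]
    · intro u _ hu; simp [hcR, hu]
    · simp [hcR]
  have h2 : entries n M c'.W = entries n M c.W := by rw [hW0, entries_pushList_zero]
  have h3 : (c'.W 0).length ≤ (c.W 0).length + 1 := by rw [hW0]; exact length_pushList_le _ _ _
  have h4 : ∀ u, c'.φ n u = c.φ n u := fun u => by
    simp only [Core.φ, Core.x0, Core.e, hcT, hcZ, hcL, hcX]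
  have h5 : c'.cnt n = c.cnt n := by simp only [Core.cnt, hcT, hcC, hcP]
  unfold Core.pot
  simp only [h2, h4, h5, hcL]
  omega

/-- The partition is refined. -/
theorem Valid.split (h : Valid n r M (fun _ => False) c) {c' : Core} (hr : r < n)
    (hcL : c'.L = c.L) (hcX : c'.X = c.X) (hcw : c'.w = c.w)
    (hcC : ∀ v < n, c'.C (c'.T v) = c'.T v) (hcR : ∀ v < n, c'.R v = 0)
    (hW0 : ∀ v < n, v ∈ c'.W 0)
    (hlay : Layout n c'.T c'.P c'.Z) (hmin : MinSpec n c'.T c'.w c'.m)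
    (href : ∀ u < n, ∀ v < n, c'.T u = c'.T v → c.T u = c.T v)
    (hint : ∀ v < n, c.T v ≤ c'.T v ∧ c'.e v ≤ c.e v) : Valid n r M (fun _ => False) c' := by
  obtain ⟨T, P, Z, L, X, C, R, W, w, m⟩ := c
  obtain ⟨T', P', Z', L', X', C', R', W', w', m'⟩ := c'
  dsimp only at hcL hcX hcw hcC hcR hW0 hlay hmin href
  subst hcL hcX hcw
  -- Edges inside an old part have never been tested, but equal labels and weights of at least 1
  -- make their tests fail. Hence neither labels nor pointers need to be reset.
  have hnew : ∀ u < n, ∀ v < n, T u = T v → L' v < L' u + w' u v := by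
    intro u hu v hv he
    have h1 : L' u = L' v := h.Lpart u hu v hv he
    have h2 : 1 ≤ w' u v := h.wpos u hu v hv
    omega
  refine ⟨hlay, hmin, h.wpos, ?_, h.Lle, ?_, ?_, ?_, ?_, ?_, ?_, ?_, ?_⟩
  · exact fun u hu v hv he => h.Lpart u hu v hv (href u hu v hv he)
  · exact fun v hv he => h.Lsrc v hv (href v hv r hr he)
  · intro u hu v hv _ k hk hg
    by_cases he : T u = T v
    · exact hk.trans (hnew u hu v hv he)
    · refine h.scan u hu v hv he k hk (lt_of_le_of_lt ?_ hg)
      have h1 := hint u hu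
      have h2 := hint v hv
      simp only [Core.gap, Core.e] at *
      omega
  · intro u hu v hv _ p h1 h2 h3 h4
    by_cases he : T u = T v
    · exact hnew u hu v hv he
    · have h5 := hint u hu
      have h6 := hint v hv
      dsimp only at h1 h2 h3 h5 h6
      exact h.ptr u hu v hv he p (by dsimp only; omega) h2 (by dsimp only; omega) (by omega)
  · intro v hv
    change T' v ≤ C' (T' v) ∧ C' (T' v) ≤ T' v + Z' (T' v)
    rw [hcC v hv]
    omega
  · intro p hp h1
    change p < C' (T' (P' p)) at h1
    rw [hcC _ (hlay.pos p hp).1] at h1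
    have := (hlay.pos p hp).2.1
    omega
  · exact fun v hv _ _ _ => .inl ⟨v, hW0 v hv, rfl⟩
  · intro v hv h1
    change R' v = 1 at h1
    rw [hcR v hv] at h1; omega
  · intro v hv
    change R' v ≤ 1
    rw [hcR v hv]; omega

/-- A refinement may refill `cnt` (n), the work list (2 n) and the flags (3 n), while `φ` does not
increase because intervals only shrink. -/
theorem Valid.pot_split (h : Valid n r M Ex c) {c' : Core}
    (hcL : c'.L = c.L) (hcX : c'.X = c.X)
    (hW0 : (c'.W 0).length ≤ n) (hWq : entries n M c'.W = entries n M c.W)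
    (hint : ∀ v < n, c.T v ≤ c'.T v ∧ c'.e v ≤ c.e v) :
    c'.pot n M ≤ c.pot n M + 6 * n := by
  have h1 : c'.cnt n ≤ n := (Finset.card_filter_le _ _).trans (by simp)
  have h2 : ∑ v ∈ Finset.range n, (1 - c'.R v) ≤ n := by
    calc ∑ v ∈ Finset.range n, (1 - c'.R v) ≤ ∑ v ∈ Finset.range n, 1 :=
          Finset.sum_le_sum fun v _ => by omega
      _ = n := by simp
  have h3 : ∑ v ∈ Finset.range n, c'.φ n v ≤ ∑ v ∈ Finset.range n, c.φ n v := by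
    refine Finset.sum_le_sum fun v hv => ?_
    rw [Finset.mem_range] at hv
    have h4 := hint v hv
    have h5 := h.T_lt_e hv
    simp only [Core.φ, Core.x0, hcL, hcX]
    omega
  unfold Core.pot
  rw [hWq, hcL]
  omega

/-! ### What the labels mean -/

/-- With an empty work list, `stab` leaves only stable parts. A successful test compares with the
minimum over a part, which is attained by some edge. -/
theorem Valid.exists_support (h : Valid n r M (fun _ => False) c) (hW : c.W 0 = []) {v : ℕ}
    (hv : v < n) (hr : c.T v ≠ c.T r) (hL : c.L v ≤ M) :
    ∃ u < n, ∃ v' < n, c.T v' = c.T v ∧ c.L u + c.w u v' ≤ c.L v := by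
  rcases h.stab v hv hr hL id with ⟨v', h1, -⟩ | ⟨h1, h2, -⟩
  · rw [hW] at h1; simp at h1
  · obtain ⟨h3, h4⟩ := h.T_cur hv h1
    have hxn := lt_of_lt_of_le h2.1 (min_le_left _ _)
    obtain ⟨-, u, hu, h5, h6⟩ := h.mins _ (h.lay.pos _ hxn).1 _ h3
    refine ⟨u, hu, _, h3, h4, ?_⟩
    rw [← h6, h.Lpart u hu _ (h.lay.pos _ hxn).1 h5, ← h.Lpart _ h3 v hv h4]
    exact h2.2

/-- A label exceeds the label of a neighbour by little more than the weight of the edge. -/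
theorem Valid.label_le (h : Valid n r M Ex c) {u v : ℕ} (hu : u < n) (hv : v < n)
    (hne : c.T u ≠ c.T v) :
    c.L v ≤ c.L u + c.w u v + 2 * ((c.T u - c.T v) + (c.T v - c.T u)) := by
  have h1 : c.gap u v + 1 ≤ (c.T u - c.T v) + (c.T v - c.T u) := by
    have := h.T_lt_e hu
    have := h.T_lt_e hv
    simp only [Core.gap]
    omega
  have hw := h.wpos u hu v hv
  -- The smallest power of two exceeding the gap. It is less than twice the difference of the
  -- interval starts, since that difference exceeds the gap by at least one interval length.
  obtain ⟨j, hj1, hj2⟩ : ∃ j, c.gap u v + 1 ≤ 2 ^ j ∧ 2 ^ j < 2 * (c.gap u v + 1) :=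
    ⟨Nat.clog 2 (c.gap u v + 1), Nat.le_pow_clog (by omega) _, by
      rcases Nat.eq_zero_or_pos (c.gap u v) with h0 | h0
      · simp [h0]
      · have := Nat.pow_pred_clog_lt_self (b := 2) (by omega) (x := c.gap u v + 1) (by omega)
        have hc : 0 < Nat.clog 2 (c.gap u v + 1) := Nat.clog_pos (by omega) (by omega)
        obtain ⟨k, hk⟩ : ∃ k, Nat.clog 2 (c.gap u v + 1) = k + 1 := ⟨_, (Nat.succ_pred_eq_of_pos hc).symm⟩
        rw [hk] at this ⊢
        rw [Nat.pred_succ] at this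
        rw [pow_succ]; omega⟩
  rcases Nat.lt_or_ge (2 ^ j) (c.L v) with hlt | hge
  · have hk0 : 0 < (c.L v - 1) / 2 ^ j := Nat.div_pos (by omega) (by positivity)
    -- The largest multiple of 2 ^ j below the label. When the label passed it, the window reached
    -- `u`, so `scan` bounds `k`, and the label exceeds it by at most 2 ^ j.
    set k := 2 ^ j * ((c.L v - 1) / 2 ^ j) with hk
    have hkL : k ≤ c.L v - 1 := Nat.mul_div_le _ _
    have hkL2 : c.L v - 1 < k + 2 ^ j := by
      have := Nat.lt_mul_div_succ (c.L v - 1) (b := 2 ^ j) (by positivity)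
      rw [mul_add, mul_one] at this; exact this
    have hkp : 0 < k := Nat.mul_pos (by positivity) hk0
    have := h.scan u hu v hv hne k (by omega)
      (lt_of_lt_of_le (by omega) (pow_le_low hkp ⟨_, hk⟩))
    omega
  · omega

/-- The entire future scanning cost of one vertex: O(M log n), by `sum_min_low_le`. -/
theorem lab_zero_le {h : ℕ} (hn : n ≤ 2 ^ h) : lab n M 0 ≤ 8 * ((M + 1) * (h + 2)) := by
  unfold lab
  rw [← Finset.range_eq_Ico, Finset.sum_add_distrib, ← Finset.mul_sum]
  have := sum_min_low_le hn (M + 1)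
  simp only [Finset.sum_const, Finset.card_range, smul_eq_mul]
  have e : 8 * ((M + 1) * (h + 2)) = 8 * ((M + 1) * (h + 1)) + 8 * (M + 1) := by ring
  omega

end

section

/-! ### Linked lists

The list `q` has the head `H q`, and `N (q * n + v)` is nonzero if and only if `v` is in the list. -/

/-- The chain of successors from a head; vertices are shifted by one, and `0` is the end. -/
def Chain (N : ℕ → ℕ) : ℕ → List ℕ → Prop
  | h, [] => h = 0
  | h, v :: l => h = v + 1 ∧ 1 ≤ N v ∧ Chain N (N v - 1) l

theorem Chain.congr {N N' : ℕ → ℕ} : ∀ {h : ℕ} {l : List ℕ}, (∀ v ∈ l, N v = N' v) →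
    Chain N h l → Chain N' h l
  | _, [], _, hc => hc
  | h, v :: l, hl, hc => by
    obtain ⟨h1, h2, h3⟩ := hc
    have h4 := hl v (by simp)
    refine ⟨h1, h4 ▸ h2, h4 ▸ Chain.congr (fun u hu => hl u (by simp [hu])) h3⟩

theorem Chain.head_le {n : ℕ} {N : ℕ → ℕ} {h : ℕ} {l : List ℕ} (hc : Chain N h l)
    (hl : ∀ v ∈ l, v < n) : h ≤ n := by
  cases l with
  | nil => exact (le_of_eq hc).trans (Nat.zero_le n)
  | cons v l => have := hl v (by simp); have := hc.1; omega

/-- A head is a vertex plus one, or 0; a successor entry is a head plus one, so that 0 can mean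
absence. This makes membership a constant-time test, and zeroed memory represents empty lists, so
the many watch lists need no initialization. -/
structure ListRep (n : ℕ) (H N : ℕ → ℕ) (W : ℕ → List ℕ) : Prop where
  chain : ∀ q, Chain (fun v => N (q * n + v)) (H q) (W q)
  nodup : ∀ q, (W q).Nodup
  lt : ∀ q, ∀ v ∈ W q, v < n
  zero : ∀ q, ∀ v < n, v ∉ W q → N (q * n + v) = 0

theorem index_inj {n q q' v v' : ℕ} (hv : v < n) (hv' : v' < n) (h : q * n + v = q' * n + v') :
    q = q' ∧ v = v' := by
  have h1 : (q * n + v) / n = q := by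
    rw [mul_comm, Nat.mul_add_div (by omega), Nat.div_eq_of_lt hv, add_zero]
  have h2 : (q' * n + v') / n = q' := by
    rw [mul_comm, Nat.mul_add_div (by omega), Nat.div_eq_of_lt hv', add_zero]
  have : q = q' := by rw [← h1, h, h2]
  subst this
  exact ⟨rfl, by omega⟩

theorem ListRep.head_le {n : ℕ} {H N : ℕ → ℕ} {W : ℕ → List ℕ} (h : ListRep n H N W) (q : ℕ) :
    H q ≤ n := (h.chain q).head_le (h.lt q)

theorem ListRep.ne_zero {n : ℕ} {H N : ℕ → ℕ} {W : ℕ → List ℕ} (h : ListRep n H N W) {q v : ℕ}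
    (hv : v ∈ W q) : 1 ≤ N (q * n + v) := by
  have key : ∀ (l : List ℕ) (k : ℕ), Chain (fun v => N (q * n + v)) k l → v ∈ l →
      1 ≤ N (q * n + v) := by
    intro l
    induction l with
    | nil => simp
    | cons a l ih =>
      rintro k ⟨_, h2, h3⟩ hv
      rcases List.mem_cons.1 hv with rfl | hv
      · exact h2
      · exact ih _ h3 hv
  exact key _ _ (h.chain q) hv

theorem ListRep.head_eq_zero {n : ℕ} {H N : ℕ → ℕ} {W : ℕ → List ℕ} (h : ListRep n H N W) {q : ℕ} :
    H q = 0 ↔ W q = [] := by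
  have := h.chain q
  cases hW : W q with
  | nil => rw [hW] at this; exact ⟨fun _ => rfl, fun _ => this⟩
  | cons v l => rw [hW] at this; simp [this.1]

theorem ListRep.push {n : ℕ} {H N : ℕ → ℕ} {W : ℕ → List ℕ} (h : ListRep n H N W) {q v : ℕ}
    (hv : v < n) (h0 : N (q * n + v) = 0) :
    ListRep n (Function.update H q (v + 1)) (Function.update N (q * n + v) (H q + 1))
      (pushList W q v) := by
  have hnot : v ∉ W q := fun hm => by have := h.ne_zero hm; omega
  have hW : pushList W q v = Function.update W q (v :: W q) := if_neg hnot
  have hN : ∀ q' v', v' < n → (q' ≠ q ∨ v' ≠ v) →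
      Function.update N (q * n + v) (H q + 1) (q' * n + v') = N (q' * n + v') := by
    intro q' v' hv' hne
    refine Function.update_of_ne (fun he => ?_) _ _
    obtain ⟨h1, h2⟩ := index_inj hv' hv he
    rcases hne with hne | hne <;> exact hne ‹_›
  refine ⟨fun q' => ?_, fun q' => ?_, fun q' v' hm => ?_, fun q' v' hv' hm => ?_⟩
  · by_cases hq : q' = q
    · subst hq
      rw [hW, Function.update_self, Function.update_self]
      refine ⟨rfl, ?_, ?_⟩
      · simp
      · simp only [Function.update_self, Nat.add_sub_cancel]
        refine (h.chain q').congr fun u hu => ?_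
        exact (hN _ _ (h.lt _ u hu) (.inr fun he => hnot (he ▸ hu))).symm
    · rw [hW, Function.update_of_ne hq, Function.update_of_ne hq]
      exact (h.chain q').congr fun u hu => (hN _ _ (h.lt _ u hu) (.inl hq)).symm
  · rw [hW, Function.update_apply]
    split_ifs
    · exact List.nodup_cons.2 ⟨hnot, h.nodup q⟩
    · exact h.nodup q'
  · rcases mem_pushList.1 hm with hm | ⟨-, rfl⟩
    · exact h.lt q' v' hm
    · exact hv
  · rw [mem_pushList, not_or] at hm
    rw [hN q' v' hv' (by tauto)]
    exact h.zero q' v' hv' hm.1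

theorem ListRep.mem_iff {n : ℕ} {H N : ℕ → ℕ} {W : ℕ → List ℕ} (h : ListRep n H N W) {q v : ℕ}
    (hv : v < n) : v ∈ W q ↔ N (q * n + v) ≠ 0 :=
  ⟨fun hm => by have := h.ne_zero hm; omega, fun h0 => by_contra fun hm => h0 (h.zero q v hv hm)⟩

theorem ListRep.pop {n : ℕ} {H N : ℕ → ℕ} {W : ℕ → List ℕ} (h : ListRep n H N W) {q v : ℕ}
    {l : List ℕ} (hl : W q = v :: l) : v < n ∧ H q = v + 1 ∧
    ListRep n (Function.update H q (N (q * n + v) - 1)) (Function.update N (q * n + v) 0)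
      (Function.update W q l) := by
  have hv : v < n := h.lt q v (by simp [hl])
  have hc := h.chain q
  have hnd := h.nodup q
  rw [hl] at hc hnd
  obtain ⟨h1, h2, h3⟩ := hc
  rw [List.nodup_cons] at hnd
  have hN : ∀ q' v', v' < n → (q' ≠ q ∨ v' ≠ v) →
      Function.update N (q * n + v) 0 (q' * n + v') = N (q' * n + v') := by
    intro q' v' hv' hne
    refine Function.update_of_ne (fun he => ?_) _ _
    obtain ⟨h1, h2⟩ := index_inj hv' hv he
    rcases hne with hne | hne <;> exact hne ‹_›
  refine ⟨hv, h1, fun q' => ?_, fun q' => ?_, fun q' v' hm => ?_, fun q' v' hv' hm => ?_⟩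
  · by_cases hq : q' = q
    · subst hq
      rw [Function.update_self, Function.update_self]
      refine h3.congr fun u hu => ?_
      exact (hN q' u (h.lt q' u (by rw [hl]; simp [hu])) (.inr fun he => hnd.1 (he ▸ hu))).symm
    · rw [Function.update_of_ne hq, Function.update_of_ne hq]
      exact (h.chain q').congr fun u hu => (hN _ _ (h.lt _ u hu) (.inl hq)).symm
  · rw [Function.update_apply]
    split_ifs
    · exact hnd.2
    · exact h.nodup q'
  · rw [Function.update_apply] at hm
    split_ifs at hm with hq
    · subst hq; exact h.lt q' v' (by simp [hl, hm])
    · exact h.lt q' v' hm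
  · rw [Function.update_apply] at hm
    split_ifs at hm with hq
    · subst hq
      by_cases hvv : v' = v
      · rw [hvv, Function.update_self]
      · rw [hN q' v' hv' (.inr hvv)]
        exact h.zero q' v' hv' (by simp [hl, hvv, hm])
    · rw [hN q' v' hv' (.inl hq)]
      exact h.zero q' v' hv' hm

/-! ### The main program -/

namespace Cmd

/-- Adds the vertex in register 31 to the list in register 30. -/
def push : Cmd :=
  .ite (.ld 8 (.r 30 * .r 0 + .r 31)) 1
    (.put 8 (.r 30 * .r 0 + .r 31) (.ld 7 (.r 30) + 1) ;; .put 7 (.r 30) (.r 31 + 1)) .skip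

/-- Moves the first vertex of the list in register 30 to register 31. -/
def pop : Cmd :=
  .set 31 (.ld 7 (.r 30) - 1) ;; .put 7 (.r 30) (.ld 8 (.r 30 * .r 0 + .r 31) - 1) ;;
    .put 8 (.r 30 * .r 0 + .r 31) 0

/-- The part at register 17 gets the label in register 18, and the estimates are updated. -/
def relabel : Cmd :=
  (.set 18 (.r 18 + 1) ;; .put 5 (.r 17) (.r 17) ;;
  .ite (.r 2) (.r 18) (.set 28 0 ;; .set 19 0)
    (.set 28 ((.r 18 * .r 4 + .r 5) / .r 6 + 1)) ;;
  .set 26 (.r 17)) ;;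
  .for 26 23 (.set 21 (.ld 1 (.r 26)) ;; .put 3 (.r 21) (.r 18) ;; .put 4 (.r 21) 0 ;;
    .put 6 (.r 21) 0 ;; .outp (.r 21) (.r 28))

/-- Moves the vertices of the list in register 32 to the work list. -/
def wake : Cmd :=
  .wh 0 (.ld 7 (.r 32)) (.set 30 (.r 32) ;; pop ;; .set 30 0 ;; push)

/-- The label of the part at register 17 increases. -/
def rise : Cmd :=
  relabel ;; .set 32 (1 + (.r 17 * (.r 2 + 2) + .r 18)) ;; wake

/-- The vertex in register 21 looks at the part at the position in register 22. -/
def look : Cmd :=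
  .set 24 (.ld 0 (.ld 1 (.r 22))) ;;
  .set 25 (.ld 10 ((.r 3 * .r 0 + (.ld 9 (.r 3 * .r 0 + .ld 1 (.r 24)) - 1)) * .r 0 + .r 21)) ;;
  .ite (.r 18) (.ld 3 (.ld 1 (.r 22)) + .r 25)
    (.put 4 (.r 21) (.r 24 + .ld 2 (.r 24)) ;; .put 6 (.r 21) 0)
    (.set 19 0 ;; .ite (.ld 6 (.r 21)) 1
      (.put 6 (.r 21) 1 ;; .set 30 (1 + (.r 24 * (.r 2 + 2) + (.r 18 - .r 25 + 1))) ;;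
        .set 31 (.r 21) ;; push) .skip)

/-- Finds the position that the vertex in register 21 looks at and the end of its window. -/
def aim : Cmd :=
  .set 22 (.ld 4 (.r 21)) ;;
  .set 24 (.r 17 - .ld 11 (.r 18)) ;; .ite (.r 22) (.r 24) (.set 22 (.r 24)) .skip ;;
  .ite (.r 22) (.r 17) .skip (.ite (.r 22) (.r 23) (.set 22 (.r 23)) .skip) ;;
  .set 27 (.r 23 + .ld 11 (.r 18)) ;; .ite (.r 27) (.r 0) .skip (.set 27 (.r 0))

/-- One step of the part at register 17. -/
def step : Cmd :=
  .set 20 (.ld 5 (.r 17)) ;; .set 23 (.r 17 + .ld 2 (.r 17)) ;;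
  .ite (.r 20) (.r 23)
    (.set 21 (.ld 1 (.r 20)) ;; aim ;;
      .ite (.r 22) (.r 27) look (.put 5 (.r 17) (.r 20 + 1)))
    rise

/-- Takes a part from the work list. -/
def start : Cmd :=
  .set 30 0 ;; pop ;;
  .set 17 (.ld 0 (.r 31)) ;; .set 18 (.ld 3 (.r 31)) ;; .set 19 1 ;;
  .ite (.r 17) (.ld 0 (.r 1)) .skip (.ite (.ld 0 (.r 1)) (.r 17) .skip (.set 19 0)) ;;
  .ite (.r 2) (.r 18) (.set 19 0) .skip

/-- Processes the parts in the work list. -/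
def main : Cmd := .wh 0 (.ld 7 0) (start ;; .wh 0 (.r 19) step)

end Cmd

/-- The constants of the algorithm: source, largest finite label, depth of the trees, and the
coefficients of the estimates. -/
structure Par where
  r : ℕ
  M : ℕ
  h : ℕ
  ka : ℕ
  kb : ℕ
  kc : ℕ

/-- The word for the estimate of a vertex with label `k`. -/
def Par.est (K : Par) (k : ℕ) : ℕ := if k ≤ K.M then (k * K.ka + K.kb) / K.kc + 1 else 0

/-- The words used by the main program are small enough. -/
structure Fits (E : Env) (K : Par) : Prop where
  two_le : 2 ≤ E.n
  r_lt : K.r < E.n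
  bound : (E.n + 1) * (K.M + 3) + 4 < E.V
  est : ∀ k ≤ K.M, K.est k < E.V

/-- The state `t` contains the data of `c`. -/
structure Holds (E : Env) (K : Par) (c : Core) (t : St) : Prop where
  r : t.reg 1 = K.r
  M : t.reg 2 = K.M
  h : t.reg 3 = K.h
  ka : t.reg 4 = K.ka
  kb : t.reg 5 = K.kb
  kc : t.reg 6 = K.kc
  T : t.arr 0 = c.T
  P : t.arr 1 = c.P
  Z : t.arr 2 = c.Z
  L : t.arr 3 = c.L
  X : t.arr 4 = c.X
  C : t.arr 5 = c.C
  R : t.arr 6 = c.R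
  W : ListRep E.n (t.arr 7) (t.arr 8) c.W
  m : ∀ a v, t.arr 10 ((K.h * E.n + (t.arr 9 (K.h * E.n + t.arr 1 a) - 1)) * E.n + v) = c.m a v
  low : ∀ k ≤ K.M + 1, t.arr 11 k = low k
  out : ∀ v < E.n, t.out v = K.est (c.L v)

variable {E : Env} {K : Par} {c : Core} {t : St}

theorem Tr.push {Q : St → Prop} {W : ℕ → List ℕ} (hn : t.reg 0 = E.n)
    (hW : ListRep E.n (t.arr 7) (t.arr 8) W) {q v : ℕ} (hq : t.reg 30 = q) (hr : t.reg 31 = v)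
    (hv : v < E.n) (hV : E.n + 1 < E.V)
    (hQ : ∀ t', t'.reg = t.reg → t'.out = t.out → (∀ a, a ≠ 7 → a ≠ 8 → t'.arr a = t.arr a) →
      ListRep E.n (t'.arr 7) (t'.arr 8) (pushList W q v) → Q t') : Cmd.push.wp E Q t := by
  have h7 := hW.head_le q
  simp only [Cmd.push, Cmd.wp, Ex.eval_ld, Ex.eval_add, Ex.eval_mul, Ex.eval_r, hn, hq, hr,
    Ex.eval_num, Ex.leaf_add, St.setArr_reg]
  refine ⟨fun h0 => ⟨.inr (by omega), .inr (by omega), hQ _ rfl rfl ?_ ?_⟩, fun h1 => hQ _ rfl rfl (fun _ _ _ => rfl) ?_⟩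
  · intro a h7 h8; simp [h7, h8]
  · simpa using hW.push hv (by omega : t.arr 8 (q * E.n + v) = 0)
  · have : pushList W q v = W := if_pos ((hW.mem_iff hv).2 (by omega))
    rwa [this]

theorem Tr.pop {Q : St → Prop} {W : ℕ → List ℕ} (hn : t.reg 0 = E.n)
    (hW : ListRep E.n (t.arr 7) (t.arr 8) W) {q v : ℕ} {l : List ℕ} (hq : t.reg 30 = q)
    (hl : W q = v :: l) (hb8 : ∀ i, t.arr 8 i < E.V) (hV : E.n + 1 < E.V)
    (hQ : ∀ t', v < E.n → t'.reg 31 = v → (∀ x, x ≠ 31 → t'.reg x = t.reg x) → t'.out = t.out →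
      (∀ a, a ≠ 7 → a ≠ 8 → t'.arr a = t.arr a) →
      ListRep E.n (t'.arr 7) (t'.arr 8) (Function.update W q l) → Q t') : Cmd.pop.wp E Q t := by
  obtain ⟨h1, h2, h3⟩ := hW.pop hl
  have h4 := hb8 (q * E.n + v)
  simp only [Cmd.pop, Cmd.wp, Ex.eval_ld, Ex.eval_add, Ex.eval_sub, Ex.eval_mul, Ex.eval_r,
    Ex.eval_num, Ex.leaf_sub, Ex.leaf_num, St.setArr_reg, St.setReg_reg, St.setReg_arr, hq,
    if_true, hn, h2, Nat.add_sub_cancel]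
  norm_num [hn, hq, h2]
  refine ⟨by omega, by omega, hQ _ h1 ?_ ?_ rfl ?_ ?_⟩
  · simp
  · intro x hx; simp [hx]
  · intro a h7 h8; simp [h7, h8]
  · simpa using h3

end

/-! ### Running time and correctness of the scan of one vertex -/

section

variable {E : Env} {K : Par} {c : Core} {t : St}

theorem Fits.lt (hf : Fits E K) : E.n + K.M + 7 < E.V := by
  have h1 := hf.bound
  have h2 := hf.two_le
  have e : (E.n + 1) * (K.M + 3) = E.n * K.M + K.M + 3 * E.n + 3 := by ring
  nlinarith [Nat.zero_le (E.n * K.M)]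

theorem Fits.watch_lt (hf : Fits E K) {a θ : ℕ} (ha : a < E.n) (hθ : θ ≤ K.M + 1) :
    watch K.M a θ < E.V := by
  have h1 := hf.bound
  have h3 : a * (K.M + 2) ≤ E.n * (K.M + 2) := Nat.mul_le_mul_right _ ha.le
  have e : (E.n + 1) * (K.M + 3) = E.n * (K.M + 2) + E.n + K.M + 3 := by ring
  simp only [watch]
  omega

theorem Tr.aim {Q : St → Prop} (hf : Fits E K) {v : ℕ} (hC : Holds E K c t)
    (hV : Valid E.n K.r K.M (· = c.T v) c) (hv : v < E.n) (h0 : t.reg 0 = E.n)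
    (h17 : t.reg 17 = c.T v) (h18 : t.reg 18 = c.L v) (h21 : t.reg 21 = v) (h23 : t.reg 23 = c.e v)
    (hQ : ∀ t', t'.reg 22 = c.xx v → t'.reg 27 = c.hi E.n v →
      (∀ x, x ≠ 22 → x ≠ 24 → x ≠ 27 → t'.reg x = t.reg x) → t'.out = t.out → t'.arr = t.arr →
      Q t') : Cmd.aim.wp E Q t := by
  have h1 := hf.lt
  have h2 := hV.Lle v hv
  have h3 := hC.low _ h2
  have h4 := low_le (c.L v)
  have h5 := hV.T_lt_e hv
  have h6 : c.e v ≤ E.n := hV.lay.le v hv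
  simp [Cmd.aim, Cmd.wp, h0, h17, h18, h21, h23, hC.X, h3]
  repeat' (first | refine ⟨?_, ?_⟩ | intro _)
  all_goals first
    | omega
    | (refine hQ _ ?_ ?_ ?_ rfl rfl
       · simp only [St.setReg_reg, Core.xx, Core.x0]
         simp
         try split_ifs
         all_goals omega
       · simp only [St.setReg_reg, Core.hi]
         simp
         try omega
       · intro x hx1 hx2 hx3
         simp [hx1, hx2, hx3])

/-- The persistent registers and the arrays outside the main loop have not changed. -/
structure Keep (t t' : St) : Prop where
  reg : ∀ x < 16, t'.reg x = t.reg x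
  arr : ∀ a, 9 ≤ a → t'.arr a = t.arr a

theorem Keep.refl (t : St) : Keep t t := ⟨fun _ _ => rfl, fun _ _ => rfl⟩

theorem Keep.trans {t t' t'' : St} (h : Keep t t') (h' : Keep t' t'') : Keep t t'' :=
  ⟨fun x hx => (h'.reg x hx).trans (h.reg x hx), fun a ha => (h'.arr a ha).trans (h.arr a ha)⟩

theorem Keep.setReg {t t' : St} (h : Keep t t') {x : ℕ} (v : ℕ) (hx : 16 ≤ x) :
    Keep t (t'.setReg x v) :=
  ⟨fun y hy => by rw [St.setReg_reg, if_neg (by omega)]; exact h.reg y hy, h.arr⟩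

theorem Keep.setArr {t t' : St} (h : Keep t t') {a : ℕ} (i v : ℕ) (ha : a < 9) :
    Keep t (t'.setArr a i v) :=
  ⟨h.reg, fun b hb => by rw [St.setArr_arr, if_neg (by omega)]; exact h.arr b hb⟩

theorem Keep.setOut {t t' : St} (h : Keep t t') (i v : ℕ) : Keep t (t'.setOut i v) :=
  ⟨h.reg, h.arr⟩

/-- A change of the registration flags and of the lists. -/
theorem Holds.of_frame (hC : Holds E K c t) {t' : St} (hr : ∀ x < 16, t'.reg x = t.reg x)
    (ho : t'.out = t.out) (ha : ∀ a, a ≠ 6 → a ≠ 7 → a ≠ 8 → t'.arr a = t.arr a) {R : ℕ → ℕ}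
    {W : ℕ → List ℕ} (hR : t'.arr 6 = R) (hW : ListRep E.n (t'.arr 7) (t'.arr 8) W) :
    Holds E K { c with R := R, W := W } t' where
  r := (hr 1 (by omega)).trans hC.r
  M := (hr 2 (by omega)).trans hC.M
  h := (hr 3 (by omega)).trans hC.h
  ka := (hr 4 (by omega)).trans hC.ka
  kb := (hr 5 (by omega)).trans hC.kb
  kc := (hr 6 (by omega)).trans hC.kc
  T := (ha 0 (by omega) (by omega) (by omega)).trans hC.T
  P := (ha 1 (by omega) (by omega) (by omega)).trans hC.P
  Z := (ha 2 (by omega) (by omega) (by omega)).trans hC.Z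
  L := (ha 3 (by omega) (by omega) (by omega)).trans hC.L
  X := (ha 4 (by omega) (by omega) (by omega)).trans hC.X
  C := (ha 5 (by omega) (by omega) (by omega)).trans hC.C
  R := hR
  W := hW
  m a v := by
    rw [ha 10 (by omega) (by omega) (by omega), ha 9 (by omega) (by omega) (by omega),
      ha 1 (by omega) (by omega) (by omega)]
    exact hC.m a v
  low k hk := by rw [ha 11 (by omega) (by omega) (by omega)]; exact hC.low k hk
  out v hv := by rw [ho]; exact hC.out v hv

/-- The two continuations are the two abstract steps: a failed test is `Core.advance`, a successful
one `Core.register`. The minimum comes from the root of the tree of the part looked at. -/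
theorem Tr.look {Q : St → Prop} (hf : Fits E K) {v : ℕ} (hC : Holds E K c t)
    (hV : Valid E.n K.r K.M (· = c.T v) c) (hv : v < E.n) (h0 : t.reg 0 = E.n)
    (h18 : t.reg 18 = c.L v) (hL : c.L v ≤ K.M)
    (h21 : t.reg 21 = v) (h22 : t.reg 22 = c.xx v) (hx : c.xx v < c.hi E.n v)
    (hfail : ∀ t', c.L v < c.L (c.P (c.xx v)) + c.m (c.item v) v → Holds E K (c.advance v) t' ∧ Keep t t' →
      t'.reg 17 = t.reg 17 → t'.reg 18 = t.reg 18 → t'.reg 19 = t.reg 19 → Q t')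
    (hhit : ∀ t', c.Hit E.n v → Holds E K (c.register K.M v) t' ∧ Keep t t' → t'.reg 19 = 0 → Q t') :
    Cmd.look.wp E Q t := by
  have h1 := hf.lt
  have hxn : c.xx v < E.n := lt_of_lt_of_le hx (min_le_left _ _)
  have hPx := (hV.lay.pos _ hxn).1
  have hit := hV.lay.le _ hPx
  have hTi := hV.T_lt hPx
  have hm : t.arr 10 ((K.h * E.n + (t.arr 9 (K.h * E.n + c.P (c.T (c.P (c.xx v)))) - 1)) * E.n + v) =
      c.m (c.item v) v := by
    have := hC.m (c.item v) v
    rwa [hC.P] at this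
  have hm1 : 1 ≤ c.m (c.item v) v := hV.m_pos hPx hv
  have hWl : watch K.M (c.item v) (c.L v - c.m (c.item v) v + 1) < E.V := by
    refine hf.watch_lt hTi ?_
    omega
  simp only [watch] at hWl
  simp [Cmd.look, Cmd.wp, h0, h18, h21, h22, hC.T, hC.P, hC.L, hC.Z, hC.R, hC.h, hC.M, hm]
  refine ⟨fun hlt => ⟨by change c.item v + _ ≤ _ at hit; change c.item v + _ < _; omega, ?_⟩, fun hle => ⟨fun hR => ⟨hWl, ?_⟩, fun hR => ?_⟩⟩
  · refine hfail _ hlt ⟨?_, ((((Keep.refl t).setReg _ (by omega)).setReg _ (by omega)).setArr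
      _ _ (by omega)).setArr _ _ (by omega)⟩ ?_ ?_ ?_
    · exact ⟨by simpa using hC.r, by simpa using hC.M, by simpa using hC.h, by simpa using hC.ka,
        by simpa using hC.kb, by simpa using hC.kc, hC.T, hC.P, hC.Z, hC.L,
        by simp [Core.advance, Core.item, hC.X], hC.C, by simp [Core.advance, hC.R], hC.W, hC.m,
        hC.low, hC.out⟩
    all_goals simp [h18]
  · have hR' : ¬ c.R v = 1 := by omega
    refine Tr.push (W := c.W) (q := c.regList K.M v) (v := v) (by simp [h0]) ?_
      (by simp; rfl) (by simp) hv (by omega) ?_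
    · simpa using hC.W
    intro t' hr ho ha hW'
    refine hhit _ ⟨hx, hle⟩ ?_ (by simp [hr])
    have hreg : c.register K.M v =
      { c with R := Function.update c.R v 1, W := pushList c.W (c.regList K.M v) v } := if_neg hR'
    rw [hreg]
    have hK : Keep t t' := by
      refine Keep.trans (((((((Keep.refl t).setReg _ (by omega)).setReg _ (by omega)).setReg
        _ (by omega)).setArr _ _ (by omega)).setReg _ (by omega)).setReg _ (by omega)) 
        ⟨fun x _ => by rw [hr], fun a ha' => ha a (by omega) (by omega)⟩
    refine ⟨hC.of_frame hK.reg (by rw [ho]; rfl) (fun a h6 h7 h8 => ?_) ?_ hW', hK⟩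
    · rw [ha a h7 h8]; simp [h6]
    · rw [ha 6 (by omega) (by omega)]; simp [hC.R]
  · have hR' : c.R v = 1 := by have := hV.Rle v hv; omega
    refine hhit _ ⟨hx, hle⟩ ?_ (by simp)
    have hreg : c.register K.M v = c := if_pos hR'
    rw [hreg]
    have hK : Keep t (((t.setReg 24 (c.T (c.P (c.xx v)))).setReg 25 (c.m (c.item v) v)).setReg
      19 0) := (((Keep.refl t).setReg _ (by omega)).setReg _ (by omega)).setReg _ (by omega)
    exact ⟨Holds.of_frame hC hK.reg rfl (fun a _ _ _ => rfl) hC.R hC.W, hK⟩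

end

/-! ### Raising the label of a part -/

section

variable {E : Env} {K : Par} {c : Core} {t : St}

/-- The state after the label of the vertices at the positions in `[b, i)` has been set. -/
structure Relabelled (P : ℕ → ℕ) (b k s : ℕ) (t : St) (i : ℕ) (t' : St) : Prop where
  keep : Keep t t'
  arr : ∀ a, a ≠ 3 → a ≠ 4 → a ≠ 6 → t'.arr a = t.arr a
  reg : ∀ x < 20, t'.reg x = t.reg x
  est : t'.reg 28 = s
  label : ∀ p, b ≤ p → p < i → t'.arr 3 (P p) = k ∧ t'.arr 4 (P p) = 0 ∧ t'.arr 6 (P p) = 0 ∧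
    t'.out (P p) = s
  other : ∀ u, (∀ p, b ≤ p → p < i → P p ≠ u) → t'.arr 3 u = t.arr 3 u ∧
    t'.arr 4 u = t.arr 4 u ∧ t'.arr 6 u = t.arr 6 u ∧ t'.out u = t.out u

theorem Tr.relabel_loop {N b k s : ℕ} {P : ℕ → ℕ} (hN : N ≤ E.n) (hnV : E.n < E.V) (hb : b ≤ N)
    (hP : ∀ p < N, P p < E.n) (h1 : t.arr 1 = P)
    (h18 : t.reg 18 = k) (h23 : t.reg 23 = N) (h28 : t.reg 28 = s) (h26 : t.reg 26 = b) :
    Tr E (.for 26 23 (.set 21 (.ld 1 (.r 26)) ;; .put 3 (.r 21) (.r 18) ;; .put 4 (.r 21) 0 ;;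
      .put 6 (.r 21) 0 ;; .outp (.r 21) (.r 28))) t
      (fun l t' => Relabelled P b k s t N t' ∧ l ≤ (N - b) * 90 + 5) := by
  refine (Tr.for (I := fun i t' => b ≤ i ∧ Relabelled P b k s t i t') (Ψ := fun _ => 0) (c := 70)
    (by omega) (by omega) (by omega) (by omega) (by omega : N < E.V) ?_ ?_ (fun _ _ => rfl) ?_
    (by omega) h23).mono ?_
  · rintro i hi t1 ⟨hbi, h⟩ hr26 hr23
    have hPi := hP i hi
    have h1' : t1.arr 1 i = P i := by rw [h.arr 1 (by omega) (by omega) (by omega), h1]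
    have h18' : t1.reg 18 = k := (h.reg 18 (by omega)).trans h18
    refine (Tr.of_wp (Q := fun t' => (b ≤ i + 1 ∧ Relabelled P b k s t (i + 1) t') ∧
      t'.reg 26 = i ∧ t'.reg 23 = N) (by decide) ?_).mono
      fun l t' ⟨h2, h3⟩ => ⟨h3.1, h3.2.1, h3.2.2, h2.trans (by decide)⟩
    simp [Cmd.wp, hr26, h1', h18', h.est, hPi, hr23]
    refine ⟨by omega, ?_, ?_, ?_, ?_, ?_, ?_⟩
    · exact ((((h.keep.setReg _ (by omega)).setArr _ _ (by omega)).setArr _ _ (by omega)).setArr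
        _ _ (by omega)).setOut _ _
    · intro a h3 h4 h6; simp [h3, h4, h6, h.arr a h3 h4 h6]
    · intro x hx; rw [← h.reg x hx]; simp; omega
    · simpa using h.est
    · intro p hp1 hp2
      by_cases hp : P p = P i
      · simp [hp]
      · have hpi : p ≠ i := fun he => hp (he ▸ rfl)
        have := h.label p hp1 (by omega)
        simpa [hp] using this
    · intro u hu
      have hui := hu i hbi (by omega)
      have := h.other u fun p hp1 hp2 => hu p hp1 (by omega)
      simpa [hui.symm] using this
  · rintro i t1 ⟨hbi, h⟩
    refine ⟨hbi, h.keep.setReg _ (by omega), h.arr, fun x hx => ?_, ?_, h.label, h.other⟩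
    · rw [← h.reg x hx]; simp; omega
    · simpa using h.est
  · rw [h26]
    exact ⟨le_rfl, Keep.refl t, fun _ _ _ _ => rfl, fun _ _ => rfl, h28,
      fun p h1 h2 => by omega, fun _ _ => ⟨rfl, rfl, rfl, rfl⟩⟩
  · rintro l t' ⟨⟨-, h⟩, -, -, hl⟩
    rw [h26] at hl
    exact ⟨h, by omega⟩

theorem Tr.relabel (hf : Fits E K) {v : ℕ} (hC : Holds E K c t)
    (hV : Valid E.n K.r K.M (· = c.T v) c) (hv : v < E.n) (hL : c.L v ≤ K.M)
    (h17 : t.reg 17 = c.T v) (h18 : t.reg 18 = c.L v) (h23 : t.reg 23 = c.e v) :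
    Tr E Cmd.relabel t (fun l t' => l ≤ c.Z (c.T v) * 90 + 100 ∧ Keep t t' ∧
      (∀ a, a ≠ 3 → a ≠ 4 → a ≠ 5 → a ≠ 6 → t'.arr a = t.arr a) ∧
      t'.arr 5 = Function.update c.C (c.T v) (c.T v) ∧
      (∀ u < E.n, t'.arr 3 u = if c.T u = c.T v then c.L v + 1 else c.L u) ∧
      (∀ u < E.n, t'.arr 4 u = if c.T u = c.T v then 0 else c.X u) ∧
      (∀ u < E.n, t'.arr 6 u = if c.T u = c.T v then 0 else c.R u) ∧
      (∀ u < E.n, t'.out u = K.est (t'.arr 3 u)) ∧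
      t'.reg 17 = c.T v ∧ t'.reg 18 = c.L v + 1 ∧
      t'.reg 19 = if K.M < c.L v + 1 then 0 else t.reg 19) := by
  have hfl := hf.lt
  have he := hV.lay.le v hv
  change c.e v ≤ E.n at he
  have hlt := hV.T_lt_e hv
  unfold Cmd.relabel
  let s : ℕ := K.est (c.L v + 1)
  let t1 : St := ((((t.setReg 18 (c.L v + 1)).setArr 5 (c.T v) (c.T v)).setReg 28 s).setReg
    19 (if K.M < c.L v + 1 then 0 else t.reg 19)).setReg 26 (c.T v)
  suffices hpre : Tr E (.set 18 (.r 18 + 1) ;; .put 5 (.r 17) (.r 17) ;;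
      .ite (.r 2) (.r 18) (.set 28 0 ;; .set 19 0)
        (.set 28 ((.r 18 * .r 4 + .r 5) / .r 6 + 1)) ;; .set 26 (.r 17)) t
      (fun l t' => l ≤ 80 ∧ (t'.arr = t1.arr ∧ t'.out = t1.out ∧ ∀ x, t'.reg x = t1.reg x)) by
    refine Tr.seq (hpre.mono fun l t' ⟨hl, ha, ho, hr⟩ => ?_)
    have ht' : t' = t1 := St.ext (funext hr) ho ha
    subst ht'
    refine (Tr.relabel_loop (N := c.e v) (b := c.T v) (k := c.L v + 1) (s := s) (P := c.P) he
      (by omega) hlt.le (fun p hp => (hV.lay.pos p (by omega)).1) (by simp [t1, hC.P])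
      (by simp [t1]) (by simp [t1, h23]) (by simp [t1]) (by simp [t1])).mono ?_
    rintro l' t' ⟨h, hl'⟩
    have hZ : c.e v - c.T v = c.Z (c.T v) := by simp [Core.e]
    rw [hZ] at hl'
    -- The loop runs over positions; `surj` and `part_eq` translate them into the vertices of the
    -- part.
    have hcase : ∀ u < E.n, (t'.arr 3 u = if c.T u = c.T v then c.L v + 1 else c.L u) ∧
        (t'.arr 4 u = if c.T u = c.T v then 0 else c.X u) ∧
        (t'.arr 6 u = if c.T u = c.T v then 0 else c.R u) ∧
        (t'.out u = if c.T u = c.T v then s else K.est (c.L u)) := by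
      intro u hu
      split_ifs with huv
      · obtain ⟨p, hp1, hp2, hp3⟩ := hV.lay.surj u hu
        rw [huv] at hp1 hp2
        have := h.label p hp1 hp2
        rwa [hp3] at this
      · have := h.other u fun p hp1 hp2 hpu => huv (by
          rw [← hpu]; exact hV.lay.part_eq hv hp1 hp2)
        simpa [t1, hC.L, hC.X, hC.R, hC.out u hu] using this
    refine ⟨by omega, ?_, ?_, ?_, fun u hu => (hcase u hu).1, fun u hu => (hcase u hu).2.1,
      fun u hu => (hcase u hu).2.2.1, fun u hu => ?_, ?_, ?_, ?_⟩
    · refine Keep.trans ?_ h.keep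
      exact (((((Keep.refl t).setReg _ (by omega)).setArr _ _ (by omega)).setReg
        _ (by omega)).setReg _ (by omega)).setReg _ (by omega)
    · intro a h3 h4 h5 h6
      rw [h.arr a h3 h4 h6]; simp [t1, h5]
    · rw [h.arr 5 (by omega) (by omega) (by omega)]; simp [t1, hC.C]
    · rw [(hcase u hu).1, (hcase u hu).2.2.2]
      split_ifs <;> rfl
    · rw [h.reg 17 (by omega)]; simp [t1, h17]
    · rw [h.reg 18 (by omega)]; simp [t1]
    · rw [h.reg 19 (by omega)]; simp [t1]
  refine (Tr.of_wp (Q := fun t' => t'.arr = t1.arr ∧ t'.out = t1.out ∧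
    ∀ x, t'.reg x = t1.reg x) (by decide) ?_).mono fun l t' h => ⟨h.1.trans (by decide), h.2⟩
  simp only [Cmd.wp, Ex.eval_add, Ex.eval_mul, Ex.eval_div, Ex.eval_r, Ex.eval_num, Ex.leaf_r,
    Ex.leaf_num, Ex.leaf_add, St.setReg_reg, St.setArr_reg, St.setReg_arr, St.setReg_out,
    St.setArr_out, h17, h18, hC.M, hC.ka, hC.kb, hC.kc]
  norm_num
  have hs : s = if c.L v + 1 ≤ K.M then ((c.L v + 1) * K.ka + K.kb) / K.kc + 1 else 0 := rfl
  refine ⟨by omega, fun h2 => ⟨rfl, rfl, fun x => ?_⟩, fun h2 => ⟨?_, rfl, rfl, fun x => ?_⟩⟩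
  · rw [if_neg (by omega)] at hs
    simp only [t1, hs, St.setReg_reg, St.setArr_reg, if_pos (by omega : K.M < c.L v + 1)]
  · have := hf.est _ h2
    rwa [Par.est, if_pos (by omega)] at this
  · rw [if_pos (by omega)] at hs
    simp only [t1, hs, St.setReg_reg, St.setArr_reg, if_neg (by omega : ¬ K.M < c.L v + 1)]
    split_ifs <;> simp_all

/-- The state after some vertices have been moved from the list `q` to the work list. -/
structure Woken (n : ℕ) (W : ℕ → List ℕ) (q : ℕ) (t : St) (W' : ℕ → List ℕ) (t' : St) : Prop where
  keep : Keep t t'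
  arr : ∀ a, a ≠ 7 → a ≠ 8 → t'.arr a = t.arr a
  reg : ∀ x < 30, t'.reg x = t.reg x
  list : t'.reg 32 = q
  out : t'.out = t.out
  rep : ListRep n (t'.arr 7) (t'.arr 8) W'
  other : ∀ q', q' ≠ 0 → q' ≠ q → W' q' = W q'
  mem : ∀ u, u ∈ W 0 ∨ u ∈ W q → u ∈ W' 0 ∨ u ∈ W' q
  length : (W' 0).length + (W' q).length ≤ (W 0).length + (W q).length

/-- The ghost state is the family of lists, and the length of the watch list pays for the rounds.
The list may contain outdated entries; waking them is harmless and already paid for. -/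
theorem Tr.wake {W : ℕ → List ℕ} (hV : E.n + 1 < E.V) (hW : ListRep E.n (t.arr 7) (t.arr 8) W)
    {q : ℕ} (hq : q ≠ 0) (h32 : t.reg 32 = q) :
    Tr E Cmd.wake t (fun l t' => ∃ W', Woken E.n W q t W' t' ∧ W' q = [] ∧
      l ≤ 240 * (W q).length + 20) := by
  refine (Tr.wh (γ := ℕ → List ℕ) (Inv := fun W' t' => Woken E.n W q t W' t')
    (Φ := fun W' => 240 * (W' q).length) (by decide) (by decide) ?_
    (g := W) ⟨Keep.refl t, fun _ _ _ => rfl, fun _ _ => rfl, h32, rfl, hW, fun _ _ _ => rfl,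
      fun _ h => h, le_rfl⟩).mono ?_
  · intro W' t1 h hlt
    refine Tr.bounded fun _ hb h0 => ?_
    simp only [Ex.eval_num, Ex.eval_ld, Ex.eval_r, h.list] at hlt
    obtain ⟨v, l, hl⟩ : ∃ v l, W' q = v :: l := by
      cases hl : W' q with
      | nil => have := h.rep.head_eq_zero.2 hl; omega
      | cons v l => exact ⟨v, l, rfl⟩
    refine (Tr.of_wp (Q := fun t' => ∃ W'', Woken E.n W q t W'' t' ∧ W'' q = l) (by decide)
      ?_).mono ?_
    · change Cmd.wp E (.set 30 (.r 32)) _ t1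
      simp only [Cmd.wp, Ex.leaf_r, true_or, true_and, Ex.eval_r, h.list]
      refine Tr.pop (W := W') (q := q) (v := v) (l := l) (by simp [h0]) h.rep (by simp) hl
        (hb 8 (by omega)) hV ?_
      intro t2 hv h31 hr2 ho2 ha2 hW2
      change Cmd.wp E (.set 30 0) _ t2
      simp only [Cmd.wp, Ex.leaf_num, true_or, true_and, Ex.eval_num]
      refine Tr.push (W := Function.update W' q l) (q := 0) (v := v) ?_ hW2 (by simp) (by simpa)
        hv hV ?_
      · rw [St.setReg_reg, if_neg (by omega), hr2 0 (by omega)]; simp [h0]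
      intro t3 hr3 ho3 ha3 hW3
      have hr : ∀ x, x ≠ 30 → x ≠ 31 → t3.reg x = t1.reg x := by
        intro x hx hx'
        rw [hr3, St.setReg_reg, if_neg hx, hr2 x hx']; simp [hx]
      have ha : ∀ a, a ≠ 7 → a ≠ 8 → t3.arr a = t1.arr a := fun a h7 h8 => by
        rw [ha3 a h7 h8, St.setReg_arr, ha2 a h7 h8]; rfl
      refine ⟨_, ⟨?_, fun a h7 h8 => (ha a h7 h8).trans (h.arr a h7 h8),
        fun x hx => (hr x (by omega) (by omega)).trans (h.reg x hx),
        (hr 32 (by omega) (by omega)).trans h.list, ?_, hW3, ?_, ?_, ?_⟩, ?_⟩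
      · exact h.keep.trans ⟨fun x hx => hr x (by omega) (by omega),
          fun a h9 => ha a (by omega) (by omega)⟩
      · rw [ho3, St.setReg_out, ho2]; exact h.out
      · intro q' h1 h2
        rw [pushList_of_ne _ _ h1, Function.update_of_ne h2]; exact h.other q' h1 h2
      · intro u hu
        rw [pushList_of_ne _ _ hq, Function.update_self, mem_pushList,
          Function.update_of_ne hq.symm]
        have := h.mem u hu
        rw [hl, List.mem_cons] at this
        tauto
      · have h4 := length_pushList_le (Function.update W' q l) 0 v
        rw [Function.update_of_ne hq.symm] at h4
        rw [pushList_of_ne _ _ hq, Function.update_self]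
        have := h.length
        rw [hl, List.length_cons] at this
        omega
      · rw [pushList_of_ne _ _ hq, Function.update_self]
    · rintro k t' ⟨hk, W'', h1, h2⟩
      refine ⟨W'', h1, ?_⟩
      have hk' : k ≤ 200 := hk.trans (by decide)
      have hc : (0 : Ex).cost + (Ex.ld 7 (.r 32)).cost + 1 ≤ 20 := by decide
      rw [hl, h2, List.length_cons]
      omega
  · rintro k t' ⟨W', h, h1, h2⟩
    refine ⟨W', h, ?_, h2.trans' (Nat.le_add_right _ _) |>.trans (Nat.add_le_add_left (by decide) _)⟩
    simp only [Ex.eval_num, Ex.eval_ld, Ex.eval_r, h.list] at h1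
    exact h.rep.head_eq_zero.1 (by omega)

/-- The steps are linear in the size of the part plus the number of woken vertices, which is what
`Valid.pot_rise` releases. -/
theorem Tr.rise (hf : Fits E K) {v : ℕ} (hC : Holds E K c t)
    (hV : Valid E.n K.r K.M (· = c.T v) c) (hv : v < E.n) (hL : c.L v ≤ K.M)
    (hr : c.T v ≠ c.T K.r) (hcur : c.e v ≤ c.C (c.T v))
    (h17 : t.reg 17 = c.T v) (h18 : t.reg 18 = c.L v) (h23 : t.reg 23 = c.e v) :
    Tr E Cmd.rise t (fun l t' => Keep t t' ∧ ∃ c', Holds E K c' t' ∧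
      Valid E.n K.r K.M (· = c'.T v) c' ∧ c'.T = c.T ∧ c'.P = c.P ∧ c'.Z = c.Z ∧ c'.w = c.w ∧
      c'.m = c.m ∧ c'.L v = c.L v + 1 ∧ t'.reg 17 = c.T v ∧ t'.reg 18 = c.L v + 1 ∧
      t'.reg 19 = (if K.M < c.L v + 1 then 0 else t.reg 19) ∧
      l + 240 * (c'.pot E.n K.M + 1) ≤ 240 * c.pot E.n K.M) := by
  have hfl := hf.lt
  have hT := hV.T_lt hv
  have hwl : watch K.M (c.T v) (c.L v + 1) < E.V := hf.watch_lt hT (by omega)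
  refine Tr.seq ((Tr.relabel hf hC hV hv hL h17 h18 h23).mono ?_)
  rintro l1 t1 ⟨hl1, hk1, ha, ha5, ha3, ha4, ha6, ho, g17, g18, g19⟩
  refine Tr.seq ((Tr.of_wp (Q := fun t' => t' = t1.setReg 32 (watch K.M (c.T v) (c.L v + 1)))
    (by decide) ?_).mono ?_)
  · have h2 : t1.reg 2 = K.M := (hk1.reg 2 (by omega)).trans hC.M
    simp only [watch] at hwl
    simp [Cmd.wp, g17, g18, h2, watch, hwl]
  rintro l2 t2 ⟨hl2, rfl⟩
  have hl2' : l2 ≤ 30 := hl2.trans (by decide)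
  refine (Tr.wake (W := c.W) (by omega) ?_ (q := watch K.M (c.T v) (c.L v + 1)) ?_
    (by simp)).mono ?_
  · simpa [ha] using hC.W
  · simp only [watch]; omega
  rintro l3 t3 ⟨W', h, hWn, hl3⟩
  have hk2 : Keep t t3 := (hk1.setReg _ (by omega)).trans h.keep
  have harr : ∀ a, a ≠ 7 → a ≠ 8 → t3.arr a = t1.arr a := fun a h7 h8 => by
    rw [h.arr a h7 h8]; rfl
  have hlen := h.length
  rw [hWn] at hlen
  have hmem : ∀ u, u ∈ c.W 0 ∨ u ∈ c.W (watch K.M (c.T v) (c.L v + 1)) → u ∈ W' 0 := by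
    intro u hu
    have := h.mem u hu
    simpa [hWn] using this
  refine ⟨hk2, { c with
    L := t3.arr 3, X := t3.arr 4, C := t3.arr 5, R := t3.arr 6, W := W' }, ?_, ?_, rfl, rfl, rfl,
    rfl, rfl, ?_, ?_, ?_, ?_, ?_⟩
  · refine ⟨(hk2.reg 1 (by omega)).trans hC.r, (hk2.reg 2 (by omega)).trans hC.M,
      (hk2.reg 3 (by omega)).trans hC.h, (hk2.reg 4 (by omega)).trans hC.ka,
      (hk2.reg 5 (by omega)).trans hC.kb, (hk2.reg 6 (by omega)).trans hC.kc, ?_, ?_, ?_, rfl, rfl,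
      rfl, rfl, h.rep, ?_, ?_, ?_⟩
    · rw [harr 0 (by omega) (by omega), ha 0 (by omega) (by omega) (by omega) (by omega), hC.T]
    · rw [harr 1 (by omega) (by omega), ha 1 (by omega) (by omega) (by omega) (by omega), hC.P]
    · rw [harr 2 (by omega) (by omega), ha 2 (by omega) (by omega) (by omega) (by omega), hC.Z]
    · intro a u
      rw [hk2.arr 10 (by omega), hk2.arr 9 (by omega), harr 1 (by omega) (by omega),
        ha 1 (by omega) (by omega) (by omega) (by omega)]
      exact hC.m a u
    · intro k hk; rw [hk2.arr 11 (by omega)]; exact hC.low k hk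
    · intro u hu
      rw [h.out, harr 3 (by omega) (by omega)]
      exact ho u hu
  · refine hV.rise hv hcur hr hL rfl rfl rfl rfl rfl ?_ ?_ ?_ ?_ hmem h.other
    · exact (harr 5 (by omega) (by omega)).trans ha5
    · intro u hu; exact (congrFun (harr 3 (by omega) (by omega)) u).trans (ha3 u hu)
    · intro u hu; exact (congrFun (harr 4 (by omega) (by omega)) u).trans (ha4 u hu)
    · intro u hu; exact (congrFun (harr 6 (by omega) (by omega)) u).trans (ha6 u hu)
  · change t3.arr 3 v = _
    rw [harr 3 (by omega) (by omega), ha3 v hv, if_pos rfl]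
  · rw [h.reg 17 (by omega)]; simpa using g17
  · rw [h.reg 18 (by omega)]; simpa using g18
  · rw [h.reg 19 (by omega)]; simpa using g19
  · have := hV.pot_rise (c' := { c with
      L := t3.arr 3, X := t3.arr 4, C := t3.arr 5, R := t3.arr 6, W := W' }) hv hL rfl rfl rfl
      ((harr 5 (by omega) (by omega)).trans ha5)
      (fun u hu => (congrFun (harr 3 (by omega) (by omega)) u).trans (ha3 u hu))
      (fun u hu => (congrFun (harr 4 (by omega) (by omega)) u).trans (ha4 u hu))
      (by simpa using hlen) h.other hWn
      (fun u hu => (congrFun (harr 6 (by omega) (by omega)) u).trans (ha6 u hu))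
    have h5 := Nat.mul_le_mul_left 240 this
    have h6 := hV.lay.Z_pos hv
    simp only [mul_add] at h5
    omega

end

/-! ### The main loop -/

section

variable {E : Env} {K : Par} {c : Core} {t : St}

/-- The parts of the state that the main program does not change. -/
structure Core.Same (c c' : Core) : Prop where
  T : c'.T = c.T
  P : c'.P = c.P
  Z : c'.Z = c.Z
  w : c'.w = c.w
  m : c'.m = c.m

theorem Core.Same.refl (c : Core) : c.Same c := ⟨rfl, rfl, rfl, rfl, rfl⟩

theorem Core.Same.trans {c c' c'' : Core} (h : c.Same c') (h' : c'.Same c'') : c.Same c'' :=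
  ⟨h'.T.trans h.T, h'.P.trans h.P, h'.Z.trans h.Z, h'.w.trans h.w, h'.m.trans h.m⟩

/-- The part at register 17 is being processed (`g = 1`), or no part is (`g = 0`). -/
structure Active (E : Env) (K : Par) (c₀ : Core) (t₀ : St) (c : Core) (g : ℕ) (t : St) : Prop where
  keep : Keep t₀ t
  same : c₀.Same c
  holds : Holds E K c t
  go : t.reg 19 = g
  le : g ≤ 1
  off : g = 0 → Valid E.n K.r K.M (fun _ => False) c
  on : g = 1 → ∃ v < E.n, t.reg 17 = c.T v ∧ t.reg 18 = c.L v ∧ c.L v ≤ K.M ∧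
    c.T v ≠ c.T K.r ∧ Valid E.n K.r K.M (· = c.T v) c

/-- There are four outcomes. Skipping a part, going on to the next vertex and raising the label each
lower the potential; finding a supported vertex ends the activity. So the potential plus the
activity flag drops by at least one in each case. -/
theorem Tr.step (hf : Fits E K) {c₀ : Core} {t₀ : St} (h : Active E K c₀ t₀ c 1 t) :
    Tr E Cmd.step t (fun l t' => ∃ c' g', Active E K c₀ t₀ c' g' t' ∧
      l + 20 + 1000 * (c'.pot E.n K.M + g') ≤ 1000 * (c.pot E.n K.M + 1)) := by
  refine Tr.bounded fun hrb hab h0 => ?_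
  obtain ⟨v, hv, h17, h18, hL, hr, hV⟩ := h.on rfl
  have hC := h.holds
  have hfl := hf.lt
  have hle := hV.lay.le v hv
  have hcur := hV.cur v hv
  unfold Cmd.step
  refine Tr.seq ((Tr.of_wp (Q := fun t' => t' = t.setReg 20 (c.C (c.T v))) (by decide) ?_).mono ?_)
  · simp [Cmd.wp, h17, hC.C]
  rintro l1 t1 ⟨hl1, rfl⟩
  have hl1' : l1 ≤ 20 := hl1.trans (by decide)
  refine Tr.seq ((Tr.of_wp (Q := fun t' => t' = (t.setReg 20 (c.C (c.T v))).setReg 23 (c.e v))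
    (by decide) ?_).mono ?_)
  · simp [Cmd.wp, h17, hC.Z, Core.e]; omega
  rintro l2 t2 ⟨hl2, rfl⟩
  have hl2' : l2 ≤ 30 := hl2.trans (by decide)
  have hC2 : Holds E K c ((t.setReg 20 (c.C (c.T v))).setReg 23 (c.e v)) :=
    Holds.of_frame hC (((Keep.refl t).setReg _ (by omega)).setReg _ (by omega)).reg rfl
      (fun a _ _ _ => rfl) hC.R hC.W
  have hk2 : Keep t₀ ((t.setReg 20 (c.C (c.T v))).setReg 23 (c.e v)) :=
    (h.keep.setReg _ (by omega)).setReg _ (by omega)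
  have hcost : ∀ x y : ℕ, (Ex.r x).cost + ((Ex.r y).cost + 1) = 5 := fun _ _ => rfl
  refine Tr.ite (by decide) (by decide) (fun hlt => ?_) fun hge => ?_
  · have hlt : c.C (c.T v) < c.T v + c.Z (c.T v) := by simpa [Core.e] using hlt
    obtain ⟨hu, hTu⟩ := hV.T_cur hv hlt
    set u := c.P (c.C (c.T v)) with hu_def
    have hLu : c.L u = c.L v := hV.Lpart u hu v hv hTu
    have heu : c.e u = c.e v := by simp only [Core.e, hTu]
    have hVu : Valid E.n K.r K.M (· = c.T u) c := hTu ▸ hV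
    refine (Tr.of_wp (Q := fun t' => ∃ c' g', Active E K c₀ t₀ c' g' t' ∧
      c'.pot E.n K.M + g' ≤ c.pot E.n K.M) (by decide) ?_).mono ?_
    · simp only [Cmd.wp, Ex.leaf_ld, true_or, true_and]
      refine Tr.aim hf (v := u) ?_ hVu hu (by simp [h0]) (by simp [h17, hTu]) (by simp [h18, hLu])
        (by simp [hC.P, hu_def]) (by simp [heu]) ?_
      · exact Holds.of_frame hC2 ((Keep.refl _).setReg _ (by omega)).reg rfl
          (fun a _ _ _ => rfl) hC.R hC.W
      intro t3 h22 h27 hr3 ho3 ha3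
      have hk3 : Keep t₀ t3 := hk2.trans ⟨fun x hx => by
        rw [hr3 x (by omega) (by omega) (by omega), St.setReg_reg, if_neg (by omega)],
        fun a _ => by rw [ha3]; rfl⟩
      have hC3 : Holds E K c t3 := Holds.of_frame hC2 (t' := t3) (fun x hx => by
        rw [hr3 x (by omega) (by omega) (by omega), St.setReg_reg, if_neg (by omega)])
        (by rw [ho3]; rfl) (fun a _ _ _ => by rw [ha3]; rfl) (by rw [ha3]; exact hC.R)
        (by rw [ha3]; exact hC.W)
      have g17 : t3.reg 17 = c.T u := by
        rw [hr3 17 (by omega) (by omega) (by omega)]; simp [h17, hTu]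
      have g18 : t3.reg 18 = c.L u := by
        rw [hr3 18 (by omega) (by omega) (by omega)]; simp [h18, hLu]
      have g19 : t3.reg 19 = 1 := by
        rw [hr3 19 (by omega) (by omega) (by omega)]; simpa using h.go
      have g20 : t3.reg 20 = c.C (c.T v) := by
        rw [hr3 20 (by omega) (by omega) (by omega)]; simp
      have g21 : t3.reg 21 = u := by
        rw [hr3 21 (by omega) (by omega) (by omega)]; simp [hC.P, hu_def]
      have g0 : t3.reg 0 = E.n := by
        rw [hr3 0 (by omega) (by omega) (by omega)]; simp [h0]
      simp only [Ex.eval_r, Ex.eval_add, Ex.eval_num, Ex.leaf_add, h22, h27]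
      refine ⟨fun hx => ?_, fun hx => ?_⟩
      · refine Tr.look hf hC3 hVu hu g0 g18 (by omega) g21 h22 hx ?_ ?_
        · rintro t4 hfail ⟨hC4, hk4⟩ r17 r18 r19
          refine ⟨c.advance u, 1, ⟨hk3.trans hk4, h.same.trans ⟨rfl, rfl, rfl, rfl, rfl⟩, hC4,
            r19.trans g19, le_rfl, by omega, fun _ => ⟨u, hu, r17.trans g17, r18.trans g18,
            by change c.L u ≤ _; omega, by change c.T u ≠ c.T _; rwa [hTu],
            hVu.advance hu hx hfail⟩⟩, hVu.pot_advance hu hx⟩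
        · rintro t4 hhit ⟨hC4, hk4⟩ r19
          refine ⟨c.register K.M u, 0, ⟨hk3.trans hk4, h.same.trans ?_, hC4, r19, by omega, fun _ => ?_,
            by omega⟩, hVu.pot_register hu⟩
          · unfold Core.register; split_ifs <;> exact ⟨rfl, rfl, rfl, rfl, rfl⟩
          · refine hVu.register hu ?_ ?_ hhit
            · rw [hTu]; exact hlt
            · rw [hTu]
      · refine ⟨.inr (by omega), c.next (c.T v), 1, ⟨hk3.setArr _ _ (by omega),
          h.same.trans ⟨rfl, rfl, rfl, rfl, rfl⟩, ?_, g19, le_rfl, by omega, fun _ =>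
            ⟨v, hv, ?_, ?_, hL, hr, hV.next hv hlt hx⟩⟩, hV.pot_next hv hlt⟩
        · refine ⟨hC3.r, hC3.M, hC3.h, hC3.ka, hC3.kb, hC3.kc, hC3.T, hC3.P, hC3.Z, hC3.L, hC3.X,
            ?_, hC3.R, hC3.W, hC3.m, hC3.low, hC3.out⟩
          simp [Core.next, hC3.C, g17, g20, hTu]
        · exact g17.trans hTu
        · exact g18.trans hLu
    · rintro l t' ⟨hl, c', g', hA, hp⟩
      have hl' : l ≤ 600 := hl.trans (by decide)
      refine ⟨c', g', hA, ?_⟩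
      have := hcost 20 23
      omega
  · have hge : c.e v ≤ c.C (c.T v) := by simpa using hge
    refine (Tr.rise hf hC2 hV hv hL hr hge (by simp [h17]) (by simp [h18]) (by simp)).mono ?_
    rintro l t' ⟨hk, c', hC', hV', eT, eP, eZ, ew, em, eL, r17, r18, r19, hp⟩
    have hT' : c'.T v = c.T v := congrFun eT v
    have r19' : t'.reg 19 = if K.M < c.L v + 1 then 0 else 1 := by
      rw [r19]; simp [h.go]
    have := hcost 20 23
    by_cases hM : K.M < c.L v + 1
    · refine ⟨c', 0, ⟨hk2.trans hk, h.same.trans ⟨eT, eP, eZ, ew, em⟩, hC', by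
        rw [r19', if_pos hM], by omega, fun _ => ?_, by omega⟩, by omega⟩
      -- The label has become M + 1, that is ∞, and needs no support.
      refine hV'.inactive fun w hw hwv => .inr ?_
      rw [hV'.Lpart w hw v hv hwv, eL]; exact hM
    · refine ⟨c', 1, ⟨hk2.trans hk, h.same.trans ⟨eT, eP, eZ, ew, em⟩, hC', by
        rw [r19', if_neg hM], by omega, by omega, fun _ => ⟨v, hv, by rw [r17, hT'], by
        rw [r18, eL], by omega, by rwa [eT], hV'⟩⟩, by omega⟩

theorem Tr.process (hf : Fits E K) {c₀ : Core} {t₀ : St} {g : ℕ} (h : Active E K c₀ t₀ c g t) :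
    Tr E (.wh 0 (.r 19) Cmd.step) t (fun l t' => ∃ c', Active E K c₀ t₀ c' 0 t' ∧
      l + 1000 * c'.pot E.n K.M ≤ 1000 * (c.pot E.n K.M + g) + 20) := by
  refine (Tr.wh (γ := Core × ℕ) (Inv := fun x t' => Active E K c₀ t₀ x.1 x.2 t')
    (Φ := fun x => 1000 * (x.1.pot E.n K.M + x.2)) (by decide) (by decide) ?_ (g := (c, g)) h).mono ?_
  · rintro ⟨c1, g1⟩ t1 h1 hlt
    have h2 := h1.go
    have h3 := h1.le
    simp only [Ex.eval_num, Ex.eval_r] at hlt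
    have h4 : g1 = 1 := by omega
    subst h4
    dsimp only at h1 ⊢
    refine (Tr.step hf h1).mono ?_
    rintro l t' ⟨c', g', hA, hp⟩
    have : (0 : Ex).cost + (Ex.r 19).cost + 1 ≤ 20 := by decide
    refine ⟨(c', g'), hA, ?_⟩
    dsimp only
    omega
  · rintro l t' ⟨⟨c', g'⟩, hA, hle, hp⟩
    have h2 := hA.go
    simp only [Ex.eval_num, Ex.eval_r] at hle
    have h4 : g' = 0 := by omega
    subst h4
    have : (0 : Ex).cost + (Ex.r 19).cost + 1 ≤ 20 := by decide
    exact ⟨c', hA, by dsimp only at hp; omega⟩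

/-- The part of the source and parts with label M + 1 are dropped at once; any other part becomes
active and is thereby exempt from stability. -/
theorem Tr.start (hf : Fits E K) {c₀ : Core} {t₀ : St} (hk : Keep t₀ t) (hs : c₀.Same c)
    (hC : Holds E K c t) (hV : Valid E.n K.r K.M (fun _ => False) c) (hW : c.W 0 ≠ []) :
    Tr E Cmd.start t (fun l t' => l ≤ 300 ∧ ∃ c', (∃ g', Active E K c₀ t₀ c' g' t') ∧
      c'.pot E.n K.M + 2 ≤ c.pot E.n K.M) := by
  refine Tr.bounded fun hrb hab h0 => ?_
  have hfl := hf.lt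
  obtain ⟨v, l, hl⟩ := List.exists_cons_of_ne_nil hW
  refine (Tr.of_wp (Q := fun t' => ∃ c', (∃ g', Active E K c₀ t₀ c' g' t') ∧
      c'.pot E.n K.M + 2 ≤ c.pot E.n K.M) (by decide) ?_).mono
    fun l t' h => ⟨h.1.trans (by decide), h.2⟩
  unfold Cmd.start
  change Cmd.wp E (.set 30 0) _ t
  simp only [Cmd.wp, Ex.leaf_num, true_or, true_and, Ex.eval_num]
  refine Tr.pop (W := c.W) (q := 0) (v := v) (l := l) (by simp [h0]) hC.W (by simp) hl
    (hab 8 (by omega)) (by omega) ?_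
  intro t2 hv h31 hr2 ho2 ha2 hW2
  have hk2 : Keep t t2 := ⟨fun x hx => by rw [hr2 x (by omega), St.setReg_reg, if_neg (by omega)],
    fun a ha => ha2 a (by omega) (by omega)⟩
  let c1 : Core := { c with W := Function.update c.W 0 l }
  have hV1 : Valid E.n K.r K.M (· = c.T v) c1 := hV.pop hl
  have hC2 : Holds E K c1 t2 := Holds.of_frame hC hk2.reg ho2
    (fun a h6 h7 h8 => ha2 a h7 h8) (by rw [ha2 6 (by omega) (by omega)]; exact hC.R) hW2
  have key : ∀ t', Keep t2 t' → t'.out = t2.out → t'.arr = t2.arr → t'.reg 17 = c.T v →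
      t'.reg 18 = c.L v → (t'.reg 19 = 1 ∧ c.T v ≠ c.T K.r ∧ c.L v ≤ K.M ∨ t'.reg 19 = 0 ∧
        (c.T v = c.T K.r ∨ K.M < c.L v)) → ∃ c', (∃ g', Active E K c₀ t₀ c' g' t') ∧
      c'.pot E.n K.M + 2 ≤ c.pot E.n K.M := by
    intro t' hk' ho ha r17 r18 h19
    have hC' : Holds E K c1 t' := Holds.of_frame hC2 hk'.reg ho (fun a _ _ _ => by rw [ha])
      (by rw [ha]; exact hC2.R) (by rw [ha]; exact hC2.W)
    have hs1 : c₀.Same c1 := hs.trans ⟨rfl, rfl, rfl, rfl, rfl⟩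
    rcases h19 with ⟨r19, h1, h2⟩ | ⟨r19, h1⟩
    · exact ⟨c1, ⟨1, (hk.trans hk2).trans hk', hs1, hC', r19, le_rfl, by omega,
        fun _ => ⟨v, hv, r17, r18, h2, h1, hV1⟩⟩, c.pot_pop hl⟩
    · refine ⟨c1, ⟨0, (hk.trans hk2).trans hk', hs1, hC', r19, by omega, fun _ => ?_, by omega⟩,
        c.pot_pop hl⟩
      refine hV1.inactive fun u hu huv => ?_
      have h2 : c.L u = c.L v := hV.Lpart u hu v hv huv
      change c.T u = c.T v at huv
      change c.T u = c.T K.r ∨ K.M < c.L u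
      rw [huv, h2]; exact h1
  have hT : c1.T = c.T := rfl
  have hLc : c1.L = c.L := rfl
  simp [h31, hC2.T, hC2.L, hC2.r, hC2.M, hT, hLc]
  repeat' (first | refine ⟨fun _ => ?_, fun _ => ?_⟩)
  all_goals
    refine key _ ?_ rfl rfl (by simp) (by simp) ?_
    · repeat' (first | exact Keep.refl _ | refine Keep.setReg ?_ _ (by omega))
    · simp; omega

theorem Tr.main (hf : Fits E K) (hC : Holds E K c t)
    (hV : Valid E.n K.r K.M (fun _ => False) c) :
    Tr E Cmd.main t (fun l t' => Keep t t' ∧ ∃ c', c.Same c' ∧ Holds E K c' t' ∧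
      Valid E.n K.r K.M (fun _ => False) c' ∧ c'.W 0 = [] ∧
      l + 1000 * c'.pot E.n K.M ≤ 1000 * c.pot E.n K.M + 20) := by
  refine (Tr.wh (γ := Core) (Inv := fun c' t' => Keep t t' ∧ c.Same c' ∧ Holds E K c' t' ∧
      Valid E.n K.r K.M (fun _ => False) c') (Φ := fun c' => 1000 * c'.pot E.n K.M)
    (by decide) (by decide) ?_ (g := c) ⟨Keep.refl t, .refl c, hC, hV⟩).mono ?_
  · rintro c1 t1 ⟨hk, hs, hC1, hV1⟩ hlt
    simp only [Ex.eval_num, Ex.eval_ld] at hlt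
    have hW : c1.W 0 ≠ [] := fun he => by have := hC1.W.head_eq_zero.2 he; omega
    refine Tr.seq ((Tr.start hf hk hs hC1 hV1 hW).mono ?_)
    rintro l1 t2 ⟨hl1, c2, ⟨g, hA⟩, hp⟩
    refine (Tr.process hf hA).mono ?_
    rintro l2 t3 ⟨c3, hA3, hp3⟩
    have hg := hA.le
    have : (0 : Ex).cost + (Ex.ld 7 0).cost + 1 ≤ 20 := by decide
    exact ⟨c3, ⟨hA3.keep, hA3.same, hA3.holds, hA3.off rfl⟩, by omega⟩
  · rintro l t' ⟨c', ⟨hk, hs, hC', hV'⟩, hle, hp⟩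
    simp only [Ex.eval_num, Ex.eval_ld] at hle
    have : (0 : Ex).cost + (Ex.ld 7 0).cost + 1 ≤ 20 := by decide
    exact ⟨hk, c', hs, hC', hV', hC'.W.head_eq_zero.1 (by omega), by omega⟩

end

section

/-! ### Binary trees over the vertices of the parts -/

section Tree

variable {n h d : ℕ} {T : ℕ → ℕ} {w : ℕ → ℕ → ℕ}

/-- The vertices of the part of `u` in the dyadic interval of length `2 ^ d` around `u`. -/
def node (n : ℕ) (T : ℕ → ℕ) (d u : ℕ) : Finset ℕ :=
  (Finset.range n).filter fun x => T x = T u ∧ x / 2 ^ d = u / 2 ^ d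

theorem mem_node {u x : ℕ} : x ∈ node n T d u ↔ x < n ∧ T x = T u ∧ x / 2 ^ d = u / 2 ^ d := by
  simp [node]

theorem self_mem_node {u : ℕ} (hu : u < n) : u ∈ node n T d u := mem_node.2 ⟨hu, rfl, rfl⟩

theorem node_eq {u x : ℕ} (hx : x ∈ node n T d u) : node n T d x = node n T d u := by
  obtain ⟨-, h1, h2⟩ := mem_node.1 hx
  simp only [node, h1, h2]

/-- The least vertex of a node. -/
noncomputable def nmin (n : ℕ) (T : ℕ → ℕ) (d u : ℕ) : ℕ := sInf {x | x ∈ node n T d u}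

/-- The largest vertex of a node. -/
def nmax (n : ℕ) (T : ℕ → ℕ) (d u : ℕ) : ℕ := (node n T d u).sup id

/-- The least weight of an edge from a node to `v`. -/
noncomputable def wmin (n : ℕ) (T : ℕ → ℕ) (w : ℕ → ℕ → ℕ) (d u v : ℕ) : ℕ :=
  sInf {k | ∃ x ∈ node n T d u, k = w x v}

theorem nmin_mem {u : ℕ} (hu : u < n) : nmin n T d u ∈ node n T d u :=
  Nat.sInf_mem (s := {x | x ∈ node n T d u}) ⟨u, self_mem_node hu⟩

theorem nmin_le {u x : ℕ} (hx : x ∈ node n T d u) : nmin n T d u ≤ x := Nat.sInf_le hx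

theorem nmin_congr {u x : ℕ} (hx : x ∈ node n T d u) : nmin n T d x = nmin n T d u := by
  simp only [nmin, node_eq hx]

theorem nmin_nmin {u : ℕ} (hu : u < n) : nmin n T d (nmin n T d u) = nmin n T d u :=
  nmin_congr (nmin_mem hu)

theorem nmin_lt {u : ℕ} (hu : u < n) : nmin n T d u < n := (mem_node.1 (nmin_mem hu)).1

theorem nmax_mem {u : ℕ} (hu : u < n) : nmax n T d u ∈ node n T d u := by
  obtain ⟨x, hx, he⟩ := Finset.exists_mem_eq_sup (node n T d u) ⟨u, self_mem_node hu⟩ id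
  rw [nmax, he]; exact hx

theorem le_nmax {u x : ℕ} (hx : x ∈ node n T d u) : x ≤ nmax n T d u :=
  Finset.le_sup (f := id) hx

theorem wmin_mem {u : ℕ} (hu : u < n) (v : ℕ) : ∃ x ∈ node n T d u, wmin n T w d u v = w x v :=
  Nat.sInf_mem (s := {k | ∃ x ∈ node n T d u, k = w x v}) ⟨w u v, u, self_mem_node hu, rfl⟩

theorem wmin_le {u x : ℕ} (v : ℕ) (hx : x ∈ node n T d u) : wmin n T w d u v ≤ w x v :=
  Nat.sInf_le ⟨x, hx, rfl⟩

theorem wmin_congr {u x : ℕ} (v : ℕ) (hx : x ∈ node n T d u) :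
    wmin n T w d x v = wmin n T w d u v := by
  simp only [wmin, node_eq hx]

theorem node_zero {u : ℕ} (hu : u < n) : node n T 0 u = {u} := by
  ext x
  rw [mem_node, Finset.mem_singleton]
  simp only [pow_zero, Nat.div_one]
  constructor
  · exact fun h => h.2.2
  · rintro rfl; exact ⟨hu, rfl, rfl⟩

theorem nmin_zero {u : ℕ} (hu : u < n) : nmin n T 0 u = u := by
  have := nmin_mem (T := T) (d := 0) hu
  rwa [node_zero hu, Finset.mem_singleton] at this

theorem wmin_zero {u : ℕ} (hu : u < n) (v : ℕ) : wmin n T w 0 u v = w u v := by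
  obtain ⟨x, hx, he⟩ := wmin_mem (T := T) (w := w) (d := 0) hu v
  rw [node_zero hu, Finset.mem_singleton] at hx
  rw [he, hx]

theorem mem_node_root (hn : n ≤ 2 ^ h) {u x : ℕ} (hu : u < n) :
    x ∈ node n T h u ↔ x < n ∧ T x = T u := by
  rw [mem_node]
  constructor
  · exact fun h => ⟨h.1, h.2.1⟩
  · rintro ⟨h1, h2⟩
    exact ⟨h1, h2, by rw [Nat.div_eq_of_lt (by omega), Nat.div_eq_of_lt (by omega)]⟩

theorem node_mono {u : ℕ} : node n T d u ⊆ node n T (d + 1) u := by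
  intro x hx
  obtain ⟨h1, h2, h3⟩ := mem_node.1 hx
  refine mem_node.2 ⟨h1, h2, ?_⟩
  rw [pow_succ, ← Nat.div_div_eq_div_mul, ← Nat.div_div_eq_div_mul, h3]

/-- Nodes grow with the level, so a least vertex of a node represents its nodes on all lower levels;
its row of minima one level below is therefore valid. -/
theorem nmin_of_succ {u : ℕ} (hu : u < n) (he : nmin n T (d + 1) u = u) : nmin n T d u = u :=
  le_antisymm (nmin_le (self_mem_node hu))
    (he.symm.trans_le (nmin_le (node_mono (nmin_mem hu))))

/-- A node is the union of the nodes of its least and of its largest vertex one level below. -/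
theorem mem_node_succ {u x : ℕ} (hu : u < n) : x ∈ node n T (d + 1) u ↔
    x ∈ node n T d (nmin n T (d + 1) u) ∨ x ∈ node n T d (nmax n T (d + 1) u) := by
  have h1 := nmin_mem (T := T) (d := d + 1) hu
  have h2 := nmax_mem (T := T) (d := d + 1) hu
  constructor
  · intro hx
    have h3 := nmin_le hx
    have h4 := le_nmax hx
    rw [mem_node] at hx h1 h2
    rw [mem_node, mem_node]
    generalize nmin n T (d + 1) u = a at *
    generalize nmax n T (d + 1) u = b at *
    obtain ⟨hx1, hx2, hx3⟩ := hx
    obtain ⟨-, ha2, ha3⟩ := h1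
    obtain ⟨-, hb2, hb3⟩ := h2
    rw [pow_succ, ← Nat.div_div_eq_div_mul, ← Nat.div_div_eq_div_mul] at hx3 ha3 hb3
    -- A dyadic interval has two halves. The least vertex lies in the first nonempty half and the
    -- largest in the last one, so every vertex shares a half with one of them.
    have h5 := Nat.div_le_div_right (c := 2 ^ d) h3
    have h6 := Nat.div_le_div_right (c := 2 ^ d) h4
    simp only [hx1, hx2, ha2, hb2, true_and]
    omega
  · rintro (hx | hx)
    · rw [← node_eq h1]; exact node_mono hx
    · rw [← node_eq h2]; exact node_mono hx

theorem wmin_succ {u : ℕ} (hu : u < n) (v : ℕ) : wmin n T w (d + 1) u v =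
    min (wmin n T w d (nmin n T (d + 1) u) v) (wmin n T w d (nmax n T (d + 1) u) v) := by
  have h1 := nmin_lt (T := T) (d := d + 1) hu
  have h2 := (mem_node.1 (nmax_mem (T := T) (d := d + 1) hu)).1
  refine le_antisymm (le_min ?_ ?_) ?_
  · obtain ⟨x, hx, he⟩ := wmin_mem (T := T) (w := w) (d := d) h1 v
    rw [he]; exact wmin_le v ((mem_node_succ hu).2 (.inl hx))
  · obtain ⟨x, hx, he⟩ := wmin_mem (T := T) (w := w) (d := d) h2 v
    rw [he]; exact wmin_le v ((mem_node_succ hu).2 (.inr hx))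
  · obtain ⟨x, hx, he⟩ := wmin_mem (T := T) (w := w) (d := d + 1) hu v
    rw [he, min_le_iff]
    rcases (mem_node_succ hu).1 hx with hx | hx
    · exact .inl (wmin_le v hx)
    · exact .inr (wmin_le v hx)

/-- The arrays describe the trees at level `d`. -/
structure Level (n : ℕ) (T : ℕ → ℕ) (w : ℕ → ℕ → ℕ) (d : ℕ) (NM MX VAL : ℕ → ℕ) : Prop where
  nm : ∀ u < n, NM (d * n + u) = nmin n T d u + 1
  mx : d ≠ 0 → ∀ u < n, MX (d * n + u) = nmax n T d u
  val : ∀ u < n, nmin n T d u = u → ∀ v < n, VAL ((d * n + u) * n + v) = wmin n T w d u v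

theorem Level.congr {NM MX VAL NM' MX' VAL' : ℕ → ℕ} (h : Level n T w d NM MX VAL)
    (h1 : ∀ u < n, NM' (d * n + u) = NM (d * n + u))
    (h2 : ∀ u < n, MX' (d * n + u) = MX (d * n + u))
    (h3 : ∀ u < n, ∀ v < n, VAL' ((d * n + u) * n + v) = VAL ((d * n + u) * n + v)) :
    Level n T w d NM' MX' VAL' :=
  ⟨fun u hu => (h1 u hu).trans (h.nm u hu), fun hd u hu => (h2 u hu).trans (h.mx hd u hu),
    fun u hu hm v hv => (h3 u hu v hv).trans (h.val u hu hm v hv)⟩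

/-- The root values are the minima over the parts. -/
theorem Level.minSpec {P Z NM MX VAL : ℕ → ℕ} (hl : Level n T w h NM MX VAL) (hn : n ≤ 2 ^ h)
    (hlay : Layout n T P Z) :
    MinSpec n T w fun a v => VAL ((h * n + (NM (h * n + P a) - 1)) * n + v) := by
  intro a ha v hv
  have hZ := hlay.Z_pos ha
  have hTa := hlay.le a ha
  have hP : P (T a) < n := (hlay.pos (T a) (by omega)).1
  have hT : T (P (T a)) = T a := hlay.part_eq ha le_rfl (by omega)
  have he : VAL ((h * n + (NM (h * n + P (T a)) - 1)) * n + v) = wmin n T w h (P (T a)) v := by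
    rw [hl.nm _ hP, Nat.add_sub_cancel, hl.val _ (nmin_lt hP) (nmin_nmin hP) v hv]
    exact wmin_congr v (nmin_mem hP)
  dsimp only
  rw [he]
  refine ⟨fun u hu hTu => wmin_le v ((mem_node_root hn hP).2 ⟨hu, hTu.trans hT.symm⟩), ?_⟩
  obtain ⟨x, hx, hex⟩ := wmin_mem (T := T) (w := w) (d := h) hP v
  obtain ⟨h1, h2⟩ := (mem_node_root hn hP).1 hx
  exact ⟨x, h1, h2.trans hT, hex⟩

/-- The number of entries of `NM` that are not the least vertices of their nodes. -/
def stale (n h : ℕ) (NM : ℕ → ℕ) : ℕ :=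
  ((Finset.range ((h + 1) * n)).filter fun j => NM j ≠ j % n + 1).card

/-- A vertex that is least in its node stays least when nodes shrink. So this count never grows, and
each recomputation can be charged to a decrease of it. -/
theorem stale_update_le {NM : ℕ → ℕ} {j x : ℕ} (hx : NM j = j % n + 1 → x = j % n + 1) :
    stale n h (Function.update NM j x) ≤ stale n h NM := by
  refine Finset.card_le_card fun i hi => ?_
  simp only [Finset.mem_filter, Function.update_apply] at hi ⊢
  refine ⟨hi.1, fun he => hi.2 ?_⟩
  split_ifs with hij
  · subst hij; exact hx he
  · exact he

theorem stale_update_lt {NM : ℕ → ℕ} {j x : ℕ} (hj : j < (h + 1) * n) (h0 : NM j ≠ j % n + 1)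
    (hx : x = j % n + 1) : stale n h (Function.update NM j x) + 1 ≤ stale n h NM := by
  refine Finset.card_lt_card (Finset.ssubset_iff_of_subset ?_ |>.2 ⟨j, ?_, ?_⟩)
  · intro i hi
    simp only [Finset.mem_filter, Function.update_apply] at hi ⊢
    refine ⟨hi.1, fun he => hi.2 ?_⟩
    split_ifs with hij
    · subst hij; exact absurd he h0
    · exact he
  · simp [hj, h0]
  · simp [hx]

theorem stale_le (n h : ℕ) (NM : ℕ → ℕ) : stale n h NM ≤ (h + 1) * n :=
  (Finset.card_filter_le _ _).trans (by simp)

end Tree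

namespace Cmd

/-- The minima over the node of the vertex in register 20, from those of its children. -/
def recompute : Cmd :=
  .set 21 (.ld 9 ((.r 17 - 1) * .r 0 + .ld 14 (.r 17 * .r 0 + .r 20)) - 1) ;; .set 22 0 ;;
  .for 22 0
    (.set 23 (.ld 10 (((.r 17 - 1) * .r 0 + .r 20) * .r 0 + .r 22)) ;;
      .set 24 (.ld 10 (((.r 17 - 1) * .r 0 + .r 21) * .r 0 + .r 22)) ;;
      .ite (.r 23) (.r 24) (.put 10 ((.r 17 * .r 0 + .r 20) * .r 0 + .r 22) (.r 23))
        (.put 10 ((.r 17 * .r 0 + .r 20) * .r 0 + .r 22) (.r 24)))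

/-- The new values of `nmin` and `nmax` for the vertex in register 19, and the minima over the nodes
that arise if it is the new least vertex of its node. -/
def renew : Cmd :=
  (.set 25 (.r 19 / .r 18 * .r 0 + .ld 0 (.r 19)) ;; .set 26 (.ld 12 (.r 25)) ;;
    .set 27 (.ld 9 (.r 17 * .r 0 + .r 19)) ;;
    .put 9 (.r 17 * .r 0 + .r 19) (.r 26 + 1) ;;
    .put 14 (.r 17 * .r 0 + .r 19) (.ld 13 (.r 25))) ;;
  .ite (.r 26) (.r 19) .skip
    (.ite (.r 27) (.r 19 + 1)
      (.set 20 (.r 19) ;; recompute ;; .set 20 (.r 27 - 1) ;; recompute) .skip)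

/-- The level in register 17 of the trees. -/
def level : Cmd :=
  .set 18 (.r 18 + .r 18) ;; .set 19 0 ;;
  .for 19 0 (.set 20 (.r 0 - 1 - .r 19) ;;
    .put 12 (.r 20 / .r 18 * .r 0 + .ld 0 (.r 20)) (.r 20)) ;;
  .set 19 0 ;; .for 19 0 (.put 13 (.r 19 / .r 18 * .r 0 + .ld 0 (.r 19)) (.r 19)) ;;
  .set 19 0 ;; .for 19 0 renew

/-- The trees after the partition has been refined. -/
def rebuild : Cmd := .set 16 (.r 3 + 1) ;; .set 17 1 ;; .set 18 1 ;; .for 17 16 level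

/-- The trees after the weight of the edge from register 10 to register 11 has changed. -/
def repath : Cmd :=
  .set 16 (.r 3 + 1) ;; .set 17 1 ;;
  .for 17 16 (.set 20 (.ld 9 (.r 17 * .r 0 + .r 10) - 1) ;;
    .set 21 (.ld 9 ((.r 17 - 1) * .r 0 + .ld 14 (.r 17 * .r 0 + .r 20)) - 1) ;;
    .set 23 (.ld 10 (((.r 17 - 1) * .r 0 + .r 20) * .r 0 + .r 11)) ;;
    .set 24 (.ld 10 (((.r 17 - 1) * .r 0 + .r 21) * .r 0 + .r 11)) ;;
    .ite (.r 23) (.r 24) (.put 10 ((.r 17 * .r 0 + .r 20) * .r 0 + .r 11) (.r 23))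
      (.put 10 ((.r 17 * .r 0 + .r 20) * .r 0 + .r 11) (.r 24)))

end Cmd

end

/-! ### The minima over one tree node -/

section

variable {E : Env} {t : St} {T : ℕ → ℕ} {w : ℕ → ℕ → ℕ} {d h : ℕ}

theorem Frame.setReg {A : List ℕ} {t t' : St} (h : Frame A t t') {x : ℕ} (v : ℕ) (hx : 16 ≤ x) :
    Frame A t (t'.setReg x v) :=
  ⟨h.out, fun y hy => by rw [St.setReg_reg, if_neg (by omega)]; exact h.reg y hy, h.arr⟩

theorem Frame.setArr {A : List ℕ} {t t' : St} (h : Frame A t t') {a : ℕ} (i v : ℕ) (ha : a ∈ A) :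
    Frame A t (t'.setArr a i v) :=
  ⟨h.out, h.reg, fun b hb => by
    rw [St.setArr_arr, if_neg (by rintro rfl; exact hb ha)]; exact h.arr b hb⟩

/-- Only the registers in `X` have changed. -/
def Regs (X : List ℕ) (t t' : St) : Prop := ∀ y, y ∉ X → t'.reg y = t.reg y

theorem Regs.refl (X : List ℕ) (t : St) : Regs X t t := fun _ _ => rfl

theorem Regs.trans {X : List ℕ} {t t' t'' : St} (h : Regs X t t') (h' : Regs X t' t'') :
    Regs X t t'' := fun y hy => (h' y hy).trans (h y hy)

theorem Regs.mono {X X' : List ℕ} {t t' : St} (h : Regs X t t') (hX : X ⊆ X') : Regs X' t t' :=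
  fun y hy => h y fun h' => hy (hX h')

theorem Regs.setReg {X : List ℕ} {t t' : St} (h : Regs X t t') {x : ℕ} (v : ℕ) (hx : x ∈ X) :
    Regs X t (t'.setReg x v) := fun y hy => by
  rw [St.setReg_reg, if_neg (by rintro rfl; exact hy hx)]; exact h y hy

/-- Only the row of `x` on level d + 1 is written while rows on level d are read, so the loop does
not disturb its own sources. The first child is represented by `x` itself, by `nmin_of_succ`. -/
theorem Tr.recompute {x : ℕ} (hx : x < E.n) (h17 : t.reg 17 = d + 1) (h20 : t.reg 20 = x)
    (hlev : Level E.n T w d (t.arr 9) (t.arr 14) (t.arr 10))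
    (hmax : t.arr 14 ((d + 1) * E.n + x) = nmax E.n T (d + 1) x)
    (hmin : nmin E.n T (d + 1) x = x) :
    Tr E Cmd.recompute t (fun l t' => l ≤ E.n * 170 + 70 ∧ Frame [10] t t' ∧
      Regs [21, 22, 23, 24] t t' ∧
      (∀ v < E.n, t'.arr 10 (((d + 1) * E.n + x) * E.n + v) = wmin E.n T w (d + 1) x v) ∧
      (∀ j, (∀ v < E.n, j ≠ ((d + 1) * E.n + x) * E.n + v) → t'.arr 10 j = t.arr 10 j)) := by
  refine Tr.bounded fun hrb hab h0 => ?_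
  have hnV : E.n < E.V := h0 ▸ hrb 0 (by omega)
  obtain ⟨hb, -⟩ := mem_node.1 (nmax_mem (T := T) (d := d + 1) hx)
  set b := nmin E.n T d (nmax E.n T (d + 1) x) with hb_def
  have hbn : b < E.n := nmin_lt hb
  have hb9 : t.arr 9 (d * E.n + nmax E.n T (d + 1) x) = b + 1 := hlev.nm _ hb
  have hxd := nmin_of_succ hx hmin
  refine Tr.seq ((Tr.of_wp (Q := fun t' => t' = t.setReg 21 b) (by decide) ?_).mono ?_)
  · simp [Cmd.wp, h17, h20, h0, hmax, hb9]; omega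
  rintro l1 t1 ⟨hl1, rfl⟩
  refine Tr.seq ((Tr.of_wp (Q := fun t' => t' = (t.setReg 21 b).setReg 22 0) (by decide) ?_).mono ?_)
  · simp [Cmd.wp]
  rintro l2 t2 ⟨hl2, rfl⟩
  refine (Tr.for (I := fun i t' => Frame [10] t t' ∧ t'.reg 21 = b ∧
      Regs [21, 22, 23, 24] t t' ∧
      (∀ v < i, t'.arr 10 (((d + 1) * E.n + x) * E.n + v) = wmin E.n T w (d + 1) x v) ∧
      (∀ j, (∀ v < i, j ≠ ((d + 1) * E.n + x) * E.n + v) → t'.arr 10 j = t.arr 10 j))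
    (Ψ := fun _ => 0) (c := 150) (N := E.n) (by omega) (by omega) (by omega) (by omega) hnV
    ?_ ?_ (fun _ _ => rfl) ?_ (by simp) (by simp [h0])).mono ?_
  · rintro i hi t1 ⟨hfr, g21, hreg, hdone, hoth⟩ g22 g0
    have g17 : t1.reg 17 = d + 1 := (hreg 17 (by simp)).trans h17
    have g20 : t1.reg 20 = x := (hreg 20 (by simp)).trans h20
    have hlow : ∀ a < E.n, t1.arr 10 ((d * E.n + a) * E.n + i) =
        t.arr 10 ((d * E.n + a) * E.n + i) := by
      intro a ha
      refine hoth _ fun v hv he => ?_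
      have h1 := (index_inj hi (by omega) he).1
      have h2 := (index_inj ha hx h1).1
      omega
    have e1 : t1.arr 10 ((d * E.n + x) * E.n + i) = wmin E.n T w d x i := by
      rw [hlow x hx]; exact hlev.val x hx hxd i hi
    have e2 : t1.arr 10 ((d * E.n + b) * E.n + i) = wmin E.n T w d (nmax E.n T (d + 1) x) i := by
      rw [hlow b hbn, hlev.val b hbn (nmin_nmin hb) i hi]
      exact wmin_congr i (nmin_mem hb)
    have e3 := wmin_succ (T := T) (w := w) (d := d) hx i
    rw [hmin] at e3
    refine (Tr.of_wp (Q := fun t' => (Frame [10] t t' ∧ t'.reg 21 = b ∧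
      Regs [21, 22, 23, 24] t t' ∧
      (∀ v < i + 1, t'.arr 10 (((d + 1) * E.n + x) * E.n + v) = wmin E.n T w (d + 1) x v) ∧
      (∀ j, (∀ v < i + 1, j ≠ ((d + 1) * E.n + x) * E.n + v) → t'.arr 10 j = t.arr 10 j)) ∧
      t'.reg 22 = i ∧ t'.reg 0 = E.n) (by decide) ?_).mono
      fun l t' ⟨h2, h3⟩ => ⟨h3.1, h3.2.1, h3.2.2, h2.trans (by decide)⟩
    set t2 := (t1.setReg 23 (wmin E.n T w d x i)).setReg 24
      (wmin E.n T w d (nmax E.n T (d + 1) x) i) with ht2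
    have key : (Frame [10] t (t2.setArr 10 (((d + 1) * E.n + x) * E.n + i)
          (wmin E.n T w (d + 1) x i)) ∧
        (t2.setArr 10 (((d + 1) * E.n + x) * E.n + i) (wmin E.n T w (d + 1) x i)).reg 21 = b ∧
        Regs [21, 22, 23, 24] t (t2.setArr 10 (((d + 1) * E.n + x) * E.n + i)
          (wmin E.n T w (d + 1) x i)) ∧
        (∀ v < i + 1, (t2.setArr 10 (((d + 1) * E.n + x) * E.n + i)
          (wmin E.n T w (d + 1) x i)).arr 10
          (((d + 1) * E.n + x) * E.n + v) = wmin E.n T w (d + 1) x v) ∧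
        (∀ j, (∀ v < i + 1, j ≠ ((d + 1) * E.n + x) * E.n + v) →
          (t2.setArr 10 (((d + 1) * E.n + x) * E.n + i)
          (wmin E.n T w (d + 1) x i)).arr 10 j = t.arr 10 j)) ∧
        (t2.setArr 10 (((d + 1) * E.n + x) * E.n + i) (wmin E.n T w (d + 1) x i)).reg 22 = i ∧
        (t2.setArr 10 (((d + 1) * E.n + x) * E.n + i) (wmin E.n T w (d + 1) x i)).reg 0 = E.n := by
      refine ⟨⟨((hfr.setReg _ (by omega)).setReg _ (by omega)).setArr _ _ (by simp), by simp [ht2, g21],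
        (hreg.setReg _ (by simp)).setReg _ (by simp), fun v hv => ?_, fun j hj => ?_⟩,
        by simp [ht2, g22], by simp [ht2, g0]⟩
      · rw [St.setArr_arr, if_pos rfl]
        by_cases hvi : v = i
        · rw [hvi, Function.update_self]
        · rw [Function.update_of_ne (by omega)]; exact hdone v (by omega)
      · rw [St.setArr_arr, if_pos rfl, Function.update_of_ne (hj i (by omega))]
        exact hoth j fun v hv => hj v (by omega)
    generalize hQ : (fun t' => (Frame [10] t t' ∧ t'.reg 21 = b ∧ Regs [21, 22, 23, 24] t t' ∧
      (∀ v < i + 1, t'.arr 10 (((d + 1) * E.n + x) * E.n + v) = wmin E.n T w (d + 1) x v) ∧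
      (∀ j, (∀ v < i + 1, j ≠ ((d + 1) * E.n + x) * E.n + v) → t'.arr 10 j = t.arr 10 j)) ∧
      t'.reg 22 = i ∧ t'.reg 0 = E.n) = Q
    have key : Q (t2.setArr 10 (((d + 1) * E.n + x) * E.n + i) (wmin E.n T w (d + 1) x i)) := by
      rw [← hQ]; exact key
    simp [Cmd.wp, g17, g20, g21, g22, g0, e1, e2]
    refine ⟨fun hlt => ?_, fun hge => ?_⟩
    · rwa [e3, min_eq_left hlt.le] at key
    · rwa [e3, min_eq_right hge] at key
  · rintro i t1 ⟨hfr, g21, hreg, hdone, hoth⟩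
    exact ⟨hfr.setReg _ (by omega), by simpa using g21, hreg.setReg _ (by simp), hdone, hoth⟩
  · exact ⟨((Frame.refl _ t).setReg _ (by omega)).setReg _ (by omega), by simp,
      ((Regs.refl _ t).setReg _ (by simp)).setReg _ (by simp), by simp, fun _ _ => rfl⟩
  · rintro l t' ⟨⟨hfr, -, hreg, hdone, hoth⟩, -, -, hl⟩
    have h1 : l1 ≤ 50 := hl1.trans (by decide)
    have h2 : l2 ≤ 10 := hl2.trans (by decide)
    simp at hl
    exact ⟨by omega, hfr, hreg, hdone, hoth⟩

end

/-! ### Extreme vertices of the nodes of a level -/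

section

variable {E : Env} {t : St} {T : ℕ → ℕ} {w : ℕ → ℕ → ℕ} {n d h : ℕ}

/-- The pair of dyadic interval and part, written as a number in base n, identifies the node; this
replaces hashing by a bucket array. -/
theorem key_eq_iff (hT : ∀ u < n, T u < n) {u x : ℕ} (hu : u < n) (hx : x < n) :
    x / 2 ^ d * n + T x = u / 2 ^ d * n + T u ↔ x ∈ node n T d u := by
  rw [mem_node]
  constructor
  · intro he
    obtain ⟨h1, h2⟩ := index_inj (hT x hx) (hT u hu) he
    exact ⟨hx, h2, h1⟩
  · rintro ⟨-, h1, h2⟩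
    rw [h1, h2]

theorem key_lt (hT : ∀ u < n, T u < n) {u : ℕ} (hu : u < n) (d : ℕ) :
    u / 2 ^ d * n + T u < n * n + n := by
  have h1 : u / 2 ^ d ≤ n := (Nat.div_le_self _ _).trans hu.le
  have h2 := Nat.mul_le_mul_right n h1
  have h3 := hT u hu
  omega

/-- The vertices are visited in decreasing order, so the last one written into a bucket is the
least. Old contents of the buckets do not matter, as every bucket that is read has been written. -/
theorem Tr.firsts (hT : ∀ u < E.n, T u < E.n) (hb : E.n * E.n + E.n < E.V) (h0 : t.arr 0 = T)
    (h18 : t.reg 18 = 2 ^ d) (h19 : t.reg 19 = 0) :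
    Tr E (.for 19 0 (.set 20 (.r 0 - 1 - .r 19) ;;
      .put 12 (.r 20 / .r 18 * .r 0 + .ld 0 (.r 20)) (.r 20))) t
      (fun l t' => l ≤ E.n * 80 + 5 ∧ Frame [12] t t' ∧ Regs [19, 20] t t' ∧
        ∀ u < E.n, t'.arr 12 (u / 2 ^ d * E.n + T u) = nmin E.n T d u) := by
  refine Tr.bounded fun hrb hab hr0 => ?_
  have hnV : E.n < E.V := hr0 ▸ hrb 0 (by omega)
  refine (Tr.for (I := fun i t' => Frame [12] t t' ∧ Regs [19, 20] t t' ∧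
      ∀ u < E.n, E.n - i ≤ u → t'.arr 12 (u / 2 ^ d * E.n + T u) ∈ node E.n T d u ∧
        ∀ x ∈ node E.n T d u, E.n - i ≤ x → t'.arr 12 (u / 2 ^ d * E.n + T u) ≤ x)
    (Ψ := fun _ => 0) (c := 64) (N := E.n) (by omega) (by omega) (by omega) (by omega) hnV
    ?_ ?_ (fun _ _ => rfl) ?_ (by omega) (by simp [hr0])).mono ?_
  · rintro i hi t1 ⟨hfr, hreg, hF⟩ g19 g0
    have g18 : t1.reg 18 = 2 ^ d := (hreg 18 (by simp)).trans h18
    have ga : t1.arr 0 = T := (hfr.arr 0 (by simp)).trans h0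
    set u0 := E.n - 1 - i with hu0
    refine (Tr.of_wp (Q := fun t' => t' = (t1.setReg 20 u0).setArr 12
      (u0 / 2 ^ d * E.n + T u0) u0) (by decide) ?_).mono ?_
    · simp [Cmd.wp, g18, g19, g0, ga, ← hu0]; omega
    rintro l t' ⟨hl, rfl⟩
    refine ⟨⟨(hfr.setReg _ (by omega)).setArr _ _ (by simp), hreg.setReg _ (by simp), ?_⟩,
      by simp [g19], by simp [g0], hl.trans (by decide)⟩
    intro u hu hui
    have hu0n : u0 < E.n := by omega
    simp only [St.setArr_arr, if_true, St.setReg_arr, Function.update_apply,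
      key_eq_iff hT hu0n hu]
    split_ifs with hmem
    · refine ⟨?_, fun x _ hx => by omega⟩
      rw [node_eq hmem]; exact self_mem_node hu0n
    · have huu : u ≠ u0 := by rintro rfl; exact hmem (self_mem_node hu)
      obtain ⟨h1, h2⟩ := hF u hu (by omega)
      refine ⟨h1, fun x hx hxi => h2 x hx ?_⟩
      have : x ≠ u0 := by
        rintro rfl
        exact hmem (by rw [node_eq hx]; exact self_mem_node hu)
      omega
  · rintro i t1 ⟨hfr, hreg, hF⟩
    exact ⟨hfr.setReg _ (by omega), hreg.setReg _ (by simp), hF⟩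
  · rw [h19]
    exact ⟨Frame.refl _ _, Regs.refl _ _, fun u hu hui => by omega⟩
  · rintro l t' ⟨⟨hfr, hreg, hF⟩, -, -, hl⟩
    rw [h19] at hl
    refine ⟨by simpa using hl, hfr, hreg, fun u hu => ?_⟩
    obtain ⟨h1, h2⟩ := hF u hu (by omega)
    exact le_antisymm (h2 _ (nmin_mem hu) (by omega)) (nmin_le h1)

theorem Tr.lasts (hT : ∀ u < E.n, T u < E.n) (h0 : t.arr 0 = T)
    (h18 : t.reg 18 = 2 ^ d) (h19 : t.reg 19 = 0) :
    Tr E (.for 19 0 (.put 13 (.r 19 / .r 18 * .r 0 + .ld 0 (.r 19)) (.r 19))) t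
      (fun l t' => l ≤ E.n * 80 + 5 ∧ Frame [13] t t' ∧ Regs [19] t t' ∧
        ∀ u < E.n, t'.arr 13 (u / 2 ^ d * E.n + T u) = nmax E.n T d u) := by
  refine Tr.bounded fun hrb hab hr0 => ?_
  have hnV : E.n < E.V := hr0 ▸ hrb 0 (by omega)
  refine (Tr.for (I := fun i t' => Frame [13] t t' ∧ Regs [19] t t' ∧
      ∀ u < E.n, u < i → t'.arr 13 (u / 2 ^ d * E.n + T u) ∈ node E.n T d u ∧
        ∀ x ∈ node E.n T d u, x < i → x ≤ t'.arr 13 (u / 2 ^ d * E.n + T u))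
    (Ψ := fun _ => 0) (c := 64) (N := E.n) (by omega) (by omega) (by omega) (by omega) hnV
    ?_ ?_ (fun _ _ => rfl) ?_ (by omega) (by simp [hr0])).mono ?_
  · rintro i hi t1 ⟨hfr, hreg, hF⟩ g19 g0
    have g18 : t1.reg 18 = 2 ^ d := (hreg 18 (by simp)).trans h18
    have ga : t1.arr 0 = T := (hfr.arr 0 (by simp)).trans h0
    refine (Tr.of_wp (Q := fun t' => t' = t1.setArr 13 (i / 2 ^ d * E.n + T i) i)
      (by decide) ?_).mono ?_
    · simp [Cmd.wp, g18, g19, g0, ga]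
    rintro l t' ⟨hl, rfl⟩
    refine ⟨⟨hfr.setArr _ _ (by simp), hreg, ?_⟩, by simp [g19], by simp [g0],
      hl.trans (by decide)⟩
    intro u hu hui
    simp only [St.setArr_arr, if_true, Function.update_apply, key_eq_iff hT hi hu]
    split_ifs with hmem
    · refine ⟨?_, fun x _ hx => by omega⟩
      rw [node_eq hmem]; exact self_mem_node hi
    · have huu : u ≠ i := by rintro rfl; exact hmem (self_mem_node hu)
      obtain ⟨h1, h2⟩ := hF u hu (by omega)
      refine ⟨h1, fun x hx hxi => h2 x hx ?_⟩
      have : x ≠ i := by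
        rintro rfl
        exact hmem (by rw [node_eq hx]; exact self_mem_node hu)
      omega
  · rintro i t1 ⟨hfr, hreg, hF⟩
    exact ⟨hfr.setReg _ (by omega), hreg.setReg _ (by simp), hF⟩
  · rw [h19]
    exact ⟨Frame.refl _ _, Regs.refl _ _, fun u hu hui => by omega⟩
  · rintro l t' ⟨⟨hfr, hreg, hF⟩, -, -, hl⟩
    rw [h19] at hl
    refine ⟨by simpa using hl, hfr, hreg, fun u hu => ?_⟩
    obtain ⟨h1, h2⟩ := hF u hu hu
    exact le_antisymm (le_nmax h1) (h2 _ (nmax_mem hu) (mem_node.1 (nmax_mem hu)).1)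

/-- The arrays at level `d` describe the trees of a coarser partition, or none. -/
structure Outdated (n : ℕ) (T : ℕ → ℕ) (w : ℕ → ℕ → ℕ) (d : ℕ) (NM VAL : ℕ → ℕ) : Prop where
  le : ∀ u < n, NM (d * n + u) ≤ u + 1
  old : ∀ u < n, nmin n T d (NM (d * n + u) - 1) = NM (d * n + u) - 1
  val : ∀ a < n, nmin n T d a = a →
    (∀ v < n, VAL ((d * n + a) * n + v) = wmin n T w d a v) ∨ NM (d * n + a) ≠ a + 1 ∨
    ∃ u < n, nmin n T d u = u ∧ NM (d * n + u) ≠ u + 1 ∧ NM (d * n + u) - 1 = a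

theorem Outdated.congr {NM VAL NM' VAL' : ℕ → ℕ} (h : Outdated n T w d NM VAL)
    (h1 : ∀ u < n, NM' (d * n + u) = NM (d * n + u))
    (h3 : ∀ u < n, ∀ v < n, VAL' ((d * n + u) * n + v) = VAL ((d * n + u) * n + v)) :
    Outdated n T w d NM' VAL' := by
  refine ⟨fun u hu => h1 u hu ▸ h.le u hu, fun u hu => h1 u hu ▸ h.old u hu, fun a ha hm => ?_⟩
  rcases h.val a ha hm with h4 | h4 | ⟨u, hu, h5, h6, h7⟩
  · exact .inl fun v hv => (h3 a ha v hv).trans (h4 v hv)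
  · exact .inr (.inl (h1 a ha ▸ h4))
  · exact .inr (.inr ⟨u, hu, h5, h1 u hu ▸ h6, h1 u hu ▸ h7⟩)

/-- The state `t'` while the level `d + 1` is being computed, up to the vertex `i`; it was `t` in
the beginning. -/
structure Renewed (n : ℕ) (T : ℕ → ℕ) (w : ℕ → ℕ → ℕ) (d : ℕ) (t : St) (i : ℕ) (t' : St) :
    Prop where
  frame : Frame [9, 10, 14] t t'
  regs : Regs [19, 20, 21, 22, 23, 24, 25, 26, 27] t t'
  nm : ∀ u < i, t'.arr 9 ((d + 1) * n + u) = nmin n T (d + 1) u + 1 ∧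
    t'.arr 14 ((d + 1) * n + u) = nmax n T (d + 1) u
  other : ∀ j, (∀ u < i, j ≠ (d + 1) * n + u) → t'.arr 9 j = t.arr 9 j ∧ t'.arr 14 j = t.arr 14 j
  val : ∀ a < n, nmin n T (d + 1) a = a →
    (∀ v < n, t'.arr 10 (((d + 1) * n + a) * n + v) = wmin n T w (d + 1) a v) ∨
    i ≤ a ∧ t.arr 9 ((d + 1) * n + a) ≠ a + 1 ∨
    ∃ u < n, i ≤ u ∧ nmin n T (d + 1) u = u ∧ t.arr 9 ((d + 1) * n + u) ≠ u + 1 ∧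
      t.arr 9 ((d + 1) * n + u) - 1 = a
  vother : ∀ j, (∀ u < n, ∀ v < n, j ≠ ((d + 1) * n + u) * n + v) → t'.arr 10 j = t.arr 10 j

end

/-! ### Renewing the tree entry of one vertex -/

section

variable {E : Env} {t : St} {T : ℕ → ℕ} {w : ℕ → ℕ → ℕ} {n d h : ℕ}

/-- The price of an entry of the trees. -/
def price (n : ℕ) : ℕ := 400 * n + 400

/-- If `i` newly becomes least in its node, two rows can be wrong: its own, and that of its former
representative, whose node has lost `i`. Both are recomputed, and the decrease of `stale` pays for
them. In all other cases a constant number of steps suffices. -/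
theorem Tr.renew {t₀ : St} {i : ℕ} (hr : Renewed E.n T w d t₀ i t) (hi : i < E.n)
    (hT : ∀ u < E.n, T u < E.n) (hb : E.n * E.n + E.n < E.V) (hd : d + 1 ≤ h)
    (h17 : t₀.reg 17 = d + 1) (h18 : t₀.reg 18 = 2 ^ (d + 1)) (hr0 : t₀.reg 0 = E.n)
    (h0 : t₀.arr 0 = T) (h19 : t.reg 19 = i)
    (hF : ∀ u < E.n, t₀.arr 12 (u / 2 ^ (d + 1) * E.n + T u) = nmin E.n T (d + 1) u)
    (hG : ∀ u < E.n, t₀.arr 13 (u / 2 ^ (d + 1) * E.n + T u) = nmax E.n T (d + 1) u)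
    (hl : Level E.n T w d (t₀.arr 9) (t₀.arr 14) (t₀.arr 10))
    (ho : Outdated E.n T w (d + 1) (t₀.arr 9) (t₀.arr 10)) :
    Tr E Cmd.renew t (fun l t' => Renewed E.n T w d t₀ (i + 1) t' ∧ t'.reg 19 = i ∧
      l + price E.n * stale E.n h (t'.arr 9) ≤ 200 + price E.n * stale E.n h (t.arr 9)) := by
  have g17 := (hr.regs 17 (by simp)).trans h17
  have g18 := (hr.regs 18 (by simp)).trans h18
  have g0 := (hr.regs 0 (by simp)).trans hr0
  have ga := (hr.frame.arr 0 (by simp)).trans h0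
  have gF := (congrFun (hr.frame.arr 12 (by simp)) _).trans (hF i hi)
  have gG := (congrFun (hr.frame.arr 13 (by simp)) _).trans (hG i hi)
  have hk := key_lt hT hi (d + 1)
  have hmi := nmin_le (self_mem_node (T := T) (d := d + 1) hi)
  have hold : t.arr 9 ((d + 1) * E.n + i) = t₀.arr 9 ((d + 1) * E.n + i) :=
    (hr.other _ fun u hu he => by omega).1
  set m := nmin E.n T (d + 1) i with hm
  set old := t₀.arr 9 ((d + 1) * E.n + i) with hold_def
  have hle : old ≤ i + 1 := ho.le i hi
  have hmod : ((d + 1) * E.n + i) % E.n = i := by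
    rw [mul_comm, Nat.mul_add_mod, Nat.mod_eq_of_lt hi]
  have hjlt : (d + 1) * E.n + i < (h + 1) * E.n := by
    have := Nat.mul_le_mul_right E.n (by omega : d + 2 ≤ h + 1)
    have e : (d + 2) * E.n = (d + 1) * E.n + E.n := by ring
    omega
  let t1 : St := ((((t.setReg 25 (i / 2 ^ (d + 1) * E.n + T i)).setReg 26 m).setReg 27 old).setArr
    9 ((d + 1) * E.n + i) (m + 1)).setArr 14 ((d + 1) * E.n + i) (nmax E.n T (d + 1) i)
  refine Tr.seq ((Tr.of_wp (Q := fun t' => t' = t1) (by decide) ?_).mono ?_)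
  · have hpos : i / 2 ^ (d + 1) * E.n + T i < E.V := by omega
    simp [Cmd.wp, g17, g18, g0, ga, h19, gF, gG, hold, hpos, t1]
    omega
  rintro l1 t' ⟨hl1, rfl⟩
  have hl1' : l1 ≤ 130 := hl1.trans (by decide)
  have hnm : ∀ u < i + 1, t1.arr 9 ((d + 1) * E.n + u) = nmin E.n T (d + 1) u + 1 ∧
      t1.arr 14 ((d + 1) * E.n + u) = nmax E.n T (d + 1) u := by
    intro u hu
    by_cases hui : u = i
    · subst hui; simp [t1, hm]
    · simpa [t1, hui] using hr.nm u (by omega)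
  have hother : ∀ j, (∀ u < i + 1, j ≠ (d + 1) * E.n + u) →
      t1.arr 9 j = t₀.arr 9 j ∧ t1.arr 14 j = t₀.arr 14 j := by
    intro j hj
    have := hj i (by omega)
    simpa [t1, this] using hr.other j fun u hu => hj u (by omega)
  have hfr1 : Frame [9, 10, 14] t₀ t1 :=
    (((((hr.frame.setReg _ (by omega)).setReg _ (by omega)).setReg _ (by omega)).setArr _ _
      (by simp)).setArr _ _ (by simp))
  have hrg1 : Regs [19, 20, 21, 22, 23, 24, 25, 26, 27] t₀ t1 :=
    (((hr.regs.setReg _ (by simp)).setReg _ (by simp)).setReg _ (by simp))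
  have h9 : t1.arr 9 = Function.update (t.arr 9) ((d + 1) * E.n + i) (m + 1) := by simp [t1]
  have h10 : t1.arr 10 = t.arr 10 := by simp [t1]
  -- If `i` represented its old node, it represents its new one, by the field `old`.
  have hst : stale E.n h (t1.arr 9) ≤ stale E.n h (t.arr 9) := by
    rw [h9]
    refine stale_update_le fun he => ?_
    rw [hmod, hold] at *
    have := ho.old i hi
    rw [← hold_def, he, Nat.add_sub_cancel] at this
    omega
  have hst' := Nat.mul_le_mul_left (price E.n) hst
  have hc1 : (Ex.r 26).cost + ((Ex.r 19).cost + 1) = 5 := rfl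
  have g19 : t1.reg 19 = i := by simp [t1, h19]
  have g26 : t1.reg 26 = m := by simp [t1]
  have g27 : t1.reg 27 = old := by simp [t1]
  have hskip : (m ≠ i ∨ old = i + 1) → Renewed E.n T w d t₀ (i + 1) t1 := by
    intro hcase
    refine ⟨hfr1, hrg1, hnm, hother, fun a ha hma => ?_, by rw [h10]; exact hr.vother⟩
    rw [h10]
    rcases hr.val a ha hma with h1 | ⟨h1, h2⟩ | ⟨u, hu, h1, h2, h3, h4⟩
    · exact .inl h1
    · have : a ≠ i := by
        rintro rfl
        rcases hcase with h | h
        · exact h hma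
        · exact h2 h
      exact .inr (.inl ⟨by omega, h2⟩)
    · have : u ≠ i := by
        rintro rfl
        rcases hcase with h | h
        · exact h h2
        · exact h3 h
      exact .inr (.inr ⟨u, hu, by omega, h2, h3, h4⟩)
  refine Tr.ite (by decide) (by decide) (fun hlt => ?_) fun hge => ?_
  · rw [Ex.eval_r, Ex.eval_r, g26, g19] at hlt
    refine (Tr.of_wp (p := .skip) (Q := fun t' => t' = t1) rfl rfl).mono ?_
    rintro l2 t' ⟨hl2, rfl⟩
    have hl2' : l2 ≤ 1 := hl2
    exact ⟨hskip (.inl (by omega)), g19, by omega⟩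
  rw [Ex.eval_r, Ex.eval_r, g26, g19] at hge
  have hmi' : m = i := by omega
  have hc2 : (Ex.r 27).cost + ((Ex.r 19 + 1).cost + 1) = 7 := rfl
  refine Tr.ite (by decide) (by decide) (fun hlt => ?_) fun hge2 => ?_
  · rw [Ex.eval_r, Ex.eval_add, Ex.eval_r, Ex.eval_num, g27, g19] at hlt
    have hst2 : stale E.n h (t1.arr 9) + 1 ≤ stale E.n h (t.arr 9) := by
      rw [h9]
      exact stale_update_lt hjlt (by rw [hmod, hold]; omega) (by rw [hmod, hmi'])
    have hst3 := Nat.mul_le_mul_left (price E.n) hst2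
    rw [mul_add, mul_one] at hst3
    have hlev : Level E.n T w d (t1.arr 9) (t1.arr 14) (t1.arr 10) := by
      have key : ∀ u < E.n, ∀ u' < i + 1, d * E.n + u ≠ (d + 1) * E.n + u' := by
        intro u hu u' hu' he
        have := (index_inj hu (by omega) he).1
        omega
      refine (hl.congr (fun u hu => (hother _ (key u hu)).1)
        (fun u hu => (hother _ (key u hu)).2) fun u hu v hv => ?_)
      rw [h10]
      refine hr.vother _ fun u' hu' v' hv' he => ?_
      have := (index_inj hu hu' (index_inj hv hv' he).1).1
      omega
    refine Tr.seq ((Tr.of_wp (Q := fun t' => t' = t1.setReg 20 i) (by decide) (by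
      simp [Cmd.wp, g19])).mono ?_)
    rintro l2 t' ⟨hl2, rfl⟩
    have hl2' : l2 ≤ 10 := hl2.trans (by decide)
    refine Tr.seq ((Tr.recompute (t := t1.setReg 20 i) (d := d) (x := i) hi (by
      simpa using (hrg1 17 (by simp)).trans h17) (by simp) hlev (hnm i (by omega)).2
      (hm.symm.trans hmi')).mono ?_)
    rintro l3 t2 ⟨hl3, hfr2, hrg2, hv2, ho2⟩
    have h29 : t2.arr 9 = t1.arr 9 := hfr2.arr 9 (by simp)
    have h214 : t2.arr 14 = t1.arr 14 := hfr2.arr 14 (by simp)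
    have gg27 : t2.reg 27 = old := by rw [hrg2 27 (by simp)]; simpa using g27
    have gg19 : t2.reg 19 = i := by rw [hrg2 19 (by simp)]; simpa using g19
    have gg17 : t2.reg 17 = d + 1 := by
      rw [hrg2 17 (by simp)]; simpa using (hrg1 17 (by simp)).trans h17
    have hlev2 : Level E.n T w d (t2.arr 9) (t2.arr 14) (t2.arr 10) := by
      rw [h29, h214]
      refine hlev.congr (fun _ _ => rfl) (fun _ _ => rfl) fun u hu v hv => ho2 _ fun v' hv' he => ?_
      have := (index_inj hu hi (index_inj hv hv' he).1).1
      omega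
    refine Tr.bounded fun hrb hab _ => ?_
    refine Tr.seq ((Tr.of_wp (Q := fun t' => t' = t2.setReg 20 (old - 1)) (by decide) (by
      have := hrb 27 (by omega)
      simp [Cmd.wp, gg27] at this ⊢; omega)).mono ?_)
    rintro l4 t' ⟨hl4, rfl⟩
    have hl4' : l4 ≤ 10 := hl4.trans (by decide)
    have hmold := ho.old i hi
    rw [← hold_def] at hmold
    -- The old representative is at most `i`, so its extreme vertices have been renewed already. If
    -- `old` is still 0 from the start, truncation selects vertex 0, which is always least in its
    -- node.
    have hxi : old - 1 < i + 1 := by omega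
    have hxn : old - 1 < E.n := by omega
    refine (Tr.recompute (t := t2.setReg 20 (old - 1)) (d := d) (x := old - 1) hxn (by simpa using gg17) (by simp) hlev2 (by
      change t2.arr 14 _ = _
      rw [h214]; exact (hnm _ hxi).2) hmold).mono ?_
    rintro l5 t3 ⟨hl5, hfr3, hrg3, hv3, ho3⟩
    have h39 : t3.arr 9 = t1.arr 9 := (hfr3.arr 9 (by simp)).trans h29
    have h314 : t3.arr 14 = t1.arr 14 := (hfr3.arr 14 (by simp)).trans h214
    have hkeep : ∀ a < E.n, (a = i ∨ a = old - 1 ∨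
        ∀ v < E.n, t1.arr 10 (((d + 1) * E.n + a) * E.n + v) = wmin E.n T w (d + 1) a v) →
        ∀ v < E.n, t3.arr 10 (((d + 1) * E.n + a) * E.n + v) = wmin E.n T w (d + 1) a v := by
      intro a ha hc v hv
      by_cases hax : a = old - 1
      · subst hax; exact hv3 v hv
      rw [ho3 _ fun v' hv' he => hax (index_inj ha hxn (index_inj hv hv' he).1).2]
      change t2.arr 10 _ = _
      by_cases hai : a = i
      · subst hai; exact hv2 v hv
      rw [ho2 _ fun v' hv' he => hai (index_inj ha hi (index_inj hv hv' he).1).2]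
      rcases hc with h | h | h
      · exact absurd h hai
      · exact absurd h hax
      · exact h v hv
    refine ⟨⟨?_, ?_, ?_, ?_, fun a ha hma => ?_, fun j hj => ?_⟩, ?_, ?_⟩
    · exact ((hfr1.setReg _ (by omega)).trans (hfr2.mono (by simp))).setReg _ (by omega) |>.trans
        (hfr3.mono (by simp))
    · exact ((hrg1.setReg _ (by simp)).trans (hrg2.mono (by simp))).setReg _ (by simp) |>.trans
        (hrg3.mono (by simp))
    · rw [h39, h314]; exact hnm
    · rw [h39, h314]; exact hother
    · rcases hr.val a ha hma with h1 | ⟨h1, h2⟩ | ⟨u, hu, h1, h2, h3, h4⟩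
      · exact .inl (hkeep a ha (.inr (.inr (by rw [h10]; exact h1))))
      · by_cases hai : a = i
        · exact .inl (hkeep a ha (.inl hai))
        · exact .inr (.inl ⟨by omega, h2⟩)
      · by_cases hui : u = i
        · subst hui; exact .inl (hkeep a ha (.inr (.inl h4.symm)))
        · exact .inr (.inr ⟨u, hu, by omega, h2, h3, h4⟩)
    · rw [ho3 j fun v hv => hj _ hxn v hv]
      change t2.arr 10 j = _
      rw [ho2 j fun v hv => hj i hi v hv]
      change t1.arr 10 j = _
      rw [h10]; exact hr.vother j hj
    · rw [hrg3 19 (by simp)]; simpa using gg19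
    · rw [h39]
      have hp : price E.n = 400 * E.n + 400 := rfl
      omega
  · rw [Ex.eval_r, Ex.eval_add, Ex.eval_r, Ex.eval_num, g27, g19] at hge2
    refine (Tr.of_wp (p := .skip) (Q := fun t' => t' = t1) rfl rfl).mono ?_
    rintro l2 t' ⟨hl2, rfl⟩
    have hl2' : l2 ≤ 1 := hl2
    exact ⟨hskip (.inr (by omega)), g19, by omega⟩

end

/-! ### Rebuilding the trees after a refinement -/

section

variable {E : Env} {t : St} {T : ℕ → ℕ} {w : ℕ → ℕ → ℕ} {n d h : ℕ}

theorem Tr.set_num {x k : ℕ} (h : (Cmd.set x (.c k)).ok) :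
    Tr E (.set x (.c k)) t (fun l t' => l ≤ 5 ∧ t' = t.setReg x k) :=
  (Tr.of_wp (Q := fun t' => t' = t.setReg x k) h ⟨.inl rfl, rfl⟩).mono
    fun _ _ h' => ⟨h'.1.trans (by simp [Cmd.cost, Ex.cost]), h'.2⟩

theorem Tr.level (hT : ∀ u < E.n, T u < E.n) (hb : E.n * E.n + E.n < E.V) (hd : d + 1 ≤ h)
    (h2 : 2 ^ h < E.V) (h17 : t.reg 17 = d + 1) (h18 : t.reg 18 = 2 ^ d) (h0 : t.arr 0 = T)
    (hl : Level E.n T w d (t.arr 9) (t.arr 14) (t.arr 10))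
    (ho : Outdated E.n T w (d + 1) (t.arr 9) (t.arr 10)) :
    Tr E Cmd.level t (fun l t' =>
      l + price E.n * stale E.n h (t'.arr 9) ≤ E.n * 380 + 100 + price E.n * stale E.n h (t.arr 9) ∧
      Frame [9, 10, 12, 13, 14] t t' ∧ Regs [18, 19, 20, 21, 22, 23, 24, 25, 26, 27] t t' ∧
      t'.reg 18 = 2 ^ (d + 1) ∧ Level E.n T w (d + 1) (t'.arr 9) (t'.arr 14) (t'.arr 10) ∧
      (∀ j, (∀ u < E.n, j ≠ (d + 1) * E.n + u) → t'.arr 9 j = t.arr 9 j ∧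
        t'.arr 14 j = t.arr 14 j) ∧
      (∀ j, (∀ u < E.n, ∀ v < E.n, j ≠ ((d + 1) * E.n + u) * E.n + v) →
        t'.arr 10 j = t.arr 10 j)) := by
  refine Tr.bounded fun hrb hab hr0 => ?_
  have hnV : E.n < E.V := hr0 ▸ hrb 0 (by omega)
  have hp2 : (2 : ℕ) ^ d + 2 ^ d = 2 ^ (d + 1) := by ring
  have hp3 : (2 : ℕ) ^ (d + 1) ≤ 2 ^ h := Nat.pow_le_pow_right (by omega) hd
  refine Tr.seq ((Tr.of_wp (Q := fun t' => t' = t.setReg 18 (2 ^ (d + 1))) (by decide) (by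
    simp [Cmd.wp, h18, hp2]; omega)).mono ?_)
  rintro l1 t' ⟨hl1, rfl⟩
  have hl1' : l1 ≤ 10 := hl1.trans (by decide)
  refine Tr.seq ((Tr.set_num (k := 0) (by decide)).mono ?_)
  rintro l2 t' ⟨hl2, rfl⟩
  refine Tr.seq ((Tr.firsts (t := (t.setReg 18 (2 ^ (d + 1))).setReg 19 0) (d := d + 1) hT hb h0 (by simp) (by simp)).mono ?_)
  rintro l3 t3 ⟨hl3, hfr3, hrg3, hF3⟩
  have fr3 : Frame [9, 10, 12, 13, 14] t t3 := Frame.trans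
    (((Frame.refl _ t).setReg _ (by omega)).setReg _ (by omega)) (hfr3.mono (by simp))
  have rg3 : Regs [18, 19, 20, 21, 22, 23, 24, 25, 26, 27] t t3 := Regs.trans
    (((Regs.refl _ t).setReg _ (by simp)).setReg _ (by simp)) (hrg3.mono (by simp))
  have g18 : t3.reg 18 = 2 ^ (d + 1) := by rw [hrg3 18 (by simp)]; simp
  refine Tr.seq ((Tr.set_num (k := 0) (by decide)).mono ?_)
  rintro l4 t' ⟨hl4, rfl⟩
  refine Tr.seq ((Tr.lasts (t := t3.setReg 19 0) (d := d + 1) hT ((fr3.arr 0 (by simp)).trans h0) (by simp [g18])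
    (by simp)).mono ?_)
  rintro l5 t5 ⟨hl5, hfr5, hrg5, hG5⟩
  have fr5 : Frame [9, 10, 12, 13, 14] t t5 := Frame.trans (fr3.setReg _ (by omega))
    (hfr5.mono (by simp))
  have rg5 : Regs [18, 19, 20, 21, 22, 23, 24, 25, 26, 27] t t5 := Regs.trans
    (rg3.setReg _ (by simp)) (hrg5.mono (by simp))
  have g18' : t5.reg 18 = 2 ^ (d + 1) := by rw [hrg5 18 (by simp)]; simpa using g18
  have hF5 : ∀ u < E.n, t5.arr 12 (u / 2 ^ (d + 1) * E.n + T u) = nmin E.n T (d + 1) u :=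
    fun u hu => (congrFun (hfr5.arr 12 (by simp)) _).trans (hF3 u hu)
  have hsame : ∀ a, a ≠ 12 → a ≠ 13 → t5.arr a = t.arr a := fun a h12 h13 =>
    (hfr5.arr a (by simpa)).trans (hfr3.arr a (by simpa))
  refine Tr.seq ((Tr.set_num (k := 0) (by decide)).mono ?_)
  rintro l6 t' ⟨hl6, rfl⟩
  set t6 := t5.setReg 19 0 with ht6
  have ga : ∀ a, t6.arr a = t5.arr a := fun a => rfl
  refine (Tr.for (I := fun i t' => Renewed E.n T w d t6 i t')
    (Ψ := fun t' => price E.n * stale E.n h (t'.arr 9)) (c := 200) (N := E.n) (by omega) (by omega)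
    (by omega) (by omega) hnV ?_ ?_ (fun _ _ => rfl) ?_ (by simp [ht6]) ?_).mono ?_
  · intro i hi t7 hr g19 g0
    refine (Tr.renew hr hi hT hb hd ?_ ?_ ?_ ?_ g19 hF5 hG5 ?_ ?_).mono ?_
    · simpa [ht6] using (rg5 17 (by simp)).trans h17
    · simpa [ht6] using g18'
    · simpa [ht6] using (rg5 0 (by simp)).trans hr0
    · exact (fr5.arr 0 (by simp)).trans h0
    · rw [ga, ga, ga, hsame 9 (by omega) (by omega), hsame 14 (by omega) (by omega),
        hsame 10 (by omega) (by omega)]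
      exact hl
    · rw [ga, ga, hsame 9 (by omega) (by omega), hsame 10 (by omega) (by omega)]
      exact ho
    · rintro l t' ⟨h1, h2, h3⟩
      exact ⟨h1, h2, (h1.regs 0 (by simp)).trans ((hr.regs 0 (by simp)).symm.trans g0), h3⟩
  · rintro i t7 ⟨a1, a2, a3, a4, a5, a6⟩
    exact ⟨a1.setReg _ (by omega), a2.setReg _ (by simp), a3, a4, a5, a6⟩
  · rw [show t6.reg 19 = 0 by simp [ht6]]
    refine ⟨Frame.refl _ _, Regs.refl _ _, fun u hu => by omega, fun _ _ => ⟨rfl, rfl⟩,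
      fun a ha hm => ?_, fun _ _ => rfl⟩
    have := ho.val a ha hm
    rw [ga, ga, hsame 9 (by omega) (by omega), hsame 10 (by omega) (by omega)]
    simpa using this
  · simpa [ht6] using (rg5 0 (by simp)).trans hr0
  · rintro l t' ⟨hr, -, -, hl7⟩
    rw [show t6.reg 19 = 0 by simp [ht6]] at hl7
    simp only [ga, hsame 9 (by omega) (by omega)] at hl7
    refine ⟨by omega, (fr5.setReg _ (by omega)).trans (hr.frame.mono (by simp)),
      (rg5.setReg _ (by simp)).trans (hr.regs.mono (by simp)), ?_, ⟨fun u hu => (hr.nm u hu).1,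
      fun _ u hu => (hr.nm u hu).2, fun a ha hm => ?_⟩, ?_, ?_⟩
    · rw [hr.regs 18 (by simp)]; simpa [ht6] using g18'
    · rcases hr.val a ha hm with h1 | h1 | ⟨u, hu, h1, -⟩
      · exact h1
      · omega
      · omega
    · intro j hj
      have := hr.other j hj
      rwa [ga, ga, hsame 9 (by omega) (by omega), hsame 14 (by omega) (by omega)] at this
    · intro j hj
      have := hr.vother j hj
      rwa [ga, hsame 10 (by omega) (by omega)] at this

/-- Levels are repaired from the bottom up, since each row is computed from two rows one level
below. Level 0 consists of single vertices and needs no repair. -/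
theorem Tr.rebuild (hT : ∀ u < E.n, T u < E.n) (hb : E.n * E.n + E.n < E.V)
    (h2 : 2 ^ h < E.V) (hh : h + 1 < E.V) (h3 : t.reg 3 = h) (h0 : t.arr 0 = T)
    (hl : Level E.n T w 0 (t.arr 9) (t.arr 14) (t.arr 10))
    (ho : ∀ d < h, Outdated E.n T w (d + 1) (t.arr 9) (t.arr 10)) :
    Tr E Cmd.rebuild t (fun l t' =>
      l + price E.n * stale E.n h (t'.arr 9) ≤ h * (E.n * 380 + 120) + 50 +
        price E.n * stale E.n h (t.arr 9) ∧
      Frame [9, 10, 12, 13, 14] t t' ∧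
      ∀ d ≤ h, Level E.n T w d (t'.arr 9) (t'.arr 14) (t'.arr 10)) := by
  refine Tr.seq ((Tr.of_wp (Q := fun t' => t' = t.setReg 16 (h + 1)) (by decide) (by
    simp [Cmd.wp, h3, hh])).mono ?_)
  rintro l1 t' ⟨hl1, rfl⟩
  have hl1' : l1 ≤ 10 := hl1.trans (by decide)
  refine Tr.seq ((Tr.set_num (k := 1) (by decide)).mono ?_)
  rintro l2 t' ⟨hl2, rfl⟩
  refine Tr.seq ((Tr.set_num (k := 1) (by decide)).mono ?_)
  rintro l3 t' ⟨hl3, rfl⟩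
  refine (Tr.for (I := fun i t' => 1 ≤ i ∧ Frame [9, 10, 12, 13, 14] t t' ∧
      t'.reg 18 = 2 ^ (i - 1) ∧ t'.reg 16 = h + 1 ∧
      (∀ d < i, Level E.n T w d (t'.arr 9) (t'.arr 14) (t'.arr 10)) ∧
      ∀ d < h, i ≤ d + 1 → Outdated E.n T w (d + 1) (t'.arr 9) (t'.arr 10))
    (Ψ := fun t' => price E.n * stale E.n h (t'.arr 9)) (c := E.n * 380 + 100) (N := h + 1)
    (by omega) (by omega) (by omega) (by omega) hh ?_ ?_ (fun _ _ => rfl) ?_ (by simp)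
    (by simp)).mono ?_
  · rintro i hi t1 ⟨hi1, hfr, g18, g16, hlev, hout⟩ g17 _
    obtain ⟨d, rfl⟩ : ∃ d, i = d + 1 := ⟨i - 1, by omega⟩
    refine (Tr.level (d := d) hT hb (by omega) h2 g17 g18 ((hfr.arr 0 (by simp)).trans h0)
      (hlev d (by omega)) (hout d (by omega) le_rfl)).mono ?_
    rintro l t' ⟨hl', hfr', hrg', g18', hlev', h9, h10⟩
    have key : ∀ d', d' ≠ d + 1 → ∀ u < E.n, ∀ u' < E.n, d' * E.n + u ≠ (d + 1) * E.n + u' :=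
      fun d' hd' u hu u' hu' he => hd' (index_inj hu hu' he).1
    have key2 : ∀ d', d' ≠ d + 1 → ∀ u < E.n, ∀ v < E.n, ∀ u' < E.n, ∀ v' < E.n,
        (d' * E.n + u) * E.n + v ≠ ((d + 1) * E.n + u') * E.n + v' :=
      fun d' hd' u hu v hv u' hu' v' hv' he => key d' hd' u hu u' hu' (index_inj hv hv' he).1
    refine ⟨⟨by omega, hfr.trans hfr', g18', (hrg' 16 (by simp)).trans g16, fun d' hd' => ?_,
      fun d' hd' hi' => ?_⟩, (hrg' 17 (by simp)).trans g17, (hrg' 16 (by simp)).trans g16, hl'⟩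
    · by_cases hdd : d' = d + 1
      · subst hdd; exact hlev'
      · exact (hlev d' (by omega)).congr (fun u hu => (h9 _ (key d' hdd u hu)).1)
          (fun u hu => (h9 _ (key d' hdd u hu)).2)
          fun u hu v hv => h10 _ (key2 d' hdd u hu v hv)
    · exact (hout d' hd' (by omega)).congr
        (fun u hu => (h9 _ (key (d' + 1) (by omega) u hu)).1)
        fun u hu v hv => h10 _ (key2 (d' + 1) (by omega) u hu v hv)
  · rintro i t1 ⟨hi1, hfr, g18, g16, hlev, hout⟩
    exact ⟨hi1, hfr.setReg _ (by omega), by simpa using g18, by simpa using g16, hlev, hout⟩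
  · refine ⟨by simp, (((Frame.refl _ t).setReg _ (by omega)).setReg _ (by omega)).setReg _
      (by omega), by simp, by simp, ?_, fun d hd _ => ho d hd⟩
    simpa using hl
  · rintro l t' ⟨⟨-, hfr, -, -, hlev, -⟩, -, -, hl'⟩
    refine ⟨?_, hfr, fun d hd => hlev d (by omega)⟩
    simp at hl'
    have e : E.n * 380 + 100 + 16 ≤ E.n * 380 + 120 := by omega
    have := Nat.mul_le_mul_left h e
    omega

end

/-! ### The effect of refinements and weight changes on the trees -/

section

variable {E : Env} {t : St} {T : ℕ → ℕ} {w : ℕ → ℕ → ℕ} {n d h : ℕ}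

theorem wmin_ext {w' : ℕ → ℕ → ℕ} {u v : ℕ} (hw : ∀ x ∈ node n T d u, w x v = w' x v) :
    wmin n T w d u v = wmin n T w' d u v := by
  unfold wmin
  congr 1
  ext k
  constructor
  · rintro ⟨x, hx, rfl⟩; exact ⟨x, hx, hw x hx⟩
  · rintro ⟨x, hx, rfl⟩; exact ⟨x, hx, (hw x hx).symm⟩

/-- A least vertex `a` of a new node either was not least before, and then its own entry shows it,
or its old node has lost some `y`. In the latter case the least vertex of the new node of `y` is a
new representative whose old entry points to `a`. So `NM` alone tells which rows have to be
recomputed. -/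
theorem Level.outdated {T' NM MX VAL : ℕ → ℕ} (hl : Level n T w d NM MX VAL)
    (href : ∀ u < n, ∀ v < n, T' u = T' v → T u = T v) : Outdated n T' w d NM VAL := by
  have hsub : ∀ u < n, node n T' d u ⊆ node n T d u := by
    intro u hu x hx
    obtain ⟨h1, h2, h3⟩ := mem_node.1 hx
    exact mem_node.2 ⟨h1, href x h1 u hu h2, h3⟩
  refine ⟨fun u hu => ?_, fun u hu => ?_, fun a ha hm => ?_⟩
  · rw [hl.nm u hu]
    exact Nat.succ_le_succ (nmin_le (self_mem_node hu))
  · rw [hl.nm u hu, Nat.add_sub_cancel]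
    have h1 := nmin_lt (T := T) (d := d) hu
    refine le_antisymm (nmin_le (self_mem_node h1)) ?_
    have h2 := nmin_le (hsub _ h1 (nmin_mem h1))
    rwa [nmin_nmin hu] at h2
  · by_cases ham : nmin n T d a = a
    · by_cases hsub' : node n T d a ⊆ node n T' d a
      · refine .inl fun v hv => ?_
        rw [hl.val a ha ham v hv]
        simp only [wmin, Finset.Subset.antisymm hsub' (hsub a ha)]
      · obtain ⟨y, hy, hy'⟩ := Finset.not_subset.1 hsub'
        have hyn := (mem_node.1 hy).1
        have hu := nmin_lt (T := T') (d := d) hyn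
        have hua : nmin n T' d y ∈ node n T d a := by
          rw [← node_eq hy]; exact hsub y hyn (nmin_mem hyn)
        have hnm : nmin n T d (nmin n T' d y) = a := (nmin_congr hua).trans ham
        refine .inr (.inr ⟨nmin n T' d y, hu, nmin_nmin hyn, ?_, ?_⟩)
        · rw [hl.nm _ hu, hnm]
          intro he
          refine hy' ?_
          have h1 : a = nmin n T' d y := by omega
          rw [h1, node_eq (nmin_mem hyn)]
          exact self_mem_node hyn
        · rw [hl.nm _ hu, hnm, Nat.add_sub_cancel]
    · refine .inr (.inl ?_)
      rw [hl.nm a ha]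
      omega

/-- One weight affects only column `v` of the nodes on the path from the leaf `u` to its root. `VAL`
is the value array before the leaf was overwritten. -/
theorem Tr.repath {w' : ℕ → ℕ → ℕ} {VAL : ℕ → ℕ} {u v : ℕ} (hu : u < E.n) (hv : v < E.n)
    (hh : h + 1 < E.V) (h3 : t.reg 3 = h) (h10 : t.reg 10 = u) (h11 : t.reg 11 = v)
    (hl : ∀ d ≤ h, Level E.n T w d (t.arr 9) (t.arr 14) VAL)
    (hV : t.arr 10 = Function.update VAL (u * E.n + v) (w' u v))
    (hw : ∀ x y, (x, y) ≠ (u, v) → w x y = w' x y) :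
    Tr E Cmd.repath t (fun l t' => l ≤ h * 300 + 50 ∧ Frame [10] t t' ∧
      ∀ d ≤ h, Level E.n T w' d (t'.arr 9) (t'.arr 14) (t'.arr 10)) := by
  refine Tr.seq ((Tr.of_wp (Q := fun t' => t' = t.setReg 16 (h + 1)) (by decide) (by
    simp [Cmd.wp, h3, hh])).mono ?_)
  rintro l1 t' ⟨hl1, rfl⟩
  have hl1' : l1 ≤ 10 := hl1.trans (by decide)
  refine Tr.seq ((Tr.set_num (k := 1) (by decide)).mono ?_)
  rintro l2 t' ⟨hl2, rfl⟩
  refine (Tr.for (I := fun i t' => 1 ≤ i ∧ Frame [10] t t' ∧ t'.reg 16 = h + 1 ∧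
      (∀ d < i, Level E.n T w' d (t'.arr 9) (t'.arr 14) (t'.arr 10)) ∧
      ∀ d ≤ h, i ≤ d → Level E.n T w d (t'.arr 9) (t'.arr 14) (t'.arr 10))
    (Ψ := fun _ => 0) (c := 280) (N := h + 1)
    (by omega) (by omega) (by omega) (by omega) hh ?_ ?_ (fun _ _ => rfl) ?_ (by simp)
    (by simp)).mono ?_
  · rintro i hi t1 ⟨hi1, hfr, g16, hlow, hhigh⟩ g17 _
    refine Tr.bounded fun hrb hab g0 => ?_
    obtain ⟨d, rfl⟩ : ∃ d, i = d + 1 := ⟨i - 1, by omega⟩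
    have g10 := (hfr.reg 10 (by omega)).trans h10
    have g11 := (hfr.reg 11 (by omega)).trans h11
    have hlevd := hlow d (by omega)
    have hlevs := hhigh (d + 1) (by omega) le_rfl
    set a := nmin E.n T (d + 1) u with ha
    have han : a < E.n := nmin_lt hu
    have haa : nmin E.n T (d + 1) a = a := nmin_nmin hu
    obtain ⟨hbn, -⟩ := mem_node.1 (nmax_mem (T := T) (d := d + 1) han)
    set b := nmin E.n T d (nmax E.n T (d + 1) a) with hb
    have hbn' : b < E.n := nmin_lt hbn
    have e1 : t1.arr 9 ((d + 1) * E.n + u) = a + 1 := hlevs.nm u hu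
    have e2 : t1.arr 14 ((d + 1) * E.n + a) = nmax E.n T (d + 1) a := hlevs.mx (by omega) a han
    have e3 : t1.arr 9 (d * E.n + nmax E.n T (d + 1) a) = b + 1 := hlevd.nm _ hbn
    have e4 : t1.arr 10 ((d * E.n + a) * E.n + v) = wmin E.n T w' d a v :=
      hlevd.val a han (nmin_of_succ han haa) v hv
    have e5 : t1.arr 10 ((d * E.n + b) * E.n + v) = wmin E.n T w' d (nmax E.n T (d + 1) a) v := by
      rw [hlevd.val b hbn' (nmin_nmin hbn) v hv]
      exact wmin_congr v (nmin_mem hbn)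
    have e6 := wmin_succ (T := T) (w := w') (d := d) han v
    rw [haa] at e6
    have hnV : E.n < E.V := g0 ▸ hrb 0 (by omega)
    refine (Tr.of_wp (Q := fun t' => ∃ x : ℕ × ℕ, t' = ((((t1.setReg 20 a).setReg 21 b).setReg 23 x.1).setReg
      24 x.2).setArr 10 (((d + 1) * E.n + a) * E.n + v) (wmin E.n T w' (d + 1) a v))
      (by decide) ?_).mono ?_
    · generalize hQ : (fun t' => ∃ x : ℕ × ℕ, t' = ((((t1.setReg 20 a).setReg 21 b).setReg 23 x.1).setReg
        24 x.2).setArr 10 (((d + 1) * E.n + a) * E.n + v) (wmin E.n T w' (d + 1) a v)) = Q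
      have key : ∀ x y, Q (((((t1.setReg 20 a).setReg 21 b).setReg 23 x).setReg
        24 y).setArr 10 (((d + 1) * E.n + a) * E.n + v) (wmin E.n T w' (d + 1) a v)) := by
        intro x y
        rw [← hQ]; exact ⟨(x, y), rfl⟩
      simp [Cmd.wp, g17, g0, g10, g11, e1, e2, e3, e4, e5]
      have key := key (wmin E.n T w' d a v) (wmin E.n T w' d (nmax E.n T (d + 1) a) v)
      refine ⟨by omega, by omega, fun hlt => ?_, fun hge => ?_⟩
      · rwa [e6, min_eq_left hlt.le] at key
      · rwa [e6, min_eq_right hge] at key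
    rintro l t' ⟨hl', x, rfl⟩
    refine ⟨⟨by omega, ?_, by simpa using g16, fun d' hd' => ?_, fun d' hd' hi' => ?_⟩,
      by simpa using g17, by simpa using g16, hl'.trans (by decide)⟩
    · exact ((((hfr.setReg _ (by omega)).setReg _ (by omega)).setReg _ (by omega)).setReg _
        (by omega)).setArr _ _ (by simp)
    · by_cases hdd : d' = d + 1
      · subst hdd
        refine ⟨hlevs.nm, hlevs.mx, fun y hy hmy z hz => ?_⟩
        simp only [St.setArr_arr, if_true, St.setReg_arr, Function.update_apply]
        split_ifs with he
        · obtain ⟨h5, h6⟩ := index_inj hz hv he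
          rw [(index_inj hy han h5).2, h6]
        · rw [hlevs.val y hy hmy z hz]
          -- An entry that was not rewritten belongs to another column or to a node that does not
          -- contain `u`.
          refine wmin_ext fun k hk => hw k z ?_
          rintro hkz
          obtain ⟨rfl, rfl⟩ := Prod.mk.inj hkz
          refine he ?_
          rw [← hmy, ← nmin_congr hk]
      · refine (hlow d' (by omega)).congr (fun _ _ => rfl) (fun _ _ => rfl) fun y hy z hz => ?_
        simp only [St.setArr_arr, if_true, St.setReg_arr]
        refine Function.update_of_ne (fun he => hdd ?_) _ _
        exact (index_inj hy han (index_inj hz hv he).1).1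
    · refine (hhigh d' hd' (by omega)).congr (fun _ _ => rfl) (fun _ _ => rfl) fun y hy z hz => ?_
      simp only [St.setArr_arr, if_true, St.setReg_arr]
      refine Function.update_of_ne (fun he => ?_) _ _
      have := (index_inj hy han (index_inj hz hv he).1).1
      omega
  · rintro i t1 ⟨hi1, hfr, g16, hlow, hhigh⟩
    exact ⟨hi1, hfr.setReg _ (by omega), by simpa using g16, hlow, hhigh⟩
  · refine ⟨by simp, ((Frame.refl _ t).setReg _ (by omega)).setReg _ (by omega), by simp,
      fun d hd => ?_, fun d hd h1 => ?_⟩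
    · have hd0 : d = 0 := by simpa using hd
      subst hd0
      have h0 := hl 0 (by omega)
      refine ⟨h0.nm, h0.mx, fun y hy hmy z hz => ?_⟩
      simp only [St.setReg_arr, hV, Function.update_apply]
      rw [wmin_zero hy]
      split_ifs with he
      · obtain ⟨h5, h6⟩ := index_inj hz hv (by simpa using he : y * E.n + z = u * E.n + v)
        rw [h5, h6]
      · rw [h0.val y hy hmy z hz, wmin_zero hy]
        refine hw y z ?_
        rintro hyz
        obtain ⟨rfl, rfl⟩ := Prod.mk.inj hyz
        exact he (by simp)
    · have h1' : 1 ≤ d := by simpa using h1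
      refine (hl d hd).congr (fun _ _ => rfl) (fun _ _ => rfl) fun y hy z hz => ?_
      simp only [St.setReg_arr, hV]
      refine Function.update_of_ne (fun he => ?_) _ _
      have h5 := (index_inj hz hv he).1
      have := (index_inj hy hu (by simpa using h5 : d * E.n + y = 0 * E.n + u)).1
      omega
  · rintro l t' ⟨⟨-, hfr, -, hlow, -⟩, -, -, hl'⟩
    refine ⟨?_, hfr, fun d hd => hlow d (by omega)⟩
    simp at hl'
    omega

end

section

/-! ### Reading the new sets of the partition -/

namespace Cmd

/-- Reads the sets of which there are as many as register 16 says. -/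
def readSets : Cmd :=
  .set 18 (.r 9 + 1) ;; .set 17 0 ;;
  .for 17 16
    ((.inp 19 (.r 18) ;; .inp 20 (.r 18 + 1) ;; .set 18 (.r 18 + 2) ;; .put 2 (.r 20) (.r 19) ;;
      .set 21 0) ;;
      .for 21 19 (.inp 22 (.r 18) ;; .put 0 (.r 22) (.r 20) ;; .put 1 (.r 20 + .r 21) (.r 22) ;;
        .set 18 (.r 18 + 1)))

/-- All vertices enter the work list, and all parts start from scratch. -/
def refresh : Cmd :=
  .set 30 0 ;; .set 31 0 ;;
  .for 31 0 (.put 5 (.ld 0 (.r 31)) (.ld 0 (.r 31)) ;; .put 6 (.r 31) 0 ;; push)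

/-- Processes the new sets of the partition. -/
def prepare : Cmd := readSets ;; rebuild ;; refresh

/-- Reads the new sets of the partition and brings the labels up to date. -/
def post : Cmd := .inp 16 (.r 9) ;; .ite 0 (.r 16) prepare .skip ;; main

end Cmd

variable {E : Env} {t : St}

theorem List.getD_of_drop {l F : List ℕ} {i x : ℕ} (h : l.drop i = x :: F) :
    l.getD i 0 = x ∧ l.drop (i + 1) = F ∧ i < l.length := by
  have h1 : i < l.length := by
    by_contra hc
    rw [List.drop_eq_nil_of_le (by omega)] at h
    simp at h
  rw [List.drop_eq_getElem_cons h1] at h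
  obtain ⟨h2, h3⟩ := List.cons.inj h
  exact ⟨by rw [List.getD_eq_getElem _ _ h1, h2], h3, h1⟩

theorem Tr.readSet {l F : List ℕ} {a : ℕ} (hlen : E.inp.length < E.V)
    (hd : E.inp.drop (t.reg 18) = l ++ F) (h19 : t.reg 19 = l.length) (h20 : t.reg 20 = a)
    (h21 : t.reg 21 = 0) :
    Tr E (.for 21 19 (.inp 22 (.r 18) ;; .put 0 (.r 22) (.r 20) ;; .put 1 (.r 20 + .r 21) (.r 22) ;;
        .set 18 (.r 18 + 1))) t (fun k t' => k ≤ l.length * 70 + 5 ∧ Frame [0, 1] t t' ∧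
      Regs [18, 21, 22] t t' ∧ t'.reg 18 = t.reg 18 + l.length ∧ E.inp.drop (t'.reg 18) = F ∧
      (∀ i (h : i < l.length), t'.arr 0 l[i] = a ∧ t'.arr 1 (a + i) = l[i]) ∧
      (∀ v, v ∉ l → t'.arr 0 v = t.arr 0 v) ∧
      (∀ p, ¬ (a ≤ p ∧ p < a + l.length) → t'.arr 1 p = t.arr 1 p)) := by
  have hl : l.length < E.V := by
    have := congrArg List.length hd
    simp at this; omega
  refine (Tr.for (I := fun i t' => i ≤ l.length ∧ Frame [0, 1] t t' ∧
      Regs [18, 21, 22] t t' ∧ t'.reg 18 = t.reg 18 + i ∧ E.inp.drop (t'.reg 18) = l.drop i ++ F ∧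
      (∀ j (h : j < l.length), j < i → t'.arr 0 l[j] = a ∧ t'.arr 1 (a + j) = l[j]) ∧
      (∀ v, v ∉ l → t'.arr 0 v = t.arr 0 v) ∧
      (∀ p, ¬ (a ≤ p ∧ p < a + l.length) → t'.arr 1 p = t.arr 1 p))
    (Ψ := fun _ => 0) (c := 54) (N := l.length)
    (by omega) (by omega) (by omega) (by omega) hl ?_ ?_ (fun _ _ => rfl) ?_ (by omega)
    h19).mono ?_
  · rintro i hi t1 ⟨-, hfr, hrg, g18, hdr, hdone, hT, hP⟩ g21 g19
    have hdl : l.drop i = l[i] :: l.drop (i + 1) := List.drop_eq_getElem_cons hi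
    rw [hdl, List.cons_append] at hdr
    obtain ⟨e1, e2, e3⟩ := List.getD_of_drop hdr
    have g20 : t1.reg 20 = a := (hrg 20 (by simp)).trans h20
    refine (Tr.of_wp (Q := fun t' => t' = (((t1.setReg 22 l[i]).setArr 0 l[i] a).setArr 1 (a + i)
      l[i]).setReg 18 (t1.reg 18 + 1)) (by decide) ?_).mono ?_
    · simp only [Cmd.wp, Ex.eval_r, Ex.eval_add, Ex.eval_num, St.setReg_reg, St.setArr_reg, e1, g20,
        g21]
      norm_num
      omega
    rintro k t' ⟨hk, rfl⟩
    refine ⟨⟨hi, ((((hfr.setReg _ (by omega)).setArr _ _ (by simp)).setArr _ _ (by simp)).setReg _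
      (by omega)), ((hrg.setReg _ (by simp)).setReg _ (by simp)), ?_, ?_, ?_, ?_, ?_⟩, ?_, ?_, ?_⟩
    · simp [g18]; omega
    · simpa using e2
    · intro j hj hji
      by_cases hjE : j = i
      · subst hjE; simp
      · obtain ⟨d1, d2⟩ := hdone j hj (by omega)
        refine ⟨?_, ?_⟩
        · simp [Function.update_apply, d1]
        · simp [hjE, d2]
    · intro v hv
      have : v ≠ l[i] := fun he => hv (he ▸ List.getElem_mem hi)
      simp [this, hT v hv]
    · intro p hp
      have : p ≠ a + i := by omega
      simp [this, hP p hp]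
    · simp [g21]
    · simp [g19]
    · exact hk.trans (by decide)
  · rintro i t1 ⟨h0, hfr, hrg, g18, hdr, hdone, hT, hP⟩
    exact ⟨h0, hfr.setReg _ (by omega), hrg.setReg _ (by simp), by simpa using g18,
      by simpa using hdr, hdone, hT, hP⟩
  · rw [h21]
    exact ⟨by omega, Frame.refl _ _, Regs.refl _ _, rfl, by simpa using hd, by simp,
      fun _ _ => rfl, fun _ _ => rfl⟩
  · rintro k t' ⟨⟨-, hfr, hrg, g18, hdr, hdone, hT, hP⟩, -, -, hk⟩
    rw [h21] at hk
    refine ⟨by simpa using hk, hfr, hrg, g18, by simpa using hdr,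
      fun i hi => hdone i hi hi, hT, hP⟩

/-- The arrays describe the part `X`. -/
structure Good {n : ℕ} (τ : Finset (Fin n) → ℕ) (T P Z : ℕ → ℕ) (X : Finset (Fin n)) : Prop where
  T : ∀ v ∈ X, T v = τ X
  Z : Z (τ X) = X.card
  P : ∃ l : List (Fin n), l.toFinset = X ∧ l.length = X.card ∧
    ∀ i (h : i < l.length), P (τ X + i) = l[i]

/-- The encoding of one set. -/
def encodeSet {n : ℕ} (τ : Finset (Fin n) → ℕ) (l : List (Fin n)) : List ℕ :=
  l.length :: τ l.toFinset :: l.map Fin.val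

/-- Sets and intervals are disjoint, so reading one set leaves the entries of the others intact. The
unread input serves as the potential for the inner loops. -/
theorem Tr.readSets {L : List (List (Fin E.n))} {τ : Finset (Fin E.n) → ℕ}
    {S : Finset (Finset (Fin E.n))} (hlen : E.inp.length + 3 < E.V)
    (hd : E.inp.drop (t.reg 9 + 1) = L.flatMap (encodeSet τ)) (h9 : t.reg 9 < E.inp.length)
    (h16 : t.reg 16 = L.length) (hL : L.length < E.V)
    (hnd : ∀ l ∈ L, l.Nodup) (hS : ∀ l ∈ L, l.toFinset ∈ S)
    (hdis : ∀ X ∈ S, ∀ Y ∈ S, X ≠ Y → Disjoint X Y)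
    (hne : ∀ X ∈ S, X.Nonempty)
    (hint : ∀ X ∈ S, ∀ Y ∈ S, X ≠ Y →
      Disjoint (Finset.Ico (τ X) (τ X + X.card)) (Finset.Ico (τ Y) (τ Y + Y.card)))
    (hold : ∀ X ∈ S, X ∉ L.map List.toFinset → Good τ (t.arr 0) (t.arr 1) (t.arr 2) X) :
    Tr E Cmd.readSets t (fun k t' => k ≤ L.length * 100 +
        70 * (E.inp.length - (t.reg 9 + 1)) + 100 ∧
      Frame [0, 1, 2] t t' ∧ ∀ X ∈ S, Good τ (t'.arr 0) (t'.arr 1) (t'.arr 2) X) := by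
  refine Tr.seq ((Tr.of_wp (Q := fun t' => t' = t.setReg 18 (t.reg 9 + 1)) (by decide) (by
    simp [Cmd.wp]; omega)).mono ?_)
  rintro k1 t' ⟨hk1, rfl⟩
  have hk1' : k1 ≤ 10 := hk1.trans (by decide)
  refine Tr.seq ((Tr.set_num (k := 0) (by decide)).mono ?_)
  rintro k2 t' ⟨hk2, rfl⟩
  refine (Tr.for (I := fun i t' => i ≤ L.length ∧ Frame [0, 1, 2] t t' ∧
      E.inp.drop (t'.reg 18) = (L.drop i).flatMap (encodeSet τ) ∧
      ∀ X ∈ S, (X ∈ (L.take i).map List.toFinset ∨ X ∉ L.map List.toFinset) →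
        Good τ (t'.arr 0) (t'.arr 1) (t'.arr 2) X)
    (Ψ := fun t' => 70 * (E.inp.length - t'.reg 18)) (c := 80) (N := L.length)
    (by omega) (by omega) (by omega) (by omega) hL ?_ ?_ (fun _ _ => by simp) ?_ (by simp)
    (by simp [h16])).mono ?_
  · rintro i hi t1 ⟨-, hfr, hdr, hgood⟩ g17 g16
    have hdl : L.drop i = L[i] :: L.drop (i + 1) := List.drop_eq_getElem_cons hi
    set l := L[i] with hl_def
    have hlL : l ∈ L := List.getElem_mem hi
    rw [hdl, List.flatMap_cons] at hdr
    obtain ⟨e1, e2, e3⟩ := List.getD_of_drop (x := l.length)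
      (F := τ l.toFinset :: l.map Fin.val ++ (L.drop (i + 1)).flatMap (encodeSet τ)) hdr
    obtain ⟨e4, e5, e6⟩ := List.getD_of_drop (x := τ l.toFinset)
      (F := l.map Fin.val ++ (L.drop (i + 1)).flatMap (encodeSet τ)) e2
    set a := τ l.toFinset with ha
    let t2 : St := ((((t1.setReg 19 l.length).setReg 20 a).setReg 18 (t1.reg 18 + 2)).setArr 2 a
      l.length).setReg 21 0
    refine Tr.seq ((Tr.of_wp (Q := fun t' => t' = t2) (by decide) (by
      simp only [Cmd.wp, Ex.eval_r, Ex.eval_add, Ex.eval_num, St.setReg_reg, e1,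
        Ex.leaf_r, Ex.leaf_add, Ex.leaf_num, true_or, true_and, if_true]
      norm_num
      simp only [← List.getD_eq_getElem?_getD, e4]
      exact ⟨by omega, rfl⟩)).mono ?_)
    rintro k3 t' ⟨hk3, rfl⟩
    have hk3' : k3 ≤ 60 := hk3.trans (by decide)
    refine (Tr.readSet (t := t2) (l := l.map Fin.val)
      (F := (L.drop (i + 1)).flatMap (encodeSet τ)) (a := a)
      (by omega) (by simpa [t2] using e5) (by simp [t2]) (by simp [t2]) (by simp [t2])).mono ?_
    rintro k4 t' ⟨hk4, hfr4, hrg4, g18, hdr4, hnew, hT, hP⟩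
    rw [List.length_map] at g18 hk4 hP
    have hZ : t'.arr 2 = Function.update (t1.arr 2) a l.length := by
      rw [hfr4.arr 2 (by simp)]; simp [t2]
    have hT1 : t2.arr 0 = t1.arr 0 := by simp [t2]
    have hP1 : t2.arr 1 = t1.arr 1 := by simp [t2]
    have hcard : l.toFinset.card = l.length := List.toFinset_card_of_nodup (hnd l hlL)
    refine ⟨⟨hi, ?_, hdr4, ?_⟩, ?_, ?_, ?_⟩
    · refine Frame.trans ?_ (hfr4.mono (by simp))
      exact ((((hfr.setReg _ (by omega)).setReg _ (by omega)).setReg _ (by omega)).setArr _ _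
        (by simp)).setReg _ (by omega)
    · intro X hX hcase
      by_cases hXl : X = l.toFinset
      · subst hXl
        refine ⟨fun v hv => ?_, ?_, l, rfl, hcard.symm, fun j hj => ?_⟩
        · obtain ⟨j, hj, rfl⟩ := List.getElem_of_mem (List.mem_toFinset.1 hv)
          have h := (hnew j (by simpa using hj)).1
          rw [List.getElem_map] at h; exact h
        · rw [hZ, ← ha, Function.update_self, hcard]
        · have h := (hnew j (by simpa using hj)).2
          rw [List.getElem_map] at h; exact h
      · have hXg : Good τ (t1.arr 0) (t1.arr 1) (t1.arr 2) X := by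
          refine hgood X hX ?_
          rcases hcase with h | h
          · rw [List.take_succ_eq_append_getElem hi, List.map_append, List.mem_append] at h
            rcases h with h | h
            · exact .inl h
            · exact absurd (by simpa using h) hXl
          · exact .inr h
        have hd1 := hdis X hX _ (hS l hlL) hXl
        have hi1 := hint X hX _ (hS l hlL) hXl
        rw [Finset.disjoint_left] at hi1
        have hXc := Finset.card_pos.2 (hne X hX)
        refine ⟨fun v hv => ?_, ?_, ?_⟩
        · rw [hT, hT1]
          · exact hXg.T v hv
          · intro hvl
            obtain ⟨y, hy, hyv⟩ := List.mem_map.1 hvl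
            have : y = v := Fin.ext hyv
            subst this
            exact Finset.disjoint_left.1 hd1 hv (List.mem_toFinset.2 hy)
        · rw [hZ, Function.update_of_ne, hXg.Z]
          intro he
          have hlc := Finset.card_pos.2 (hne _ (hS l hlL))
          exact hi1 (Finset.mem_Ico.2 ⟨le_rfl, by omega⟩) (Finset.mem_Ico.2 ⟨he.ge, by omega⟩)
        · obtain ⟨l', h1, h2, h3⟩ := hXg.P
          refine ⟨l', h1, h2, fun j hj => ?_⟩
          rw [hP, hP1, h3 j hj]
          rintro ⟨h4, h5⟩
          exact hi1 (a := τ X + j) (Finset.mem_Ico.2 ⟨by omega, by omega⟩)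
            (Finset.mem_Ico.2 ⟨h4, by rw [hcard]; exact h5⟩)
    · rw [hrg4 17 (by simp)]; simp [t2, g17]
    · rw [hrg4 16 (by simp)]; simp [t2, g16]
    · have g18' : t'.reg 18 = t1.reg 18 + 2 + l.length := by rw [g18]; simp [t2]
      have hle : t1.reg 18 + 2 + l.length ≤ E.inp.length := by
        have := congrArg List.length e5
        simp at this; omega
      rw [g18']
      omega
  · rintro i t1 ⟨h0, hfr, hdr, hgood⟩
    exact ⟨h0, hfr.setReg _ (by omega), by simpa using hdr, hgood⟩
  · refine ⟨by simp, ((Frame.refl _ t).setReg _ (by omega)).setReg _ (by omega), ?_, ?_⟩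
    · simpa using hd
    · intro X hX hcase
      refine hold X hX ?_
      simpa using hcase
  · rintro k t' ⟨⟨-, hfr, -, hgood⟩, -, -, hk⟩
    simp at hk
    refine ⟨by omega, hfr, fun X hX => hgood X hX ?_⟩
    rw [List.take_length]
    exact em _

end

section

/-! ### Partitions and their layouts -/

section Partition

open Finset

variable {n : ℕ} {Q : Finpartition (univ : Finset (Fin n))} {τ : Finset (Fin n) → ℕ}
  {T P Z : ℕ → ℕ}

/-- The values of `τ` are the starts of disjoint intervals in `[0, n)`. -/
structure Intervals (Q : Finpartition (univ : Finset (Fin n))) (τ : Finset (Fin n) → ℕ) :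
    Prop where
  le : ∀ X ∈ Q.parts, τ X + X.card ≤ n
  disj : ∀ X ∈ Q.parts, ∀ Y ∈ Q.parts, X ≠ Y →
    Disjoint (Ico (τ X) (τ X + X.card)) (Ico (τ Y) (τ Y + Y.card))

theorem part_mem (Q : Finpartition (univ : Finset (Fin n))) (v : Fin n) : Q.part v ∈ Q.parts :=
  Q.part_mem.2 (mem_univ v)

theorem self_mem_part (Q : Finpartition (univ : Finset (Fin n))) (v : Fin n) : v ∈ Q.part v :=
  Q.mem_part (mem_univ v)

theorem part_eq_iff {u v : Fin n} : Q.part u = Q.part v ↔ u ∈ Q.part v :=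
  ⟨fun h => h ▸ self_mem_part Q u, fun h => Q.part_eq_of_mem (part_mem Q v) h⟩

theorem Intervals.inj (h : Intervals Q τ) {X Y : Finset (Fin n)} (hX : X ∈ Q.parts)
    (hY : Y ∈ Q.parts) (he : τ X = τ Y) : X = Y := by
  by_contra hne
  have h1 := card_pos.2 (Q.nonempty_of_mem_parts hX)
  have h2 := card_pos.2 (Q.nonempty_of_mem_parts hY)
  exact disjoint_left.1 (h.disj X hX Y hY hne) (mem_Ico.2 ⟨le_rfl, by omega⟩)
    (mem_Ico.2 ⟨by omega, by omega⟩)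

/-- Disjoint intervals of total length n inside [0, n) leave no position free. -/
theorem Intervals.cover (h : Intervals Q τ) {p : ℕ} (hp : p < n) :
    ∃ X ∈ Q.parts, τ X ≤ p ∧ p < τ X + X.card := by
  have hsub : Q.parts.biUnion (fun X => Ico (τ X) (τ X + X.card)) ⊆ range n := by
    intro p hp
    simp only [mem_biUnion, mem_Ico, mem_range] at hp ⊢
    obtain ⟨X, hX, h1, h2⟩ := hp
    have := h.le X hX
    omega
  have hcard : (range n).card ≤ (Q.parts.biUnion (fun X => Ico (τ X) (τ X + X.card))).card := by
    rw [card_biUnion fun X hX Y hY hne => h.disj X hX Y hY hne]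
    simp [Q.sum_card_parts]
  have := eq_of_subset_of_card_le hsub hcard
  rw [← mem_range, ← this] at hp
  simpa using hp

/-- Distinct parts have distinct starts, so the number T v can stand for the part of v throughout
the algorithm. -/
theorem Intervals.layout (h : Intervals Q τ) (hg : ∀ X ∈ Q.parts, Good τ T P Z X) :
    Layout n T P Z where
  le v hv := by
    have := hg _ (part_mem Q ⟨v, hv⟩)
    rw [this.T _ (self_mem_part Q ⟨v, hv⟩), this.Z]
    exact h.le _ (part_mem Q _)
  pos p hp := by
    obtain ⟨X, hX, h1, h2⟩ := h.cover hp
    have hgX := hg X hX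
    obtain ⟨l, h3, h4, h5⟩ := hgX.P
    have h6 := h5 (p - τ X) (by omega)
    rw [Nat.add_sub_cancel' h1] at h6
    have h7 : l[p - τ X]'(by omega) ∈ X := (Finset.ext_iff.1 h3 _).1
      (List.mem_toFinset.2 (List.getElem_mem _))
    rw [h6, hgX.T _ h7, hgX.Z]
    exact ⟨Fin.is_lt _, h1, h2⟩
  surj v hv := by
    have hgX := hg _ (part_mem Q ⟨v, hv⟩)
    obtain ⟨l, h3, h4, h5⟩ := hgX.P
    have h6 := self_mem_part Q ⟨v, hv⟩
    have h8 := hgX.T _ h6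
    rw [← h3, List.mem_toFinset] at h6
    obtain ⟨j, hj, he⟩ := List.getElem_of_mem h6
    refine ⟨τ (Q.part ⟨v, hv⟩) + j, ?_, ?_, ?_⟩
    · rw [h8]; omega
    · rw [h8, hgX.Z]; omega
    · rw [h5 j hj, he]
  disj u hu v hv hne := by
    have hgu := hg _ (part_mem Q ⟨u, hu⟩)
    have hgv := hg _ (part_mem Q ⟨v, hv⟩)
    rw [hgu.T _ (self_mem_part Q ⟨u, hu⟩), hgv.T _ (self_mem_part Q ⟨v, hv⟩)] at hne ⊢
    rw [hgu.Z, hgv.Z]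
    have h1 := h.disj _ (part_mem Q ⟨u, hu⟩) _ (part_mem Q ⟨v, hv⟩) fun he => hne (by rw [he])
    have h2 := card_pos.2 ⟨_, self_mem_part Q ⟨u, hu⟩⟩
    have h3 := card_pos.2 ⟨_, self_mem_part Q ⟨v, hv⟩⟩
    rw [disjoint_left] at h1
    by_contra hc
    push Not at hc
    rcases le_total (τ (Q.part ⟨u, hu⟩)) (τ (Q.part ⟨v, hv⟩)) with h4 | h4
    · exact h1 (mem_Ico.2 ⟨h4, hc.1⟩) (mem_Ico.2 ⟨le_rfl, by omega⟩)
    · exact h1 (mem_Ico.2 ⟨le_rfl, by omega⟩) (mem_Ico.2 ⟨h4, hc.2⟩)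
  card v hv := by
    have hgv := hg _ (part_mem Q ⟨v, hv⟩)
    rw [hgv.T _ (self_mem_part Q ⟨v, hv⟩), hgv.Z, ← card_map Fin.valEmbedding]
    congr 1
    ext u
    simp only [mem_filter, mem_range, mem_map, Fin.valEmbedding_apply]
    constructor
    · rintro ⟨hu, he⟩
      refine ⟨⟨u, hu⟩, ?_, rfl⟩
      rw [(hg _ (part_mem Q ⟨u, hu⟩)).T _ (self_mem_part Q ⟨u, hu⟩)] at he
      exact part_eq_iff.1 (h.inj (part_mem Q _) (part_mem Q _) he)
    · rintro ⟨x, hx, rfl⟩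
      exact ⟨x.2, hgv.T x hx⟩

theorem Good.T_part (hg : ∀ X ∈ Q.parts, Good τ T P Z X) (v : Fin n) : T v = τ (Q.part v) :=
  (hg _ (part_mem Q v)).T v (self_mem_part Q v)

theorem Intervals.T_eq_iff (h : Intervals Q τ) (hg : ∀ X ∈ Q.parts, Good τ T P Z X)
    (u v : Fin n) : T u = T v ↔ Q.part u = Q.part v := by
  rw [Good.T_part hg, Good.T_part hg]
  exact ⟨h.inj (part_mem Q u) (part_mem Q v), fun he => by rw [he]⟩

theorem Consecutive.le {τ : Finset (Fin n) → ℕ} : ∀ {l : List (Finset (Fin n))} {a : ℕ},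
    Consecutive τ a l → ∀ Y ∈ l, a ≤ τ Y ∧ τ Y + Y.card ≤ a + (l.map card).sum
  | [], _, _, _, h => by simp at h
  | X :: l, a, ⟨h1, h2⟩, Y, hY => by
    rw [List.map_cons, List.sum_cons]
    rcases List.mem_cons.1 hY with rfl | hY
    · omega
    · have := Consecutive.le h2 Y hY
      omega

variable {G : DecrementalGraph n} {η : ℚ} {A : DynamicOrder n}

theorem IsATO.intervals (hA : IsATO G η A) {s : ℕ} (hs : s ≤ G.numUpdates) :
    Intervals (A.part s) (A.τ s) := ⟨hA.interval_le s hs, hA.interval_disjoint s hs⟩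

theorem IsATO.part_subset (hA : IsATO G η A) {s : ℕ} (hs : s < G.numUpdates) (v : Fin n) :
    (A.part (s + 1)).part v ⊆ (A.part s).part v := by
  obtain ⟨X, hX, hsub⟩ := hA.refines s hs (part_mem (A.part (s + 1)) v)
  have := (A.part s).part_eq_of_mem hX (hsub (self_mem_part _ v))
  rw [this]; exact hsub

theorem IsATO.part_eq (hA : IsATO G η A) {s : ℕ} (hs : s < G.numUpdates) {u v : Fin n}
    (h : (A.part (s + 1)).part u = (A.part (s + 1)).part v) :
    (A.part s).part u = (A.part s).part v :=
  part_eq_iff.2 (hA.part_subset hs v (part_eq_iff.1 h))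

/-- The interval of a piece is contained in that of the set. -/
theorem IsATO.nested (hA : IsATO G η A) {s : ℕ} (hs : s < G.numUpdates) {X Y : Finset (Fin n)}
    (hX : X ∈ (A.part s).parts) (hY : Y ∈ (A.part (s + 1)).parts) (hYX : Y ⊆ X) :
    A.τ s X ≤ A.τ (s + 1) Y ∧ A.τ (s + 1) Y + Y.card ≤ A.τ s X + X.card := by
  obtain ⟨l, hnd, hmem, hcons⟩ := hA.split s hs X hX
  have h1 := hcons.le Y ((hmem Y).2 ⟨hY, hYX⟩)
  have h2 : (l.map card).sum ≤ X.card := by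
    rw [← List.sum_toFinset _ hnd, ← card_biUnion]
    · refine card_le_card fun v hv => ?_
      obtain ⟨Y', hY', hv⟩ := mem_biUnion.1 hv
      exact ((hmem Y').1 (List.mem_toFinset.1 hY')).2 hv
    · intro Y1 h1 Y2 h2 hne
      exact (A.part (s + 1)).disjoint ((hmem Y1).1 (List.mem_toFinset.1 h1)).1
        ((hmem Y2).1 (List.mem_toFinset.1 h2)).1 hne
  omega

/-- A set that is not split keeps its value. -/
theorem IsATO.τ_eq (hA : IsATO G η A) {s : ℕ} (hs : s < G.numUpdates) {X : Finset (Fin n)}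
    (hX : X ∈ (A.part s).parts) (hX' : X ∈ (A.part (s + 1)).parts) :
    A.τ (s + 1) X = A.τ s X := by
  have := hA.nested hs hX hX' (Subset.refl X)
  omega

/-- The number of parts grows whenever there are new sets. -/
theorem IsATO.card_lt (hA : IsATO G η A) {s : ℕ} (hs : s < G.numUpdates)
    (hne : (A.newSets (s + 1)).Nonempty) :
    (A.part s).parts.card < (A.part (s + 1)).parts.card := by
  obtain ⟨Y, hY⟩ := hne
  obtain ⟨hY, hYn⟩ := mem_sdiff.1 hY
  -- A new set `Y` contains no old set, so every old set has a vertex outside `Y`. The new parts of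
  -- these vertices are distinct and different from `Y`.
  have h1 : ∀ X ∈ (A.part s).parts, ∃ v ∈ X, v ∉ Y := by
    intro X hX
    by_contra hc
    push Not at hc
    obtain ⟨v, hv⟩ := (A.part s).nonempty_of_mem_parts hX
    have h2 := (A.part s).part_eq_of_mem hX hv
    have h3 := (A.part (s + 1)).part_eq_of_mem hY (hc v hv)
    have h4 := hA.part_subset hs v
    rw [h2, h3] at h4
    exact hYn (Subset.antisymm h4 hc ▸ hX)
  obtain ⟨y, -⟩ := (A.part (s + 1)).nonempty_of_mem_parts hY
  have : Nonempty (Fin n) := ⟨y⟩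
  choose! f hf using h1
  refine lt_of_le_of_lt (card_le_card_of_injOn (t := (A.part (s + 1)).parts.erase Y)
    (fun X => (A.part (s + 1)).part (f X)) (fun X hX => ?_) fun X hX X' hX' he => ?_)
    (card_erase_lt_of_mem hY)
  · refine mem_coe.2 (mem_erase.2 ⟨fun he => (hf X hX).2 ?_, part_mem _ _⟩)
    rw [← he]; exact self_mem_part _ _
  · have := hA.part_eq hs he
    rwa [(A.part s).part_eq_of_mem hX (hf X hX).1, (A.part s).part_eq_of_mem hX' (hf X' hX').1]
      at this

theorem IsATO.card_le (hA : IsATO G η A) {s : ℕ} (hs : s < G.numUpdates) :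
    (A.part s).parts.card ≤ (A.part (s + 1)).parts.card :=
  Finpartition.card_mono (hA.refines s hs)

theorem card_parts_le (Q : Finpartition (univ : Finset (Fin n))) : Q.parts.card ≤ n := by
  simpa using Q.card_parts_le_card

end Partition

/-! ### The new layout, the trees and the work list -/

variable {E : Env} {t : St} {T : ℕ → ℕ} {w : ℕ → ℕ → ℕ} {h : ℕ}

/-- Every part is to be checked again, but labels and scan pointers are kept. The watch lists are
not emptied, since their entries have been paid for. -/
theorem Tr.refresh {W : ℕ → List ℕ} (hV : E.n + 1 < E.V) (h0 : t.arr 0 = T)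
    (hW : ListRep E.n (t.arr 7) (t.arr 8) W) :
    Tr E Cmd.refresh t (fun k t' => k ≤ E.n * 200 + 30 ∧ Frame [5, 6, 7, 8] t t' ∧
      (∀ v < E.n, t'.arr 5 (T v) = T v) ∧ (∀ v < E.n, t'.arr 6 v = 0) ∧
      ∃ W', ListRep E.n (t'.arr 7) (t'.arr 8) W' ∧ (∀ v < E.n, v ∈ W' 0) ∧
        ∀ q, q ≠ 0 → W' q = W q) := by
  refine Tr.bounded fun hrb hab hr0 => ?_
  refine Tr.seq ((Tr.set_num (k := 0) (by decide)).mono ?_)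
  rintro k1 t' ⟨hk1, rfl⟩
  refine Tr.seq ((Tr.set_num (k := 0) (by decide)).mono ?_)
  rintro k2 t' ⟨hk2, rfl⟩
  refine (Tr.for (I := fun i t' => t'.reg 30 = 0 ∧ Frame [5, 6, 7, 8] t t' ∧
      (∀ v < E.n, v < i → t'.arr 5 (T v) = T v) ∧ (∀ v < i, t'.arr 6 v = 0) ∧
      ∃ W', ListRep E.n (t'.arr 7) (t'.arr 8) W' ∧ (∀ v < i, v ∈ W' 0) ∧
        ∀ q, q ≠ 0 → W' q = W q)
    (Ψ := fun _ => 0) (c := 150) (N := E.n)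
    (by omega) (by omega) (by omega) (by omega) (by omega) ?_ ?_ (fun _ _ => rfl) ?_ (by simp)
    (by simp [hr0])).mono ?_
  · rintro i hi t1 ⟨g30, hfr, hC, hR, W', hW', hm, hq⟩ g31 g0
    have g0' : t1.arr 0 = T := (hfr.arr 0 (by simp)).trans h0
    refine (Tr.of_wp (Q := fun t' => ((t'.reg 30 = 0 ∧ Frame [5, 6, 7, 8] t t' ∧
      (∀ v < E.n, v < i + 1 → t'.arr 5 (T v) = T v) ∧ (∀ v < i + 1, t'.arr 6 v = 0) ∧
      ∃ W', ListRep E.n (t'.arr 7) (t'.arr 8) W' ∧ (∀ v < i + 1, v ∈ W' 0) ∧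
        ∀ q, q ≠ 0 → W' q = W q) ∧ t'.reg 31 = i ∧ t'.reg 0 = E.n)) (by decide) ?_).mono
      fun l t' ⟨h2, h3⟩ => ⟨h3.1, h3.2.1, h3.2.2, h2.trans (by decide)⟩
    let t2 : St := (t1.setArr 5 (T i) (T i)).setArr 6 i 0
    suffices hp : Cmd.push.wp E (fun t' => ((t'.reg 30 = 0 ∧ Frame [5, 6, 7, 8] t t' ∧
      (∀ v < E.n, v < i + 1 → t'.arr 5 (T v) = T v) ∧ (∀ v < i + 1, t'.arr 6 v = 0) ∧
      ∃ W', ListRep E.n (t'.arr 7) (t'.arr 8) W' ∧ (∀ v < i + 1, v ∈ W' 0) ∧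
        ∀ q, q ≠ 0 → W' q = W q) ∧ t'.reg 31 = i ∧ t'.reg 0 = E.n)) t2 by
      simp only [Cmd.wp, Ex.eval_ld, Ex.eval_r, Ex.eval_num, Ex.leaf_ld, Ex.leaf_num, true_or,
        true_and, St.setArr_reg, g0', g31]
      exact hp
    refine Tr.push (W := W') (q := 0) (v := i) (by simpa [t2] using g0) (by simpa [t2] using hW')
      (by simpa [t2] using g30) (by simpa [t2] using g31) hi hV ?_
    intro t3 hr3 ho3 ha3 hW3
    have a5 : t3.arr 5 = Function.update (t1.arr 5) (T i) (T i) := by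
      rw [ha3 5 (by omega) (by omega)]; simp [t2]
    have a6 : t3.arr 6 = Function.update (t1.arr 6) i 0 := by
      rw [ha3 6 (by omega) (by omega)]; simp [t2]
    refine ⟨⟨by rw [hr3]; exact g30, hfr.trans ⟨?_, ?_, ?_⟩, ?_, ?_, _, hW3, ?_, ?_⟩,
      by rw [hr3]; exact g31, by rw [hr3]; exact g0⟩
    · rw [ho3]; rfl
    · intro x _; rw [hr3]; rfl
    · intro a ha
      simp at ha
      rw [ha3 a ha.2.2.1 ha.2.2.2]; simp [t2, ha.1, ha.2.1]
    · intro v hv hvi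
      rw [a5, Function.update_apply]
      split_ifs with he
      · exact he.symm
      · exact hC v hv (by
          have : v ≠ i := fun h => he (by rw [h])
          omega)
    · intro v hv
      rw [a6, Function.update_apply]
      split_ifs with he
      · rfl
      · exact hR v (by omega)
    · intro v hv
      rw [mem_pushList]
      by_cases he : v = i
      · exact .inr ⟨rfl, he⟩
      · exact .inl (hm v (by omega))
    · intro q hq0
      rw [pushList_of_ne _ _ hq0]; exact hq q hq0
  · rintro i t1 ⟨g30, hfr, hC, hR, W', hW', hm, hq⟩
    exact ⟨by simpa using g30, hfr.setReg _ (by omega), hC, hR, W', hW', hm, hq⟩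
  · refine ⟨by simp, ((Frame.refl _ t).setReg _ (by omega)).setReg _ (by omega), ?_, ?_, W, hW,
      ?_, fun _ _ => rfl⟩
    all_goals simp
  · rintro k t' ⟨⟨-, hfr, hC, hR, W', hW', hm, hq⟩, -, -, hk⟩
    simp at hk
    exact ⟨by omega, hfr, fun v hv => hC v hv hv, hR, W', hW', hm, hq⟩

end

section

/-! ### Changes of weights -/

namespace Cmd

/-- Rounds the weight in register 28 to a multiple of the unit. -/
def round : Cmd :=
  .ite 0 (.r 28)
    (.ite ((.r 2 + 1) * .r 7) (.r 28 * .r 8) (.set 29 (.r 2 + 1))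
      (.set 29 ((.r 28 * .r 8 + .r 7 - 1) / .r 7)))
    (.set 29 (.r 2 + 1))

/-- Reads the updated edge and its weight. -/
def reweigh : Cmd :=
  (.inp 10 0 ;; .inp 11 1 ;; .inp 28 2 ;; round ;; .put 10 (.r 10 * .r 0 + .r 11) (.r 29) ;;
    .put 6 (.r 11) 0 ;; .set 30 0 ;; .set 31 (.r 11) ;; push) ;; repath

end Cmd

/-- The weight `x` (a word) in multiples of the unit `gn / gd`, rounded up, and at most `M + 1`. -/
def roundWeight (M gn gd x : ℕ) : ℕ :=
  if 0 < x then if (M + 1) * gn < x * gd then M + 1 else (x * gd + gn - 1) / gn else M + 1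

theorem roundWeight_le {M gn gd x : ℕ} (hn : 0 < gn) : roundWeight M gn gd x ≤ M + 1 := by
  unfold roundWeight
  split_ifs with h1 h2
  · exact le_rfl
  · refine Nat.lt_succ_iff.1 ((Nat.div_lt_iff_lt_mul hn).2 ?_)
    have e : (M + 1).succ * gn = (M + 1) * gn + gn := Nat.succ_mul _ _
    omega
  · exact le_rfl

theorem one_le_roundWeight {M gn gd x : ℕ} (hn : 0 < gn) (hd : 0 < gd) :
    1 ≤ roundWeight M gn gd x := by
  unfold roundWeight
  split_ifs with h1 h2
  · omega
  · rw [Nat.one_le_div_iff hn]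
    have := Nat.mul_pos h1 hd
    omega
  · omega

/-- The word 0 encodes an absent edge and rounds to M + 1, so it must be excluded on the left. -/
theorem roundWeight_mono {M gn gd x y : ℕ} (hn : 0 < gn) (hx : 0 < x) (hxy : x ≤ y) :
    roundWeight M gn gd x ≤ roundWeight M gn gd y := by
  have hm := Nat.mul_le_mul_right gd hxy
  have hy : 0 < y := by omega
  by_cases h2 : (M + 1) * gn < y * gd
  · have : roundWeight M gn gd y = M + 1 := by simp only [roundWeight, if_pos hy, if_pos h2]
    rw [this]; exact roundWeight_le hn
  · have h3 : ¬ (M + 1) * gn < x * gd := by omega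
    simp only [roundWeight, if_pos hx, if_pos hy, if_neg h2, if_neg h3]
    exact Nat.div_le_div_right (by omega)

theorem roundWeight_zero {M gn gd : ℕ} : roundWeight M gn gd 0 = M + 1 := rfl

variable {E : Env} {K : Par} {c : Core} {t : St}

theorem Tr.round {Q : St → Prop} {gn gd x : ℕ} (hn : 0 < gn) (h2 : t.reg 2 = K.M)
    (hM : K.M + 1 < E.V) (h7 : t.reg 7 = gn) (h8 : t.reg 8 = gd) (h28 : t.reg 28 = x)
    (hQ : Q (t.setReg 29 (roundWeight K.M gn gd x))) : Cmd.round.wp E Q t := by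
  have hle := roundWeight_le (M := K.M) (gd := gd) (x := x) hn
  simp only [Cmd.round, Cmd.wp, Ex.eval_num, Ex.eval_r, Ex.eval_mul, Ex.eval_add, Ex.eval_sub,
    Ex.eval_div, h2, h7, h8, h28, Ex.leaf_add, Ex.leaf_div]
  refine ⟨fun h1 => ⟨fun h3 => ?_, fun h3 => ?_⟩, fun h1 => ?_⟩
  · rw [roundWeight, if_pos h1, if_pos h3] at hQ
    exact ⟨.inr hM, hQ⟩
  · rw [roundWeight, if_pos h1, if_neg (by omega)] at hQ hle
    exact ⟨.inr (by omega), hQ⟩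
  · rw [roundWeight, if_neg (by omega)] at hQ
    exact ⟨.inr hM, hQ⟩

/-- The number of vertices and the depth of the trees are small enough, too. -/
structure Setup (E : Env) (K : Par) : Prop extends Fits E K where
  le_pow : E.n ≤ 2 ^ K.h
  pow_lt : 2 ^ K.h < E.V
  sq_lt : E.n * E.n + E.n < E.V

theorem Setup.h_lt (hs : Setup E K) : K.h + 1 < E.V := by
  have := hs.pow_lt
  have : K.h < 2 ^ K.h := Nat.lt_two_pow_self
  omega

theorem Level.root {n h u : ℕ} {T : ℕ → ℕ} {w : ℕ → ℕ → ℕ} {NM MX VAL : ℕ → ℕ}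
    (hl : Level n T w h NM MX VAL) (hu : u < n) {v : ℕ} (hv : v < n) :
    VAL ((h * n + (NM (h * n + u) - 1)) * n + v) = wmin n T w h u v := by
  rw [hl.nm _ hu, Nat.add_sub_cancel, hl.val _ (nmin_lt hu) (nmin_nmin hu) v hv]
  exact wmin_congr v (nmin_mem hu)

/-- The minima that are stored in the trees. -/
def rootMin (n h : ℕ) (t : St) (a v : ℕ) : ℕ :=
  t.arr 10 ((h * n + (t.arr 9 (h * n + t.arr 1 a) - 1)) * n + v)

/-- All trees are up to date. -/
def Trees (E : Env) (K : Par) (c : Core) (t : St) : Prop :=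
  ∀ d ≤ K.h, Level E.n c.T c.w d (t.arr 9) (t.arr 14) (t.arr 10)

/-- Only minima for the target `v` can change, so `v` alone loses its registration and enters the
work list. The new minima are read off at the roots of the repaired trees. -/
theorem Tr.reweigh {gn gd u v x : ℕ} {w' : ℕ → ℕ → ℕ} (hs : Setup E K) (hC : Holds E K c t)
    (hV : Valid E.n K.r K.M (fun _ => False) c) (hl : Trees E K c t) (hn : 0 < gn)
    (h7 : t.reg 7 = gn) (h8 : t.reg 8 = gd) (hu : u < E.n) (hv : v < E.n)
    (hiu : E.inp.getD 0 0 = u) (hiv : E.inp.getD 1 0 = v) (hix : E.inp.getD 2 0 = x)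
    (hwx : w' u v = roundWeight K.M gn gd x) (hwo : ∀ y z, (y, z) ≠ (u, v) → c.w y z = w' y z)
    (hle : c.w u v ≤ w' u v) :
    Tr E Cmd.reweigh t (fun k t' => k ≤ K.h * 300 + 450 ∧ t'.reg 7 = gn ∧ t'.reg 8 = gd ∧
      t'.arr 9 = t.arr 9 ∧ ∃ c', Holds E K c' t' ∧ Valid E.n K.r K.M (fun _ => False) c' ∧
      Trees E K c' t' ∧ c'.T = c.T ∧ c'.P = c.P ∧ c'.Z = c.Z ∧ c'.w = w' ∧
      c'.pot E.n K.M ≤ c.pot E.n K.M + 5) := by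
  refine Tr.bounded fun hrb hab h0 => ?_
  have hfl := hs.lt
  refine Tr.seq ((Tr.of_wp (Q := fun t' => (∀ y < 10, t'.reg y = t.reg y) ∧ t'.reg 10 = u ∧
    t'.reg 11 = v ∧ t'.out = t.out ∧ (∀ a, a ∉ [6, 7, 8, 10] → t'.arr a = t.arr a) ∧
    t'.arr 6 = Function.update (t.arr 6) v 0 ∧
    t'.arr 10 = Function.update (t.arr 10) (u * E.n + v) (w' u v) ∧
    ListRep E.n (t'.arr 7) (t'.arr 8) (pushList c.W 0 v)) (by decide) ?_).mono ?_)
  · let t1 : St := (((t.setReg 10 u).setReg 11 v).setReg 28 x)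
    let t2 : St := ((((t1.setReg 29 (w' u v)).setArr 10 (u * E.n + v) (w' u v)).setArr 6 v 0).setReg
      30 0).setReg 31 v
    have key : Cmd.push.wp E (fun t' => (∀ y < 10, t'.reg y = t.reg y) ∧ t'.reg 10 = u ∧
        t'.reg 11 = v ∧ t'.out = t.out ∧ (∀ a, a ∉ [6, 7, 8, 10] → t'.arr a = t.arr a) ∧
        t'.arr 6 = Function.update (t.arr 6) v 0 ∧
        t'.arr 10 = Function.update (t.arr 10) (u * E.n + v) (w' u v) ∧
        ListRep E.n (t'.arr 7) (t'.arr 8) (pushList c.W 0 v)) t2 := by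
      refine Tr.push (W := c.W) (q := 0) (v := v) (by simpa [t2, t1] using h0)
        (by simpa [t2, t1] using hC.W) (by simp [t2]) (by simp [t2]) hv (by omega) ?_
      intro t3 hr3 ho3 ha3 hW3
      refine ⟨fun y hy => ?_, by rw [hr3]; simp [t2, t1], by rw [hr3]; simp [t2, t1],
        by rw [ho3]; simp [t2, t1], fun a ha => ?_, ?_, ?_, hW3⟩
      · rw [hr3]
        simp only [t2, t1, St.setReg_reg, St.setArr_reg]
        split_ifs <;> first | rfl | omega
      · simp at ha
        rw [ha3 a (by tauto) (by tauto)]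
        simp [t2, t1, ha]
      · rw [ha3 6 (by omega) (by omega)]; simp [t2, t1]
      · rw [ha3 10 (by omega) (by omega)]; simp [t2, t1]
    generalize hQ : (fun t' : St => _ ∧ _) = Q at key ⊢
    simp only [Cmd.wp, Ex.eval_num, hiu, hiv, hix]
    refine Tr.round (K := K) (gd := gd) (x := x) hn (by simpa using hC.M) (by omega) (by simpa using h7)
      (by simpa using h8) (by simp) ?_
    rw [← hwx]
    simp only [Ex.eval_r, Ex.eval_mul, Ex.eval_add, Ex.leaf_r, Ex.leaf_num, true_or, true_and]
    simpa [t2, t1, h0] using key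
  rintro k1 t1 ⟨hk1, g1, g10, g11, go, ga, ga6, ga10, gW⟩
  have hk1' : k1 ≤ 350 := hk1.trans (by decide)
  have hl1 : ∀ d ≤ K.h, Level E.n c.T c.w d (t1.arr 9) (t1.arr 14) (t.arr 10) := by
    intro d hd
    rw [ga 9 (by simp), ga 14 (by simp)]; exact hl d hd
  refine (Tr.repath (w' := w') hu hv hs.h_lt ((g1 3 (by omega)).trans hC.h) g10 g11 hl1 ga10
    hwo).mono ?_
  rintro k2 t2 ⟨hk2, hfr, hl2⟩
  have harr : ∀ a, a ∉ [6, 7, 8, 10] → t2.arr a = t.arr a := fun a ha => by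
    rw [hfr.arr a (fun h => ha (by simp at h; simp [h])), ga a ha]
  have hreg : ∀ y < 10, t2.reg y = t.reg y := fun y hy =>
    (hfr.reg y (by omega)).trans (g1 y hy)
  have hlay := hV.lay
  have hval : ∀ a < E.n, ∀ y < E.n, rootMin E.n K.h t2 (c.T a) y =
      wmin E.n c.T w' K.h (c.P (c.T a)) y := by
    intro a ha y hy
    have hT := hV.T_lt ha
    have h1 := (hl2 K.h le_rfl).root (hlay.pos _ hT).1 hy
    rw [← h1, rootMin, harr 1 (by simp), hC.P]
  refine ⟨by omega, (hreg 7 (by omega)).trans h7, (hreg 8 (by omega)).trans h8,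
    harr 9 (by simp), ⟨c.T, c.P, c.Z, c.L, c.X, c.C, Function.update c.R v 0, pushList c.W 0 v,
      w', rootMin E.n K.h t2⟩, ?_, ?_, ?_, rfl, rfl, rfl, rfl, ?_⟩
  · exact {
      r := (hreg 1 (by omega)).trans hC.r
      M := (hreg 2 (by omega)).trans hC.M
      h := (hreg 3 (by omega)).trans hC.h
      ka := (hreg 4 (by omega)).trans hC.ka
      kb := (hreg 5 (by omega)).trans hC.kb
      kc := (hreg 6 (by omega)).trans hC.kc
      T := (harr 0 (by simp)).trans hC.T
      P := (harr 1 (by simp)).trans hC.P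
      Z := (harr 2 (by simp)).trans hC.Z
      L := (harr 3 (by simp)).trans hC.L
      X := (harr 4 (by simp)).trans hC.X
      C := (harr 5 (by simp)).trans hC.C
      R := by rw [hfr.arr 6 (by simp), ga6, hC.R]
      W := by rw [hfr.arr 7 (by simp), hfr.arr 8 (by simp)]; exact gW
      m := fun a v => rfl
      low := fun k hk => by rw [harr 11 (by simp)]; exact hC.low k hk
      out := fun v hv => by rw [hfr.out, go]; exact hC.out v hv }
  · refine hV.weight (v := v) rfl rfl rfl rfl rfl rfl rfl rfl ?_ ?_ ?_
    · intro y _ z _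
      by_cases he : (y, z) = (u, v)
      · obtain ⟨rfl, rfl⟩ := Prod.mk.inj he; exact hle
      · exact (hwo y z he).le
    · intro a ha y hy hyv
      have hT := hV.T_lt ha
      have h1 := (hl K.h le_rfl).root (hlay.pos _ hT).1 hy
      change rootMin E.n K.h t2 (c.T a) y = _
      rw [hval a ha y hy, ← hC.m, hC.P, h1]
      refine (wmin_ext fun z _ => hwo z y ?_).symm
      intro he; exact hyv (Prod.mk.inj he).2
    · have := (hl2 K.h le_rfl).minSpec hs.le_pow hlay
      intro a ha y hy
      have h2 := this a ha y hy
      have h3 : rootMin E.n K.h t2 (c.T a) y = _ := hval a ha y hy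
      have h4 := (hl2 K.h le_rfl).root (hlay.pos _ (hV.T_lt ha)).1 hy
      dsimp only at h2
      rw [h4, ← h3] at h2
      exact h2
  · exact fun d hd => hl2 d hd
  · exact Core.pot_weight hv rfl rfl rfl rfl rfl rfl rfl rfl

end

section

/-! ### The new sets of the partition -/

section Announces

open Finset

variable {n : ℕ} {Q : Finpartition (univ : Finset (Fin n))} {τ : Finset (Fin n) → ℕ}
  {new : Finset (Finset (Fin n))} {L : List (List (Fin n))}

theorem Announces.mem (h : Announces new L) {X : Finset (Fin n)} :
    X ∈ L.map List.toFinset ↔ X ∈ new := by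
  rw [← h.2.2, List.mem_toFinset]

theorem Announces.length_eq (h : Announces new L) : L.length = new.card := by
  rw [← h.2.2, List.toFinset_card_of_nodup h.2.1, List.length_map]

theorem Announces.length_flatMap_le (h : Announces new L) (hsub : new ⊆ Q.parts) :
    (L.flatMap (encodeSet τ)).length ≤ 3 * n := by
  have h1 : (L.flatMap (encodeSet τ)).length = (L.map fun l => l.toFinset.card + 2).sum := by
    rw [List.length_flatMap]
    congr 1
    refine List.map_congr_left fun l hl => ?_
    rw [List.toFinset_card_of_nodup (h.1 l hl)]
    simp [encodeSet]
  have h2 : (L.map fun l => l.toFinset.card + 2) = (L.map List.toFinset).map fun X => X.card + 2 := by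
    rw [List.map_map]; rfl
  rw [h1, h2, ← List.sum_toFinset _ h.2.1, h.2.2]
  calc ∑ X ∈ new, (X.card + 2) ≤ ∑ X ∈ Q.parts, (X.card + 2) := sum_le_sum_of_subset hsub
    _ = n + 2 * Q.parts.card := by
        rw [sum_add_distrib, Q.sum_card_parts]; simp [mul_comm]
    _ ≤ 3 * n := by have := card_parts_le Q; omega

end Announces

variable {E : Env} {K : Par} {c : Core} {t : St}

/-- The hypotheses on the trees are stated for all layouts of the new partition, because the actual
layout depends on the order in which the vertices are listed. This form serves both the
preprocessing and the updates. -/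
theorem Tr.prepare {Q : Finpartition (Finset.univ : Finset (Fin E.n))} {τ : Finset (Fin E.n) → ℕ}
    {new : Finset (Finset (Fin E.n))} {L : List (List (Fin E.n))} {w : ℕ → ℕ → ℕ}
    {W : ℕ → List ℕ} (hs : Setup E K) (hlen : E.inp.length + 3 < E.V)
    (hd : E.inp.drop (t.reg 9 + 1) = L.flatMap (encodeSet τ)) (h9 : t.reg 9 < E.inp.length)
    (h3 : t.reg 3 = K.h) (h16 : t.reg 16 = L.length) (hA : Announces new L) (hnew : new ⊆ Q.parts)
    (hI : Intervals Q τ)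
    (hold : ∀ X ∈ Q.parts, X ∉ new → Good τ (t.arr 0) (t.arr 1) (t.arr 2) X)
    (hl : ∀ T, Level E.n T w 0 (t.arr 9) (t.arr 14) (t.arr 10))
    (ho : ∀ T P Z, (∀ X ∈ Q.parts, Good τ T P Z X) →
      ∀ d < K.h, Outdated E.n T w (d + 1) (t.arr 9) (t.arr 10))
    (hW : ListRep E.n (t.arr 7) (t.arr 8) W) :
    Tr E Cmd.prepare t (fun l t' =>
      l + price E.n * stale E.n K.h (t'.arr 9) ≤ K.h * (E.n * 380 + 120) + E.n * 510 + 200 +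
        price E.n * stale E.n K.h (t.arr 9) ∧
      Frame [0, 1, 2, 5, 6, 7, 8, 9, 10, 12, 13, 14] t t' ∧
      (∀ X ∈ Q.parts, Good τ (t'.arr 0) (t'.arr 1) (t'.arr 2) X) ∧
      (∀ d ≤ K.h, Level E.n (t'.arr 0) w d (t'.arr 9) (t'.arr 14) (t'.arr 10)) ∧
      (∀ v < E.n, t'.arr 5 (t'.arr 0 v) = t'.arr 0 v) ∧ (∀ v < E.n, t'.arr 6 v = 0) ∧
      ∃ W', ListRep E.n (t'.arr 7) (t'.arr 8) W' ∧ (∀ v < E.n, v ∈ W' 0) ∧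
        ∀ q, q ≠ 0 → W' q = W q) := by
  have hfl := hs.lt
  have hLn : L.length ≤ E.n := by
    rw [hA.length_eq]; exact (Finset.card_le_card hnew).trans (card_parts_le Q)
  have hdl : E.inp.length - (t.reg 9 + 1) ≤ 3 * E.n := by
    rw [← List.length_drop, hd]; exact hA.length_flatMap_le hnew
  refine Tr.seq ((Tr.readSets (S := Q.parts) (τ := τ) (L := L) hlen hd h9 h16 (by omega) hA.1
    (fun l hl => hnew (hA.mem.1 (List.mem_map_of_mem hl))) (fun X hX Y hY hne =>
      Q.disjoint hX hY hne) (fun X hX => Q.nonempty_of_mem_parts hX) hI.disj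
    fun X hX hn => hold X hX (fun h => hn (hA.mem.2 h))).mono ?_)
  rintro k1 t1 ⟨hk1, hf1, hg1⟩
  have hlay := hI.layout hg1
  refine Tr.seq ((Tr.rebuild (T := t1.arr 0) (w := w) (h := K.h) ?_ hs.sq_lt hs.pow_lt hs.h_lt
    ((hf1.reg 3 (by omega)).trans h3) rfl ?_ ?_).mono ?_)
  · intro u hu
    have := hlay.le u hu
    have := hlay.Z_pos hu
    omega
  · rw [hf1.arr 9 (by simp), hf1.arr 14 (by simp), hf1.arr 10 (by simp)]
    exact hl _
  · intro d hd
    rw [hf1.arr 9 (by simp), hf1.arr 10 (by simp)]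
    exact ho _ _ _ hg1 d hd
  rintro k2 t2 ⟨hk2, hf2, hl2⟩
  have e2 : ∀ a, a ∉ [9, 10, 12, 13, 14] → t2.arr a = t1.arr a := hf2.arr
  refine (Tr.refresh (T := t2.arr 0) (W := W) (by omega) rfl ?_).mono ?_
  · rw [e2 7 (by simp), e2 8 (by simp), hf1.arr 7 (by simp), hf1.arr 8 (by simp)]
    exact hW
  rintro k3 t3 ⟨hk3, hf3, hC, hR, hW'⟩
  have a0 : t3.arr 0 = t1.arr 0 := by rw [hf3.arr 0 (by simp), e2 0 (by simp)]
  rw [hf1.arr 9 (by simp)] at hk2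
  refine ⟨?_, ?_, ?_, ?_, ?_, hR, hW'⟩
  · rw [hf3.arr 9 (by simp)]
    omega
  · exact ((hf1.mono (by simp)).trans (hf2.mono (by simp))).trans (hf3.mono (by simp))
  · rw [a0, hf3.arr 1 (by simp), hf3.arr 2 (by simp), e2 1 (by simp), e2 2 (by simp)]
    exact hg1
  · rw [a0, hf3.arr 9 (by simp), hf3.arr 14 (by simp), hf3.arr 10 (by simp)]
    exact hl2
  · rw [hf3.arr 0 (by simp)]; exact hC

end

/-! ### One complete update -/

section

variable {E : Env} {K : Par} {c : Core} {t : St}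

theorem Good.congr {n : ℕ} {τ τ' : Finset (Fin n) → ℕ} {T P Z : ℕ → ℕ} {X : Finset (Fin n)}
    (h : Good τ T P Z X) (he : τ' X = τ X) : Good τ' T P Z X :=
  ⟨fun v hv => (h.T v hv).trans he.symm, by rw [he]; exact h.Z, by rw [he]; exact h.P⟩

theorem ListRep.length_le {n : ℕ} {H N : ℕ → ℕ} {W : ℕ → List ℕ} (h : ListRep n H N W) (q : ℕ) :
    (W q).length ≤ n := by
  have h1 : (W q).toFinset ⊆ Finset.range n := fun v hv =>
    Finset.mem_range.2 (h.lt q v (List.mem_toFinset.1 hv))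
  have h2 := Finset.card_le_card h1
  rwa [List.toFinset_card_of_nodup (h.nodup q), Finset.card_range] at h2

/-- The state between two updates, or before the work list is processed. -/
structure Stage (E : Env) (K : Par) (τ : Finset (Fin E.n) → ℕ)
    (Q : Finpartition (Finset.univ : Finset (Fin E.n))) (c : Core) (t : St) : Prop where
  holds : Holds E K c t
  valid : Valid E.n K.r K.M (fun _ => False) c
  trees : Trees E K c t
  good : ∀ X ∈ Q.parts, Good τ c.T c.P c.Z X

theorem Tr.finish {τ : Finset (Fin E.n) → ℕ} {Q : Finpartition (Finset.univ : Finset (Fin E.n))}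
    (hs : Setup E K) (h : Stage E K τ Q c t) :
    Tr E Cmd.main t (fun l t' => Keep t t' ∧ ∃ c', Stage E K τ Q c' t' ∧ c'.W 0 = [] ∧
      c'.w = c.w ∧ l + 1000 * c'.pot E.n K.M ≤ 1000 * c.pot E.n K.M + 20) := by
  refine (Tr.main hs.toFits h.holds h.valid).mono ?_
  rintro l t' ⟨hk, c', hsame, hh, hv, hW, hl⟩
  refine ⟨hk, c', ⟨hh, hv, fun d hd => ?_, fun X hX => ?_⟩, hW, hsame.w, hl⟩
  · rw [hsame.T, hsame.w, hk.arr 9 (by omega), hk.arr 14 (by omega), hk.arr 10 (by omega)]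
    exact h.trees d hd
  · rw [hsame.T, hsame.P, hsame.Z]; exact h.good X hX

theorem IsATO.good_old {n : ℕ} {G : DecrementalGraph n} {η : ℚ} {A : DynamicOrder n}
    (hA : IsATO G η A) {s : ℕ} (hs : s < G.numUpdates) {T P Z : ℕ → ℕ}
    (hg : ∀ X ∈ (A.part s).parts, Good (A.τ s) T P Z X) {X : Finset (Fin n)}
    (hX : X ∈ (A.part (s + 1)).parts) (hn : X ∉ A.newSets (s + 1)) :
    Good (A.τ (s + 1)) T P Z X := by
  have hX' : X ∈ (A.part s).parts := by
    by_contra hc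
    exact hn (Finset.mem_sdiff.2 ⟨hX, hc⟩)
  exact (hg X hX').congr (hA.τ_eq hs hX' hX)

/-- The abstract step is `Valid.split`. The term 6510 n consists of 510 n steps and of 1000 times
the potential increase 6 n. -/
theorem Tr.advance {G : DecrementalGraph E.n} {η : ℚ} {A : DynamicOrder E.n} (hA : IsATO G η A)
    {s : ℕ} (hsu : s < G.numUpdates) {L : List (List (Fin E.n))}
    (hL : Announces (A.newSets (s + 1)) L) (hs : Setup E K) (hlen : E.inp.length + 3 < E.V)
    (h : Stage E K (A.τ s) (A.part s) c t) (hd : E.inp.drop (t.reg 9 + 1) =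
      L.flatMap (encodeSet (A.τ (s + 1)))) (h9 : t.reg 9 < E.inp.length)
    (h16 : t.reg 16 = L.length) :
    Tr E Cmd.prepare t (fun l t' => ∃ c', Stage E K (A.τ (s + 1)) (A.part (s + 1)) c' t' ∧
      c'.w = c.w ∧ (∀ x < 16, t'.reg x = t.reg x) ∧
      l + 1000 * c'.pot E.n K.M + price E.n * stale E.n K.h (t'.arr 9) ≤
        1000 * c.pot E.n K.M + price E.n * stale E.n K.h (t.arr 9) +
          (K.h * (E.n * 380 + 120) + E.n * 6510 + 200)) := by
  have hC := h.holds
  have hV := h.valid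
  have hgd := h.good
  have hI := hA.intervals (s := s + 1) (by omega)
  have hI0 := hA.intervals (s := s) (by omega)
  have href : ∀ T P Z, (∀ X ∈ (A.part (s + 1)).parts, Good (A.τ (s + 1)) T P Z X) →
      ∀ u < E.n, ∀ v < E.n, T u = T v → c.T u = c.T v := by
    intro T P Z hg u hu v hv he
    have h1 := (hI.T_eq_iff hg ⟨u, hu⟩ ⟨v, hv⟩).1 he
    exact (hI0.T_eq_iff hgd ⟨u, hu⟩ ⟨v, hv⟩).2 (hA.part_eq hsu h1)
  refine (Tr.prepare (w := c.w) (W := c.W) hs hlen hd h9 hC.h h16 hL Finset.sdiff_subset hI ?_ ?_ ?_ hC.W).mono ?_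
  · intro X hX hn
    rw [hC.T, hC.P, hC.Z]
    exact hA.good_old hsu hgd hX hn
  · intro T
    -- The leaves are single vertices, so level 0 does not depend on the partition.
    have h0 := h.trees 0 (by omega)
    refine ⟨fun u hu => ?_, fun h => absurd rfl h, fun u hu _ v hv => ?_⟩
    · rw [h0.nm u hu, nmin_zero hu, nmin_zero hu]
    · rw [h0.val u hu (nmin_zero hu) v hv, wmin_zero hu, wmin_zero hu]
  · intro T P Z hg d hd
    exact (h.trees (d + 1) (by omega)).outdated (href T P Z hg)
  rintro l t' ⟨hl, hfr, hg, htr, h5, h6, W', hW', hW0, hWq⟩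
  have hint : ∀ v < E.n, c.T v ≤ t'.arr 0 v ∧
      t'.arr 0 v + t'.arr 2 (t'.arr 0 v) ≤ c.T v + c.Z (c.T v) := by
    intro v hv
    have g1 := hg _ (part_mem (A.part (s + 1)) ⟨v, hv⟩)
    have g0 := hgd _ (part_mem (A.part s) ⟨v, hv⟩)
    have := hA.nested hsu (part_mem (A.part s) ⟨v, hv⟩) (part_mem (A.part (s + 1)) ⟨v, hv⟩)
      (hA.part_subset hsu _)
    rw [g1.T _ (self_mem_part _ ⟨v, hv⟩), g0.T _ (self_mem_part _ ⟨v, hv⟩), g1.Z, g0.Z]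
    exact this
  have hlay := hI.layout hg
  refine ⟨⟨t'.arr 0, t'.arr 1, t'.arr 2, c.L, c.X, t'.arr 5, t'.arr 6, W', c.w,
    rootMin E.n K.h t'⟩, ⟨?_, ?_, htr, hg⟩, rfl, hfr.reg, ?_⟩
  · exact {
      r := (hfr.reg 1 (by omega)).trans hC.r
      M := (hfr.reg 2 (by omega)).trans hC.M
      h := (hfr.reg 3 (by omega)).trans hC.h
      ka := (hfr.reg 4 (by omega)).trans hC.ka
      kb := (hfr.reg 5 (by omega)).trans hC.kb
      kc := (hfr.reg 6 (by omega)).trans hC.kc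
      T := rfl
      P := rfl
      Z := rfl
      L := (hfr.arr 3 (by simp)).trans hC.L
      X := (hfr.arr 4 (by simp)).trans hC.X
      C := rfl
      R := rfl
      W := hW'
      m := fun a v => rfl
      low := fun k hk => by rw [hfr.arr 11 (by simp)]; exact hC.low k hk
      out := fun v hv => by rw [hfr.out]; exact hC.out v hv }
  · exact hV.split hs.r_lt rfl rfl rfl h5 h6 hW0 hlay
      ((htr K.h le_rfl).minSpec hs.le_pow hlay) (href _ _ _ hg) hint
  · have := hV.pot_split (M := K.M) (c' := ⟨t'.arr 0, t'.arr 1, t'.arr 2, c.L, c.X, t'.arr 5,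
      t'.arr 6, W', c.w, rootMin E.n K.h t'⟩) rfl rfl (hW'.length_le 0) (by
        unfold entries
        exact Finset.sum_congr rfl fun q _ => congrArg List.length (hWq _ (by omega))) hint
    omega

/-- The state after the preprocessing or an update. -/
structure Store (E : Env) (K : Par) (gn gd : ℕ) (G : DecrementalGraph E.n) (A : DynamicOrder E.n)
    (s : ℕ) (c : Core) (t : St) : Prop extends Stage E K (A.τ s) (A.part s) c t where
  idle : c.W 0 = []
  num : t.reg 7 = gn
  den : t.reg 8 = gd
  weight : ∀ u v : Fin E.n, c.w u v = roundWeight K.M gn gd (encodeWeight (G.weight s u v))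

/-- The program for an update. -/
def Cmd.update : Cmd := reweigh ;; .set 9 3 ;; post

theorem Holds.setReg (hC : Holds E K c t) {x : ℕ} (v : ℕ) (hx : 7 ≤ x) :
    Holds E K c (t.setReg x v) :=
  have key : ∀ y < 7, (t.setReg x v).reg y = t.reg y := fun y hy => by
    rw [St.setReg_reg, if_neg (by omega)]
  { r := (key 1 (by omega)).trans hC.r
    M := (key 2 (by omega)).trans hC.M
    h := (key 3 (by omega)).trans hC.h
    ka := (key 4 (by omega)).trans hC.ka
    kb := (key 5 (by omega)).trans hC.kb
    kc := (key 6 (by omega)).trans hC.kc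
    T := hC.T, P := hC.P, Z := hC.Z, L := hC.L, X := hC.X, C := hC.C, R := hC.R, W := hC.W
    m := hC.m, low := hC.low, out := hC.out }

theorem Stage.setReg {τ : Finset (Fin E.n) → ℕ} {Q : Finpartition (Finset.univ : Finset (Fin E.n))}
    (h : Stage E K τ Q c t) {x : ℕ} (v : ℕ) (hx : 7 ≤ x) : Stage E K τ Q c (t.setReg x v) :=
  ⟨h.holds.setReg v hx, h.valid, h.trees, h.good⟩

theorem encodeWeight_pos {x : ℕ∞} (h : 1 ≤ x) (hx : x ≠ ⊤) : 0 < encodeWeight x :=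
  ENat.toNat_pos (by rintro rfl; simp at h) hx

/-- The weight change is processed under the old partition, then the refinement, and finally the
work list is emptied. The expensive term appears only when new sets are announced, which happens at
most n times. -/
theorem Tr.update {G : DecrementalGraph E.n} {η : ℚ} {A : DynamicOrder E.n} (hA : IsATO G η A)
    {s gn gd : ℕ} (hsu : s < G.numUpdates) {L : ℕ → List (List (Fin E.n))}
    (hL : Announces (A.newSets (s + 1)) (L (s + 1))) (hs : Setup E K)
    (hlen : E.inp.length + 3 < E.V) (hn : 0 < gn) (hinp : E.inp = updateInput G A L s)
    (h : Store E K gn gd G A s c t) :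
    Tr E Cmd.update t (fun l t' => ∃ c', Store E K gn gd G A (s + 1) c' t' ∧
      l + 1000 * c'.pot E.n K.M + price E.n * stale E.n K.h (t'.arr 9) ≤
        1000 * c.pot E.n K.M + price E.n * stale E.n K.h (t.arr 9) + (K.h * 300 + 6000) +
          if (A.newSets (s + 1)).Nonempty then K.h * (E.n * 380 + 120) + E.n * 6510 + 200
          else 0) := by
  rcases he : G.edge s with ⟨u, v⟩
  have hfl := hs.lt
  set x := encodeWeight (G.weight (s + 1) u v) with hx
  have hi : E.inp = [(u : ℕ), (v : ℕ), x] ++ encodeSets (A.τ (s + 1)) (L (s + 1)) := by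
    rw [hinp, updateInput, he]
  let w' : ℕ → ℕ → ℕ := fun y z => if (y, z) = ((u : ℕ), (v : ℕ)) then roundWeight K.M gn gd x
    else c.w y z
  have hlt := G.weight_edge_lt s hsu
  rw [he] at hlt
  refine Tr.seq ((Tr.reweigh (u := u) (v := v) (x := x) (w' := w') hs h.holds h.valid h.trees hn
    h.num h.den u.2 v.2 (by rw [hi]; rfl) (by rw [hi]; rfl) (by rw [hi]; rfl) (if_pos rfl)
    (fun y z hne => (if_neg hne).symm) ?_).mono ?_)
  · simp only [w', if_true, h.weight]
    have hx0 := encodeWeight_pos (G.one_le_weight s (by omega) u v) hlt.ne_top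
    rcases eq_or_ne (G.weight (s + 1) u v) ⊤ with htop | htop
    · have : x = 0 := by rw [hx, htop]; rfl
      rw [this, roundWeight_zero]
      exact roundWeight_le hn
    · exact roundWeight_mono hn hx0 (ENat.toNat_le_toNat hlt.le htop)
  rintro k1 t1 ⟨hk1, g7, g8, g9, c1, hC1, hV1, hT1, eT, eP, eZ, ew, hp1⟩
  refine Tr.seq ((Tr.set_num (k := 3) (by decide)).mono ?_)
  rintro k2 t2 ⟨hk2, rfl⟩
  have hd : E.inp.drop 3 = (L (s + 1)).length ::
      (L (s + 1)).flatMap (encodeSet (A.τ (s + 1))) := by rw [hi]; rfl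
  obtain ⟨d1, d2, d3⟩ := List.getD_of_drop hd
  refine Tr.seq ((Tr.of_wp (Q := fun t' => t' = (t1.setReg 9 3).setReg 16 (L (s + 1)).length)
    (by decide) ?_).mono ?_)
  · simp only [Cmd.wp, Ex.eval_r, St.setReg_reg, if_true, d1]
  rintro k3 t3 ⟨hk3, rfl⟩
  have hk3' : k3 ≤ 10 := hk3.trans (by decide)
  have hw1 : ∀ y z : Fin E.n, c1.w y z =
      roundWeight K.M gn gd (encodeWeight (G.weight (s + 1) y z)) := by
    intro y z
    rw [ew]
    by_cases hyz : (y, z) = (u, v)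
    · obtain ⟨rfl, rfl⟩ := Prod.mk.inj hyz
      exact if_pos rfl
    · have h1 : ((y : ℕ), (z : ℕ)) ≠ ((u : ℕ), (v : ℕ)) := fun h => by
        obtain ⟨h1, h2⟩ := Prod.mk.inj h
        exact hyz (by rw [Fin.ext h1, Fin.ext h2])
      simp only [w', if_neg h1, h.weight]
      rw [G.weight_eq s hsu y z (by rw [he]; exact hyz)]
  have hg1 : ∀ X ∈ (A.part s).parts, Good (A.τ s) c1.T c1.P c1.Z X := by
    rw [eT, eP, eZ]; exact h.good
  have hS : Stage E K (A.τ s) (A.part s) c1 ((t1.setReg 9 3).setReg 16 (L (s + 1)).length) :=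
    (Stage.setReg ⟨hC1, hV1, hT1, hg1⟩ _ (by omega)).setReg _ (by omega)
  have h7 : ((t1.setReg 9 3).setReg 16 (L (s + 1)).length).reg 7 = gn := by simpa using g7
  have h8 : ((t1.setReg 9 3).setReg 16 (L (s + 1)).length).reg 8 = gd := by simpa using g8
  have h9 : ((t1.setReg 9 3).setReg 16 (L (s + 1)).length).arr 9 = t.arr 9 := g9
  have h9' : ((t1.setReg 9 3).setReg 16 (L (s + 1)).length).reg 9 = 3 := by simp
  have h16 : ((t1.setReg 9 3).setReg 16 (L (s + 1)).length).reg 16 = (L (s + 1)).length := by simp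
  generalize (t1.setReg 9 3).setReg 16 (L (s + 1)).length = t2 at *
  have fin : ∀ {t3 : St} {c3 : Core} {b k : ℕ}, Stage E K (A.τ (s + 1)) (A.part (s + 1)) c3 t3 →
      c3.w = c1.w → (∀ x < 16, t3.reg x = t2.reg x) →
      k + 1000 * c3.pot E.n K.M + price E.n * stale E.n K.h (t3.arr 9) ≤
        1000 * c1.pot E.n K.M + price E.n * stale E.n K.h (t2.arr 9) + b →
      Tr E Cmd.main t3 (fun l t' => ∃ c', Store E K gn gd G A (s + 1) c' t' ∧
        k + l + 1000 * c'.pot E.n K.M + price E.n * stale E.n K.h (t'.arr 9) ≤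
        1000 * c1.pot E.n K.M + price E.n * stale E.n K.h (t2.arr 9) + b + 20) := by
    intro t3 c3 b k hS3 hw3 hr3 hb
    refine (Tr.finish hs hS3).mono ?_
    rintro l t4 ⟨hk, c4, hS4, hW, hw4, hl⟩
    refine ⟨c4, ⟨hS4, hW, ?_, ?_, fun y z => ?_⟩, ?_⟩
    · rw [hk.reg 7 (by omega), hr3 7 (by omega), h7]
    · rw [hk.reg 8 (by omega), hr3 8 (by omega), h8]
    · rw [hw4, hw3, hw1]
    · rw [hk.arr 9 (by omega)]; omega
  have hlen0 := hL.length_eq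
  refine Tr.seq (Tr.ite (by decide) (by decide) (fun hlt => ?_) fun hge => ?_)
  · simp only [Ex.eval_num, Ex.eval_r, h16, hlen0] at hlt
    rw [if_pos (Finset.card_pos.1 hlt)]
    refine (Tr.advance hA hsu hL hs hlen hS (by rw [h9']; exact d2) (by rw [h9']; exact d3)
      h16).mono ?_
    rintro k4 t4 ⟨c4, hS4, hw4, hr4, hb4⟩
    refine (fin hS4 hw4 hr4 hb4).mono ?_
    rintro k5 t5 ⟨c5, hS5, hb5⟩
    rw [h9] at hb5
    have : (0 : Ex).cost + ((Ex.r 16).cost + 1) ≤ 10 := by decide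
    exact ⟨c5, hS5, by omega⟩
  · simp only [Ex.eval_num, Ex.eval_r, h16, hlen0] at hge
    have hem : A.newSets (s + 1) = ∅ := Finset.card_eq_zero.1 (by omega)
    rw [if_neg (by rw [hem]; simp)]
    refine (Tr.of_wp (Q := fun t' => t' = t2) (by decide) (by simp [Cmd.wp])).mono ?_
    rintro k4 t4 ⟨hk4, rfl⟩
    have hk4' : k4 ≤ 1 := hk4
    refine (fin (b := k4) (k := k4) ⟨hS.holds, hS.valid, hS.trees, fun X hX => hA.good_old hsu hg1 hX (by
      rw [hem]; simp)⟩ rfl (fun _ _ => rfl) (by omega)).mono ?_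
    rintro k5 t5 ⟨c5, hS5, hb5⟩
    rw [h9] at hb5
    have : (0 : Ex).cost + ((Ex.r 16).cost + 1) ≤ 10 := by decide
    exact ⟨c5, hS5, by omega⟩

end

section

/-! ### Distances -/

section Distances

variable {n : ℕ} {w : Fin n → Fin n → ℕ∞}

theorem pathWeight_append {b : Fin n} {l : List (Fin n)} : ∀ {p : List (Fin n)},
    p.getLast? = some b → pathWeight w (p ++ l) = pathWeight w p + pathWeight w (b :: l)
  | [], h => by simp at h
  | [x], h => by
    simp at h
    subst h
    simp [pathWeight]
  | x :: y :: p, h => by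
    rw [List.getLast?_cons_cons] at h
    have := pathWeight_append (l := l) h
    simp only [List.cons_append, pathWeight] at this ⊢
    rw [this, add_assoc]

theorem exists_walk (w : Fin n → Fin n → ℕ∞) (a b : Fin n) :
    ∃ p, IsWalk a b p ∧ pathWeight w p = graphDist w a b := by
  have : Nonempty {p : List (Fin n) // IsWalk a b p} := ⟨⟨[a, b], rfl, rfl⟩⟩
  obtain ⟨p, hp⟩ := ciInf_mem fun p : {p : List (Fin n) // IsWalk a b p} => pathWeight w p.1
  exact ⟨p.1, p.2, hp⟩

theorem graphDist_le {a b : Fin n} {p : List (Fin n)} (hp : IsWalk a b p) :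
    graphDist w a b ≤ pathWeight w p :=
  iInf_le (fun p : {p : List (Fin n) // IsWalk a b p} => pathWeight w p.1) ⟨p, hp⟩

theorem graphDist_edge (a b : Fin n) : graphDist w a b ≤ w a b := by
  simpa [pathWeight] using graphDist_le (w := w) (p := [a, b]) ⟨rfl, rfl⟩

theorem graphDist_triangle (a b c : Fin n) :
    graphDist w a c ≤ graphDist w a b + graphDist w b c := by
  obtain ⟨p, ⟨h1, h2⟩, h3⟩ := exists_walk w a b
  obtain ⟨p', ⟨h4, h5⟩, h6⟩ := exists_walk w b c
  rw [← h3, ← h6]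
  obtain ⟨l, rfl⟩ : ∃ l, p' = b :: l := by
    cases p' with
    | nil => simp at h4
    | cons x l => simp at h4; exact ⟨l, by rw [h4]⟩
  rw [← pathWeight_append h2]
  refine graphDist_le ⟨?_, ?_⟩
  · rw [List.head?_append, h1]; rfl
  · rw [List.getLast?_append]
    cases l with
    | nil => simp at h5; simp [h2, h5]
    | cons y l => rw [List.getLast?_cons_cons] at h5; rw [h5]; rfl

end Distances

/-! ### The estimates are correct -/

/-- The unit `gn / gd` and the constants suit the parameters. -/
structure Scale (K : Par) (gn gd : ℕ) (δ q ε η : ℚ) : Prop where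
  gn_pos : 0 < gn
  gd_pos : 0 < gd
  est : ∀ k ≤ K.M, K.est k = ⌊k * (gn / gd : ℚ) + η⌋₊ + 1
  lt_M : 2 * δ < (K.M + 1) * (gn / gd : ℚ)
  le_ε : 6 * q * δ * (gn / gd : ℚ) ≤ ε * δ
  le_δ : 6 * q * δ * (gn / gd : ℚ) ≤ δ

variable {E : Env} {K : Par} {c : Core} {t : St} {gn gd s : ℕ} {δ q ε η : ℚ}
  {G : DecrementalGraph E.n} {A : DynamicOrder E.n}

theorem le_of_roundWeight_le {M x : ℕ} (hx : roundWeight M gn gd x ≤ M) (hn : 0 < gn) (hd : 0 < gd) :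
    0 < x ∧ (x : ℚ) ≤ roundWeight M gn gd x * (gn / gd : ℚ) := by
  unfold roundWeight at hx ⊢
  split_ifs at hx ⊢ with h1 h2
  · omega
  · refine ⟨h1, ?_⟩
    rw [← mul_div_assoc, le_div_iff₀ (by exact_mod_cast hd)]
    have h3 := Nat.lt_mul_div_succ (x * gd + gn - 1) hn
    rw [Nat.mul_succ, mul_comm gn] at h3
    exact_mod_cast (by omega : x * gd ≤ (x * gd + gn - 1) / gn * gn)
  · omega

theorem roundWeight_mul_le {M x : ℕ} (hx : 0 < x) (hn : 0 < gn) (hd : 0 < gd) :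
    (roundWeight M gn gd x : ℚ) * (gn / gd : ℚ) ≤ x + (gn / gd : ℚ) := by
  have hd' : (0 : ℚ) < gd := by exact_mod_cast hd
  rw [← mul_div_assoc, div_le_iff₀ hd', add_mul, div_mul_cancel₀ _ hd'.ne']
  have : roundWeight M gn gd x * gn ≤ x * gd + gn := by
    simp only [roundWeight, if_pos hx]
    split_ifs with h2
    · omega
    · have := Nat.div_mul_le_self (x * gd + gn - 1) gn
      omega
  exact_mod_cast this

/-- Induction along supporting edges. The diameters are charged to the number of vertices with label
at most l: the part of v has label l and is disjoint from everything counted for the smaller label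
of the supporting vertex. -/
theorem Store.dist_le (hA : IsATO G η A) (hη : 0 ≤ η) (hs : s ≤ G.numUpdates)
    (h : Store E K gn gd G A s c t) (hsc : Scale K gn gd δ q ε η) {r : Fin E.n} (hr : K.r = r) :
    ∀ l ≤ K.M, ∀ v : Fin E.n, c.L v = l → ∃ d : ℕ, graphDist (G.weight s) r v ≤ d ∧
      (d : ℚ) ≤ l * (gn / gd : ℚ) +
        (Finset.univ.filter fun u : Fin E.n => c.L u ≤ l).card * η / E.n := by
  have hI := hA.intervals hs
  have hg0 : (0 : ℚ) ≤ gn / gd := by positivity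
  intro l
  induction l using Nat.strong_induction_on with
  | _ l ih =>
  intro hlM v hv
  have hsub : (A.part s).part v ⊆ Finset.univ.filter fun u : Fin E.n => c.L u = l := by
    intro u hu
    refine Finset.mem_filter.2 ⟨Finset.mem_univ _, ?_⟩
    rw [← hv]
    exact h.valid.Lpart u u.2 v v.2 ((hI.T_eq_iff h.good u v).2 (part_eq_iff.2 hu))
  by_cases hT : c.T v = c.T r
  · have hmem : r ∈ (A.part s).part v := part_eq_iff.1 ((hI.T_eq_iff h.good r v).1 hT.symm)
    obtain ⟨d, hd1, hd2⟩ := hA.diam_le s hs _ (part_mem (A.part s) v) r hmem v (self_mem_part _ v)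
    refine ⟨d, hd1.le, hd2.trans ?_⟩
    have : ((A.part s).part v).card ≤
        (Finset.univ.filter fun u : Fin E.n => c.L u ≤ l).card :=
      Finset.card_le_card (hsub.trans fun u hu => by simp at hu ⊢; omega)
    have h2 : (0 : ℚ) ≤ l * (gn / gd : ℚ) := by positivity
    have h3 : (((A.part s).part v).card : ℚ) * η / E.n ≤
        (Finset.univ.filter fun u : Fin E.n => c.L u ≤ l).card * η / E.n := by
      gcongr
    linarith
  · obtain ⟨u, hu, v', hv', hTv', hle⟩ := h.valid.exists_support h.idle v.2 (by rwa [hr])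
      (by omega)
    have hw1 := h.valid.wpos u hu v' hv'
    obtain ⟨d, hd1, hd2⟩ := ih (c.L u) (by omega) (by omega) ⟨u, hu⟩ rfl
    have hmem : (⟨v', hv'⟩ : Fin E.n) ∈ (A.part s).part v :=
      part_eq_iff.1 ((hI.T_eq_iff h.good ⟨v', hv'⟩ v).1 hTv')
    obtain ⟨d', hd1', hd2'⟩ := hA.diam_le s hs _ (part_mem (A.part s) v) _ hmem v (self_mem_part _ v)
    have hwt := h.weight ⟨u, hu⟩ ⟨v', hv'⟩
    dsimp only at hwt
    -- A supporting edge has rounded weight at most the label, hence at most M; so it is present and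
    -- its rounding was not capped.
    obtain ⟨hx0, hx⟩ := le_of_roundWeight_le (M := K.M) (gn := gn) (gd := gd)
      (x := encodeWeight (G.weight s ⟨u, hu⟩ ⟨v', hv'⟩)) (by omega) hsc.gn_pos hsc.gd_pos
    have hfin : G.weight s ⟨u, hu⟩ ⟨v', hv'⟩ ≠ ⊤ := by
      intro he; rw [he] at hx0; simp [encodeWeight] at hx0
    rw [← hwt] at hx
    refine ⟨d + encodeWeight (G.weight s ⟨u, hu⟩ ⟨v', hv'⟩) + d', ?_, ?_⟩
    · push_cast
      rw [← hd1']
      refine (graphDist_triangle r ⟨v', hv'⟩ v).trans (add_le_add_left ?_ _)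
      refine (graphDist_triangle r ⟨u, hu⟩ ⟨v', hv'⟩).trans (add_le_add hd1 ?_)
      refine (graphDist_edge _ _).trans ?_
      rw [encodeWeight, ENat.natCast_toNat hfin]
    · push_cast
      have hcard : (Finset.univ.filter fun z : Fin E.n => c.L z ≤ c.L u).card +
          ((A.part s).part v).card ≤ (Finset.univ.filter fun z : Fin E.n => c.L z ≤ l).card := by
        rw [← Finset.card_union_of_disjoint]
        · refine Finset.card_le_card (Finset.union_subset (fun z hz => ?_) fun z hz => ?_)
          · simp at hz ⊢; omega
          · have := hsub hz
            simp at this ⊢; omega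
        · rw [Finset.disjoint_left]
          intro z hz hz'
          have := hsub hz'
          simp at hz this; omega
      have hcard' : (((Finset.univ.filter fun z : Fin E.n => c.L z ≤ c.L u).card : ℚ) +
          ((A.part s).part v).card) * η / E.n ≤
          (Finset.univ.filter fun z : Fin E.n => c.L z ≤ l).card * η / E.n := by
        have : (((Finset.univ.filter fun z : Fin E.n => c.L z ≤ c.L u).card : ℚ) +
          ((A.part s).part v).card) ≤ (Finset.univ.filter fun z : Fin E.n => c.L z ≤ l).card := by
          exact_mod_cast hcard
        gcongr
      have hlab : ((c.L u : ℚ) + c.w u v') * (gn / gd : ℚ) ≤ l * (gn / gd : ℚ) := by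
        have : (c.L u : ℚ) + c.w u v' ≤ l := by exact_mod_cast (by omega : c.L u + c.w u v' ≤ l)
        gcongr
      rw [add_mul, add_div] at hcard'
      rw [add_mul] at hlab
      linarith

/-- At most n vertices are counted, so the diameters add up to at most η. As the distance is bounded
by an integer, rounding the estimate down is safe. -/
theorem Store.lower (hA : IsATO G η A) (hη : 0 ≤ η) (hs : s ≤ G.numUpdates)
    (h : Store E K gn gd G A s c t) (hsc : Scale K gn gd δ q ε η) {r : Fin E.n} (hr : K.r = r)
    (v : Fin E.n) : graphDist (G.weight s) r v ≤ decodeEstimate (t.out v) := by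
  rw [h.holds.out v v.2]
  by_cases hL : c.L v ≤ K.M
  · obtain ⟨d, hd1, hd2⟩ := h.dist_le hA hη hs hsc hr _ hL v rfl
    rw [hsc.est _ hL]
    refine hd1.trans ?_
    change (d : ℕ∞) ≤ ((⌊_⌋₊ : ℕ) : ℕ∞)
    refine Nat.cast_le.2 (Nat.le_floor (hd2.trans (add_le_add_right ?_ _)))
    have hn : (0 : ℚ) < E.n := by exact_mod_cast (Nat.zero_le _).trans_lt v.2
    rw [div_le_iff₀ hn, mul_comm]
    have : (Finset.univ.filter fun u : Fin E.n => c.L u ≤ c.L v).card ≤ E.n :=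
      (Finset.card_filter_le _ _).trans (by simp)
    gcongr
  · have : K.est (c.L v) = 0 := if_neg hL
    rw [this]; exact le_top

/-- The factor 3 is 2 from `Valid.label_le` plus 1 for rounding the weight; the latter is covered
because an edge between different parts has difference at least 1. Edges inside a part do not change
the label at all. -/
theorem Store.label_path (h : Store E K gn gd G A s c t) (hs : s ≤ G.numUpdates)
    (hsc : Scale K gn gd δ q ε η) {b : Fin E.n} : ∀ {p : List (Fin E.n)} {a : Fin E.n} {d : ℕ},
    IsWalk a b p → pathWeight (G.weight s) p = d →
    (c.L b : ℚ) * (gn / gd : ℚ) ≤ c.L a * (gn / gd : ℚ) + d +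
      3 * topDiff (A.part s) (A.τ s) p * (gn / gd : ℚ)
  | [], a, d, hp, _ => by simp [IsWalk] at hp
  | [x], a, d, hp, _ => by
    have h1 : x = a := by simpa using hp.1
    have h2 : x = b := by simpa using hp.2
    subst h1 h2
    simp [topDiff]
  | x :: y :: p, a, d, hp, hd => by
    have hg0 : (0 : ℚ) ≤ gn / gd := by positivity
    have h1 : x = a := by simpa using hp.1
    subst h1
    have hp2 : IsWalk y b (y :: p) := ⟨rfl, by rw [← hp.2, List.getLast?_cons_cons]⟩
    rw [pathWeight] at hd
    have hfin1 : G.weight s x y ≠ ⊤ := fun he => by rw [he, top_add] at hd; simp at hd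
    have hfin2 : pathWeight (G.weight s) (y :: p) ≠ ⊤ := fun he => by
      rw [he, add_top] at hd; simp at hd
    obtain ⟨d1, hd1⟩ := ENat.ne_top_iff_exists.1 hfin1
    obtain ⟨d2, hd2⟩ := ENat.ne_top_iff_exists.1 hfin2
    have ih := h.label_path hs hsc hp2 hd2.symm
    have hdd : d1 + d2 = d := by rw [← hd1, ← hd2] at hd; exact_mod_cast hd
    have hdq : (d : ℚ) = d1 + d2 := by exact_mod_cast hdd.symm
    rw [topDiff, hdq]
    push_cast
    set D := ((A.τ s ((A.part s).part x) : ℤ) - (A.τ s ((A.part s).part y) : ℤ)).natAbs with hD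
    rw [← Good.T_part h.good x, ← Good.T_part h.good y] at hD
    have key : (c.L y : ℚ) * (gn / gd : ℚ) ≤ c.L x * (gn / gd : ℚ) + d1 +
        3 * D * (gn / gd : ℚ) := by
      by_cases hT : c.T x = c.T y
      · rw [h.valid.Lpart x x.2 y y.2 hT]
        have : (0 : ℚ) ≤ 3 * D * (gn / gd : ℚ) := by positivity
        have : (0 : ℚ) ≤ d1 := by positivity
        linarith
      · have h3 := h.valid.label_le x.2 y.2 hT
        have h4 : c.L y ≤ c.L x + c.w x y + 2 * D := by omega
        have h5 : 1 ≤ D := by omega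
        have h6 : (c.L y : ℚ) ≤ c.L x + c.w x y + 2 * D := by exact_mod_cast h4
        have h7 := mul_le_mul_of_nonneg_right h6 hg0
        have h8 := roundWeight_mul_le (M := K.M) (gn := gn) (gd := gd)
          (encodeWeight_pos (G.one_le_weight s hs x y) hfin1) hsc.gn_pos hsc.gd_pos
        rw [← h.weight, encodeWeight, ← hd1] at h8
        have h9 : (1 : ℚ) ≤ D := by exact_mod_cast h5
        have h10 := mul_le_mul_of_nonneg_right h9 hg0
        simp only [ENat.toNat_natCast] at h8
        rw [add_mul, add_mul] at h7
        linarith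
    linarith

/-- The bound n ≤ δ q turns 3 (q δ + n) into 6 q δ. The excess is at most δ, which keeps the label
finite, and at most ε δ, which is the claimed error. -/
theorem Store.upper (h : Store E K gn gd G A s c t) (hs : s ≤ G.numUpdates)
    (hsc : Scale K gn gd δ q ε η) (hη : 0 ≤ η) (hnδ : (E.n : ℚ) ≤ δ * q) {r : Fin E.n} (hr : K.r = r)
    {v : Fin E.n} {d : ℕ} (hd : graphDist (G.weight s) r v = d) (hdδ : (d : ℚ) ≤ δ)
    {p : List (Fin E.n)} (hp : IsShortestPath (G.weight s) r v p)
    (hT : (topDiff (A.part s) (A.τ s) p : ℚ) ≤ q * δ + E.n) :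
    ∃ e : ℕ, decodeEstimate (t.out v) = e ∧ (e : ℚ) ≤ d + η + ε * δ := by
  have hg0 : (0 : ℚ) < gn / gd := by
    have h1 : (0 : ℚ) < gn := by exact_mod_cast hsc.gn_pos
    have h2 : (0 : ℚ) < gd := by exact_mod_cast hsc.gd_pos
    positivity
  have h1 := h.label_path hs hsc hp.1 (hp.2.1.trans hd)
  have h2 : c.L r = 0 := h.valid.Lsrc r r.2 (by rw [hr])
  have h3 : 3 * (topDiff (A.part s) (A.τ s) p : ℚ) * (gn / gd : ℚ) ≤
      6 * q * δ * (gn / gd : ℚ) := by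
    refine mul_le_mul_of_nonneg_right ?_ hg0.le
    linarith
  rw [h2] at h1
  have h4 := hsc.le_δ
  have h5 := hsc.lt_M
  have h6 := hsc.le_ε
  have hL : c.L v ≤ K.M := by
    have h7 : (c.L v : ℚ) * (gn / gd : ℚ) < (K.M + 1) * (gn / gd : ℚ) := by
      push_cast at h1
      linarith
    have := lt_of_mul_lt_mul_right h7 hg0.le
    exact Nat.lt_succ_iff.1 (by exact_mod_cast this)
  refine ⟨⌊c.L v * (gn / gd : ℚ) + η⌋₊, ?_, ?_⟩
  · rw [h.holds.out v v.2, hsc.est _ hL]; rfl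
  · refine (Nat.floor_le (by positivity)).trans ?_
    push_cast at h1
    linarith

end

section

/-! ### The preprocessing -/

namespace Cmd

/-- Reads the parameters and computes the constants. -/
def readPars : Cmd :=
  .inp 1 1 ;; .inp 20 2 ;; .inp 21 3 ;; .inp 22 4 ;; .inp 23 5 ;; .inp 24 6 ;; .inp 25 7 ;;
  .inp 26 8 ;; .inp 27 9 ;; .ite (.r 25) (.r 24) (.set 24 1 ;; .set 25 1) .skip ;;
  .set 7 (.r 24 * .r 23) ;; .set 8 (6 * .r 25 * .r 22) ;;
  .set 2 ((2 * .r 20 * .r 8) / (.r 21 * .r 7)) ;;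
  .set 4 (.r 7 * .r 27) ;; .set 5 (.r 26 * .r 8) ;; .set 6 (.r 8 * .r 27)

/-- The depth of the trees. -/
def depth : Cmd :=
  (.set 3 0 ;; .set 16 1) ;; .wh (.r 16) (.r 0) (.set 16 (.r 16 + .r 16) ;; .set 3 (.r 3 + 1))

/-- The table of the largest powers of two that divide the labels. -/
def lowTable : Cmd :=
  (.set 16 (.r 2 + 2) ;; .set 17 1) ;;
  .for 17 16 (.set 18 (.r 17 / 2) ;;
    .ite (.r 18 + .r 18) (.r 17) (.put 11 (.r 17) 1) (.put 11 (.r 17) (2 * .ld 11 (.r 18))))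

/-- The rounded weights, as the lowest level of the trees. -/
def weights : Cmd :=
  (.set 16 (.r 0 * .r 0) ;; .set 17 0) ;;
  .for 17 16 (.inp 28 (.r 17 + 10) ;; round ;; .put 10 (.r 17) (.r 29))

/-- The estimates for the label `0`. -/
def clear : Cmd :=
  .set 17 0 ;; .for 17 0 (.put 9 (.r 17) (.r 17 + 1) ;; .outp (.r 17) (.r 5 / .r 6 + 1))

/-- Reads everything except for the partition. -/
def read : Cmd := readPars ;; depth ;; lowTable ;; weights ;; clear

/-- The program for the preprocessing. -/
def init : Cmd := read ;; (.set 9 (.r 0 * .r 0 + 10) ;; .inp 16 (.r 9)) ;; prepare ;; main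

end Cmd

variable {E : Env} {t : St}

theorem Tr.readPars {r dn dd qn qd en ed hn hd en' ed' gn gd M : ℕ}
    (h1 : E.inp.getD 1 0 = r) (h2 : E.inp.getD 2 0 = dn) (h3 : E.inp.getD 3 0 = dd)
    (h4 : E.inp.getD 4 0 = qn) (h5 : E.inp.getD 5 0 = qd) (h6 : E.inp.getD 6 0 = en)
    (h7 : E.inp.getD 7 0 = ed) (h8 : E.inp.getD 8 0 = hn) (h9 : E.inp.getD 9 0 = hd)
    (hen : (if ed < en then 1 else en) = en') (hed : (if ed < en then 1 else ed) = ed')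
    (hgn : en' * qd = gn) (hgd : 6 * ed' * qn = gd) (hM : 2 * dn * gd / (dd * gn) = M)
    (bgn : gn < E.V) (bgd : gd < E.V) (bM : M < E.V) (ba : gn * hd < E.V) (bb : hn * gd < E.V)
    (bc : gd * hd < E.V) :
    Tr E Cmd.readPars t (fun k t' => k ≤ 300 ∧ t'.out = t.out ∧ t'.arr = t.arr ∧
      t'.reg 0 = t.reg 0 ∧ t'.reg 1 = r ∧ t'.reg 2 = M ∧ t'.reg 4 = gn * hd ∧
      t'.reg 5 = hn * gd ∧ t'.reg 6 = gd * hd ∧ t'.reg 7 = gn ∧ t'.reg 8 = gd) := by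
  refine (Tr.of_wp (Q := fun t' => t'.out = t.out ∧ t'.arr = t.arr ∧
      t'.reg 0 = t.reg 0 ∧ t'.reg 1 = r ∧ t'.reg 2 = M ∧ t'.reg 4 = gn * hd ∧
      t'.reg 5 = hn * gd ∧ t'.reg 6 = gd * hd ∧ t'.reg 7 = gn ∧ t'.reg 8 = gd) (by decide)
      ?_).mono fun k t' h => ⟨h.1.trans (by decide), h.2⟩
  simp only [Cmd.readPars, Cmd.wp, Ex.eval_r, Ex.eval_num, Ex.eval_mul, Ex.eval_div, St.setReg_reg, Ex.leaf_num,
    Ex.leaf_mul, Ex.leaf_div, h1, h2, h3, h4, h5, h6, h7, h8, h9, true_or, true_and, St.setReg_out, St.setReg_arr]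
  norm_num
  refine ⟨fun hlt => ?_, fun hge => ?_⟩
  · rw [if_pos hlt] at hen hed
    subst hen hed
    rw [one_mul] at hgn
    rw [mul_one] at hgd
    subst hgn hgd
    rw [hM]
    exact ⟨bgn, bgd, bM, ba, bb, bc, by simp⟩
  · rw [if_neg (by omega)] at hen hed
    subst hen hed hgn hgd
    rw [hM]
    exact ⟨bgn, bgd, bM, ba, bb, bc, by simp⟩

theorem Tr.depth {n : ℕ} (hn : 2 ≤ n) (h0 : t.reg 0 = n) (hV : 2 * n < E.V) :
    Tr E Cmd.depth t (fun k t' => k ≤ n * 40 + 30 ∧ t'.out = t.out ∧ t'.arr = t.arr ∧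
      Regs [3, 16] t t' ∧ n ≤ 2 ^ t'.reg 3 ∧ 2 ^ t'.reg 3 < 2 * n) := by
  refine Tr.seq ((Tr.of_wp (Q := fun t' => t' = (t.setReg 3 0).setReg 16 1) (by decide)
    (by simp [Cmd.wp])).mono ?_)
  rintro k1 t1 ⟨hk1, rfl⟩
  have hk1' : k1 ≤ 10 := hk1.trans (by decide)
  refine (Tr.wh (γ := ℕ) (e := .r 16) (f := .r 0) (p := .set 16 (.r 16 + .r 16) ;;
    .set 3 (.r 3 + 1)) (t := (t.setReg 3 0).setReg 16 1)
    (Inv := fun h t' => t'.out = t.out ∧ t'.arr = t.arr ∧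
    Regs [3, 16] t t' ∧ t'.reg 3 = h ∧ t'.reg 16 = 2 ^ h ∧ 2 ^ h < 2 * n)
    (Φ := fun h => (n - h) * 40) (by decide) (by decide) ?_ (g := 0)
    ⟨rfl, rfl, ((Regs.refl _ _).setReg _ (by simp)).setReg _ (by simp), by simp, by simp, by omega⟩).mono ?_
  · rintro h t1 ⟨ho, ha, hr, g3, g16, hlt⟩ hc
    have g0 : t1.reg 0 = n := (hr 0 (by simp)).trans h0
    simp only [Ex.eval_r, g16, g0] at hc
    have hh : h < 2 ^ h := Nat.lt_two_pow_self
    refine (Tr.of_wp (Q := fun t' => t' = (t1.setReg 16 (2 ^ (h + 1))).setReg 3 (h + 1))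
      (by decide) ?_).mono ?_
    · simp only [Cmd.wp, Ex.eval_r, Ex.eval_add, Ex.eval_num, St.setReg_reg, g16]
      norm_num [g3, pow_succ]
      refine ⟨by omega, by omega, by congr 2; omega⟩
    · rintro k t' ⟨hk, rfl⟩
      have hk' : k ≤ 20 := hk.trans (by decide)
      have hcost : (Ex.r 16).cost + (Ex.r 0).cost + 1 ≤ 10 := by decide
      refine ⟨h + 1, ⟨ho, ha, (hr.setReg _ (by simp)).setReg _ (by simp), by simp, by simp, ?_⟩, ?_⟩
      · rw [pow_succ]; omega
      · have : n - h = (n - (h + 1)) + 1 := by omega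
        omega
  · rintro k t' ⟨h, ⟨ho, ha, hr, g3, g16, hlt⟩, hc, hk⟩
    have g0 : t'.reg 0 = n := (hr 0 (by simp)).trans h0
    simp only [Ex.eval_r, g16, g0] at hc
    have hcost : (Ex.r 16).cost + (Ex.r 0).cost + 1 ≤ 10 := by decide
    refine ⟨by omega, ho, ha, hr, by rw [g3]; exact hc, by rw [g3]; exact hlt⟩

/-- The recursion of `low` looks up half of the index, which has been tabulated before. -/
theorem Tr.lowTable {M : ℕ} (h2 : t.reg 2 = M) (hM : M + 2 < E.V) (h11 : t.arr 11 0 = 0) :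
    Tr E Cmd.lowTable t (fun k t' => k ≤ M * 80 + 130 ∧ Frame [11] t t' ∧
      ∀ k ≤ M + 1, t'.arr 11 k = low k) := by
  refine Tr.seq ((Tr.of_wp (Q := fun t' => t' = (t.setReg 16 (M + 2)).setReg 17 1) (by decide)
    (by simp [Cmd.wp, h2, hM])).mono ?_)
  rintro k1 t1 ⟨hk1, rfl⟩
  have hk1' : k1 ≤ 20 := hk1.trans (by decide)
  refine (Tr.for (I := fun i t' => 1 ≤ i ∧ Frame [11] t t' ∧ ∀ k < i, t'.arr 11 k = low k)
    (Ψ := fun _ => 0) (c := 60) (N := M + 2)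
    (by omega) (by omega) (by omega) (by omega) hM ?_ ?_ (fun _ _ => rfl) ?_ (by simp)
    (by simp)).mono ?_
  · rintro i hi t1 ⟨hi1, hfr, hlow⟩ g17 g16
    refine (Tr.of_wp (Q := fun t' => t' = (t1.setReg 18 (i / 2)).setArr 11 i (low i))
      (by decide) ?_).mono ?_
    · have hl := low_le i
      have hlt : i / 2 < i := by omega
      have e := hlow (i / 2) hlt
      simp only [Cmd.wp, Ex.eval_r, Ex.eval_add, Ex.eval_div, Ex.eval_mul, Ex.eval_ld, Ex.eval_num,
        St.setReg_reg, g17]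
      norm_num [e, g17]
      refine ⟨by omega, fun h => ?_, fun h => ?_⟩
      · rw [low_odd (by omega)]
      · rw [← low_even (by omega : i % 2 = 0)]
        exact ⟨by omega, rfl⟩
    · rintro k t' ⟨hk, rfl⟩
      refine ⟨⟨by omega, (hfr.setReg _ (by omega)).setArr _ _ (by simp), fun k hk => ?_⟩,
        by simp [g17], by simp [g16], hk.trans (by decide)⟩
      by_cases hki : k = i
      · subst hki; simp
      · simpa [hki] using hlow k (by omega)
  · rintro i t1 ⟨hi1, hfr, hlow⟩
    exact ⟨hi1, hfr.setReg _ (by omega), hlow⟩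
  · refine ⟨by simp, ((Frame.refl _ t).setReg _ (by omega)).setReg _ (by omega), fun k hk => ?_⟩
    have : k = 0 := by simp at hk; omega
    subst this
    rw [low_zero]; exact h11
  · rintro k t' ⟨⟨-, hfr, hlow⟩, -, -, hk⟩
    simp at hk
    exact ⟨by omega, hfr, fun k hk => hlow k (by omega)⟩

theorem Tr.weights {K : Par} {n gn gd : ℕ} (hn : 0 < gn) (h0 : t.reg 0 = n) (h2 : t.reg 2 = K.M)
    (h7 : t.reg 7 = gn) (h8 : t.reg 8 = gd) (hM : K.M + 1 < E.V) (hV : n * n + 10 < E.V) :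
    Tr E Cmd.weights t (fun k t' => k ≤ n * n * 100 + 30 ∧ Frame [10] t t' ∧
      ∀ j < n * n, t'.arr 10 j = roundWeight K.M gn gd (E.inp.getD (j + 10) 0)) := by
  refine Tr.seq ((Tr.of_wp (Q := fun t' => t' = (t.setReg 16 (n * n)).setReg 17 0) (by decide)
    (by simp [Cmd.wp, h0]; omega)).mono ?_)
  rintro k1 t1 ⟨hk1, rfl⟩
  have hk1' : k1 ≤ 20 := hk1.trans (by decide)
  refine (Tr.for (I := fun i t' => Frame [10] t t' ∧
      ∀ j < i, t'.arr 10 j = roundWeight K.M gn gd (E.inp.getD (j + 10) 0))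
    (Ψ := fun _ => 0) (c := 80) (N := n * n)
    (by omega) (by omega) (by omega) (by omega) (by omega) ?_ ?_ (fun _ _ => rfl) ?_ (by simp)
    (by simp)).mono ?_
  · rintro i hi t1 ⟨hfr, hdone⟩ g17 g16
    set x := E.inp.getD (i + 10) 0 with hx
    refine (Tr.of_wp (Q := fun t' => t' = ((t1.setReg 28 x).setReg 29
      (roundWeight K.M gn gd x)).setArr 10 i (roundWeight K.M gn gd x)) (by decide) ?_).mono ?_
    · simp only [Cmd.wp, Ex.eval_r, Ex.eval_add, Ex.eval_num, g17, ← hx]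
      refine Tr.round (K := K) (gd := gd) (x := x) hn (by simpa using (hfr.reg 2 (by omega)).trans h2)
        hM (by simpa using (hfr.reg 7 (by omega)).trans h7)
        (by simpa using (hfr.reg 8 (by omega)).trans h8) (by simp) ?_
      simp [g17]
    · rintro k t' ⟨hk, rfl⟩
      refine ⟨⟨((hfr.setReg _ (by omega)).setReg _ (by omega)).setArr _ _ (by simp),
        fun j hj => ?_⟩, by simp [g17], by simp [g16], hk.trans (by decide)⟩
      by_cases hji : j = i
      · subst hji; simp [hx]
      · simpa [hji] using hdone j (by omega)
  · rintro i t1 ⟨hfr, hdone⟩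
    exact ⟨hfr.setReg _ (by omega), hdone⟩
  · exact ⟨((Frame.refl _ t).setReg _ (by omega)).setReg _ (by omega), by simp⟩
  · rintro k t' ⟨⟨hfr, hdone⟩, -, -, hk⟩
    simp at hk
    exact ⟨by omega, hfr, hdone⟩

theorem Tr.clear {kb kc : ℕ} (h5 : t.reg 5 = kb) (h6 : t.reg 6 = kc) (hV : E.n + 1 < E.V) :
    Tr E Cmd.clear t (fun k t' => k ≤ E.n * 60 + 30 ∧ t'.reg 0 = E.n ∧
      (∀ x < 16, t'.reg x = t.reg x) ∧ (∀ a, a ≠ 9 → t'.arr a = t.arr a) ∧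
      (∀ v < E.n, t'.arr 9 v = v + 1) ∧ (∀ j, E.n ≤ j → t'.arr 9 j = t.arr 9 j) ∧
      ∀ v < E.n, t'.out v = kb / kc + 1) := by
  refine Tr.bounded fun hrb hab h0 => ?_
  refine Tr.seq ((Tr.set_num (k := 0) (by decide)).mono ?_)
  rintro k1 t1 ⟨hk1, rfl⟩
  refine (Tr.for (I := fun i t' => (∀ x < 16, t'.reg x = t.reg x) ∧
      (∀ a, a ≠ 9 → t'.arr a = t.arr a) ∧
      (∀ v < i, t'.arr 9 v = v + 1) ∧ (∀ j, E.n ≤ j → t'.arr 9 j = t.arr 9 j) ∧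
      ∀ v < i, t'.out v = kb / kc + 1)
    (Ψ := fun _ => 0) (c := 40) (N := E.n)
    (by omega) (by omega) (by omega) (by omega) (by omega) ?_ ?_ (fun _ _ => rfl) ?_ (by simp)
    (by simp [h0])).mono ?_
  · rintro i hi t1 ⟨hr, ha, h9, h9', ho⟩ g17 g0
    refine (Tr.of_wp (Q := fun t' => t' = (t1.setArr 9 i (i + 1)).setOut i (kb / kc + 1))
      (by decide) ?_).mono ?_
    · simp [Cmd.wp, g17, hr, h5, h6, hi]; omega
    · rintro k t' ⟨hk, rfl⟩
      refine ⟨⟨hr, fun a ha9 => ?_, fun v hv => ?_, fun j hj => ?_, fun v hv => ?_⟩, g17, g0,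
        hk.trans (by decide)⟩
      · simpa [ha9] using ha a ha9
      · by_cases hvi : v = i
        · subst hvi; simp
        · simpa [hvi] using h9 v (by omega)
      · have : j ≠ i := by omega
        simpa [this] using h9' j hj
      · by_cases hvi : v = i
        · subst hvi; simp
        · simpa [hvi] using ho v (by omega)
  · rintro i t1 ⟨hr, ha, h9, h9', ho⟩
    refine ⟨fun x hx => ?_, ha, h9, h9', ho⟩
    rw [St.setReg_reg, if_neg (by omega)]; exact hr x hx
  · refine ⟨fun x hx => ?_, fun _ _ => rfl, by simp, fun _ _ => rfl, by simp⟩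
    rw [St.setReg_reg, if_neg (by omega)]
  · rintro k t' ⟨⟨hr, ha, h9, h9', ho⟩, -, g0, hk⟩
    simp at hk
    exact ⟨by omega, g0, hr, ha, h9, h9', ho⟩

end

section

/-! ### The state after the preprocessing -/

/-- With all labels and pointers 0, `scan`, `ptr` and `done` are vacuous, and the full work list
takes care of `stab`. -/
theorem Valid.init {n r M : ℕ} {c : Core} (hlay : Layout n c.T c.P c.Z)
    (hmin : MinSpec n c.T c.w c.m) (hw : ∀ u < n, ∀ v < n, 1 ≤ c.w u v) (hL : c.L = fun _ => 0)
    (hX : c.X = fun _ => 0) (hC : ∀ v < n, c.C (c.T v) = c.T v) (hR : ∀ v < n, c.R v = 0)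
    (hW : ∀ v < n, v ∈ c.W 0) : Valid n r M (fun _ => False) c where
  lay := hlay
  mins := hmin
  wpos := hw
  Lpart u _ v _ _ := by rw [hL]
  Lle v _ := by simp [hL]
  Lsrc v _ _ := by rw [hL]
  scan u _ v _ _ k hk := by simp [hL] at hk
  ptr u _ v _ _ p _ hp := by simp [hX] at hp
  cur v hv := by rw [hC v hv]; exact ⟨le_rfl, Nat.le_add_right _ _⟩
  done p hp h1 := by
    have h2 := hlay.pos p hp
    rw [hC _ h2.1] at h1
    omega
  stab v hv _ _ _ := .inl ⟨v, hW v hv, rfl⟩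
  reg v hv h1 := by rw [hR v hv] at h1; omega
  Rle v hv := by rw [hR v hv]; omega

theorem Core.pot_init {n M : ℕ} {c : Core} (hlay : Layout n c.T c.P c.Z) (hL : c.L = fun _ => 0)
    (hX : c.X = fun _ => 0) (hW0 : (c.W 0).length ≤ n) (hW : ∀ q, q ≠ 0 → c.W q = []) :
    c.pot n M ≤ 4 * (n * n) + 6 * n + n * lab n M 0 := by
  have h1 : ∑ v ∈ Finset.range n, c.φ n v ≤ n * n := by
    calc ∑ v ∈ Finset.range n, c.φ n v ≤ ∑ v ∈ Finset.range n, n :=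
          Finset.sum_le_sum fun v hv => by
            have := hlay.le v (Finset.mem_range.1 hv)
            simp only [Core.φ, Core.x0, Core.e, hL, hX, low_zero]
            omega
      _ = n * n := by simp
  have h2 : c.cnt n ≤ n := (Finset.card_filter_le _ _).trans (by simp)
  have h3 : entries n M c.W = 0 :=
    Finset.sum_eq_zero fun q _ => by rw [hW _ (by omega)]; rfl
  have h4 : ∑ v ∈ Finset.range n, (1 - c.R v) ≤ n := by
    calc ∑ v ∈ Finset.range n, (1 - c.R v) ≤ ∑ v ∈ Finset.range n, 1 :=
          Finset.sum_le_sum fun v _ => by omega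
      _ = n := by simp
  have h5 : ∑ v ∈ Finset.range n, lab n M (c.L v) = n * lab n M 0 := by simp [hL]
  unfold Core.pot
  rw [h3, h5]
  omega

theorem index_lt {n u v : ℕ} (hu : u < n) (hv : v < n) : u * n + v < n * n := by
  have := Nat.mul_le_mul_right n hu
  rw [Nat.succ_mul] at this
  omega

theorem List.length_flatMap_of_forall {α : Type*} {f : α → List ℕ} {n : ℕ}
    (hf : ∀ a, (f a).length = n) (l : List α) : (l.flatMap f).length = l.length * n := by
  induction l with
  | nil => simp
  | cons a l ih => rw [List.flatMap_cons, List.length_append, ih, hf, List.length_cons]; ring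

theorem List.getD_flatMap {α : Type*} {f : α → List ℕ} {n : ℕ} (hf : ∀ a, (f a).length = n) {j : ℕ}
    (hj : j < n) : ∀ (l : List α) (i : ℕ) (hi : i < l.length),
    (l.flatMap f).getD (i * n + j) 0 = (f l[i]).getD j 0
  | [], i, hi => by simp at hi
  | a :: l, 0, _ => by
    rw [List.flatMap_cons, zero_mul, zero_add, List.getD_append _ _ _ _ (by rw [hf]; exact hj)]
    rfl
  | a :: l, i + 1, hi => by
    rw [List.flatMap_cons, List.getD_append_right _ _ _ _ (by rw [hf]; nlinarith), hf,
      show (i + 1) * n + j - n = i * n + j by rw [Nat.succ_mul]; omega,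
      List.getD_flatMap hf hj l i (by simpa using hi)]
    rfl

/-- The unit of the labels is `min ε 1 / (6 q)`. -/
def unitNum (q ε : ℚ) : ℕ := (if ε.den < ε.num.toNat then 1 else ε.num.toNat) * q.den

def unitDen (q ε : ℚ) : ℕ := 6 * (if ε.den < ε.num.toNat then 1 else ε.den) * q.num.toNat

/-- The constants for the given parameters. -/
def par (r h : ℕ) (δ q ε η : ℚ) : Par where
  r := r
  M := 2 * δ.num.toNat * unitDen q ε / (δ.den * unitNum q ε)
  h := h
  ka := unitNum q ε * η.den
  kb := η.num.toNat * unitDen q ε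
  kc := unitDen q ε * η.den

section InitInput

variable {n : ℕ} {G : DecrementalGraph n} {A : DynamicOrder n} {L : ℕ → List (List (Fin n))}
  {r : Fin n} {δ q ε η : ℚ}

/-- The weights in the input. -/
noncomputable def weightList (G : DecrementalGraph n) : List ℕ :=
  (List.finRange n).flatMap fun u => (List.finRange n).map fun v => encodeWeight (G.weight 0 u v)

theorem length_weightList (G : DecrementalGraph n) : (weightList G).length = n * n := by
  rw [weightList, List.length_flatMap_of_forall (n := n) (fun u => by simp)]
  simp

theorem initInput_eq : initInput G A L r δ q ε η =
    [n, (r : ℕ), δ.num.toNat, δ.den, q.num.toNat, q.den, ε.num.toNat, ε.den, η.num.toNat, η.den] ++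
      (weightList G ++ encodeSets (A.τ 0) (L 0)) := by
  simp [initInput, encodeRat, weightList]

theorem initInput_weight (u v : Fin n) :
    (initInput G A L r δ q ε η).getD ((u : ℕ) * n + v + 10) 0 = encodeWeight (G.weight 0 u v) := by
  have hlt := index_lt u.2 v.2
  rw [initInput_eq, List.getD_append_right _ _ _ _ (by simp)]
  simp only [List.length_cons, List.length_nil]
  rw [show (u : ℕ) * n + v + 10 - (0 + 1 + 1 + 1 + 1 + 1 + 1 + 1 + 1 + 1 + 1) = u * n + v by omega,
    List.getD_append _ _ _ _ (by rw [length_weightList]; exact hlt), weightList,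
    List.getD_flatMap (by simp) v.2 _ _ (by simp)]
  simp

theorem initInput_drop : (initInput G A L r δ q ε η).drop (n * n + 10) =
    (L 0).length :: (L 0).flatMap (encodeSet (A.τ 0)) := by
  rw [initInput_eq, add_comm, ← List.drop_drop, List.drop_left' (by simp),
    List.drop_left' (length_weightList G)]
  rfl

theorem length_initInput_le (hL : Announces (A.newSets 0) (L 0)) :
    (initInput G A L r δ q ε η).length ≤ 10 + n * n + 1 + 3 * n := by
  rw [initInput_eq, List.length_append, List.length_append, length_weightList]
  have h1 := hL.length_flatMap_le (τ := A.τ 0) (Q := A.part 0) (Finset.Subset.refl _)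
  have h2 : (encodeSets (A.τ 0) (L 0)).length =
    ((L 0).flatMap (encodeSet (A.τ 0))).length + 1 := rfl
  rw [h2]
  simp only [List.length_cons, List.length_nil]
  omega

theorem length_updateInput_le {s : ℕ} (hL : Announces (A.newSets (s + 1)) (L (s + 1))) :
    (updateInput G A L s).length ≤ 4 + 3 * n := by
  have h1 := hL.length_flatMap_le (τ := A.τ (s + 1)) (Q := A.part (s + 1)) Finset.sdiff_subset
  have h2 : (encodeSets (A.τ (s + 1)) (L (s + 1))).length =
    ((L (s + 1)).flatMap (encodeSet (A.τ (s + 1)))).length + 1 := rfl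
  rw [updateInput, List.length_append, h2]
  simp only [List.length_cons, List.length_nil]
  omega

end InitInput

/-- Identifies the depth computed by the program with the one fixed in the analysis. -/
theorem pow_unique {n h k : ℕ} (h1 : n ≤ 2 ^ h) (h2 : 2 ^ h < 2 * n) (h3 : n ≤ 2 ^ k)
    (h4 : 2 ^ k < 2 * n) : h = k := by
  have key : ∀ {a b : ℕ}, a < b → n ≤ 2 ^ a → 2 ^ b < 2 * n → False := by
    intro a b hab h5 h6
    have := Nat.pow_le_pow_right (n := 2) (by omega) hab
    rw [Nat.succ_eq_add_one, pow_succ] at this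
    omega
  rcases lt_trichotomy h k with h5 | h5 | h5
  · exact (key h5 h1 h4).elim
  · exact h5
  · exact (key h5 h3 h2).elim

variable {E : Env} {t : St} {G : DecrementalGraph E.n} {A : DynamicOrder E.n} {δ q ε η : ℚ}

/-- The state before the sets of the initial partition are read. -/
structure Raw (E : Env) (K : Par) (gn gd : ℕ) (w : ℕ → ℕ → ℕ) (t : St) : Prop where
  r : t.reg 1 = K.r
  M : t.reg 2 = K.M
  h : t.reg 3 = K.h
  ka : t.reg 4 = K.ka
  kb : t.reg 5 = K.kb
  kc : t.reg 6 = K.kc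
  num : t.reg 7 = gn
  den : t.reg 8 = gd
  zero : ∀ a, a ∉ [9, 10, 11] → t.arr a = fun _ => 0
  nm : ∀ v < E.n, t.arr 9 v = v + 1
  nm_zero : ∀ j, E.n ≤ j → t.arr 9 j = 0
  weight : ∀ u < E.n, ∀ v < E.n, t.arr 10 (u * E.n + v) = w u v
  low : ∀ k ≤ K.M + 1, t.arr 11 k = low k
  out : ∀ v < E.n, t.out v = K.est 0

theorem Tr.read {h gn gd : ℕ} {K : Par} {L : ℕ → List (List (Fin E.n))} {r : Fin E.n}
    (hs : Setup E K) (hK : par r h δ q ε η = K) (hh : 2 ^ h < 2 * E.n)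
    (hinp : E.inp = initInput G A L r δ q ε η)
    (hgn : unitNum q ε = gn) (hgd : unitDen q ε = gd) (hg0 : 0 < gn) (bgn : gn < E.V)
    (bgd : gd < E.V) (ba : K.ka < E.V) (bb : K.kb < E.V) (bc : K.kc < E.V)
    (h2n : 2 * E.n < E.V) (hsq : E.n * E.n + 10 < E.V)
    (h0 : t.reg 0 = E.n) (harr : ∀ a, t.arr a = fun _ => 0) :
    Tr E .read t (fun l t' =>
      l ≤ 80 * K.M + 100 * (E.n * E.n) + 100 * E.n + 600 ∧ Raw E K gn gd
        (fun u v => roundWeight K.M gn gd (E.inp.getD (u * E.n + v + 10) 0)) t') := by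
  have hfl := hs.lt
  have hn2 := hs.two_le
  have hKh : K.h = h := by rw [← hK]; rfl
  have hpow := hs.le_pow
  rw [← hKh] at hh
  have hi : E.inp = [E.n, (r : ℕ), δ.num.toNat, δ.den, q.num.toNat, q.den, ε.num.toNat, ε.den,
      η.num.toNat, η.den] ++ (weightList G ++ encodeSets (A.τ 0) (L 0)) :=
    hinp.trans initInput_eq
  have eka : gn * η.den = K.ka := by rw [← hK, ← hgn]; rfl
  have ekb : η.num.toNat * gd = K.kb := by rw [← hK, ← hgd]; rfl
  have ekc : gd * η.den = K.kc := by rw [← hK, ← hgd]; rfl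
  have eM : 2 * δ.num.toNat * gd / (δ.den * gn) = K.M := by rw [← hK, ← hgd, ← hgn]; rfl
  have er : (r : ℕ) = K.r := by rw [← hK]; rfl
  refine Tr.seq ((Tr.readPars (gn := gn) (gd := gd) (M := K.M) (r := r) (dn := δ.num.toNat)
    (dd := δ.den) (qn := q.num.toNat) (qd := q.den) (en := ε.num.toNat) (ed := ε.den)
    (hn := η.num.toNat) (hd := η.den) (by rw [hi]; rfl) (by rw [hi]; rfl)
    (by rw [hi]; rfl) (by rw [hi]; rfl) (by rw [hi]; rfl) (by rw [hi]; rfl) (by rw [hi]; rfl)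
    (by rw [hi]; rfl) (by rw [hi]; rfl) rfl rfl hgn hgd eM bgn bgd (by omega) (by rwa [eka])
    (by rwa [ekb]) (by rwa [ekc])).mono ?_)
  rintro k1 t1 ⟨hk1, o1, a1, r0, r1, r2, r4, r5, r6, r7, r8⟩
  refine Tr.seq ((Tr.depth hn2 (r0.trans h0) h2n).mono ?_)
  rintro k2 t2 ⟨hk2, o2, a2, hr2, hp1, hp2⟩
  have r3 : t2.reg 3 = K.h := pow_unique hp1 hp2 hpow hh
  have hreg : ∀ x, x ∉ [3, 16] → t2.reg x = t1.reg x := hr2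
  have harr2 : ∀ a, t2.arr a = fun _ => 0 := fun a => by rw [a2, a1, harr]
  refine Tr.seq ((Tr.lowTable (M := K.M) ((hreg 2 (by simp)).trans r2) (by omega)
    (by rw [harr2])).mono ?_)
  rintro k3 t3 ⟨hk3, hf3, hlow⟩
  refine Tr.seq ((Tr.weights (K := K) (n := E.n) (gn := gn) (gd := gd) hg0
    ((hf3.reg 0 (by omega)).trans ((hreg 0 (by simp)).trans (r0.trans h0)))
    ((hf3.reg 2 (by omega)).trans ((hreg 2 (by simp)).trans r2))
    ((hf3.reg 7 (by omega)).trans ((hreg 7 (by simp)).trans r7))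
    ((hf3.reg 8 (by omega)).trans ((hreg 8 (by simp)).trans r8)) (by omega) hsq).mono ?_)
  rintro k4 t4 ⟨hk4, hf4, hw⟩
  have hreg4 : ∀ x < 16, t4.reg x = t2.reg x := fun x hx => (hf4.reg x hx).trans (hf3.reg x hx)
  have e5 : t1.reg 5 = K.kb := r5.trans ekb
  have e6 : t1.reg 6 = K.kc := r6.trans ekc
  refine (Tr.clear (kb := K.kb) (kc := K.kc)
    ((hreg4 5 (by omega)).trans ((hreg 5 (by simp)).trans e5))
    ((hreg4 6 (by omega)).trans ((hreg 6 (by simp)).trans e6)) (by omega)).mono ?_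
  rintro k5 t5 ⟨hk5, g0, hreg5, ha5, h9, h9', hout⟩
  have hreg6 : ∀ x, x < 9 → x ≠ 3 → t5.reg x = t1.reg x := by
    intro x hx h3
    rw [hreg5 x (by omega), hreg4 x (by omega), hreg x (by simp; omega)]
  refine ⟨by omega, (hreg6 1 (by omega) (by omega)).trans (r1.trans er),
    (hreg6 2 (by omega) (by omega)).trans r2, ?_,
    (hreg6 4 (by omega) (by omega)).trans (r4.trans eka),
    (hreg6 5 (by omega) (by omega)).trans e5,
    (hreg6 6 (by omega) (by omega)).trans e6, (hreg6 7 (by omega) (by omega)).trans r7,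
    (hreg6 8 (by omega) (by omega)).trans r8, fun a ha => ?_, h9, fun j hj => ?_,
    fun u hu v hv => ?_, fun k hk => ?_, fun v hv => ?_⟩
  · rw [hreg5 3 (by omega), hreg4 3 (by omega), r3]
  · simp at ha
    rw [ha5 a ha.1, hf4.arr a (by simp; omega), hf3.arr a (by simp; omega), harr2]
  · rw [h9' j hj, hf4.arr 9 (by simp), hf3.arr 9 (by simp), harr2]
  · rw [ha5 10 (by omega)]
    exact hw _ (index_lt hu hv)
  · rw [ha5 11 (by omega), hf4.arr 11 (by simp)]; exact hlow k hk
  · rw [hout v hv, Par.est, if_pos (Nat.zero_le _), zero_mul, zero_add]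

theorem Tr.arrange {K : Par} {gn gd : ℕ} (hA : IsATO G η A) {L : ℕ → List (List (Fin E.n))}
    {r : Fin E.n} (hL : Announces (A.newSets 0) (L 0)) (hs : Setup E K)
    (hlen : E.inp.length + 3 < E.V) (hinp : E.inp = initInput G A L r δ q ε η)
    (hg0 : 0 < gn) (hd0 : 0 < gd) {w : ℕ → ℕ → ℕ}
    (hw : ∀ u v, w u v = roundWeight K.M gn gd (E.inp.getD (u * E.n + v + 10) 0))
    (h : Raw E K gn gd w t)
    (r9 : t.reg 9 = E.n * E.n + 10) (r16 : t.reg 16 = (L 0).length) :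
    Tr E (.prepare ;; .main) t (fun l t' => ∃ c', Store E K gn gd G A 0 c' t' ∧
      l + 1000 * c'.pot E.n K.M + price E.n * stale E.n K.h (t'.arr 9) ≤
        1000 * (4 * (E.n * E.n) + 6 * E.n + E.n * lab E.n K.M 0) +
        price E.n * ((K.h + 1) * E.n) + K.h * (E.n * 380 + 120) + 510 * E.n + 300) := by
  have hdrop := (congrArg (List.drop (E.n * E.n + 10)) hinp).trans initInput_drop
  obtain ⟨d1, d2, d3⟩ := List.getD_of_drop hdrop
  refine Tr.seq ((Tr.prepare (w := w) (W := fun _ => []) (τ := A.τ 0) (Q := A.part 0)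
    (new := A.newSets 0) (L := L 0) hs hlen (by rw [r9]; exact d2) (by rw [r9]; exact d3)
    h.h r16 hL (Finset.Subset.refl _) (hA.intervals (Nat.zero_le _)) ?_ ?_ ?_ ?_).mono ?_)
  · intro X hX hn; exact absurd hX hn
  · intro T
    refine ⟨fun u hu => ?_, fun h => absurd rfl h, fun u hu _ v hv => ?_⟩
    · rw [nmin_zero hu, zero_mul, zero_add, h.nm u hu]
    · rw [wmin_zero hu, zero_mul, zero_add, h.weight u hu v hv]
  · intro T P Z _ d hd
    have hz : ∀ u, t.arr 9 ((d + 1) * E.n + u) = 0 := fun u =>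
      h.nm_zero _ (by rw [Nat.succ_mul]; omega)
    -- Above level 0 all entries are still 0, so every node counts as new; the trees are built by
    -- the same routine as after a refinement.
    refine ⟨fun u _ => by rw [hz]; omega, fun u hu => ?_, fun a _ _ => .inr (.inl (by rw [hz]; omega))⟩
    rw [hz]
    exact Nat.le_zero.1 (nmin_le (self_mem_node (by omega)))
  · rw [h.zero 7 (by simp), h.zero 8 (by simp)]
    exact ⟨fun _ => rfl, fun _ => List.nodup_nil, fun _ _ h => by simp at h, fun _ _ _ _ => rfl⟩
  rintro k7 t7 ⟨hk7, hf7, hg7, hl7, hC7, hR7, W', hW', hW0, hWq⟩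
  have hlay := (hA.intervals (Nat.zero_le _)).layout hg7
  have hst := stale_le E.n K.h (t.arr 9)
  have hS : Stage E K (A.τ 0) (A.part 0) ⟨t7.arr 0, t7.arr 1, t7.arr 2, fun _ => 0, fun _ => 0,
      t7.arr 5, t7.arr 6, W', w, rootMin E.n K.h t7⟩ t7 := by
    refine ⟨?_, ?_, hl7, hg7⟩
    · exact {
        r := (hf7.reg 1 (by omega)).trans h.r
        M := (hf7.reg 2 (by omega)).trans h.M
        h := (hf7.reg 3 (by omega)).trans h.h
        ka := (hf7.reg 4 (by omega)).trans h.ka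
        kb := (hf7.reg 5 (by omega)).trans h.kb
        kc := (hf7.reg 6 (by omega)).trans h.kc
        T := rfl
        P := rfl
        Z := rfl
        L := (hf7.arr 3 (by simp)).trans (h.zero 3 (by simp))
        X := (hf7.arr 4 (by simp)).trans (h.zero 4 (by simp))
        C := rfl
        R := rfl
        W := hW'
        m := fun a v => rfl
        low := fun k hk => by rw [hf7.arr 11 (by simp)]; exact h.low k hk
        out := fun v hv => by rw [hf7.out]; exact h.out v hv }
    · exact Valid.init hlay ((hl7 K.h le_rfl).minSpec hs.le_pow hlay)
        (fun u _ v _ => by dsimp only; rw [hw]; exact one_le_roundWeight hg0 hd0) rfl rfl hC7 hR7 hW0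
  have hpot := Core.pot_init (n := E.n) (M := K.M) (c := ⟨t7.arr 0, t7.arr 1, t7.arr 2,
    fun _ => 0, fun _ => 0, t7.arr 5, t7.arr 6, W', w, rootMin E.n K.h t7⟩) hlay rfl rfl
    (hW'.length_le 0) hWq
  refine (Tr.finish hs hS).mono ?_
  rintro k8 t8 ⟨hk8, c8, hS8, hW8, hw8, hl8⟩
  refine ⟨c8, ⟨hS8, hW8, ?_, ?_, fun u v => ?_⟩, ?_⟩
  · rw [hk8.reg 7 (by omega), hf7.reg 7 (by omega), h.num]
  · rw [hk8.reg 8 (by omega), hf7.reg 8 (by omega), h.den]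
  · rw [hw8]
    dsimp only
    rw [hw, hinp, initInput_weight]
  · rw [hk8.arr 9 (by omega)]
    have := Nat.mul_le_mul_left (price E.n) hst
    omega


theorem Tr.init {h gn gd : ℕ} {K : Par} (hA : IsATO G η A) {L : ℕ → List (List (Fin E.n))}
    {r : Fin E.n} (hL : Announces (A.newSets 0) (L 0)) (hs : Setup E K)
    (hK : par r h δ q ε η = K) (hh : 2 ^ h < 2 * E.n)
    (hlen : E.inp.length + 3 < E.V) (hinp : E.inp = initInput G A L r δ q ε η)
    (hgn : unitNum q ε = gn) (hgd : unitDen q ε = gd) (hg0 : 0 < gn) (hd0 : 0 < gd)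
    (bgn : gn < E.V) (bgd : gd < E.V) (ba : K.ka < E.V) (bb : K.kb < E.V) (bc : K.kc < E.V)
    (h2n : 2 * E.n < E.V) (h0 : t.reg 0 = E.n) (harr : ∀ a, t.arr a = fun _ => 0) :
    Tr E .init t (fun l t' => ∃ c', Store E K gn gd G A 0 c' t' ∧
      l + 1000 * c'.pot E.n K.M + price E.n * stale E.n K.h (t'.arr 9) ≤
        1000 * (4 * (E.n * E.n) + 6 * E.n + E.n * lab E.n K.M 0) +
        price E.n * ((K.h + 1) * E.n) + K.h * (E.n * 380 + 120) + 80 * K.M +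
        100 * (E.n * E.n) + 610 * E.n + 1000) := by
  have hdrop := (congrArg (List.drop (E.n * E.n + 10)) hinp).trans initInput_drop
  obtain ⟨d1, -, d3⟩ := List.getD_of_drop hdrop
  refine Tr.seq ((Tr.read hs hK hh hinp hgn hgd hg0 bgn bgd ba bb bc h2n (by omega) h0
    harr).mono ?_)
  rintro k1 t1 ⟨hk1, hR⟩
  refine Tr.bounded fun _ _ g0 => ?_
  refine Tr.seq ((Tr.of_wp (Q := fun t' => t' = (t1.setReg 9 (E.n * E.n + 10)).setReg 16
    (L 0).length) (by decide) ?_).mono ?_)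
  · simp only [Cmd.wp, Ex.eval_r, Ex.eval_add, Ex.eval_mul, Ex.eval_num, St.setReg_reg, g0, if_true,
      d1, and_true]
    exact .inr (by omega)
  rintro k2 t2 ⟨hk2, rfl⟩
  have hk2' : k2 ≤ 30 := hk2.trans (by decide)
  have hreg : ∀ x < 9, ((t1.setReg 9 (E.n * E.n + 10)).setReg 16 (L 0).length).reg x = t1.reg x := by
    intro x hx
    rw [St.setReg_reg, if_neg (by omega), St.setReg_reg, if_neg (by omega)]
  refine (Tr.arrange hA hL hs hlen hinp hg0 hd0 (fun _ _ => rfl) ⟨(hreg 1 (by omega)).trans hR.r,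
    (hreg 2 (by omega)).trans hR.M, (hreg 3 (by omega)).trans hR.h, (hreg 4 (by omega)).trans hR.ka,
    (hreg 5 (by omega)).trans hR.kb, (hreg 6 (by omega)).trans hR.kc,
    (hreg 7 (by omega)).trans hR.num, (hreg 8 (by omega)).trans hR.den, hR.zero, hR.nm, hR.nm_zero,
    hR.weight, hR.low, hR.out⟩ (by simp) (by simp)).mono ?_
  rintro k3 t3 ⟨c3, hS, hk3⟩
  exact ⟨c3, hS, by omega⟩

end

section

/-! ### The parameters -/

theorem num_toNat_div_den {x : ℚ} (hx : 0 ≤ x) : (x.num.toNat : ℚ) / x.den = x := by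
  have h : ((x.num.toNat : ℤ) : ℚ) = x.num := by rw [Int.toNat_of_nonneg (Rat.num_nonneg.2 hx)]
  rw [Int.cast_natCast] at h
  rw [h, Rat.num_div_den]

theorem num_toNat_pos {x : ℚ} (hx : 0 < x) : 0 < x.num.toNat := by
  have := Rat.num_pos.2 hx
  omega

section Parameters

variable {δ q ε η : ℚ}

theorem unitNum_pos (hε : 0 < ε) : 0 < unitNum q ε := by
  have h1 := num_toNat_pos hε
  refine Nat.mul_pos ?_ q.den_pos
  split_ifs <;> omega

theorem unitDen_pos (hq : 0 < q) : 0 < unitDen q ε := by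
  refine Nat.mul_pos ?_ (num_toNat_pos hq)
  have := ε.den_pos
  split_ifs <;> omega

/-- The case distinction on ε.den < ε.num in `unitNum` and `unitDen` computes min(ε, 1) in integers.
-/
theorem unit_eq (hq : 0 < q) (hε : 0 < ε) :
    (unitNum q ε / unitDen q ε : ℚ) = min ε 1 / (6 * q) := by
  have hq' := num_toNat_div_den hq.le
  have hε' := num_toNat_div_den hε.le
  have h1 : (0 : ℚ) < q.den := by exact_mod_cast q.den_pos
  have h2 : (0 : ℚ) < ε.den := by exact_mod_cast ε.den_pos
  have h3 : (0 : ℚ) < q.num.toNat := by exact_mod_cast num_toNat_pos hq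
  have key : (unitNum q ε / unitDen q ε : ℚ) =
      ((if ε.den < ε.num.toNat then 1 else ε.num.toNat : ℕ) : ℚ) /
        ((if ε.den < ε.num.toNat then 1 else ε.den : ℕ) : ℚ) / (6 * (q.num.toNat / q.den)) := by
    unfold unitNum unitDen
    push_cast
    split_ifs <;> field_simp
  rw [key, hq']
  congr 1
  by_cases hlt : ε.den < ε.num.toNat
  · rw [if_pos hlt, if_pos hlt, min_eq_right]
    · simp
    · rw [← hε', le_div_iff₀ h2, one_mul]
      exact_mod_cast hlt.le
  · rw [if_neg hlt, if_neg hlt, hε', min_eq_left]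
    rw [← hε', div_le_iff₀ h2, one_mul]
    exact_mod_cast not_lt.1 hlt

/-- By the choice of the unit g, 6 q δ g = min(ε, 1) δ, which gives both error bounds. The estimate
k g + η is put over the common denominator `kc`, so integer division rounds it down. -/
theorem par_scale (hδ : 0 < δ) (hq : 0 < q) (hε : 0 < ε) (hη : 0 ≤ η) (r h : ℕ) :
    Scale (par r h δ q ε η) (unitNum q ε) (unitDen q ε) δ q ε η := by
  have hgn : (0 : ℚ) < unitNum q ε := by exact_mod_cast unitNum_pos hε
  have hgd : (0 : ℚ) < unitDen q ε := by exact_mod_cast unitDen_pos hq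
  have hdd : (0 : ℚ) < δ.den := by exact_mod_cast δ.den_pos
  have hhd : (0 : ℚ) < η.den := by exact_mod_cast η.den_pos
  have hu : 6 * q * δ * (unitNum q ε / unitDen q ε : ℚ) = min ε 1 * δ := by
    rw [unit_eq hq hε]; field_simp
  refine ⟨unitNum_pos hε, unitDen_pos hq, fun k hk => ?_, ?_, ?_, ?_⟩
  · rw [Par.est, if_pos hk]
    congr 1
    simp only [par]
    rw [← Nat.floor_div_eq_div (K := ℚ)]
    congr 1
    rw [← num_toNat_div_den hη]
    simp only [num_toNat_div_den hη]
    push_cast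
    rw [add_div]
    congr 1
    · field_simp
    · nth_rw 3 [← num_toNat_div_den hη]
      field_simp
  · have h1 := Nat.lt_mul_div_succ (2 * δ.num.toNat * unitDen q ε)
      (Nat.mul_pos δ.den_pos (unitNum_pos (q := q) hε))
    have h2 : (2 * δ.num.toNat * unitDen q ε : ℚ) <
        δ.den * unitNum q ε * ((par r h δ q ε η).M + 1) := by exact_mod_cast h1
    nth_rw 1 [← num_toNat_div_den hδ.le]
    rw [← mul_div_assoc, ← mul_div_assoc, div_lt_div_iff₀ hdd hgd]
    linarith
  · rw [hu]; exact mul_le_mul_of_nonneg_right (min_le_left _ _) hδ.le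
  · rw [hu]
    have := mul_le_mul_of_nonneg_right (min_le_right ε 1) hδ.le
    linarith

theorem par_M_le (hδ : 0 < δ) (hq : 0 < q) (hε : 0 < ε) (r h : ℕ) :
    ((par r h δ q ε η).M : ℚ) ≤ 12 * (δ * q / min ε 1) := by
  have hgn : (0 : ℚ) < unitNum q ε := by exact_mod_cast unitNum_pos hε
  have hgd : (0 : ℚ) < unitDen q ε := by exact_mod_cast unitDen_pos hq
  have hdd : (0 : ℚ) < δ.den := by exact_mod_cast δ.den_pos
  have hm : 0 < min ε 1 := lt_min hε one_pos
  have h1 : ((par r h δ q ε η).M : ℚ) ≤ (2 * δ.num.toNat * unitDen q ε : ℕ) /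
      (δ.den * unitNum q ε : ℕ) := Nat.cast_div_le
  refine h1.trans (le_of_eq ?_)
  have h2 : ((2 * δ.num.toNat * unitDen q ε : ℕ) : ℚ) / (δ.den * unitNum q ε : ℕ) =
      2 * (δ.num.toNat / δ.den) / (unitNum q ε / unitDen q ε) := by
    push_cast
    field_simp
  rw [h2, num_toNat_div_den hδ.le, unit_eq hq hε]
  field_simp
  ring

end Parameters

/-! ### Bounds for the words -/

section Words

variable {n : ℕ} {G : DecrementalGraph n} {A : DynamicOrder n} {L : ℕ → List (List (Fin n))}
  {r : Fin n} {δ q ε η : ℚ}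

theorem inputSize_eq : inputSize G δ q ε η = n + G.maxWeight + (δ.num.toNat + δ.den) +
    (q.num.toNat + q.den) + (ε.num.toNat + ε.den) + (η.num.toNat + η.den) := by
  simp [inputSize, encodeRat]

theorem nine_le_inputSize (hn : 2 ≤ n) (hδ : 0 < δ) (hq : 0 < q) (hε : 0 < ε) :
    9 ≤ inputSize G δ q ε η := by
  have := num_toNat_pos hδ
  have := num_toNat_pos hq
  have := num_toNat_pos hε
  have := δ.den_pos
  have := q.den_pos
  have := ε.den_pos
  have := η.den_pos
  rw [inputSize_eq]
  omega

theorem encodeWeight_le {s : ℕ} (hs : s ≤ G.numUpdates) (u v : Fin n) :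
    encodeWeight (G.weight s u v) ≤ G.maxWeight := by
  by_cases h : G.weight s u v = ⊤
  · rw [h]; simp [encodeWeight]
  · exact ENat.toNat_le_of_le_natCast (G.weight_le s hs u v h)

theorem mem_encodeSets_le {τ : Finset (Fin n) → ℕ} {new : Finset (Finset (Fin n))}
    {Q : Finpartition (Finset.univ : Finset (Fin n))} {L : List (List (Fin n))}
    (hL : Announces new L) (hsub : new ⊆ Q.parts) (hI : Intervals Q τ) {x : ℕ}
    (hx : x ∈ encodeSets τ L) : x ≤ n := by
  rcases List.mem_cons.1 hx with rfl | hx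
  · rw [hL.length_eq]; exact (Finset.card_le_card hsub).trans (card_parts_le Q)
  · obtain ⟨l, hl, hx⟩ := List.mem_flatMap.1 hx
    have h1 := hI.le _ (hsub (hL.mem.1 (List.mem_map_of_mem hl)))
    rw [List.toFinset_card_of_nodup (hL.1 l hl)] at h1
    rcases List.mem_cons.1 hx with rfl | hx
    · omega
    rcases List.mem_cons.1 hx with rfl | hx
    · omega
    · obtain ⟨v, -, rfl⟩ := List.mem_map.1 hx
      exact v.2.le

theorem mem_updateInput_le (hA : IsATO G η A) {s : ℕ} (hs : s < G.numUpdates)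
    (hL : Announces (A.newSets (s + 1)) (L (s + 1))) {x : ℕ} (hx : x ∈ updateInput G A L s) :
    x ≤ inputSize G δ q ε η := by
  rw [inputSize_eq]
  rcases List.mem_append.1 hx with hx | hx
  · have h1 := (G.edge s).1.2
    have h2 := (G.edge s).2.2
    have h3 := encodeWeight_le (G := G) (s := s + 1) hs (G.edge s).1 (G.edge s).2
    simp at hx
    omega
  · have := mem_encodeSets_le hL Finset.sdiff_subset (hA.intervals (s := s + 1) hs) hx
    omega

theorem mem_initInput_le (hA : IsATO G η A) (hL : Announces (A.newSets 0) (L 0)) {x : ℕ}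
    (hx : x ∈ initInput G A L r δ q ε η) : x ≤ inputSize G δ q ε η := by
  rw [inputSize_eq]
  rw [initInput_eq] at hx
  have h1 := r.2
  rcases List.mem_append.1 hx with hx | hx
  · simp at hx
    omega
  rcases List.mem_append.1 hx with hx | hx
  · obtain ⟨u, -, hx⟩ := List.mem_flatMap.1 hx
    obtain ⟨v, -, rfl⟩ := List.mem_map.1 hx
    have := encodeWeight_le (G := G) (Nat.zero_le _) u v
    omega
  · have := mem_encodeSets_le hL (Finset.Subset.refl _) (hA.intervals (Nat.zero_le _)) hx
    omega

theorem getD_lt {l : List ℕ} {S V : ℕ} (h : ∀ x ∈ l, x ≤ S) (hV : S < V) (i : ℕ) :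
    l.getD i 0 < V := by
  rcases Nat.lt_or_ge i l.length with hi | hi
  · rw [List.getD_eq_getElem _ _ hi]
    exact (h _ (List.getElem_mem hi)).trans_lt hV
  · rw [List.getD_eq_default _ _ hi]; omega

/-- All constants are bounded by powers of the size. -/
structure Bounded (S : ℕ) (K : Par) (gn gd : ℕ) : Prop where
  gn : gn ≤ S ^ 2
  gd : gd ≤ S ^ 3
  M : K.M ≤ S ^ 5
  ka : K.ka ≤ S ^ 3
  kb : K.kb ≤ S ^ 4
  kc : K.kc ≤ S ^ 4

theorem par_bounded (hn : 2 ≤ n) (hδ : 0 < δ) (hq : 0 < q) (hε : 0 < ε) (h : ℕ) :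
    Bounded (inputSize G δ q ε η) (par r h δ q ε η) (unitNum q ε) (unitDen q ε) := by
  have hS := nine_le_inputSize (G := G) (η := η) hn hδ hq hε
  have hSe := inputSize_eq (G := G) (δ := δ) (q := q) (ε := ε) (η := η)
  set S := inputSize G δ q ε η
  have hgn : unitNum q ε ≤ S ^ 2 := by
    rw [pow_two]
    refine Nat.mul_le_mul ?_ (by omega)
    split_ifs <;> omega
  have hgd : unitDen q ε ≤ S ^ 3 := by
    have : S ^ 3 = S * S * S := by ring
    rw [this]
    refine Nat.mul_le_mul (Nat.mul_le_mul (by omega) ?_) (by omega)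
    split_ifs <;> omega
  refine ⟨hgn, hgd, ?_, ?_, ?_, ?_⟩
  · refine (Nat.div_le_self _ _).trans ?_
    calc 2 * δ.num.toNat * unitDen q ε ≤ S * S * S ^ 3 :=
          Nat.mul_le_mul (Nat.mul_le_mul (by omega) (by omega)) hgd
      _ = S ^ 5 := by ring
  · calc unitNum q ε * η.den ≤ S ^ 2 * S := Nat.mul_le_mul hgn (by omega)
      _ = S ^ 3 := by ring
  · calc η.num.toNat * unitDen q ε ≤ S * S ^ 3 := Nat.mul_le_mul (by omega) hgd
      _ = S ^ 4 := by ring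
  · calc unitDen q ε * η.den ≤ S ^ 3 * S := Nat.mul_le_mul hgd (by omega)
      _ = S ^ 4 := by ring

/-- The largest stored words are estimates of order S ^ 8 and list numbers of order S ^ 6, so V = S
^ 10 leaves room. -/
theorem Bounded.setup {E : Env} {S gn gd : ℕ} {K : Par} (hb : Bounded S K gn gd) (hS : 9 ≤ S)
    (hV : E.V = S ^ 10) (hn : E.n ≤ S) (h2 : 2 ≤ E.n) (hr : K.r < E.n) (hh : E.n ≤ 2 ^ K.h)
    (hh' : 2 ^ K.h < 2 * E.n) : Setup E K := by
  have p1 : S ^ 2 = S * S := pow_two S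
  have p2 : ∀ {a b : ℕ}, a ≤ b → S ^ a ≤ S ^ b := fun h => Nat.pow_le_pow_right (by omega) h
  have q1 := p2 (show 1 ≤ 9 by omega)
  have q2 := p2 (show 2 ≤ 9 by omega)
  have q3 := p2 (show 3 ≤ 9 by omega)
  have q4 := p2 (show 4 ≤ 9 by omega)
  have q5 := p2 (show 5 ≤ 9 by omega)
  have q6 := p2 (show 6 ≤ 9 by omega)
  have q8 := p2 (show 8 ≤ 9 by omega)
  have q9 : S ^ 10 = S ^ 9 * S := pow_succ S 9
  have q10 : 9 * S ^ 9 ≤ S ^ 10 := by rw [q9, mul_comm]; exact Nat.mul_le_mul_left _ hS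
  have hpos : 9 ≤ S ^ 9 := hS.trans (by simpa using q1)
  rw [pow_one] at q1
  refine ⟨⟨h2, hr, ?_, fun k hk => ?_⟩, hh, ?_, ?_⟩
  · have h3 : (E.n + 1) * (K.M + 3) ≤ (S + 1) * (S ^ 5 + 3) :=
      Nat.mul_le_mul (by omega) (by have := hb.M; omega)
    have h4 : (S + 1) * (S ^ 5 + 3) = S ^ 6 + S ^ 5 + 3 * S + 3 := by ring
    omega
  · rw [Par.est, if_pos hk]
    have h3 : k * K.ka ≤ S ^ 8 :=
      (Nat.mul_le_mul (hk.trans hb.M) hb.ka).trans_eq (pow_add S 5 3).symm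
    have h4 := Nat.div_le_self (k * K.ka + K.kb) K.kc
    have := hb.kb
    omega
  · omega
  · have : E.n * E.n ≤ S * S := Nat.mul_le_mul hn hn
    omega

end Words

end

section

/-! ### The sequence of updates -/

/-- Chains the single updates into one run by dependent choice. -/
theorem exists_run {σ : Type*} {I : ℕ → σ → Prop} {R : ℕ → σ → σ → Prop} {N : ℕ} {x : σ}
    (hx : I 0 x) (step : ∀ t < N, ∀ x, I t x → ∃ y, R t x y ∧ I (t + 1) y) :
    ∃ f : ℕ → σ, f 0 = x ∧ (∀ t ≤ N, I t (f t)) ∧ ∀ t < N, R t (f t) (f (t + 1)) := by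
  have : ∀ t x, ∃ y, t < N → I t x → R t x y ∧ I (t + 1) y := by
    intro t x
    by_cases h : t < N ∧ I t x
    · obtain ⟨y, hy⟩ := step t h.1 x h.2
      exact ⟨y, fun _ _ => hy⟩
    · exact ⟨x, fun h1 h2 => absurd ⟨h1, h2⟩ h⟩
  choose g hg using this
  let f : ℕ → σ := fun t => Nat.rec x g t
  have hI : ∀ t ≤ N, I t (f t) := by
    intro t
    induction t with
    | zero => exact fun _ => hx
    | succ t ih => exact fun h => (hg t (f t) h (ih (by omega))).2
  exact ⟨f, rfl, hI, fun t ht => (hg t (f t) ht (hI t ht.le)).1⟩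

section Count

variable {n : ℕ} {G : DecrementalGraph n} {A : DynamicOrder n} {η : ℚ}

theorem DecrementalGraph.weight_mono (u v : Fin n) {s t : ℕ} (hst : s ≤ t) (ht : t ≤ G.numUpdates) :
    G.weight s u v ≤ G.weight t u v := by
  induction t, hst using Nat.le_induction with
  | base => exact le_rfl
  | succ t _ ih =>
    refine (ih (by omega)).trans ?_
    by_cases he : (u, v) = G.edge t
    · have := (G.weight_edge_lt t ht).le
      rwa [← he] at this
    · exact (G.weight_eq t ht u v he).ge

theorem DecrementalGraph.numUpdates_le (G : DecrementalGraph n) :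
    G.numUpdates ≤ n * n + G.numIncreases := by
  classical
  have h1 : G.numIncreases = ((Finset.range G.numUpdates).filter fun t =>
      G.weight (t + 1) (G.edge t).1 (G.edge t).2 ≠ ⊤).card := by
    rw [DecrementalGraph.numIncreases, ← Set.ncard_coe_finset]
    congr 1
    ext t
    simp
  have h2 : ((Finset.range G.numUpdates).filter fun t =>
      ¬ G.weight (t + 1) (G.edge t).1 (G.edge t).2 ≠ ⊤).card ≤ n * n := by
    have : (Finset.univ : Finset (Fin n × Fin n)).card = n * n := by simp
    rw [← this]
    refine Finset.card_le_card_of_injOn G.edge (fun _ _ => Finset.mem_coe.2 (Finset.mem_univ _)) ?_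
    -- A deleted edge keeps weight ⊤, which cannot increase strictly; so deletions hit distinct
    -- edges.
    have key : ∀ s < G.numUpdates, ∀ t < G.numUpdates, s < t →
        G.weight (s + 1) (G.edge s).1 (G.edge s).2 = ⊤ → G.edge s ≠ G.edge t := by
      intro s hs t ht hst htop he
      have h3 := G.weight_mono (G.edge s).1 (G.edge s).2 (s := s + 1) (t := t) hst ht.le
      rw [htop, top_le_iff, he] at h3
      have h4 := G.weight_edge_lt t ht
      rw [h3] at h4
      exact not_top_lt h4
    intro s hs t ht he
    simp only [Finset.coe_filter, Finset.mem_range, ne_eq, not_not, Set.mem_ofPred_eq] at hs ht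
    rcases lt_trichotomy s t with h | h | h
    · exact absurd he (key s hs.1 t ht.1 h hs.2)
    · exact h
    · exact absurd he.symm (key t ht.1 s hs.1 h ht.2)
  have h3 := Finset.card_filter_add_card_filter_not (s := Finset.range G.numUpdates)
    (fun t => G.weight (t + 1) (G.edge t).1 (G.edge t).2 ≠ ⊤)
  rw [Finset.card_range] at h3
  omega

/-- The number of parts grows whenever new sets appear and never exceeds n, so there are at most n
refinements. -/
theorem IsATO.sum_new_le (hA : IsATO G η A) (D : ℕ) :
    ∑ t ∈ Finset.range G.numUpdates, (if (A.newSets (t + 1)).Nonempty then D else 0) ≤ n * D := by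
  have key : ∀ N ≤ G.numUpdates,
      ∑ t ∈ Finset.range N, (if (A.newSets (t + 1)).Nonempty then D else 0) ≤
        (A.part N).parts.card * D := by
    intro N
    induction N with
    | zero => simp
    | succ N ih =>
      intro hN
      rw [Finset.sum_range_succ]
      have h1 := ih (by omega)
      split_ifs with hne
      · have h2 := Nat.mul_le_mul_right D (hA.card_lt hN hne)
        rw [Nat.succ_mul] at h2
        omega
      · have h2 := Nat.mul_le_mul_right D (hA.card_le hN)
        omega
  exact (key _ le_rfl).trans (Nat.mul_le_mul_right D (card_parts_le _))

end Count

theorem sum_cost_le {cost pot B : ℕ → ℕ} {B₀ N : ℕ} (h0 : cost 0 + pot 0 ≤ B₀)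
    (h : ∀ t < N, cost (t + 1) + pot (t + 1) ≤ pot t + B t) :
    ∑ t ∈ Finset.range (N + 1), cost t ≤ B₀ + ∑ t ∈ Finset.range N, B t := by
  have key : ∀ M ≤ N, ∑ t ∈ Finset.range (M + 1), cost t + pot M ≤
      B₀ + ∑ t ∈ Finset.range M, B t := by
    intro M
    induction M with
    | zero => simpa using h0
    | succ M ih =>
      intro hM
      rw [Finset.sum_range_succ cost (M + 1), Finset.sum_range_succ B M]
      have h1 := ih (by omega)
      have h2 := h M hM
      omega
  have := key N le_rfl
  omega

/-- The total number of steps. -/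
theorem total_cost_le {n h M N k lab₀ : ℕ} (hn : 2 ≤ n) (hlab : lab₀ ≤ 8 * ((M + 1) * (h + 2)))
    (hN : N ≤ n * n + k) :
    1000 * (4 * (n * n) + 6 * n + n * lab₀) + (400 * n + 400) * ((h + 1) * n) +
        h * (n * 380 + 120) + 80 * M + 100 * (n * n) + 610 * n + 1002 + N * (h * 300 + 6000) +
        n * (h * (n * 380 + 120) + n * 6510 + 200) ≤
      10000 * (n * ((M + 1) * (h + 2))) + 40000 * (n * n * (h + 2)) + 6000 * (k * (h + 2)) := by
  have h1 : n * lab₀ ≤ 8 * (n * ((M + 1) * (h + 2))) :=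
    (Nat.mul_le_mul_left n hlab).trans_eq (by ring)
  have h2 : N * (h * 300 + 6000) ≤ (n * n + k) * (h * 300 + 6000) := Nat.mul_le_mul_right _ hN
  have h3 : n ≤ n * n := Nat.le_mul_self n
  have h4 : n * h ≤ n * n * h := Nat.mul_le_mul_right h h3
  have h5 : h ≤ n * h := Nat.le_mul_of_pos_left h (by omega)
  have h6 : M ≤ n * (M * (h + 2)) :=
    (Nat.le_mul_of_pos_right M (by omega)).trans (Nat.le_mul_of_pos_left _ (by omega))
  have e1 : n * ((M + 1) * (h + 2)) = n * (M * (h + 2)) + n * h + 2 * n := by ring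
  have e2 : (400 * n + 400) * ((h + 1) * n) =
      400 * (n * n * h) + 400 * (n * n) + 400 * (n * h) + 400 * n := by ring
  have e3 : (n * n + k) * (h * 300 + 6000) =
      300 * (n * n * h) + 6000 * (n * n) + 300 * (k * h) + 6000 * k := by ring
  have e4 : n * (h * (n * 380 + 120) + n * 6510 + 200) =
      380 * (n * n * h) + 120 * (n * h) + 6510 * (n * n) + 200 * n := by ring
  have e5 : n * n * (h + 2) = n * n * h + 2 * (n * n) := by ring
  have e6 : k * (h + 2) = k * h + 2 * k := by ring
  have e7 : h * (n * 380 + 120) = 380 * (n * h) + 120 * h := by ring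
  rw [e2, e4, e5, e6, e7]
  rw [e3] at h2
  rw [e1] at h1 ⊢
  omega

theorem depth_le {n h : ℕ} (hn : 2 ≤ n) (hh : 2 ^ h < 2 * n) :
    ((h + 2 : ℕ) : ℝ) ≤ 6 * Real.log n := by
  have hn0 : (2 : ℝ) ≤ n := by exact_mod_cast hn
  have h2 := Real.log_two_gt_d9
  have h3 : Real.log 2 ≤ Real.log n := Real.log_le_log (by norm_num) hn0
  have h4 : (h : ℝ) * Real.log 2 ≤ Real.log 2 + Real.log n := by
    rw [← Real.log_pow, ← Real.log_mul (by norm_num) (by positivity)]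
    refine Real.log_le_log (by positivity) ?_
    exact_mod_cast hh.le
  push_cast
  nlinarith

/-- By n ≤ δ q the quotient δ q / min(ε, 1) is at least 1, so it absorbs the extra label and the
additive constants. -/
theorem real_cost_le {n h M N k : ℕ} {δ q ε : ℚ} (hn : 2 ≤ n) (hnδ : (n : ℚ) ≤ δ * q)
    (hδ : 0 < δ) (hq : 0 < q) (hε : 0 < ε) (hM : (M : ℚ) ≤ 12 * (δ * q / min ε 1))
    (hh : ((h + 2 : ℕ) : ℝ) ≤ 6 * Real.log n)
    (hN : N ≤ 10000 * (n * ((M + 1) * (h + 2))) + 40000 * (n * n * (h + 2)) +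
      6000 * (k * (h + 2))) :
    (N : ℝ) ≤ (1000000 : ℕ) * ((n : ℝ) * δ * q * Real.log n / min (ε : ℝ) 1 +
      (n : ℝ) ^ 2 * Real.log n + k * Real.log n) := by
  have hm : 0 < min ε 1 := lt_min hε one_pos
  have hY : (1 : ℚ) ≤ δ * q / min ε 1 := by
    rw [le_div_iff₀ hm, one_mul]
    have : (1 : ℚ) ≤ n := by exact_mod_cast (by omega : 1 ≤ n)
    exact (min_le_right _ _).trans (this.trans hnδ)
  have hM1 : ((M + 1 : ℕ) : ℚ) ≤ 13 * (δ * q / min ε 1) := by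
    push_cast
    linarith
  have hM2 : ((M + 1 : ℕ) : ℝ) ≤ 13 * ((δ : ℝ) * q / min (ε : ℝ) 1) := by
    have : (((M + 1 : ℕ) : ℚ) : ℝ) ≤ ((13 * (δ * q / min ε 1) : ℚ) : ℝ) := Rat.cast_le.2 hM1
    push_cast at this ⊢
    exact this
  have hl : 0 ≤ Real.log n := Real.log_natCast_nonneg n
  have hN' : (N : ℝ) ≤ 10000 * (n * (((M + 1 : ℕ) : ℝ) * ((h + 2 : ℕ) : ℝ))) +
      40000 * (n * n * ((h + 2 : ℕ) : ℝ)) + 6000 * (k * ((h + 2 : ℕ) : ℝ)) := by exact_mod_cast hN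
  have hY' : 0 ≤ (δ : ℝ) * q / min (ε : ℝ) 1 := by
    have := (Nat.cast_nonneg (α := ℝ) (M + 1)).trans hM2
    linarith
  have a1 : (n : ℝ) * (((M + 1 : ℕ) : ℝ) * ((h + 2 : ℕ) : ℝ)) ≤
      n * (13 * ((δ : ℝ) * q / min (ε : ℝ) 1) * (6 * Real.log n)) := by gcongr
  have a2 : (n : ℝ) * n * ((h + 2 : ℕ) : ℝ) ≤ n * n * (6 * Real.log n) := by gcongr
  have a3 : (k : ℝ) * ((h + 2 : ℕ) : ℝ) ≤ k * (6 * Real.log n) := by gcongr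
  have e1 : (n : ℝ) * δ * q * Real.log n / min (ε : ℝ) 1 =
      n * ((δ : ℝ) * q / min (ε : ℝ) 1 * Real.log n) := by ring
  have b1 : 0 ≤ (n : ℝ) * ((δ : ℝ) * q / min (ε : ℝ) 1 * Real.log n) := by positivity
  have b2 : 0 ≤ (n : ℝ) ^ 2 * Real.log n := by positivity
  have b3 : 0 ≤ (k : ℝ) * Real.log n := by positivity
  rw [e1]
  push_cast at hN' a1 a2 a3 ⊢
  nlinarith

theorem Store.congr_input {n V : ℕ} {inp inp' : List ℕ} {hV : 64 ≤ V}
    {hi : ∀ i, inp.getD i 0 < V} {hi' : ∀ i, inp'.getD i 0 < V} {K : Par} {gn gd s : ℕ}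
    {G : DecrementalGraph n} {A : DynamicOrder n} {c : Core} {t : St}
    (h : Store ⟨n, V, inp, hV, hi⟩ K gn gd G A s c t) :
    Store ⟨n, V, inp', hV, hi'⟩ K gn gd G A s c t :=
  have hC := h.holds
  ⟨⟨⟨hC.r, hC.M, hC.h, hC.ka, hC.kb, hC.kc, hC.T, hC.P, hC.Z, hC.L, hC.X, hC.C, hC.R, hC.W, hC.m,
    hC.low, hC.out⟩, h.valid, h.trees, h.good⟩, h.idle, h.num, h.den, h.weight⟩

/-- The memory after the number of vertices has been read. -/
theorem represents_start {n V : ℕ} (hn : n < V) :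
    Represents n V ((RamState.zero.setReg 40 0).setReg 0 n)
      ⟨fun x => if x = 0 then n else 0, fun _ => 0, fun _ _ => 0⟩ where
  reg x hx := by
    by_cases h0 : x = 0 <;> simp [RamState.setReg, RamState.zero, h0]
  out _ _ := rfl
  arr _ _ _ := rfl
  zero := rfl
  reg_lt x _ := by
    dsimp only
    split_ifs <;> omega
  arr_lt _ _ _ := by
    dsimp only
    omega

theorem mainTheorem6 :
    ∃ (init update : Prog) (C c : ℕ),
      ∀ (n : ℕ) (_ : 2 ≤ n) (G : DecrementalGraph n) (r : Fin n) (δ q ε η : ℚ)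
        (_ : 0 < δ) (_ : 0 < q) (_ : 0 < ε) (_ : 0 ≤ η) (_ : (n : ℚ) ≤ δ * q)
        (A : DynamicOrder n) (_ : IsATO G η A)
        (L : ℕ → List (List (Fin n)))
        (_ : ∀ t ≤ G.numUpdates, Announces (A.newSets t) (L t)),
        ∃ (s : ℕ → RamState) (cost : ℕ → ℕ),
          Exec (inputSize G δ q ε η ^ c) (initInput G A L r δ q ε η)
            init RamState.zero (cost 0) (s 0) ∧
          (∀ t < G.numUpdates,
            Exec (inputSize G δ q ε η ^ c) (updateInput G A L t)
              update (s t) (cost (t + 1)) (s (t + 1))) ∧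
          (∀ t ≤ G.numUpdates, ∀ v : Fin n,
            graphDist (G.weight t) r v ≤ decodeEstimate ((s t).mem v) ∧
            ∀ d : ℕ, graphDist (G.weight t) r v = d → (d : ℚ) ≤ δ →
              ∀ p : List (Fin n), IsShortestPath (G.weight t) r v p →
                (topDiff (A.part t) (A.τ t) p : ℚ) ≤ q * δ + n →
                ∃ e : ℕ, decodeEstimate ((s t).mem v) = e ∧ (e : ℚ) ≤ d + η + ε * δ) ∧
          ((∑ t ∈ Finset.range (G.numUpdates + 1), cost t : ℕ) : ℝ) ≤
            C * ((n : ℝ) * δ * q * Real.log n / min (ε : ℝ) 1 + (n : ℝ) ^ 2 * Real.log n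
              + G.numIncreases * Real.log n) := by
  -- The number of vertices is read first, because the memory layout behind compiled commands relies
  -- on register 0. The exponent 160 is 10 · 16: stored words are below S ^ 10, and intermediate
  -- results below the 16th power of that.
  refine ⟨.seq (.seq (.const 40 0) (.input 0 40)) Cmd.init.comp, Cmd.update.comp, 1000000, 160, ?_⟩
  intro n hn G r δ q ε η hδ hq hε hη hnδ A hA L hL
  have hS := nine_le_inputSize (G := G) (η := η) hn hδ hq hε
  have hSn : n ≤ inputSize G δ q ε η := by rw [inputSize_eq]; omega
  set S := inputSize G δ q ε η with hS_def
  obtain ⟨h, hh1, hh2⟩ : ∃ h, n ≤ 2 ^ h ∧ 2 ^ h < 2 * n := by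
    refine ⟨Nat.clog 2 n, Nat.le_pow_clog (by omega) n, ?_⟩
    have h1 := Nat.pow_pred_clog_lt_self (b := 2) (by omega) (x := n) (by omega)
    have hc : 0 < Nat.clog 2 n := Nat.clog_pos (by omega) (by omega)
    obtain ⟨k, hk⟩ : ∃ k, Nat.clog 2 n = k + 1 := ⟨_, (Nat.succ_pred_eq_of_pos hc).symm⟩
    rw [hk] at h1 ⊢
    rw [Nat.pred_succ] at h1
    rw [pow_succ]; omega
  obtain ⟨K, hK⟩ : ∃ K, par r h δ q ε η = K := ⟨_, rfl⟩
  obtain ⟨gn, hgn⟩ : ∃ gn, unitNum q ε = gn := ⟨_, rfl⟩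
  obtain ⟨gd, hgd⟩ : ∃ gd, unitDen q ε = gd := ⟨_, rfl⟩
  have hb : Bounded S K gn gd := hK ▸ hgn ▸ hgd ▸ par_bounded hn hδ hq hε h
  have hsc : Scale K gn gd δ q ε η := hK ▸ hgn ▸ hgd ▸ par_scale hδ hq hε hη r h
  have hKr : K.r = r := by rw [← hK]; rfl
  have hKh : K.h = h := by rw [← hK]; rfl
  have hpow : S ^ 4 * 9 ≤ S ^ 10 := by
    calc S ^ 4 * 9 ≤ S ^ 4 * S ^ 6 := Nat.mul_le_mul_left _ (hS.trans (Nat.le_self_pow (by omega) S))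
      _ = S ^ 10 := by ring
  have hp4 : ∀ i ≤ 4, 0 < i → S ^ i ≤ S ^ 4 := fun i hi _ => Nat.pow_le_pow_right (by omega) hi
  have hp1 := hp4 1 (by omega) (by omega)
  have hp2 := hp4 2 (by omega) (by omega)
  have hp3 := hp4 3 (by omega) (by omega)
  rw [pow_one] at hp1
  have hnn : n * n ≤ S ^ 2 := by rw [pow_two]; exact Nat.mul_le_mul hSn hSn
  obtain ⟨V, hV⟩ : ∃ V, S ^ 10 = V := ⟨_, rfl⟩
  rw [hV] at hpow
  have hSS : 9 * S ≤ S ^ 2 := by rw [pow_two]; exact Nat.mul_le_mul_right S hS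
  have hVS : S < V := by omega
  have hV64 : 64 ≤ V := by omega
  have hB : S ^ 160 = V ^ 16 := by rw [← hV, ← pow_mul]
  rw [hB]
  have hsetup : ∀ inp hi, Setup ⟨n, V, inp, hV64, hi⟩ K := fun inp hi =>
    hb.setup hS hV.symm hSn hn (by rw [hKr]; exact r.2) (by rw [hKh]; exact hh1)
      (by rw [hKh]; exact hh2)
  have hi0 : ∀ i, (initInput G A L r δ q ε η).getD i 0 < V :=
    getD_lt (fun x hx => mem_initInput_le hA (hL 0 (Nat.zero_le _)) hx) hVS
  have hlen0 := length_initInput_le (G := G) (A := A) (r := r) (δ := δ) (q := q) (ε := ε) (η := η)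
    (hL 0 (Nat.zero_le _))
  have hl0 : (initInput G A L r δ q ε η).length + 3 < V := by omega
  have h2n : 2 * n < V := by omega
  have hSV2 : S ^ 2 < V := by omega
  have hSV3 : S ^ 3 < V := by omega
  have hSV4 : S ^ 4 < V := by omega
  let E0 : Env := ⟨n, V, initInput G A L r δ q ε η, hV64, hi0⟩
  obtain ⟨k0, s0, t0, x0, R0, c0, S0, b0⟩ := Tr.init (E := E0) (G := G) (A := A) (δ := δ) (q := q)
    (ε := ε) (η := η) (gn := gn) (gd := gd) (K := K) (L := L) (r := r)
    (t := ⟨fun x => if x = 0 then n else 0, fun _ => 0, fun _ _ => 0⟩) hA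
    (hL 0 (Nat.zero_le _)) (hsetup _ _) hK hh2 hl0 rfl hgn hgd hsc.gn_pos
    hsc.gd_pos (hb.gn.trans_lt hSV2) (hb.gd.trans_lt hSV3)
    (hb.ka.trans_lt hSV3) (hb.kb.trans_lt hSV4) (hb.kc.trans_lt hSV4) h2n rfl (fun _ => rfl) _
    (represents_start (hSn.trans_lt hVS))
  have x0' : Exec (V ^ 16) (initInput G A L r δ q ε η)
      (.seq (.seq (.const 40 0) (.input 0 40)) Cmd.init.comp) RamState.zero (1 + 1 + k0) s0 := by
    have hnV : n < V ^ 16 := lt_of_lt_of_le (by omega : n < V) (Nat.le_self_pow (by omega) V)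
    refine .seq (.seq (.const _ 40 0 (by omega)) ?_) x0
    exact .input _ 0 40 hnV
  -- The two numbers are the total potential, with the share of the trees included, and the cost of
  -- the stage.
  obtain ⟨f, hf0, hfI, hfR⟩ := exists_run (σ := RamState × ℕ × ℕ) (N := G.numUpdates)
    (x := (s0, 1000 * c0.pot n K.M + price n * stale n K.h (t0.arr 9), 1 + 1 + k0))
    (I := fun s x => ∃ c t, Represents n V x.1 t ∧ Store E0 K gn gd G A s c t ∧
      x.2.1 = 1000 * c.pot n K.M + price n * stale n K.h (t.arr 9))
    (R := fun s x y => Exec (V ^ 16) (updateInput G A L s) Cmd.update.comp x.1 y.2.2 y.1 ∧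
      y.2.2 + y.2.1 ≤ x.2.1 + ((K.h * 300 + 6000) +
        if (A.newSets (s + 1)).Nonempty then K.h * (n * 380 + 120) + n * 6510 + 200 else 0))
    ⟨c0, t0, R0, S0, rfl⟩ (by
      rintro s hs ⟨m, p, k⟩ ⟨c, t, hR, hSt, hp⟩
      have hi : ∀ i, (updateInput G A L s).getD i 0 < V :=
        getD_lt (fun x hx => mem_updateInput_le hA hs (hL (s + 1) hs) hx) hVS
      have hlen := length_updateInput_le (G := G) (A := A) (L := L) (hL (s + 1) hs)
      have hl1 : (updateInput G A L s).length + 3 < V := by omega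
      obtain ⟨k', m', t', x', R', c', S', b'⟩ := Tr.update
        (E := ⟨n, V, updateInput G A L s, hV64, hi⟩) hA hs (hL (s + 1) hs) (hsetup _ _)
        hl1 hsc.gn_pos rfl hSt.congr_input m hR
      refine ⟨(m', 1000 * c'.pot n K.M + price n * stale n K.h (t'.arr 9), k'), ⟨x', ?_⟩,
        c', t', R', S'.congr_input, rfl⟩
      dsimp only at hp b' ⊢
      omega)
  refine ⟨fun s => (f s).1, fun s => (f s).2.2, ?_, fun s hs => (hfR s hs).1, fun s hs v => ?_, ?_⟩
  · dsimp only
    rw [hf0]; exact x0'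
  · obtain ⟨c, t, hR, hSt, -⟩ := hfI s hs
    dsimp only
    rw [hR.out v v.2]
    exact ⟨hSt.lower hA hη hs hsc hKr v, fun d hd hdδ p hp hT =>
      hSt.upper hs hsc hη hnδ hKr hd hdδ hp hT⟩
  · have hp0 : (f 0).2.2 + (f 0).2.1 ≤ 1000 * (4 * (n * n) + 6 * n + n * lab n K.M 0) +
        (400 * n + 400) * ((K.h + 1) * n) + K.h * (n * 380 + 120) + 80 * K.M + 100 * (n * n) +
        610 * n + 1002 := by
      rw [hf0]
      have hb0 := b0
      change k0 + 1000 * c0.pot n K.M + price n * stale n K.h (t0.arr 9) ≤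
        1000 * (4 * (n * n) + 6 * n + n * lab n K.M 0) +
        (400 * n + 400) * ((K.h + 1) * n) + K.h * (n * 380 + 120) + 80 * K.M + 100 * (n * n) +
        610 * n + 1000 at hb0
      dsimp only
      omega
    have hsum := sum_cost_le (cost := fun t => (f t).2.2) (pot := fun t => (f t).2.1) hp0
      fun t ht => (hfR t ht).2
    rw [Finset.sum_add_distrib, Finset.sum_const, Finset.card_range, smul_eq_mul] at hsum
    have hnew := hA.sum_new_le (K.h * (n * 380 + 120) + n * 6510 + 200)
    have htot := total_cost_le hn (lab_zero_le (M := K.M) (n := n) (h := K.h) (by rw [hKh]; exact hh1))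
      G.numUpdates_le
    refine real_cost_le hn hnδ hδ hq hε (hK ▸ par_M_le hδ hq hε r h)
      (depth_le (h := K.h) hn (by rw [hKh]; exact hh2)) ?_
    dsimp only
    omega

end
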